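/- For $\lambda\in\mathbb R$ let $H(x,y,\lambda)=x^2-y^3+\lambda y$ on $\mathbb R^2$. For $(h,\lambda)$ in the swallow-tail domain $D=\{(h,\lambda):\lambda>0,\ h^2<4(\lambda/3)^3\}$ the set $\{(x,y): H(x,y,\lambda)=h,\ y<\sqrt{\lambda/3}\}$ is a closed curve (the vanishing cycle), which bounds the disc $\Delta(h,\lambda)=\{(x,y): H(x,y,\lambda)\le h,\ y<\sqrt{\lambda/3}\}$. These discs shrink to the origin as $(h,\lambda)\to(0,0)$ in $D$. Let $U\subset\mathbb R^3$ be a connected open neighbourhood of the origin of the $(x,y,\lambda)$-space (for instance $U=\mathbb R^3$), and put $U_\lambda=\{(x,y):(x,y,\lambda)\in U\}$. For $i=1,2$ let $\omega_{i,\lambda}=g_i(x,y,\lambda)\,\mathrm dx\wedge\mathrm dy$ be a symplectic form on $U_\lambda$ that depends smoothly on $\lambda$, that is, $g_i\in C^\infty(U)$ is nowhere zero. Define the area functions $$I_i^\circ(h,\lambda)=\frac1{2\pi}\int_{\Delta(h,\lambda)}\omega_{i,\lambda}$$ with respect to the standard orientation of $\mathbb R^2$; they are defined for all $(h,\lambda)\in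 D$ sufficiently close to $(0,0)$. Suppose that $I_1^\circ(h,\lambda)=I_2^\circ(h,\lambda)$ for all $(h,\lambda)\in D$ sufficiently close to $(0,0)$. Then: 1. $\omega_{1,\lambda}/\omega_{2,\lambda}>0$ everywhere on $U$; 2. there are open neighbourhoods $V,W\subset U$ of the origin of $\mathbb R^3$, with slices $V_\lambda,W_\lambda\subset\mathbb R^2$, and a family of diffeomorphisms $\Phi_\lambda:V_\lambda\to W_\lambda$ such that $\Phi_\lambda(x,y)$ and $\Phi_\lambda^{-1}(x,y)$ are $C^\infty$ functions of all the variables $(x,y,\lambda)$, on $V$ and on $W$ respectively, and such that $H(\Phi_\lambda(x,y),\lambda)=H(x,y,\lambda)$ for all $(x,y,\lambda)\in V$ and $\Phi_\lambda^*\omega_{2,\lambda}=\omega_{1,\lambda}$ on $V_\lambda$ for all $\lambda$. -/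

import Mathlib

open scoped ContDiff Topology

/-- The `(x, y)`-plane: a point `p` has coordinates `x = p.1` and `y = p.2`. -/
abbrev Plane : Type := ℝ × ℝ

/-- A family of differential `2`-forms on the plane, depending on a real parameter. -/
abbrev FormFamily : Type := ℝ → Plane → Plane [⋀^Fin 2]→L[ℝ] ℝ

/-- The one-parameter family of functions `H = x ^ 2 - y ^ 3 + lam * y`. -/
def cuspH (lam : ℝ) (p : Plane) : ℝ := p.1 ^ 2 - p.2 ^ 3 + lam * p.2

/-- The swallow-tail domain, a set of pairs `(h, lam)`. -/
def swallowTail : Set (ℝ × ℝ) := {b | 0 < b.2 ∧ b.1 ^ 2 < 4 * (b.2 / 3) ^ 3}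

/-- The vanishing cycle over a point `(h, lam)` of the swallow-tail domain: the compact component
of the level set `H = h`, which is the part below the saddle point `(0, √(lam / 3))`. -/
def vanishingCycle (h lam : ℝ) : Set Plane := {p | cuspH lam p = h ∧ p.2 < √(lam / 3)}

/-- The closed disc bounded by the vanishing cycle over a point `(h, lam)` of the swallow-tail
domain; it contains the local minimum `(0, -√(lam / 3))` of `H`. -/
def vanishingDisc (h lam : ℝ) : Set Plane := {p | cuspH lam p ≤ h ∧ p.2 < √(lam / 3)}

/-- Over the swallow-tail domain the vanishing cycle is the boundary of the vanishing disc. -/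
theorem frontier_vanishingDisc (h lam : ℝ) (hb : (h, lam) ∈ swallowTail) :
    frontier (vanishingDisc h lam) = vanishingCycle h lam := by
  obtain ⟨h1, h2⟩ := hb
  simp only at h1 h2
  set s := √(lam / 3) with hs
  have hs0 : 0 < s := Real.sqrt_pos.2 (by positivity)
  have hl : lam = 3 * s ^ 2 := by rw [hs, Real.sq_sqrt (by positivity)]; ring
  have hh : h ^ 2 < (2 * s ^ 3) ^ 2 := by rw [hl] at h2; ring_nf at h2 ⊢; exact h2
  obtain ⟨hlo, hhi⟩ := abs_lt.1 (abs_lt_of_sq_lt_sq hh (by positivity))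
  have hcont : Continuous (cuspH lam) := by unfold cuspH; fun_prop
  have hclosed : IsClosed (vanishingDisc h lam) := by
    have : vanishingDisc h lam = {p | cuspH lam p ≤ h ∧ p.2 ≤ s} := by
      ext p
      refine ⟨fun hp => ⟨hp.1, hp.2.le⟩, fun hp => ⟨hp.1, lt_of_le_of_ne hp.2 fun he => ?_⟩⟩
      have he' : p.2 = s := he
      have hle : p.1 ^ 2 - p.2 ^ 3 + lam * p.2 ≤ h := hp.1
      rw [he', hl] at hle
      nlinarith [sq_nonneg p.1]
    rw [this]
    exact (isClosed_le hcont continuous_const).inter (isClosed_le continuous_snd continuous_const)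
  rw [hclosed.frontier_eq]
  ext p
  constructor
  · rintro ⟨hp, hp'⟩
    refine ⟨?_, hp.2⟩
    by_contra hne
    refine hp' (mem_interior.2 ⟨{p | cuspH lam p < h ∧ p.2 < s}, fun q hq => ⟨hq.1.le, hq.2⟩,
      (isOpen_lt hcont continuous_const).inter (isOpen_lt continuous_snd continuous_const),
      lt_of_le_of_ne hp.1 hne, hp.2⟩)
  · rintro ⟨hp, hps⟩
    refine ⟨⟨hp.le, hps⟩, fun hint => ?_⟩
    have hmem := mem_interior_iff_mem_nhds.1 hint
    have hx : IsLocalMax (fun t : ℝ => cuspH lam (t, p.2)) p.1 := by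
      have : Filter.Tendsto (fun t : ℝ => ((t, p.2) : Plane)) (𝓝 p.1) (𝓝 p) :=
        (by fun_prop : Continuous fun t : ℝ => ((t, p.2) : Plane)).tendsto p.1
      filter_upwards [this hmem] with t ht
      exact ht.1.trans hp.ge
    have hy : IsLocalMax (fun t : ℝ => cuspH lam (p.1, t)) p.2 := by
      have : Filter.Tendsto (fun t : ℝ => ((p.1, t) : Plane)) (𝓝 p.2) (𝓝 p) :=
        (by fun_prop : Continuous fun t : ℝ => ((p.1, t) : Plane)).tendsto p.2
      filter_upwards [this hmem] with t ht
      exact ht.1.trans hp.ge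
    have dx : HasDerivAt (fun t : ℝ => cuspH lam (t, p.2)) (2 * p.1) p.1 := by
      have := (((hasDerivAt_id p.1).pow 2).sub_const (p.2 ^ 3)).add_const (lam * p.2)
      simpa [cuspH] using this
    have dy : HasDerivAt (fun t : ℝ => cuspH lam (p.1, t)) (-(3 * p.2 ^ 2) + lam) p.2 := by
      have := ((hasDerivAt_pow 3 p.2).const_sub (p.1 ^ 2)).add
        ((hasDerivAt_id p.2).const_mul lam)
      refine this.congr_deriv ?_
      norm_num
    have ex := hx.hasDerivAt_eq_zero dx
    have ey := hy.hasDerivAt_eq_zero dy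
    have ex' : p.1 = 0 := by linarith
    have hfac : (p.2 - s) * (p.2 + s) = 0 := by rw [hl] at ey; linarith
    rcases mul_eq_zero.1 hfac with he | he
    · linarith
    · have he' : p.2 = -s := by linarith
      simp only [cuspH, ex', he', hl] at hp
      nlinarith

/-- The area function (action variable): `1 / (2π)` times the integral of the form `η lam` over
the disc bounded by the vanishing cycle, the plane having its standard orientation. -/
noncomputable def areaFunction (η : FormFamily) (h lam : ℝ) : ℝ :=
  1 / (2 * Real.pi) * ∫ p in vanishingDisc h lam, η lam p ![((1, 0) : Plane), ((0, 1) : Plane)]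

/-- `η lam` is a symplectic form (closed and nondegenerate) at every point of the slice
`{p | (lam, p) ∈ U}`, for every `lam`, and depends smoothly on `(lam, p) ∈ U`. -/
structure IsSmoothSymplecticFamilyOn (η : FormFamily) (U : Set (ℝ × Plane)) : Prop where
  smooth : ContDiffOn ℝ ∞ (fun q : ℝ × Plane => η q.1 q.2) U
  closed : ∀ q ∈ U, extDeriv (η q.1) q.2 = 0
  nondegenerate : ∀ q ∈ U, ∀ v : Plane, (∀ w : Plane, η q.1 q.2 ![v, w] = 0) → v = 0

/-- The maps `Φ lam`, for all `lam`, are diffeomorphisms from the slice `{p | (lam, p) ∈ V}` onto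
the slice `{p | (lam, p) ∈ W}` of the open sets `V` and `W`; they and their inverses `Ψ lam`
depend smoothly on all variables, including the parameter. -/
structure IsSmoothDiffeoFamily (Φ : ℝ → Plane → Plane) (V W : Set (ℝ × Plane)) : Prop where
  isOpen_source : IsOpen V
  isOpen_target : IsOpen W
  smooth : ContDiffOn ℝ ∞ (fun q : ℝ × Plane => Φ q.1 q.2) V
  mapsTo : ∀ q ∈ V, (q.1, Φ q.1 q.2) ∈ W
  exists_inverse : ∃ Ψ : ℝ → Plane → Plane,
    ContDiffOn ℝ ∞ (fun q : ℝ × Plane => Ψ q.1 q.2) W ∧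
    (∀ q ∈ W, (q.1, Ψ q.1 q.2) ∈ V) ∧
    (∀ q ∈ V, Ψ q.1 (Φ q.1 q.2) = q.2) ∧
    (∀ q ∈ W, Φ q.1 (Ψ q.1 q.2) = q.2)

/-- The pullback of a differential `2`-form on the plane under a map, at the point `p`. -/
noncomputable def pullbackForm (φ : Plane → Plane) (η : Plane → Plane [⋀^Fin 2]→L[ℝ] ℝ)
    (p : Plane) : Plane [⋀^Fin 2]→L[ℝ] ℝ :=
  (η (φ p)).compContinuousLinearMap (fderiv ℝ φ p)

open Set Filter MeasureTheory

/-! ### Integrals depending on a parameter -/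

/-! Near the origin write the two forms as `g₁ dx ∧ dy` and `g₂ dx ∧ dy`, and let X = (3y² - lam) ∂x
+ 2x ∂y be the Hamiltonian field of H; the derivative along X is `cuspBracket`. Suppose that g₁ - g₂
= X a with a smooth in (lam, x, y) and a(0) = 0. Then the diffeomorphism is explicit: let T(p) be
the time for which the integral of g₂ along the X-orbit of p over [0, T(p)] equals a(p), and let Φ
be the time-T(p) map of the flow. It preserves H and carries X to kX with g₂(Φ) k = g₁, and a map
with these two properties has Jacobian k (`exists_moser_map`). Moreover X vanishes at the origin, so
g₁ = g₂ there, and connectedness of U gives the sign statement.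

The core is therefore a division theorem (`exists_cuspBracket_eq`): a smooth f whose mean over every
small vanishing cycle is zero has the form X a, for small lam. Equality of areas yields zero means
of g₁ - g₂ by differentiation in h: for lam = 3q⁴ there is a coordinate z = z(y) with H + 2q⁶ = x² +
z², in which the discs are round and the means are integrals over circles.

For the division, f is split into an even and an odd part in x. The odd part is integrated in y with
the level fixed. For the even part the ansatz a = x b(lam, H, y) leads to 2P b' + P' b = k with P =
y³ - lam y + h (`levelOp`). Modulo the image of this operator, k is affine in y, φ₀ + φ₁ y, up to a
remainder that is flat at the saddle values (`exists_level_decomposition`). This comes from formal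
expansions, first at the cuspidal cubic and then at the nodal cubics, summed by Borel's lemma. The
nodal parameter s = √(lam / 3) is not smooth in lam; the expansion at the cusp comes first because
it makes the nodal coefficients flat at s = 0, and flat functions of s are smooth in s².

Near the saddle the mean of 1 diverges logarithmically while the mean of q² - y stays between
positive bounds, so vanishing means force the affine part to be flat at the saddle values as well
(`flat_of_unbounded_mean`). There remains an equation X a = r(lam, H, y) with r flat. It is solved
by an averaged primitive along the cycles inside the discs, where the zero means are needed, and by
integration from the axis x = 0 outside. The functions in these formulas blow up at most like
inverse powers of the distance to the saddle levels, which the flat r absorbs, so both solutions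
extend smoothly by zero (`contDiff_indicator_mul_comp`) and their sum solves the equation. -/

theorem hasFDerivAt_integral_param {E V : Type} [NormedAddCommGroup E] [NormedSpace ℝ E]
    [FiniteDimensional ℝ E] [NormedAddCommGroup V] [NormedSpace ℝ V] [CompleteSpace V]
    (a b : ℝ) {F : E × ℝ → V} (hF : ContDiff ℝ 1 F) (p : E) :
    HasFDerivAt (fun p => ∫ t in a..b, F (p, t))
      (∫ t in a..b, (fderiv ℝ F (p, t)).comp (ContinuousLinearMap.inl ℝ E ℝ)) p := by
  have hF' : Continuous fun q : E × ℝ =>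
      (fderiv ℝ F q).comp (ContinuousLinearMap.inl ℝ E ℝ) :=
    (hF.continuous_fderiv one_ne_zero).clm_comp continuous_const
  obtain ⟨C, hC⟩ := ((isCompact_closedBall p 1).prod (isCompact_uIcc (a := a) (b := b))
    ).exists_bound_of_continuousOn hF'.continuousOn
  refine intervalIntegral.hasFDerivAt_integral_of_dominated_of_fderiv_le
    (F' := fun p t => (fderiv ℝ F (p, t)).comp (ContinuousLinearMap.inl ℝ E ℝ))
    (bound := fun _ => C) (Metric.ball_mem_nhds p one_pos) ?_ ?_ ?_ ?_ ?_ ?_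
  · filter_upwards with x
    exact (hF.continuous.comp (by fun_prop : Continuous fun t : ℝ => (x, t))).aestronglyMeasurable
  · exact (hF.continuous.comp
      (by fun_prop : Continuous fun t : ℝ => (p, t))).intervalIntegrable _ _
  · exact (hF'.comp (by fun_prop : Continuous fun t : ℝ => (p, t))).aestronglyMeasurable
  · filter_upwards with t ht x hx
    exact hC (x, t) ⟨Metric.ball_subset_closedBall hx, uIoc_subset_uIcc ht⟩
  · exact intervalIntegrable_const
  · filter_upwards with t _ x _
    have h1 : HasFDerivAt F (fderiv ℝ F (x, t)) (x, t) :=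
      (hF.differentiable one_ne_zero _).hasFDerivAt
    exact h1.comp x (hasFDerivAt_prodMk_left x t)

/-- The target space is quantified after `n`, since the induction step passes to the differential,
with values in `E →L[ℝ] V`. -/
theorem contDiff_integral_param_nat {E : Type} [NormedAddCommGroup E] [NormedSpace ℝ E]
    [FiniteDimensional ℝ E] (a b : ℝ) (n : ℕ) :
    ∀ {V : Type} [NormedAddCommGroup V] [NormedSpace ℝ V] [CompleteSpace V] {F : E × ℝ → V},
    ContDiff ℝ n F → ContDiff ℝ n (fun p => ∫ t in a..b, F (p, t)) := by
  induction n with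
  | zero =>
    intro V _ _ _ F hF
    have hc := contDiff_zero.1 hF
    exact contDiff_zero.2 (intervalIntegral.continuous_parametric_intervalIntegral_of_continuous'
      (f := fun p t => F (p, t)) hc a b)
  | succ n ih =>
    intro V _ _ _ F hF
    push_cast at hF ⊢
    refine contDiff_succ_iff_hasFDerivAt.2 ⟨_, ?_, fun p => hasFDerivAt_integral_param a b
      (hF.of_le (by simp)) p⟩
    exact ih (F := fun q => (fderiv ℝ F q).comp (ContinuousLinearMap.inl ℝ E ℝ))
      ((hF.fderiv_right le_rfl).clm_comp contDiff_const)

theorem contDiff_integral_param {E V : Type} [NormedAddCommGroup E] [NormedSpace ℝ E]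
    [FiniteDimensional ℝ E] [NormedAddCommGroup V] [NormedSpace ℝ V] [CompleteSpace V]
    (a b : ℝ) {F : E × ℝ → V} (hF : ContDiff ℝ ∞ F) :
    ContDiff ℝ ∞ (fun p => ∫ t in a..b, F (p, t)) :=
  contDiff_infty.2 fun n => contDiff_integral_param_nat a b n (contDiff_infty.1 hF n)

/-- The directional derivative of a real function. -/
noncomputable def dirDeriv {E : Type} [NormedAddCommGroup E] [NormedSpace ℝ E] (v : E)
    (F : E → ℝ) (q : E) : ℝ := fderiv ℝ F q v

section
variable {E : Type} [NormedAddCommGroup E] [NormedSpace ℝ E]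

theorem ContDiff.dirDeriv {F : E → ℝ} (hF : ContDiff ℝ ∞ F) (v : E) :
    ContDiff ℝ ∞ (dirDeriv v F) :=
  (hF.fderiv_right (m := ∞) (by simp)).clm_apply contDiff_const

theorem ContDiff.hasFDerivAt_infty {V : Type} [NormedAddCommGroup V] [NormedSpace ℝ V]
    {F : E → V} (hF : ContDiff ℝ ∞ F) (q : E) :
    HasFDerivAt F (fderiv ℝ F q) q := (hF.differentiable (by simp) q).hasFDerivAt

theorem ContDiff.hasDerivAt_comp_infty {F : E → ℝ} (hF : ContDiff ℝ ∞ F) {c : ℝ → E} {v : E}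
    {t : ℝ} (hc : HasDerivAt c v t) :
    HasDerivAt (fun t => F (c t)) (_root_.dirDeriv v F (c t)) t :=
  (hF.hasFDerivAt_infty (c t)).comp_hasDerivAt t hc

theorem dirDeriv_integral_param [FiniteDimensional ℝ E] (a b : ℝ) {F : E × ℝ → ℝ}
    (hF : ContDiff ℝ ∞ F) (v p : E) :
    dirDeriv v (fun p => ∫ t in a..b, F (p, t)) p = ∫ t in a..b, dirDeriv (v, 0) F (p, t) := by
  have h := hasFDerivAt_integral_param a b (hF.of_le (by simp)) p
  rw [dirDeriv, h.fderiv, ContinuousLinearMap.intervalIntegral_apply]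
  · rfl
  · refine Continuous.intervalIntegrable ?_ _ _
    exact ((((hF.fderiv_right (m := ∞) (by simp)).continuous).comp
      (by fun_prop : Continuous fun t : ℝ => (p, t))).clm_comp continuous_const)

/-- The quotient of `F (p, t) - F (p, 0)` by `t`. -/
noncomputable def hadamardQuot (F : E × ℝ → ℝ) (q : E × ℝ) : ℝ :=
  ∫ τ in (0 : ℝ)..1, dirDeriv (0, 1) F (q.1, τ * q.2)

theorem ContDiff.hadamardQuot [FiniteDimensional ℝ E] {F : E × ℝ → ℝ} (hF : ContDiff ℝ ∞ F) :
    ContDiff ℝ ∞ (hadamardQuot F) :=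
  contDiff_integral_param 0 1 (F := fun x : (E × ℝ) × ℝ => _root_.dirDeriv (0, 1) F
    (x.1.1, x.2 * x.1.2)) ((hF.dirDeriv _).comp (by fun_prop))

theorem eq_add_mul_hadamardQuot {F : E × ℝ → ℝ} (hF : ContDiff ℝ ∞ F) (p : E) (t : ℝ) :
    F (p, t) = F (p, 0) + t * hadamardQuot F (p, t) := by
  have h1 : ∀ τ ∈ uIcc (0 : ℝ) 1, HasDerivAt (fun τ : ℝ => F (p, τ * t))
      (t * dirDeriv (0, 1) F (p, τ * t)) τ := by
    intro τ _
    have hc : HasDerivAt (fun τ : ℝ => ((p, τ * t) : E × ℝ)) (0, t) τ := by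
      have := (hasDerivAt_const τ p).prodMk ((hasDerivAt_id τ).mul_const t)
      simpa using this
    have := hF.hasDerivAt_comp_infty hc
    convert this using 1
    have : ((0, t) : E × ℝ) = t • ((0, 1) : E × ℝ) := by simp
    simp only [dirDeriv]
    rw [this, map_smul, smul_eq_mul]
  have h2 := intervalIntegral.integral_eq_sub_of_hasDerivAt h1 (by
    refine Continuous.intervalIntegrable ?_ _ _
    exact continuous_const.mul ((hF.dirDeriv _).continuous.comp (by fun_prop)))
  rw [intervalIntegral.integral_const_mul] at h2
  simp only [one_mul, zero_mul] at h2
  rw [hadamardQuot]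
  linarith

end

/-! ### Flat functions -/

section
variable {E V : Type} [NormedAddCommGroup E] [NormedSpace ℝ E]
  [NormedAddCommGroup V] [NormedSpace ℝ V]

/-- A smooth function is flat on `Z` if all its derivatives vanish at the points of `Z`. -/
structure FlatOn (Z : Set E) (F : E → V) : Prop where
  contDiff : ContDiff ℝ ∞ F
  flat : ∀ q ∈ Z, ∀ n : ℕ, iteratedFDeriv ℝ n F q = 0

theorem FlatOn.eq_zero {Z : Set E} {F : E → V} (hF : FlatOn Z F) {q : E} (hq : q ∈ Z) :
    F q = 0 := by
  have := congrArg norm (hF.flat q hq 0)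
  simpa [norm_iteratedFDeriv_zero] using this

theorem FlatOn.fderiv {Z : Set E} {F : E → V} (hF : FlatOn Z F) : FlatOn Z (fderiv ℝ F) := by
  refine ⟨hF.contDiff.fderiv_right (by simp), fun q hq n => ?_⟩
  have := congrArg norm (hF.flat q hq (n + 1))
  rw [← norm_iteratedFDeriv_fderiv, norm_zero, norm_eq_zero] at this
  exact this

theorem FlatOn.dirDeriv {Z : Set E} {F : E → ℝ} (hF : FlatOn Z F) (v : E) :
    FlatOn Z (dirDeriv v F) := by
  refine ⟨hF.contDiff.dirDeriv v, fun q hq n => ?_⟩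
  have h := ContinuousLinearMap.iteratedFDeriv_comp_left
    (ContinuousLinearMap.apply ℝ ℝ v) (f := _root_.fderiv ℝ F) (x := q) (n := ∞) (i := n)
    (hF.fderiv.contDiff.contDiffAt) (by exact_mod_cast le_top)
  have e : (ContinuousLinearMap.apply ℝ ℝ v) ∘ (_root_.fderiv ℝ F) = _root_.dirDeriv v F := rfl
  rw [← e, h, hF.fderiv.flat q hq n]
  ext; simp

/-- The differential is a combination of the derivatives along `e i` with the constant covectors `l
i`. In a class closed under these derivatives, flatness thus reduces to vanishing of the values on
`Z`. -/
theorem flatOn_of_dirDeriv {Z : Set E} {ι : Type} [Fintype ι] (e : ι → E) (l : ι → E →L[ℝ] ℝ)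
    (hel : ∀ v, v = ∑ i, l i v • e i) (𝒵 : Set (E → ℝ)) (hs : ∀ F ∈ 𝒵, ContDiff ℝ ∞ F)
    (hd : ∀ F ∈ 𝒵, ∀ i, dirDeriv (e i) F ∈ 𝒵) (h0 : ∀ F ∈ 𝒵, ∀ q ∈ Z, F q = 0) {F : E → ℝ}
    (hF : F ∈ 𝒵) : FlatOn Z F := by
  refine ⟨hs F hF, fun q hq n => ?_⟩
  induction n generalizing F with
  | zero => 
    rw [← norm_eq_zero, norm_iteratedFDeriv_zero, h0 F hF q hq, norm_zero]
  | succ n ih =>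
    rw [← norm_eq_zero, ← norm_iteratedFDeriv_fderiv, norm_eq_zero]
    have h1 : _root_.fderiv ℝ F = fun x => ∑ i, dirDeriv (e i) F x • l i := by
      funext x
      ext v
      conv_lhs => rw [hel v]
      simp [dirDeriv, mul_comm]
    rw [h1, iteratedFDeriv_fun_sum_apply]
    · refine Finset.sum_eq_zero fun i _ => ?_
      have h := ContinuousLinearMap.iteratedFDeriv_comp_left
        (ContinuousLinearMap.toSpanSingleton ℝ (l i)) (f := dirDeriv (e i) F) (x := q)
        (n := ∞) (i := n) ((hs F hF).dirDeriv _).contDiffAt (by exact_mod_cast le_top)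
      have e' : (ContinuousLinearMap.toSpanSingleton ℝ (l i)) ∘ (dirDeriv (e i) F)
        = fun x => dirDeriv (e i) F x • l i := by
        funext x; simp
      rw [← e', h, ih (hd F hF i)]
      ext; simp
    · intro i _
      exact ((((hs F hF).dirDeriv (e i)).smul contDiff_const).of_le
        (by exact_mod_cast le_top)).contDiffAt

/-- Mean value inequality on the segment from `q₀` to `q`, applied to the differential, which is
flat again: every step gains one power of the distance. The constant depends only on `R` and `N`,
not on `q₀`. -/
theorem FlatOn.bound [FiniteDimensional ℝ E] {Z : Set E} (R : ℝ) (N : ℕ) :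
    ∀ {V : Type} [NormedAddCommGroup V] [NormedSpace ℝ V] {F : E → V}, FlatOn Z F →
    ∃ C, 0 ≤ C ∧ ∀ q q₀, q₀ ∈ Z → ‖q‖ ≤ R → ‖q₀‖ ≤ R → ‖F q‖ ≤ C * ‖q - q₀‖ ^ N := by
  induction N with
  | zero =>
    intro V _ _ F hF
    obtain ⟨C, hC⟩ := (isCompact_closedBall (0 : E) R).exists_bound_of_continuousOn
      hF.contDiff.continuous.continuousOn
    refine ⟨max C 0, le_max_right _ _, fun q q₀ _ hq _ => ?_⟩
    simpa using Or.inl (hC q (by simpa using hq))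
  | succ N ih =>
    intro V _ _ F hF
    obtain ⟨C, hC0, hC⟩ := ih hF.fderiv
    refine ⟨C, hC0, fun q q₀ hZ hq hq₀ => ?_⟩
    have h := (convex_segment q₀ q).norm_image_sub_le_of_norm_fderiv_le (f := F) (𝕜 := ℝ)
      (C := C * ‖q - q₀‖ ^ N) (fun x _ => hF.contDiff.differentiable (by simp) x)
      (fun x hx => ?_) (left_mem_segment ℝ q₀ q) (right_mem_segment ℝ q₀ q)
    · rw [hF.eq_zero hZ, sub_zero] at h
      rwa [pow_succ, ← mul_assoc]
    · have hxR : ‖x‖ ≤ R := by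
        have : segment ℝ q₀ q ⊆ Metric.closedBall 0 R :=
          (convex_closedBall 0 R).segment_subset (by simpa using hq₀) (by simpa using hq)
        simpa using this hx
      refine (hC x q₀ hZ hxR hq₀).trans ?_
      gcongr
      obtain ⟨u, v, hu, hv, huv, rfl⟩ := hx
      have : u • q₀ + v • q - q₀ = v • (q - q₀) := by
        have : u = 1 - v := by linarith
        subst this
        module
      rw [this, norm_smul, Real.norm_of_nonneg hv]
      exact mul_le_of_le_one_left (norm_nonneg _) (by linarith)

theorem flatOn_of_eqOn_zero {Z O : Set E} {F : E → V} (hF : ContDiff ℝ ∞ F) (hO : IsOpen O)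
    (h0 : ∀ q ∈ O, F q = 0) (hZ : Z ⊆ closure O) : FlatOn Z F := by
  refine ⟨hF, fun q hq n => ?_⟩
  have hc : Continuous (iteratedFDeriv ℝ n F) :=
    hF.continuous_iteratedFDeriv (by exact_mod_cast le_top)
  have h1 : EqOn (iteratedFDeriv ℝ n F) 0 (closure O) := by
    refine EqOn.closure (fun x hx => ?_) hc continuous_const
    have : F =ᶠ[𝓝 x] fun _ => 0 := by
      filter_upwards [hO.mem_nhds hx] with y hy using h0 y hy
    have h2 := this.iteratedFDeriv ℝ n
    rw [h2.eq_of_nhds]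
    simp
  exact h1 (hZ hq)

theorem FlatOn.mono {Z Z' : Set E} {F : E → V} (hF : FlatOn Z F) (h : Z' ⊆ Z) : FlatOn Z' F :=
  ⟨hF.contDiff, fun q hq => hF.flat q (h hq)⟩

end

/-! ### Composition of a flat function with a map with controlled singularities -/

section
variable {E E' κ ι : Type} [NormedAddCommGroup E] [NormedSpace ℝ E]
  [NormedAddCommGroup E'] [NormedSpace ℝ E'] [Fintype κ] [Fintype ι]

/-- On `O` the differential of `M` is a combination of the covectors `l k` with coefficients in
the algebra `𝒜`. -/
def HasCoeffDeriv (O : Set E) (l : κ → E →L[ℝ] ℝ) (𝒜 : Subalgebra ℝ (E → ℝ)) (M : E → ℝ) : Prop :=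
  ∃ c : κ → E → ℝ, (∀ k, c k ∈ 𝒜) ∧ ∀ p ∈ O, HasFDerivAt M (∑ k, c k p • l k) p

theorem HasCoeffDeriv.add {O : Set E} {l : κ → E →L[ℝ] ℝ} {𝒜 : Subalgebra ℝ (E → ℝ)}
    {M N : E → ℝ} (hM : HasCoeffDeriv O l 𝒜 M) (hN : HasCoeffDeriv O l 𝒜 N) :
    HasCoeffDeriv O l 𝒜 (M + N) := by
  obtain ⟨c, hc, h⟩ := hM
  obtain ⟨d, hd, h'⟩ := hN
  refine ⟨c + d, fun k => 𝒜.add_mem (hc k) (hd k), fun p hp => ?_⟩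
  have := (h p hp).add (h' p hp)
  rw [← Finset.sum_add_distrib] at this
  simpa only [Pi.add_apply, add_smul] using this

theorem HasCoeffDeriv.mul {O : Set E} {l : κ → E →L[ℝ] ℝ} {𝒜 : Subalgebra ℝ (E → ℝ)}
    {M N : E → ℝ} (hM : HasCoeffDeriv O l 𝒜 M) (hN : HasCoeffDeriv O l 𝒜 N) (hM' : M ∈ 𝒜)
    (hN' : N ∈ 𝒜) : HasCoeffDeriv O l 𝒜 (M * N) := by
  obtain ⟨c, hc, h⟩ := hM
  obtain ⟨d, hd, h'⟩ := hN
  refine ⟨fun k => M * d k + N * c k, fun k => 𝒜.add_mem (𝒜.mul_mem hM' (hd k))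
    (𝒜.mul_mem hN' (hc k)), fun p hp => ?_⟩
  have := (h p hp).mul (h' p hp)
  rw [Finset.smul_sum, Finset.smul_sum, ← Finset.sum_add_distrib] at this
  simpa only [Pi.add_apply, Pi.mul_apply, add_smul, smul_smul] using this

theorem HasCoeffDeriv.const (O : Set E) (l : κ → E →L[ℝ] ℝ) (𝒜 : Subalgebra ℝ (E → ℝ))
    (r : ℝ) : HasCoeffDeriv O l 𝒜 (algebraMap ℝ (E → ℝ) r) := by
  refine ⟨0, fun k => 𝒜.zero_mem, fun p _ => ?_⟩
  simp only [Pi.zero_apply, zero_smul, Finset.sum_const_zero]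
  exact hasFDerivAt_const r p

theorem hasCoeffDeriv_adjoin {O : Set E} {l : κ → E →L[ℝ] ℝ} {s : Set (E → ℝ)}
    (hs : ∀ γ ∈ s, HasCoeffDeriv O l (Algebra.adjoin ℝ s) γ) {M : E → ℝ}
    (hM : M ∈ Algebra.adjoin ℝ s) : HasCoeffDeriv O l (Algebra.adjoin ℝ s) M := by
  induction hM using Algebra.adjoin_induction with
  | mem x hx => exact hs x hx
  | algebraMap r => exact HasCoeffDeriv.const _ _ _ r
  | add x y _ _ hx hy => exact hx.add hy
  | mul x y hx' hy' hx hy => exact hx.mul hy hx' hy'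

/-- The functions `M * F ∘ G`, extended by zero, form a class that is stable under differentiation:
in `O` the partial derivatives are sums of such products, with new coefficients in `𝒜` and with `F`
or its directional derivatives. Off `O` the quadratic bound makes the differential zero, in
accordance with the same formula. Induction on the order of differentiability then needs nothing but
this stability. -/
theorem contDiff_indicator_mul_comp_aux {O : Set E} (hO : IsOpen O) {Z : Set E'}
    {l : κ → E →L[ℝ] ℝ} {𝒜 : Subalgebra ℝ (E → ℝ)} (h𝒜 : ∀ M ∈ 𝒜, HasCoeffDeriv O l 𝒜 M)
    {e : ι → E'} {g : ι → E → ℝ} (hg : ∀ j, HasCoeffDeriv O l 𝒜 (g j)) {G : E → E'}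
    (hG : ∀ p ∈ O, G p = ∑ j, g j p • e j)
    (hbd : ∀ F : E' → ℝ, FlatOn Z F → ∀ M ∈ 𝒜, ∀ p₀ ∉ O, ∃ C, ∀ᶠ p in 𝓝 p₀, p ∈ O →
      |M p * F (G p)| ≤ C * ‖p - p₀‖ ^ 2) (n : ℕ) :
    ∀ {M : E → ℝ}, M ∈ 𝒜 → ∀ {F : E' → ℝ}, FlatOn Z F →
    ContDiff ℝ n (O.indicator fun p => M p * F (G p)) := by
  have key : ∀ M : E → ℝ, M ∈ 𝒜 → ∀ F : E' → ℝ, FlatOn Z F → ∃ d : κ → ι → E → ℝ, 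
      (∀ k j, d k j ∈ 𝒜) ∧ ∃ c : κ → E → ℝ, (∀ k, c k ∈ 𝒜) ∧ 
      ∀ p, HasFDerivAt (O.indicator fun p => M p * F (G p))
        (∑ k, (O.indicator (fun p => c k p * F (G p)) p + ∑ j,
          O.indicator (fun p => d k j p * dirDeriv (e j) F (G p)) p) • l k) p := by
    intro M hM F hF
    obtain ⟨c, hc, h⟩ := h𝒜 M hM
    choose b hb hb' using hg
    refine ⟨fun k j => M * b j k, fun k j => 𝒜.mul_mem hM (hb j k), c, hc, fun p => ?_⟩
    by_cases hp : p ∈ O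
    · simp only [indicator_of_mem hp]
      have hGd : HasFDerivAt G (∑ j, (∑ k, b j k p • l k).smulRight (e j)) p := by
        have : HasFDerivAt (fun p => ∑ j, g j p • e j)
            (∑ j, (∑ k, b j k p • l k).smulRight (e j)) p :=
          HasFDerivAt.fun_sum fun j _ => (hb' j p hp).smul_const (e j)
        refine this.congr_of_eventuallyEq ?_
        filter_upwards [hO.mem_nhds hp] with x hx using hG x hx
      have h1 := (h p hp).mul ((hF.contDiff.hasFDerivAt_infty (G p)).comp p hGd)
      refine (h1.congr_fderiv ?_).congr_of_eventuallyEq ?_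
      · ext v
        simp only [_root_.add_apply, _root_.smul_apply,
          _root_.sum_apply, ContinuousLinearMap.comp_apply, smul_eq_mul,
          ContinuousLinearMap.smulRight_apply, map_sum, map_smul, Pi.mul_apply, dirDeriv,
          Finset.mul_sum, Finset.sum_mul, add_mul, Finset.sum_add_distrib, Function.comp_apply]
        rw [add_comm]
        congr 1
        · exact Finset.sum_congr rfl fun k _ => by ring
        · rw [Finset.sum_comm]
          exact Finset.sum_congr rfl fun k _ => Finset.sum_congr rfl fun j _ => by ring
      · filter_upwards [hO.mem_nhds hp] with x hx
        simp [hx]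
    · simp only [indicator_of_notMem hp, Finset.sum_const_zero, add_zero, zero_smul]
      obtain ⟨C, hC⟩ := hbd F hF M hM p hp
      rw [hasFDerivAt_iff_isLittleO_nhds_zero]
      have h2 : (fun v : E => O.indicator (fun p => M p * F (G p)) (p + v) -
          O.indicator (fun p => M p * F (G p)) p - (0 : E →L[ℝ] ℝ) v) =O[𝓝 0]
          fun v => ‖v‖ ^ 2 := by
        refine Asymptotics.IsBigO.of_bound |C| ?_
        have ht : Tendsto (fun v : E => p + v) (𝓝 0) (𝓝 p) := by
          have : Continuous fun v : E => p + v := by fun_prop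
          simpa using this.tendsto 0
        filter_upwards [ht.eventually hC] with v hv
        simp only [indicator_of_notMem hp, sub_zero, _root_.zero_apply]
        rw [Real.norm_of_nonneg (by positivity : 0 ≤ ‖v‖ ^ 2)]
        by_cases hv' : p + v ∈ O
        · rw [indicator_of_mem hv', Real.norm_eq_abs]
          refine (hv hv').trans ?_
          rw [add_sub_cancel_left]
          gcongr
          exact le_abs_self C
        · rw [indicator_of_notMem hv', norm_zero]
          positivity
      refine h2.trans_isLittleO ?_
      simpa using (Asymptotics.isLittleO_norm_pow_id one_lt_two)
  induction n with
  | zero =>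
    intro M hM F hF
    obtain ⟨d, hd, c, hc, h⟩ := key M hM F hF
    exact contDiff_zero.2 (continuous_iff_continuousAt.2 fun p => (h p).continuousAt)
  | succ n ih =>
    intro M hM F hF
    obtain ⟨d, hd, c, hc, h⟩ := key M hM F hF
    push_cast
    refine contDiff_succ_iff_hasFDerivAt.2 ⟨_, ?_, h⟩
    refine ContDiff.sum fun k _ => ContDiff.smul (ContDiff.add (ih (hc k) hF)
      (ContDiff.sum fun j _ => ih (hd k j) (hF.dirDeriv (e j)))) contDiff_const

/-- Growth like an inverse power of the weight `W` passes from the generators to the whole algebra.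
The bound on `W` allows different powers to be replaced by a common one. -/
theorem exists_bound_of_mem_adjoin {O : Set E} {s : Set (E → ℝ)} {W : E → ℝ}
    (hW0 : ∀ p ∈ O, 0 ≤ W p) {p₀ : E} {B : ℝ} (hW : ∀ᶠ p in 𝓝 p₀, p ∈ O → W p ≤ B)
    (hs : ∀ γ ∈ s, ∃ C, ∃ N : ℕ, ∀ᶠ p in 𝓝 p₀, p ∈ O → |γ p| * W p ^ N ≤ C) {M : E → ℝ}
    (hM : M ∈ Algebra.adjoin ℝ s) : ∃ C, ∃ N : ℕ, ∀ᶠ p in 𝓝 p₀, p ∈ O → |M p| * W p ^ N ≤ C := by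
  induction hM using Algebra.adjoin_induction with
  | mem x hx => exact hs x hx
  | algebraMap r => exact ⟨|r|, 0, Eventually.of_forall fun p _ => by simp⟩
  | add x y _ _ hx hy =>
    obtain ⟨C, N, h⟩ := hx
    obtain ⟨C', N', h'⟩ := hy
    refine ⟨C * max B 0 ^ N' + C' * max B 0 ^ N, N + N', ?_⟩
    filter_upwards [h, h', hW] with p hp hp' hWp hpO
    have h0 := hW0 p hpO
    have h1 : W p ≤ max B 0 := (hWp hpO).trans (le_max_left _ _)
    calc |(x + y) p| * W p ^ (N + N') ≤ (|x p| + |y p|) * W p ^ (N + N') := by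
          gcongr
          exact abs_add_le _ _
      _ = (|x p| * W p ^ N) * W p ^ N' + (|y p| * W p ^ N') * W p ^ N := by ring
      _ ≤ C * max B 0 ^ N' + C' * max B 0 ^ N := by
          have hC : 0 ≤ C := (by positivity : 0 ≤ |x p| * W p ^ N).trans (hp hpO)
          have hC' : 0 ≤ C' := (by positivity : 0 ≤ |y p| * W p ^ N').trans (hp' hpO)
          gcongr
          · exact hp hpO
          · exact hp' hpO
  | mul x y _ _ hx hy =>
    obtain ⟨C, N, h⟩ := hx
    obtain ⟨C', N', h'⟩ := hy
    refine ⟨C * C', N + N', ?_⟩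
    filter_upwards [h, h', hW] with p hp hp' hWp hpO
    have h0 := hW0 p hpO
    have hC : 0 ≤ C := (by positivity : 0 ≤ |x p| * W p ^ N).trans (hp hpO)
    calc |(x * y) p| * W p ^ (N + N') = (|x p| * W p ^ N) * (|y p| * W p ^ N') := by
          rw [Pi.mul_apply, abs_mul]; ring
      _ ≤ C * C' := by
          gcongr
          · exact hp hpO
          · exact hp' hpO

/-- Quantitative form of the principle that flat functions absorb singularities. The weight `W`
vanishes at least linearly at the boundary of `O`, the generators grow at most like inverse powers
of `W`, and `G` approaches `Z` at the rate of a root of `W`. Hence `F ∘ G` is smaller than any power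
of `W` and compensates for every `M` in the algebra. -/
theorem contDiff_indicator_mul_comp [FiniteDimensional ℝ E'] {O : Set E} (hO : IsOpen O)
    {Z : Set E'} {l : κ → E →L[ℝ] ℝ} {s : Set (E → ℝ)}
    (hs : ∀ γ ∈ s, HasCoeffDeriv O l (Algebra.adjoin ℝ s) γ)
    {e : ι → E'} {g : ι → E → ℝ} (hg : ∀ j, HasCoeffDeriv O l (Algebra.adjoin ℝ s) (g j))
    {G : E → E'} (hG : ∀ p ∈ O, G p = ∑ j, g j p • e j) {W : E → ℝ} (hW0 : ∀ p ∈ O, 0 ≤ W p)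
    (hW : ∀ p₀ ∉ O, ∃ C, ∀ᶠ p in 𝓝 p₀, p ∈ O → W p ≤ C * ‖p - p₀‖)
    (hγ : ∀ p₀ ∉ O, ∀ γ ∈ s, ∃ C, ∃ N : ℕ, ∀ᶠ p in 𝓝 p₀, p ∈ O → |γ p| * W p ^ N ≤ C)
    (hZ : ∀ p₀ ∉ O, ∃ R, ∃ m : ℕ, ∀ᶠ p in 𝓝 p₀, p ∈ O → ∃ q₀ ∈ Z, ‖G p‖ ≤ R ∧ ‖q₀‖ ≤ R ∧
      ‖G p - q₀‖ ^ m ≤ W p)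
    {M : E → ℝ} (hM : M ∈ Algebra.adjoin ℝ s) {F : E' → ℝ} (hF : FlatOn Z F) :
    ContDiff ℝ ∞ (O.indicator fun p => M p * F (G p)) := by
  refine contDiff_infty.2 fun n => contDiff_indicator_mul_comp_aux hO
    (fun M hM => hasCoeffDeriv_adjoin hs hM) hg hG ?_ n hM hF
  intro F hF M hM p₀ hp₀
  obtain ⟨C, hC⟩ := hW p₀ hp₀
  have hB : ∀ᶠ p in 𝓝 p₀, p ∈ O → W p ≤ |C| := by
    filter_upwards [hC, Metric.ball_mem_nhds p₀ one_pos] with p hp hp1 hpO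
    refine (hp hpO).trans ((mul_le_mul_of_nonneg_right (le_abs_self C) (norm_nonneg _)).trans ?_)
    rw [Metric.mem_ball, dist_eq_norm] at hp1
    exact mul_le_of_le_one_right (abs_nonneg _) hp1.le
  obtain ⟨D, N, hD⟩ := exists_bound_of_mem_adjoin hW0 hB (hγ p₀ hp₀) hM
  obtain ⟨R, m, hR⟩ := hZ p₀ hp₀
  -- This exponent makes `F ∘ G` of size `W ^ (N + 2)`: the power `N` absorbs the growth of `M`, and
  -- the remaining square gives the quadratic bound.
  obtain ⟨K, hK0, hK⟩ := hF.bound R (m * (N + 2))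
  refine ⟨K * D * C ^ 2, ?_⟩
  filter_upwards [hC, hD, hR] with p h1 h3 h4 hpO
  obtain ⟨q₀, hq₀, hGR, hq₀R, hq⟩ := h4 hpO
  have hW0' := hW0 p hpO
  have h6 := hK (G p) q₀ hq₀ hGR hq₀R
  have hD0 : 0 ≤ D := (by positivity : 0 ≤ |M p| * W p ^ N).trans (h3 hpO)
  rw [Real.norm_eq_abs] at h6
  calc |M p * F (G p)| = |M p| * |F (G p)| := abs_mul _ _
    _ ≤ |M p| * (K * W p ^ (N + 2)) := by
        gcongr
        refine h6.trans ?_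
        rw [pow_mul]
        gcongr
    _ = K * (|M p| * W p ^ N) * W p ^ 2 := by ring
    _ ≤ K * D * (C * ‖p - p₀‖) ^ 2 := by
        gcongr
        · exact h3 hpO
        · exact h1 hpO
    _ = K * D * C ^ 2 * ‖p - p₀‖ ^ 2 := by ring

/-- A locally Lipschitz function vanishing on the boundary of `O` is bounded in `O` by the distance
to the complement. -/
theorem exists_le_mul_norm_sub {O : Set E} (hO : IsOpen O) {W : E → ℝ}
    (hW : ∀ p₀, ∃ C, ∃ r > 0, ∀ p ∈ Metric.ball p₀ r, ∀ q ∈ Metric.ball p₀ r,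
      |W p - W q| ≤ C * ‖p - q‖) (h0 : ∀ p ∈ closure O, p ∉ O → W p = 0) (p₀ : E) (hp₀ : p₀ ∉ O) :
    ∃ C, ∀ᶠ p in 𝓝 p₀, p ∈ O → W p ≤ C * ‖p - p₀‖ := by
  obtain ⟨C, r, hr, h⟩ := hW p₀
  refine ⟨|C|, ?_⟩
  filter_upwards [Metric.ball_mem_nhds p₀ hr] with p hp hpO
  let c : ℝ → E := fun t => p₀ + t • (p - p₀)
  have hc : Continuous c := by fun_prop
  -- The last parameter at which the segment from `p₀` to `p` is outside `O` gives a boundary point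
  -- of `O`, where `W` vanishes; the Lipschitz estimate is applied between that point and `p`.
  let T : Set ℝ := {t | t ∈ Icc (0 : ℝ) 1 ∧ c t ∉ O}
  have hT : IsClosed T := isClosed_Icc.inter (hO.isClosed_compl.preimage hc)
  have hT0 : (0 : ℝ) ∈ T := ⟨by simp, by simpa [c] using hp₀⟩
  have hTb : BddAbove T := ⟨1, fun t ht => ht.1.2⟩
  have hm := hT.csSup_mem ⟨0, hT0⟩ hTb
  set t := sSup T with htdef
  have ht1 : t < 1 := lt_of_le_of_ne hm.1.2 fun he => by
    apply hm.2
    rw [he]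
    simpa [c] using hpO
  have hcl : c t ∈ closure O := by
    have h1 : t ∈ closure (Ioc t 1) := by
      rw [closure_Ioc ht1.ne]; exact left_mem_Icc.2 ht1.le
    have h2 : Ioc t 1 ⊆ c ⁻¹' O := by
      intro u hu
      by_contra hu'
      have : u ∈ T := ⟨⟨hm.1.1.trans hu.1.le, hu.2⟩, hu'⟩
      exact absurd (le_csSup hTb this) (not_le.2 hu.1)
    exact hc.closure_preimage_subset O (closure_mono h2 h1)
  have hz := h0 _ hcl hm.2
  have hball : c t ∈ Metric.ball p₀ r := by
    rw [Metric.mem_ball, dist_eq_norm] at hp ⊢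
    have : c t - p₀ = t • (p - p₀) := by simp [c]
    rw [this, norm_smul, Real.norm_of_nonneg hm.1.1]
    exact (mul_le_of_le_one_left (norm_nonneg _) hm.1.2).trans_lt hp
  have h3 := h p hp (c t) hball
  rw [hz, sub_zero] at h3
  refine (le_abs_self _).trans (h3.trans ?_)
  have h4 : p - c t = (1 - t) • (p - p₀) := by simp only [c]; module
  rw [h4, norm_smul, Real.norm_of_nonneg (by linarith)]
  refine (mul_le_mul_of_nonneg_right (le_abs_self C) (mul_nonneg (by linarith) (norm_nonneg _))).trans ?_
  gcongr
  exact mul_le_of_le_one_left (norm_nonneg _) (by linarith [hm.1.1])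

end

/-! ### Borel's lemma with parameters -/

section
variable {P : Type} [NormedAddCommGroup P] [NormedSpace ℝ P] [FiniteDimensional ℝ P]

/-- The criterion `contDiff_tsum_of_eventually` requires bounds on the whole space. Multiplication
of all terms by a bump function around `p₀` provides them, by the Leibniz rule, without changing the
sum near `p₀`. -/
theorem contDiff_tsum_of_locally_bounded {f : ℕ → P → ℝ} (hf : ∀ m, ContDiff ℝ ∞ (f m))
    (hb : ∀ (k : ℕ) (p₀ : P), ∃ r > 0, ∀ᶠ m in atTop, ∀ p ∈ Metric.ball p₀ r,
      ‖iteratedFDeriv ℝ k (f m) p‖ ≤ (1 / 2) ^ m) :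
    ContDiff ℝ ∞ fun p => ∑' m, f m p := by
  refine contDiff_infty.2 fun n => contDiff_iff_contDiffAt.2 fun p₀ => ?_
  choose r hr hrb using fun k => hb k p₀
  obtain ⟨r₀, hr₀, hr₀'⟩ : ∃ r₀ > 0, ∀ k ≤ n, r₀ ≤ r k := by
    refine ⟨(Finset.range (n + 1)).inf' ⟨0, by simp⟩ r, ?_, fun k hk => ?_⟩
    · exact (Finset.lt_inf'_iff _).2 fun k _ => hr k
    · exact Finset.inf'_le _ (by simp; omega)
  let ψ : ContDiffBump p₀ := ⟨r₀ / 4, r₀ / 2, by positivity, by linarith⟩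
  have hψ : ContDiff ℝ ∞ ψ := ψ.contDiff
  have hψb : ∀ i : ℕ, ∃ C, 0 ≤ C ∧ ∀ p, ‖iteratedFDeriv ℝ i ψ p‖ ≤ C := by
    intro i
    have hcs := (ψ.hasCompactSupport).iteratedFDeriv (𝕜 := ℝ) i
    obtain ⟨C, hC⟩ := hcs.exists_bound_of_continuous
      (hψ.continuous_iteratedFDeriv (by exact_mod_cast le_top))
    exact ⟨C, (norm_nonneg _).trans (hC p₀), hC⟩
  choose A hA0 hA using hψb
  have hsm : ContDiff ℝ n fun p => ∑' m, ψ p * f m p := by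
    refine contDiff_tsum_of_eventually (N := n)
      (v := fun k m => (∑ i ∈ Finset.range (k + 1), (k.choose i : ℝ) * A i) * (1 / 2) ^ m)
      (fun m => (hψ.mul (hf m)).of_le (by exact_mod_cast le_top))
      (fun k _ => (summable_geometric_two).mul_left _) fun k hk => ?_
    rw [Nat.cofinite_eq_atTop]
    have hall : ∀ᶠ m in atTop, ∀ j ∈ Finset.range (k + 1), ∀ p ∈ Metric.ball p₀ (r j),
      ‖iteratedFDeriv ℝ j (f m) p‖ ≤ (1 / 2) ^ m := by
      rw [Filter.eventually_all_finset]
      exact fun j _ => hrb j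
    filter_upwards [hall] with m hm p
    have hk' : k ≤ n := by exact_mod_cast hk
    by_cases hp : p ∈ Metric.ball p₀ r₀
    · refine (norm_iteratedFDeriv_mul_le hψ (hf m) p (n := k) (by exact_mod_cast le_top)).trans ?_
      rw [Finset.sum_mul]
      refine Finset.sum_le_sum fun i hi => ?_
      have hi' : k - i ≤ k := Nat.sub_le _ _
      have h1 := hm (k - i) (by simp) p (Metric.ball_subset_ball (hr₀' _ (hi'.trans hk')) hp)
      have := hA i p
      have := hA0 i
      exact mul_le_mul (by gcongr) h1 (norm_nonneg _) (by positivity)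
    · have h0 : (fun p => ψ p * f m p) =ᶠ[𝓝 p] fun _ => 0 := by
        have hd : ∀ᶠ q in 𝓝 p, r₀ / 2 < dist q p₀ := by
          have : Continuous fun q => dist q p₀ := by fun_prop
          refine this.continuousAt.eventually (lt_mem_nhds ?_)
          rw [Metric.mem_ball, not_lt] at hp
          linarith
        filter_upwards [hd] with q hq
        rw [ψ.zero_of_le_dist hq.le, zero_mul]
      have h2 := (h0.iteratedFDeriv ℝ k).eq_of_nhds
      rw [h2]
      simp only [iteratedFDeriv_fun_zero, Pi.zero_apply, norm_zero]
      have : 0 ≤ ∑ i ∈ Finset.range (k + 1), (k.choose i : ℝ) * A i :=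
        Finset.sum_nonneg fun i _ => mul_nonneg (by positivity) (hA0 i)
      positivity
  refine hsm.contDiffAt.congr_of_eventuallyEq ?_
  filter_upwards [Metric.ball_mem_nhds p₀ (by positivity : 0 < r₀ / 4)] with p hp
  have : ψ p = 1 := ψ.one_of_mem_closedBall (Metric.ball_subset_closedBall hp)
  simp [this]

/-- A smooth cut-off function on the line, equal to one near the origin. -/
noncomputable def lineBump : ContDiffBump (0 : ℝ) := ⟨1, 2, one_pos, one_lt_two⟩

/-- With η(u) = uⁿ χ(u) the function of the last variable is T⁻ⁿ η(T t). A derivative of order `k <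
n` costs at most a factor Tᵏ, so a factor T⁻¹ is left over and makes the product small. -/
theorem exists_scale_bound {c : P → ℝ} (hc : ContDiff ℝ ∞ c) (n : ℕ) (R ε : ℝ) (hε : 0 < ε) :
    ∃ T₀ : ℝ, 1 ≤ T₀ ∧ ∀ T, T₀ ≤ T → ∀ k < n, ∀ q : P × ℝ, ‖q.1‖ ≤ R →
      ‖iteratedFDeriv ℝ k (fun q : P × ℝ => c q.1 * (q.2 ^ n * lineBump (T * q.2))) q‖ ≤ ε := by
  have hη : ContDiff ℝ ∞ fun u : ℝ => u ^ n * lineBump u :=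
    (contDiff_id.pow n).mul lineBump.contDiff
  have hηb : ∀ i : ℕ, ∃ C, 0 ≤ C ∧ ∀ p,
      ‖iteratedFDeriv ℝ i (fun u : ℝ => u ^ n * lineBump u) p‖ ≤ C := by
    intro i
    have hcs := (lineBump.hasCompactSupport.mul_left (f := fun u : ℝ => u ^ n)).iteratedFDeriv
      (𝕜 := ℝ) i
    obtain ⟨C, hC⟩ := hcs.exists_bound_of_continuous
      (hη.continuous_iteratedFDeriv (by exact_mod_cast le_top))
    exact ⟨C, (norm_nonneg _).trans (hC 0), hC⟩
  choose A hA0 hA using hηb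
  have hc1 : ContDiff ℝ ∞ fun q : P × ℝ => c q.1 := hc.comp contDiff_fst
  have hcb : ∀ i : ℕ, ∃ C, 0 ≤ C ∧ ∀ q : P × ℝ, ‖q.1‖ ≤ R →
      ‖iteratedFDeriv ℝ i (fun q : P × ℝ => c q.1) q‖ ≤ C := by
    intro i
    obtain ⟨C, hC⟩ := (isCompact_closedBall (0 : P) R).exists_bound_of_continuousOn
      (hc.continuous_iteratedFDeriv (m := i) (by exact_mod_cast le_top)).continuousOn
    refine ⟨max C 0, le_max_right _ _, fun q hq => ?_⟩
    have h := ContinuousLinearMap.iteratedFDeriv_comp_right (ContinuousLinearMap.fst ℝ P ℝ)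
      (f := c) (n := ∞) hc q (i := i) (by exact_mod_cast le_top)
    have e : c ∘ (ContinuousLinearMap.fst ℝ P ℝ) = fun q : P × ℝ => c q.1 := rfl
    rw [← e, h]
    refine (ContinuousMultilinearMap.norm_compContinuousLinearMap_le _ _).trans ?_
    have h1 : ∏ _j : Fin i, ‖ContinuousLinearMap.fst ℝ P ℝ‖ ≤ 1 :=
      Finset.prod_le_one (fun _ _ => norm_nonneg _) fun _ _ => ContinuousLinearMap.norm_fst_le ..
    refine (mul_le_of_le_one_right (norm_nonneg _) h1).trans ?_
    exact (hC q.1 (by simpa using hq)).trans (le_max_left _ _)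
  choose D hD0 hD using hcb
  set C : ℝ := ∑ k ∈ Finset.range n, ∑ i ∈ Finset.range (k + 1), (k.choose i : ℝ) * D i * A (k - i)
    with hCdef
  have hCk : ∀ k < n, ∑ i ∈ Finset.range (k + 1), (k.choose i : ℝ) * D i * A (k - i) ≤ C := by
    intro k hk
    exact Finset.single_le_sum (f := fun k => ∑ i ∈ Finset.range (k + 1),
      (k.choose i : ℝ) * D i * A (k - i)) (fun k _ => Finset.sum_nonneg fun i _ =>
      mul_nonneg (mul_nonneg (by positivity) (hD0 i)) (hA0 _)) (Finset.mem_range.2 hk)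
  refine ⟨max 1 (C / ε), le_max_left _ _, fun T hT k hk q hq => ?_⟩
  have hT1 : 1 ≤ T := (le_max_left _ _).trans hT
  have hT0 : 0 < T := by linarith
  have hTC : C ≤ ε * T := by
    have := (le_max_right 1 (C / ε)).trans hT
    rwa [div_le_iff₀ hε, mul_comm] at this
  let Λ : P × ℝ →L[ℝ] ℝ := T • ContinuousLinearMap.snd ℝ P ℝ
  have hΛ : ‖Λ‖ ≤ T := by
    rw [norm_smul, Real.norm_of_nonneg hT0.le]
    exact mul_le_of_le_one_right hT0.le (ContinuousLinearMap.norm_snd_le ..)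
  have e1 : (fun q : P × ℝ => c q.1 * (q.2 ^ n * lineBump (T * q.2))) =
      fun q => c q.1 * ((T⁻¹ ^ n) * ((fun u : ℝ => u ^ n * lineBump u) ∘ Λ) q) := by
    funext q
    simp only [Function.comp_apply, Λ, _root_.smul_apply, ContinuousLinearMap.coe_snd',
      smul_eq_mul, mul_pow]
    have : T⁻¹ ^ n * T ^ n = 1 := by rw [← mul_pow, inv_mul_cancel₀ hT0.ne', one_pow]
    linear_combination (-(c q.1 * q.2 ^ n * lineBump (T * q.2))) * this
  have hcomp : ContDiff ℝ ∞ ((fun u : ℝ => u ^ n * lineBump u) ∘ Λ) := hη.comp Λ.contDiff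
  have hb2 : ∀ j < n, ‖iteratedFDeriv ℝ j
      (fun q => (T⁻¹ ^ n) * ((fun u : ℝ => u ^ n * lineBump u) ∘ Λ) q) q‖ ≤ T⁻¹ * A j := by
    intro j hj
    have h0 : iteratedFDeriv ℝ j
      (fun q => (T⁻¹ ^ n) * ((fun u : ℝ => u ^ n * lineBump u) ∘ Λ) q) q =
      (T⁻¹ ^ n) • iteratedFDeriv ℝ j ((fun u : ℝ => u ^ n * lineBump u) ∘ Λ) q := by
      have := iteratedFDeriv_const_smul_apply (𝕜 := ℝ) (a := T⁻¹ ^ n) (i := j) (x := q)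
        (f := (fun u : ℝ => u ^ n * lineBump u) ∘ Λ)
        (hcomp.of_le (by exact_mod_cast le_top)).contDiffAt
      rw [← this]
      rfl
    rw [h0, norm_smul, Λ.iteratedFDeriv_comp_right (n := ∞) hη q (by exact_mod_cast le_top)]
    have h1 := ContinuousMultilinearMap.norm_compContinuousLinearMap_le
      (iteratedFDeriv ℝ j (fun u : ℝ => u ^ n * lineBump u) (Λ q)) (fun _ : Fin j => Λ)
    rw [Finset.prod_const, Finset.card_univ, Fintype.card_fin] at h1
    have h2 : ‖Λ‖ ^ j ≤ T ^ j := by gcongr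
    have h3 := hA j (Λ q)
    have h4 : ‖T⁻¹ ^ n‖ = T⁻¹ ^ n := Real.norm_of_nonneg (by positivity)
    rw [h4]
    have h5 : T⁻¹ ^ n * T ^ j ≤ T⁻¹ := by
      obtain ⟨m, rfl⟩ : ∃ m, n = j + (m + 1) := ⟨n - j - 1, by omega⟩
      have : T⁻¹ ^ (j + (m + 1)) * T ^ j = T⁻¹ ^ m * T⁻¹ := by
        rw [pow_add, pow_succ]
        have : T⁻¹ ^ j * T ^ j = 1 := by rw [← mul_pow, inv_mul_cancel₀ hT0.ne', one_pow]
        linear_combination (T⁻¹ ^ m * T⁻¹) * this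
      rw [this]
      exact mul_le_of_le_one_left (by positivity)
        (pow_le_one₀ (by positivity) (inv_le_one_of_one_le₀ hT1))
    calc _ ≤ T⁻¹ ^ n * (A j * T ^ j) := by
          have := hA0 j
          gcongr
          exact h1.trans (mul_le_mul h3 h2 (by positivity) this)
      _ = (T⁻¹ ^ n * T ^ j) * A j := by ring
      _ ≤ _ := by gcongr; exact hA0 j
  rw [e1]
  refine (norm_iteratedFDeriv_mul_le hc1 (contDiff_const.mul hcomp) q (n := k)
    (by exact_mod_cast le_top)).trans ?_
  calc _ ≤ ∑ i ∈ Finset.range (k + 1), (k.choose i : ℝ) * D i * (T⁻¹ * A (k - i)) := by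
        refine Finset.sum_le_sum fun i hi => ?_
        have h1 := hb2 (k - i) (by omega)
        have h2 := hD i q hq
        have := hD0 i
        gcongr
    _ = T⁻¹ * ∑ i ∈ Finset.range (k + 1), (k.choose i : ℝ) * D i * A (k - i) := by
        rw [Finset.mul_sum]
        exact Finset.sum_congr rfl fun i _ => by ring
    _ ≤ T⁻¹ * (ε * T) := by
        gcongr
        exact (hCk k hk).trans hTC
    _ = ε := by field_simp

/-- The numerator vanishes near the origin. Such quotients account for the cut-offs in the first `n`
terms of the Borel sum when the remainder is divided by `t ^ n`. -/
theorem contDiff_lineBump_sub_one_div (T : ℝ) (n : ℕ) :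
    ContDiff ℝ ∞ fun t : ℝ => (lineBump (T * t) - 1) / t ^ n := by
  refine contDiff_iff_contDiffAt.2 fun t => ?_
  by_cases ht : t = 0
  · have : (fun t : ℝ => (lineBump (T * t) - 1) / t ^ n) =ᶠ[𝓝 t] fun _ => 0 := by
      have hc : Continuous fun t : ℝ => T * t := by fun_prop
      have : ∀ᶠ u in 𝓝 t, T * u ∈ Metric.ball (0 : ℝ) 1 :=
        hc.continuousAt.eventually (Metric.isOpen_ball.mem_nhds (by simp [ht]))
      filter_upwards [this] with u hu
      rw [lineBump.one_of_mem_closedBall (Metric.ball_subset_closedBall hu)]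
      simp
    exact contDiffAt_const.congr_of_eventuallyEq this
  · exact ContDiffAt.div (((lineBump.contDiff.comp (contDiff_const.mul contDiff_id)).sub
      contDiff_const).contDiffAt) (contDiff_id.pow n).contDiffAt (pow_ne_zero n ht)

/-- Borel's lemma: there is a smooth function with prescribed Taylor coefficients in the last
variable, which depend smoothly on parameters. -/
theorem exists_borel_sum {c : ℕ → P → ℝ} (hc : ∀ n, ContDiff ℝ ∞ (c n)) :
    ∃ B : P × ℝ → ℝ, ContDiff ℝ ∞ B ∧
      (∀ n, ∃ B' : P × ℝ → ℝ, ContDiff ℝ ∞ B' ∧ ∀ p t,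
        B (p, t) = ∑ j ∈ Finset.range n, c j p * t ^ j + t ^ n * B' (p, t)) ∧
      ∀ p, (∀ n, c n p = 0) → ∀ t, B (p, t) = 0 := by
  choose T₀ hT₀ hT₀b using fun m n : ℕ => exists_scale_bound (hc m) n m ((1 / 2) ^ m) (by positivity)
  -- One scale for the coefficient `m` has to serve for all exponents `n ≤ m`, because the
  -- remainders below carry the same cut-offs with lower powers of `t`.
  let T : ℕ → ℝ := fun m => ∑ n ∈ Finset.range (m + 1), T₀ m n
  have hTle : ∀ m, ∀ n ≤ m, T₀ m n ≤ T m := fun m n hn =>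
    Finset.single_le_sum (f := fun n => T₀ m n) (fun i _ => by linarith [hT₀ m i])
      (Finset.mem_range.2 (by omega))
  -- For `n = 0` these are the terms of the Borel sum; for general `n` they are its terms from the
  -- `n`-th on, divided by `t ^ n`.
  let f : ℕ → ℕ → P × ℝ → ℝ := fun n m q =>
    c (m + n) q.1 * (q.2 ^ m * lineBump (T (m + n) * q.2))
  have hfs : ∀ n m, ContDiff ℝ ∞ (f n m) := fun n m =>
    ((hc _).comp contDiff_fst).mul ((contDiff_snd.pow m).mul
      (lineBump.contDiff.comp (contDiff_const.mul contDiff_snd)))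
  have hS : ∀ n, ContDiff ℝ ∞ fun q => ∑' m, f n m q := by
    intro n
    refine contDiff_tsum_of_locally_bounded (hfs n) fun k p₀ => ⟨1, one_pos, ?_⟩
    obtain ⟨m₀, hm₀⟩ := exists_nat_ge (‖p₀‖ + 1)
    filter_upwards [eventually_gt_atTop k, eventually_ge_atTop m₀] with m hm hm' q hq
    have hq1 : ‖q.1‖ ≤ ((m + n : ℕ) : ℝ) := by
      rw [Metric.mem_ball, dist_eq_norm] at hq
      have h1 : ‖q‖ ≤ ‖p₀‖ + ‖q - p₀‖ := by simpa using norm_add_le p₀ (q - p₀)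
      have h2 : (m₀ : ℝ) ≤ ((m + n : ℕ) : ℝ) := by exact_mod_cast (by omega)
      linarith [norm_fst_le q]
    refine (hT₀b (m + n) m (T (m + n)) (hTle _ _ (by omega)) k hm q hq1).trans ?_
    exact pow_le_pow_of_le_one (by norm_num) (by norm_num) (by omega)
  have hsum : ∀ n q, Summable fun m => f n m q := by
    intro n q
    by_cases hq : q.2 = 0
    · refine summable_of_ne_finset_zero (s := {0}) fun m hm => ?_
      have : m ≠ 0 := by simpa using hm
      simp [f, hq, this]
    · obtain ⟨m₀, hm₀⟩ := exists_nat_ge ‖q.1‖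
      refine Summable.of_norm_bounded_eventually_nat (g := fun m => (1 / 2 : ℝ) ^ m)
        summable_geometric_two ?_
      filter_upwards [eventually_ge_atTop m₀, eventually_gt_atTop 0] with m hm hm'
      have hq1 : ‖q.1‖ ≤ ((m + n : ℕ) : ℝ) := by
        have h2 : (m₀ : ℝ) ≤ ((m + n : ℕ) : ℝ) := by exact_mod_cast (by omega)
        linarith
      have := hT₀b (m + n) m (T (m + n)) (hTle _ _ (by omega)) 0 hm' q hq1
      rw [norm_iteratedFDeriv_zero] at this
      exact this.trans (pow_le_pow_of_le_one (by norm_num) (by norm_num) (by omega))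
  refine ⟨fun q => ∑' m, f 0 m q, hS 0, fun n => ⟨fun q => (∑ j ∈ Finset.range n, c j q.1 *
    q.2 ^ j * ((lineBump (T j * q.2) - 1) / q.2 ^ n)) + ∑' m, f n m q, ?_, fun p t => ?_⟩, ?_⟩
  · refine ContDiff.add (ContDiff.sum fun j _ => ?_) (hS n)
    exact (((hc j).comp contDiff_fst).mul (contDiff_snd.pow j)).mul
      ((contDiff_lineBump_sub_one_div (T j) n).comp contDiff_snd)
  · have h1 := (hsum 0 (p, t)).sum_add_tsum_nat_add n
    change ∑' m, f 0 m (p, t) = _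
    rw [← h1, mul_add, ← add_assoc, Finset.mul_sum, ← Finset.sum_add_distrib]
    congr 1
    · refine Finset.sum_congr rfl fun j _ => ?_
      by_cases ht : t = 0
      · subst ht
        have : lineBump (0 : ℝ) = 1 := lineBump.one_of_mem_closedBall (by simp [lineBump])
        simp [f, this]
      · simp only [f, Nat.add_zero]
        field_simp
        ring
    · rw [← tsum_mul_left]
      refine tsum_congr fun m => ?_
      simp only [f, Nat.add_zero]
      ring
  · intro p hp t
    simp [f, hp]

end

/-! ### Flatness of functions divisible by all powers of a function -/

section
variable {E E' : Type} [NormedAddCommGroup E] [NormedSpace ℝ E] [NormedAddCommGroup E']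
  [NormedSpace ℝ E']

theorem FlatOn.comp {Z : Set E'} {F : E' → ℝ} (hF : FlatOn Z F) {Ψ : E → E'}
    (hΨ : ContDiff ℝ ∞ Ψ) : FlatOn (Ψ ⁻¹' Z) (fun q => F (Ψ q)) := by
  refine ⟨hF.contDiff.comp hΨ, fun q hq n => ?_⟩
  obtain ⟨D, hD1, hD⟩ : ∃ D : ℝ, 1 ≤ D ∧ ∀ i ≤ n, ‖iteratedFDeriv ℝ i Ψ q‖ ≤ D := by
    refine ⟨1 + ∑ i ∈ Finset.range (n + 1), ‖iteratedFDeriv ℝ i Ψ q‖, ?_, fun i hi => ?_⟩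
    · have := Finset.sum_nonneg fun i (_ : i ∈ Finset.range (n + 1)) =>
        norm_nonneg (iteratedFDeriv ℝ i Ψ q)
      linarith
    · have := Finset.single_le_sum (f := fun i => ‖iteratedFDeriv ℝ i Ψ q‖)
        (fun i _ => norm_nonneg _) (Finset.mem_range.2 (Nat.lt_succ_of_le hi))
      linarith
  -- All derivatives of `F` vanish at `Ψ q`, so the estimate for derivatives of a composition holds
  -- with `C = 0`.
  have h := norm_iteratedFDeriv_comp_le (g := F) (f := Ψ) (n := n) (N := ∞) hF.contDiff hΨ
    (by exact_mod_cast le_top) q (C := 0) (D := D)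
    (fun i _ => by rw [hF.flat _ hq i, norm_zero])
    (fun i hi hin => (hD i hin).trans (le_self_pow₀ hD1 (by omega)))
  simp only [mul_zero, zero_mul] at h
  exact norm_le_zero_iff.1 h

/-- Each differentiation lowers the exponent of `ℓ` by at most one, and the other factor stays
smooth, with values in a new space. -/
theorem iteratedFDeriv_pow_smul_eq_zero {ℓ : E → ℝ} (hℓ : ContDiff ℝ ∞ ℓ) {q : E} (hq : ℓ q = 0)
    (n : ℕ) : ∀ {V : Type} [NormedAddCommGroup V] [NormedSpace ℝ V] {G : E → V} (m : ℕ), n < m →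
    ContDiff ℝ ∞ G → iteratedFDeriv ℝ n (fun q => ℓ q ^ m • G q) q = 0 := by
  induction n with
  | zero =>
    intro V _ _ G m hm _
    rw [← norm_eq_zero, norm_iteratedFDeriv_zero, hq, zero_pow (by omega), zero_smul, norm_zero]
  | succ n ih =>
    intro V _ _ G m hm hG
    obtain ⟨m, rfl⟩ : ∃ k, m = k + 1 := ⟨m - 1, by omega⟩
    rw [← norm_eq_zero, ← norm_iteratedFDeriv_fderiv, norm_eq_zero]
    have h1 : fderiv ℝ (fun q => ℓ q ^ (m + 1) • G q) = fun q => ℓ q ^ m •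
        (ℓ q • fderiv ℝ G q + ((m + 1 : ℝ) • fderiv ℝ ℓ q).smulRight (G q)) := by
      funext x
      have h2 := ((hℓ.hasFDerivAt_infty x).pow (m + 1)).smul (hG.hasFDerivAt_infty x)
      refine h2.fderiv.trans ?_
      ext v
      simp only [add_apply, smul_apply, ContinuousLinearMap.smulRight_apply, Nat.add_sub_cancel,
        nsmul_eq_mul, smul_eq_mul, smul_add, smul_smul, pow_succ]
      push_cast
      congr 2
      ring
    rw [h1]
    refine ih m (by omega) ?_
    have hd : ContDiff ℝ ∞ (fderiv ℝ ℓ) := hℓ.fderiv_right (by simp)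
    have hd' : ContDiff ℝ ∞ (fderiv ℝ G) := hG.fderiv_right (by simp)
    have hd2 : ContDiff ℝ ∞ fun q => (m + 1 : ℝ) • fderiv ℝ ℓ q := hd.const_smul _
    exact (hℓ.smul hd').add (hd2.smulRight hG)

theorem flatOn_of_forall_eq_pow_mul {F ℓ : E → ℝ} (hF : ContDiff ℝ ∞ F) (hℓ : ContDiff ℝ ∞ ℓ)
    (h : ∀ n : ℕ, ∃ G : E → ℝ, ContDiff ℝ ∞ G ∧ ∀ q, F q = ℓ q ^ n * G q) :
    FlatOn {q | ℓ q = 0} F := by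
  refine ⟨hF, fun q hq n => ?_⟩
  obtain ⟨G, hG, hFG⟩ := h (n + 1)
  have : F = fun q => ℓ q ^ (n + 1) • G q := funext fun q => by rw [hFG q, smul_eq_mul]
  rw [this]
  exact iteratedFDeriv_pow_smul_eq_zero hℓ hq n (n + 1) (Nat.lt_succ_self n) hG

end

/-! ### Square roots and even functions -/

/-- The coordinates of three-dimensional space. -/
noncomputable def coordThree : Fin 3 → (ℝ × ℝ × ℝ) →L[ℝ] ℝ :=
  ![ContinuousLinearMap.fst ℝ ℝ (ℝ × ℝ),
    (ContinuousLinearMap.fst ℝ ℝ ℝ).comp (ContinuousLinearMap.snd ℝ ℝ (ℝ × ℝ)),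
    (ContinuousLinearMap.snd ℝ ℝ ℝ).comp (ContinuousLinearMap.snd ℝ ℝ (ℝ × ℝ))]

/-- The standard basis of three-dimensional space. -/
def basisThree : Fin 3 → ℝ × ℝ × ℝ := ![(1, 0, 0), (0, 1, 0), (0, 0, 1)]

/-- Flatness at zero makes a function of a square root smooth in the square. This is the absorption
principle for the algebra generated by √t and its inverse, with weight t: the derivatives of √t grow
like inverse powers of t, and √t approaches zero as the square root of the weight. -/
theorem contDiff_indicator_comp_sqrt {F : ℝ × ℝ × ℝ → ℝ} (hF : FlatOn {q | q.1 = 0} F) :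
    ContDiff ℝ ∞ ({q : ℝ × ℝ × ℝ | 0 < q.1}.indicator fun q => F (√q.1, q.2)) := by
  let s : Set (ℝ × ℝ × ℝ → ℝ) := {fun q => √q.1, fun q => (√q.1)⁻¹}
  have hO : IsOpen {q : ℝ × ℝ × ℝ | 0 < q.1} := isOpen_lt continuous_const continuous_fst
  have m1 : (fun q : ℝ × ℝ × ℝ => √q.1) ∈ Algebra.adjoin ℝ s :=
    Algebra.subset_adjoin (by simp [s])
  have m2 : (fun q : ℝ × ℝ × ℝ => (√q.1)⁻¹) ∈ Algebra.adjoin ℝ s :=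
    Algebra.subset_adjoin (by simp [s])
  have d1 : ∀ p ∈ {q : ℝ × ℝ × ℝ | 0 < q.1}, HasFDerivAt (fun q : ℝ × ℝ × ℝ => √q.1)
      (((1 / 2 : ℝ) * (√p.1)⁻¹) • ContinuousLinearMap.fst ℝ ℝ (ℝ × ℝ)) p := by
    intro p hp
    have := (hasFDerivAt_fst (𝕜 := ℝ) (p := p)).sqrt (ne_of_gt hp)
    refine this.congr_fderiv ?_
    rw [one_div, one_div, mul_inv]
  have c1 : HasCoeffDeriv {q : ℝ × ℝ × ℝ | 0 < q.1} coordThree (Algebra.adjoin ℝ s)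
      fun q => √q.1 := by
    refine ⟨![(1 / 2 : ℝ) • fun q => (√q.1)⁻¹, 0, 0], ?_, fun p hp => ?_⟩
    · intro k
      fin_cases k
      · exact Subalgebra.smul_mem _ m2 _
      · exact Subalgebra.zero_mem _
      · exact Subalgebra.zero_mem _
    · simpa [Fin.sum_univ_three, coordThree] using d1 p hp
  have hpow : ∀ p₀ : ℝ × ℝ × ℝ, p₀ ∉ {q : ℝ × ℝ × ℝ | 0 < q.1} → ∀ᶠ p in 𝓝 p₀, p.1 < 1 := by
    intro p₀ hp₀
    have : p₀.1 < 1 := by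
      simp only [mem_ofPred_eq, not_lt] at hp₀
      linarith
    exact (isOpen_lt continuous_fst continuous_const).mem_nhds this
  have := contDiff_indicator_mul_comp (E' := ℝ × ℝ × ℝ) hO (Z := {q | q.1 = 0}) (l := coordThree)
    (s := s) ?_ (e := basisThree) (g := ![fun q => √q.1, fun q => q.2.1, fun q => q.2.2]) ?_
    (G := fun q => (√q.1, q.2)) ?_ (W := fun q => q.1) ?_ ?_ ?_ ?_ (M := 1)
    (Subalgebra.one_mem _) hF
  · simpa using this
  · intro γ hγ
    rcases hγ with rfl | rfl
    · exact c1
    · refine ⟨![(-(1 / 2) : ℝ) • ((fun q => (√q.1)⁻¹) * (fun q => (√q.1)⁻¹) *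
        fun q => (√q.1)⁻¹), 0, 0], ?_, fun p hp => ?_⟩
      · intro k
        fin_cases k
        · exact Subalgebra.smul_mem _ (mul_mem (mul_mem m2 m2) m2) _
        · exact Subalgebra.zero_mem _
        · exact Subalgebra.zero_mem _
      · have hne : √p.1 ≠ 0 := (Real.sqrt_pos.2 hp).ne'
        have := (hasDerivAt_inv hne).comp_hasFDerivAt p (d1 p hp)
        refine this.congr_fderiv ?_
        simp only [Fin.sum_univ_three, coordThree, Matrix.cons_val_zero, Matrix.cons_val_one,
          Matrix.cons_val, Pi.zero_apply, zero_smul, add_zero, Pi.smul_apply, Pi.mul_apply,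
          smul_eq_mul, smul_smul]
        congr 1
        field_simp
  · intro j
    fin_cases j
    · exact c1
    · refine ⟨![0, 1, 0], ?_, fun p _ => ?_⟩
      · intro k
        fin_cases k
        · exact Subalgebra.zero_mem _
        · exact Subalgebra.one_mem _
        · exact Subalgebra.zero_mem _
      · have := (coordThree 1).hasFDerivAt (x := p)
        simp only [Fin.sum_univ_three, Matrix.cons_val_zero, Matrix.cons_val_one,
          Matrix.cons_val, Pi.zero_apply, Pi.one_apply, zero_smul, one_smul, add_zero, zero_add]
        exact this
    · refine ⟨![0, 0, 1], ?_, fun p _ => ?_⟩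
      · intro k
        fin_cases k
        · exact Subalgebra.zero_mem _
        · exact Subalgebra.zero_mem _
        · exact Subalgebra.one_mem _
      · have := (coordThree 2).hasFDerivAt (x := p)
        simp only [Fin.sum_univ_three, Matrix.cons_val_zero, Matrix.cons_val_one,
          Matrix.cons_val, Pi.zero_apply, Pi.one_apply, zero_smul, one_smul, add_zero, zero_add]
        exact this
  · intro p _
    simp [Fin.sum_univ_three, basisThree]
  · exact fun p hp => le_of_lt hp
  · intro p₀ hp₀
    refine ⟨1, Eventually.of_forall fun p hp => ?_⟩
    rw [one_mul]
    simp only [mem_ofPred_eq, not_lt] at hp₀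
    calc p.1 ≤ (p - p₀).1 := by simp only [Prod.fst_sub]; linarith
      _ ≤ ‖(p - p₀).1‖ := le_abs_self _
      _ ≤ ‖p - p₀‖ := norm_fst_le _
  · intro p₀ hp₀ γ hγ
    rcases hγ with rfl | rfl
    · refine ⟨1, 0, ?_⟩
      filter_upwards [hpow p₀ hp₀] with p hp _
      simpa [abs_of_nonneg (Real.sqrt_nonneg _)] using hp.le
    · refine ⟨1, 1, ?_⟩
      filter_upwards [hpow p₀ hp₀] with p hp hp'
      have h0 : 0 < p.1 := hp'
      have : (√p.1)⁻¹ * p.1 = √p.1 := by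
        have := Real.sq_sqrt h0.le
        have hne : √p.1 ≠ 0 := (Real.sqrt_pos.2 h0).ne'
        field_simp
        linarith
      rw [abs_of_nonneg (by positivity), pow_one, this]
      simpa using hp.le
  · intro p₀ hp₀
    refine ⟨‖p₀‖ + 1, 2, ?_⟩
    filter_upwards [hpow p₀ hp₀, Metric.ball_mem_nhds p₀ one_pos] with p hp hp1 hp'
    have h0 : 0 < p.1 := hp'
    have hn : ‖p.2‖ ≤ ‖p₀‖ + 1 := by
      rw [Metric.mem_ball, dist_eq_norm] at hp1
      have h1 : ‖p‖ ≤ ‖p₀‖ + ‖p - p₀‖ := by simpa using norm_add_le p₀ (p - p₀)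
      linarith [norm_snd_le p]
    refine ⟨(0, p.2), rfl, ?_, ?_, ?_⟩
    · rw [Prod.norm_def]
      refine max_le ?_ hn
      simp only [Real.norm_eq_abs, abs_of_nonneg (Real.sqrt_nonneg p.1)]
      have : √p.1 ≤ 1 := by simpa using hp.le
      linarith [norm_nonneg p₀]
    · rw [Prod.norm_def]
      exact max_le (by simp; positivity) hn
    · simp [Prod.norm_def, abs_of_nonneg (Real.sqrt_nonneg _), Real.sq_sqrt h0.le]

/-- Division by `x` reverses parity; σ = 1 is the even case and σ = -1 the odd one. At `x = 0` the
identity follows by continuity. -/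
theorem hadamardQuot_neg {E : Type} [NormedAddCommGroup E] [NormedSpace ℝ E]
    [FiniteDimensional ℝ E] {F : E × ℝ → ℝ} (hF : ContDiff ℝ ∞ F) {σ : ℝ} 
    (h : ∀ p x, F (p, -x) - F (p, 0) = σ * (F (p, x) - F (p, 0))) (p : E) (x : ℝ) :
    hadamardQuot F (p, -x) = -(σ * hadamardQuot F (p, x)) := by
  have hc : Continuous (hadamardQuot F) := hF.hadamardQuot.continuous
  refine congrFun (Continuous.ext_on (dense_compl_singleton (0 : ℝ))
    (f := fun x => hadamardQuot F (p, -x)) (g := fun x => -(σ * hadamardQuot F (p, x)))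
    (hc.comp (by fun_prop)) ((continuous_const.mul (hc.comp (by fun_prop))).neg)
    fun x hx => ?_) x
  have h1 := eq_add_mul_hadamardQuot hF p x
  have h2 := eq_add_mul_hadamardQuot hF p (-x)
  have h3 := h p x
  have hx' : x ≠ 0 := hx
  apply mul_left_cancel₀ hx'
  dsimp only
  linear_combination h2 - h3 - σ * h1

/-- Whitney's theorem on even functions. -/
theorem exists_comp_sq_of_even {F : (ℝ × ℝ) × ℝ → ℝ} (hF : ContDiff ℝ ∞ F)
    (he : ∀ p x, F (p, -x) = F (p, x)) :
    ∃ K : (ℝ × ℝ) × ℝ → ℝ, ContDiff ℝ ∞ K ∧ ∀ p x, F (p, x) = K (p, x ^ 2) := by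
  -- Each step subtracts the value at `x = 0` and divides by `x ^ 2`, which keeps the function even;
  -- the values at zero are the Taylor coefficients in `x ^ 2`.
  let S : ℕ → (ℝ × ℝ) × ℝ → ℝ := fun n => (fun F => hadamardQuot (hadamardQuot F))^[n] F
  have hS1 : ∀ n, S (n + 1) = hadamardQuot (hadamardQuot (S n)) := fun n =>
    Function.iterate_succ_apply' _ _ _
  have hS : ∀ n, ContDiff ℝ ∞ (S n) ∧ ∀ p x, S n (p, -x) = S n (p, x) := by
    intro n
    induction n with
    | zero => exact ⟨hF, he⟩
    | succ n ih =>
      have h1 := ih.1.hadamardQuot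
      have h2 := hadamardQuot_neg ih.1 (σ := 1) (fun p x => by rw [ih.2, one_mul])
      have h0 : ∀ p, hadamardQuot (S n) (p, 0) = 0 := by
        intro p
        have := h2 p 0
        rw [neg_zero] at this
        linarith
      have h3 := hadamardQuot_neg h1 (σ := -1) (fun p x => by rw [h2, h0]; ring)
      rw [hS1]
      exact ⟨h1.hadamardQuot, fun p x => by rw [h3]; ring⟩
  have hstep : ∀ n p x, S n (p, x) = S n (p, 0) + x ^ 2 * S (n + 1) (p, x) := by
    intro n p x
    have h1 := (hS n).1.hadamardQuot
    have h2 := hadamardQuot_neg (hS n).1 (σ := 1) (fun p x => by rw [(hS n).2, one_mul])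
    have h0 : hadamardQuot (S n) (p, 0) = 0 := by
      have := h2 p 0
      rw [neg_zero] at this
      linarith
    have h3 := eq_add_mul_hadamardQuot (hS n).1 p x
    have h4 := eq_add_mul_hadamardQuot h1 p x
    rw [hS1]
    linear_combination h3 + x * h4 + x * h0
  have hexp : ∀ n p x, F (p, x) = ∑ j ∈ Finset.range n, S j (p, 0) * (x ^ 2) ^ j +
      (x ^ 2) ^ n * S n (p, x) := by
    intro n p x
    induction n with
    | zero => simp [S]
    | succ n ih =>
      rw [ih, Finset.sum_range_succ, hstep n p x]
      ring
  obtain ⟨B, hB, hBn, -⟩ := exists_borel_sum (c := fun n p => S n (p, 0))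
    fun n => (hS n).1.comp (contDiff_id.prodMk contDiff_const)
  -- The Borel sum has the correct Taylor coefficients, so the difference is flat at `x = 0` and may
  -- be composed with the square root.
  let G : ℝ × ℝ × ℝ → ℝ := fun q => F (q.2, q.1) - B (q.2, q.1 ^ 2)
  have hG : ContDiff ℝ ∞ G := (hF.comp (contDiff_snd.prodMk contDiff_fst)).sub
    (hB.comp (contDiff_snd.prodMk (contDiff_fst.pow 2)))
  have hGflat : FlatOn {q : ℝ × ℝ × ℝ | q.1 = 0} G := by
    refine flatOn_of_forall_eq_pow_mul hG contDiff_fst fun n => ?_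
    obtain ⟨B', hB', h⟩ := hBn n
    refine ⟨fun q => q.1 ^ n * (S n (q.2, q.1) - B' (q.2, q.1 ^ 2)), ?_, fun q => ?_⟩
    · exact (contDiff_fst.pow n).mul (((hS n).1.comp (contDiff_snd.prodMk contDiff_fst)).sub
        (hB'.comp (contDiff_snd.prodMk (contDiff_fst.pow 2))))
    · simp only [G]
      rw [h, hexp n]
      ring
  refine ⟨fun q => B q + ({q : ℝ × ℝ × ℝ | 0 < q.1}.indicator fun q => G (√q.1, q.2))
    (q.2, q.1), hB.add ((contDiff_indicator_comp_sqrt hGflat).comp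
      (contDiff_snd.prodMk contDiff_fst)), fun p x => ?_⟩
  by_cases hx : x = 0
  · have := hGflat.eq_zero (q := (0, p)) rfl
    simp only [G] at this
    subst hx
    simp only [ne_eq, OfNat.ofNat_ne_zero, not_false_eq_true, zero_pow, mem_ofPred_eq, lt_self_iff_false,
      indicator_of_notMem, add_zero]
    simp at this
    linarith
  · have hx2 : ((x ^ 2, p) : ℝ × ℝ × ℝ) ∈ {q : ℝ × ℝ × ℝ | 0 < q.1} := by
      simp only [mem_ofPred_eq]; positivity
    dsimp only
    rw [indicator_of_mem hx2]
    simp only [G, Real.sqrt_sq_eq_abs, sq_abs]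
    rcases abs_choice x with h | h
    · rw [h]; ring
    · rw [h, he]; ring

/-- A smooth function of `(lam, x, y)` is the sum of an even and an odd function of `x`, which are
expressed by smooth functions of `x ^ 2`. -/
theorem exists_even_odd_decomposition {f : ℝ × ℝ × ℝ → ℝ} (hf : ContDiff ℝ ∞ f) :
    ∃ k₀ k₁ : ℝ × ℝ × ℝ → ℝ, ContDiff ℝ ∞ k₀ ∧ ContDiff ℝ ∞ k₁ ∧ ∀ lam x y,
      f (lam, x, y) = k₀ (lam, x ^ 2, y) + x * k₁ (lam, x ^ 2, y) := by
  let A : (ℝ × ℝ) × ℝ → ℝ := fun q => f (q.1.1, q.2, q.1.2)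
  have hA : ContDiff ℝ ∞ A := hf.comp (by fun_prop)
  have hA' : ContDiff ℝ ∞ fun q : (ℝ × ℝ) × ℝ => A (q.1, -q.2) := hA.comp (by fun_prop)
  let O : (ℝ × ℝ) × ℝ → ℝ := fun q => (A q - A (q.1, -q.2)) / 2
  have hO : ContDiff ℝ ∞ O := (hA.sub hA').div_const 2
  obtain ⟨K₀, hK₀, h₀⟩ := exists_comp_sq_of_even (F := fun q => (A q + A (q.1, -q.2)) / 2)
    ((hA.add hA').div_const 2) (fun p x => by simp; ring)
  obtain ⟨K₁, hK₁, h₁⟩ := exists_comp_sq_of_even hO.hadamardQuot (fun p x => by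
    rw [hadamardQuot_neg hO (σ := -1) (fun p x => by simp [O]; ring)]; ring)
  refine ⟨fun q => K₀ ((q.1, q.2.2), q.2.1), fun q => K₁ ((q.1, q.2.2), q.2.1),
    hK₀.comp (by fun_prop), hK₁.comp (by fun_prop), fun lam x y => ?_⟩
  dsimp only
  rw [← h₀, ← h₁]
  have h2 := eq_add_mul_hadamardQuot hO (lam, y) x
  have h3 : O ((lam, y), 0) = 0 := by simp [O]
  have h4 : f (lam, x, y) = A ((lam, y), x) := rfl
  rw [h3, zero_add] at h2
  rw [← h2, h4]
  simp only [O]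
  ring

/-! ### The equation at the nodal cubic -/

theorem ContDiff.hasDerivAt_snd {E : Type} [NormedAddCommGroup E] [NormedSpace ℝ E]
    {F : E × ℝ → ℝ} (hF : ContDiff ℝ ∞ F) (p : E) (t : ℝ) :
    HasDerivAt (fun t => F (p, t)) (_root_.dirDeriv (0, 1) F (p, t)) t :=
  hF.hasDerivAt_comp_infty ((hasDerivAt_const t p).prodMk (hasDerivAt_id t))

theorem ContDiff.hasDerivAt_mid {F : (ℝ × ℝ) × ℝ → ℝ} (hF : ContDiff ℝ ∞ F) (s y δ : ℝ) :
    HasDerivAt (fun t => F ((s, t), δ)) (_root_.dirDeriv ((0, 1), 0) F ((s, y), δ)) y :=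
  hF.hasDerivAt_comp_infty
    (((hasDerivAt_const y s).prodMk (hasDerivAt_id y)).prodMk (hasDerivAt_const y δ))

theorem eq_of_mul_eq_off_zero {f g : ℝ → ℝ} (hf : Continuous f) (hg : Continuous g) (a : ℝ)
    (h : ∀ y, (y - a) * f y = (y - a) * g y) (y : ℝ) : f y = g y :=
  congrFun (Continuous.ext_on (dense_compl_singleton a) hf hg fun x hx =>
    mul_left_cancel₀ (sub_ne_zero.2 hx) (h x)) y

/-- The quotient of `κ (s, y) - κ (s, s)` by `y - s`. -/
noncomputable def nodeQuot (κ : ℝ × ℝ → ℝ) (q : ℝ × ℝ) : ℝ :=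
  hadamardQuot (fun x : ℝ × ℝ => κ (x.1, x.1 + x.2)) (q.1, q.2 - q.1)

/-- The coefficient of `y` in the obstruction to solving the equation at the nodal cubic. -/
noncomputable def nodeLinCoeff (κ : ℝ × ℝ → ℝ) (s : ℝ) : ℝ :=
  ∫ τ in (0 : ℝ)..1, nodeQuot κ (s, -2 * s + 3 * s * τ ^ 2)

/-- The constant coefficient in the obstruction to solving the equation at the nodal cubic. -/
noncomputable def nodeConstCoeff (κ : ℝ × ℝ → ℝ) (s : ℝ) : ℝ := κ (s, s) - s * nodeLinCoeff κ s

/-- The product of the solution of the equation at the nodal cubic by `y - s`. -/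
noncomputable def nodeSolMul (κ : ℝ × ℝ → ℝ) (q : ℝ × ℝ) : ℝ :=
  (∫ τ in (0 : ℝ)..1, nodeQuot κ (q.1, -2 * q.1 + τ ^ 2 * (q.2 + 2 * q.1))) - nodeLinCoeff κ q.1

/-- The solution of the equation at the nodal cubic. -/
noncomputable def nodeSol (κ : ℝ × ℝ → ℝ) : ℝ × ℝ → ℝ := nodeQuot (nodeSolMul κ)

section
variable {κ : ℝ × ℝ → ℝ} (hκ : ContDiff ℝ ∞ κ)
include hκ

theorem contDiff_nodeQuot : ContDiff ℝ ∞ (nodeQuot κ) :=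
  (ContDiff.hadamardQuot (F := fun x : ℝ × ℝ => κ (x.1, x.1 + x.2))
    (hκ.comp (by fun_prop))).comp (by fun_prop)

theorem eq_add_mul_nodeQuot (s y : ℝ) : κ (s, y) = κ (s, s) + (y - s) * nodeQuot κ (s, y) := by
  have := eq_add_mul_hadamardQuot (F := fun x : ℝ × ℝ => κ (x.1, x.1 + x.2))
    (hκ.comp (by fun_prop)) s (y - s)
  simpa [nodeQuot] using this

theorem contDiff_nodeLinCoeff : ContDiff ℝ ∞ (nodeLinCoeff κ) :=
  contDiff_integral_param 0 1 (F := fun x : ℝ × ℝ => nodeQuot κ (x.1, -2 * x.1 + 3 * x.1 * x.2 ^ 2))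
    ((contDiff_nodeQuot hκ).comp (by fun_prop))

theorem contDiff_nodeConstCoeff : ContDiff ℝ ∞ (nodeConstCoeff κ) :=
  (hκ.comp (by fun_prop : ContDiff ℝ ∞ fun s : ℝ => (s, s))).sub
    (contDiff_id.mul (contDiff_nodeLinCoeff hκ))

theorem contDiff_nodeSolMul : ContDiff ℝ ∞ (nodeSolMul κ) := by
  refine ContDiff.sub ?_ ((contDiff_nodeLinCoeff hκ).comp contDiff_fst)
  exact contDiff_integral_param 0 1 (F := fun x : (ℝ × ℝ) × ℝ =>
    nodeQuot κ (x.1.1, -2 * x.1.1 + x.2 ^ 2 * (x.1.2 + 2 * x.1.1)))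
    ((contDiff_nodeQuot hκ).comp (by fun_prop))

theorem contDiff_nodeSol : ContDiff ℝ ∞ (nodeSol κ) := contDiff_nodeQuot (contDiff_nodeSolMul hκ)

omit hκ in
theorem nodeSolMul_self (s : ℝ) : nodeSolMul κ (s, s) = 0 := by
  rw [nodeSolMul, nodeLinCoeff, sub_eq_zero]
  refine intervalIntegral.integral_congr fun τ _ => ?_
  dsimp only
  congr 2
  ring

theorem nodeSolMul_eq (s y : ℝ) : nodeSolMul κ (s, y) = (y - s) * nodeSol κ (s, y) := by
  have := eq_add_mul_nodeQuot (contDiff_nodeSolMul hκ) s y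
  rwa [nodeSolMul_self, zero_add] at this

/-- The point y = -2s is a regular singular point of 2(y + 2s) M' + M = Q, and its smooth solution
is the average of Q(-2s + τ²(y + 2s)) over τ in [0, 1]. The equation results from integrating the
τ-derivative of τ Q(-2s + τ²(y + 2s)), whose boundary term is Q(y). -/
theorem nodeSolMul_ode (s y : ℝ) :
    2 * (y + 2 * s) * dirDeriv (0, 1) (nodeSolMul κ) (s, y) + nodeSolMul κ (s, y) =
      nodeQuot κ (s, y) - nodeLinCoeff κ s := by
  have hQ := contDiff_nodeQuot hκ
  have hF : ContDiff ℝ ∞ fun x : (ℝ × ℝ) × ℝ =>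
    nodeQuot κ (x.1.1, -2 * x.1.1 + x.2 ^ 2 * (x.1.2 + 2 * x.1.1)) := hQ.comp (by fun_prop)
  have h1 : dirDeriv (0, 1) (nodeSolMul κ) (s, y) = ∫ τ in (0 : ℝ)..1,
      τ ^ 2 * dirDeriv (0, 1) (nodeQuot κ) (s, -2 * s + τ ^ 2 * (y + 2 * s)) := by
    have h2 := dirDeriv_integral_param 0 1 hF (0, 1) (s, y)
    have h3 : dirDeriv (0, 1) (nodeSolMul κ) (s, y) = dirDeriv (0, 1) (fun p : ℝ × ℝ =>
        ∫ τ in (0 : ℝ)..1, nodeQuot κ (p.1, -2 * p.1 + τ ^ 2 * (p.2 + 2 * p.1))) (s, y) := by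
      have e1 := (contDiff_nodeSolMul hκ).hasDerivAt_snd s y
      have e2 := (contDiff_integral_param 0 1 hF).hasDerivAt_snd s y
      refine e1.unique ?_
      simpa [nodeSolMul] using e2.sub_const (nodeLinCoeff κ s)
    rw [h3, h2]
    refine intervalIntegral.integral_congr fun τ _ => ?_
    have e1 := hF.hasDerivAt_mid s y τ
    have e2 : HasDerivAt (fun t => -2 * s + τ ^ 2 * (t + 2 * s)) (τ ^ 2) y := by
      simpa using (((hasDerivAt_id y).add_const (2 * s)).const_mul (τ ^ 2)).const_add (-2 * s)
    have e3 := (hQ.hasDerivAt_snd s (-2 * s + τ ^ 2 * (y + 2 * s))).comp y e2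
    rw [mul_comm]
    exact e1.unique e3
  have h4 : ∀ τ ∈ uIcc (0 : ℝ) 1, HasDerivAt
      (fun τ => τ * nodeQuot κ (s, -2 * s + τ ^ 2 * (y + 2 * s)))
      (nodeQuot κ (s, -2 * s + τ ^ 2 * (y + 2 * s)) + 2 * (y + 2 * s) *
      (τ ^ 2 * dirDeriv (0, 1) (nodeQuot κ) (s, -2 * s + τ ^ 2 * (y + 2 * s)))) τ := by
    intro τ _
    have e2 : HasDerivAt (fun τ : ℝ => -2 * s + τ ^ 2 * (y + 2 * s)) (2 * τ * (y + 2 * s)) τ := by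
      simpa using (((hasDerivAt_id τ).pow 2).mul_const (y + 2 * s)).const_add (-2 * s)
    have e3 := (hQ.hasDerivAt_snd s (-2 * s + τ ^ 2 * (y + 2 * s))).comp τ e2
    refine ((hasDerivAt_id τ).mul e3).congr_deriv ?_
    simp only [id, Function.comp_apply]
    ring
  have hc1 : Continuous fun τ : ℝ => nodeQuot κ (s, -2 * s + τ ^ 2 * (y + 2 * s)) :=
    hQ.continuous.comp (by fun_prop)
  have hc2 : Continuous fun τ : ℝ => 2 * (y + 2 * s) *
      (τ ^ 2 * dirDeriv (0, 1) (nodeQuot κ) (s, -2 * s + τ ^ 2 * (y + 2 * s))) :=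
    continuous_const.mul ((continuous_id.pow 2).mul ((hQ.dirDeriv _).continuous.comp (by fun_prop)))
  have h5 := intervalIntegral.integral_eq_sub_of_hasDerivAt h4
    ((hc1.add hc2).intervalIntegrable _ _)
  rw [intervalIntegral.integral_add (hc1.intervalIntegrable _ _) (hc2.intervalIntegrable _ _),
    intervalIntegral.integral_const_mul] at h5
  rw [h1, nodeSolMul]
  have h6 : -2 * s + 1 ^ 2 * (y + 2 * s) = y := by ring
  rw [h6] at h5
  dsimp only
  linarith

/-- On the nodal cubic (y - s)²(y + 2s) the equation, divided by y - s, becomes 2(y + 2s) M' + M = Q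
for M = (y - s) b. Division of M by y - s requires M(s) = 0, which is what `nodeLinCoeff` is chosen
for; `nodeConstCoeff` adjusts the value of the right-hand side at y = s. -/
theorem nodeSol_ode (s y : ℝ) :
    2 * ((y - s) ^ 2 * (y + 2 * s)) * dirDeriv (0, 1) (nodeSol κ) (s, y) +
      3 * (y - s) * (y + s) * nodeSol κ (s, y) =
      κ (s, y) - nodeConstCoeff κ s - nodeLinCoeff κ s * y := by
  have h1 := nodeSolMul_eq hκ s y
  have h2 := nodeSolMul_ode hκ s y
  have h3 := eq_add_mul_nodeQuot hκ s y
  have h4 : dirDeriv (0, 1) (nodeSolMul κ) (s, y) =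
      nodeSol κ (s, y) + (y - s) * dirDeriv (0, 1) (nodeSol κ) (s, y) := by
    have e1 := (contDiff_nodeSolMul hκ).hasDerivAt_snd s y
    have e2 := ((hasDerivAt_id y).sub_const s).mul ((contDiff_nodeSol hκ).hasDerivAt_snd s y)
    have e3 : (fun t => nodeSolMul κ (s, t)) = (fun t => id t - s) * fun t => nodeSol κ (s, t) := by
      funext t
      exact nodeSolMul_eq hκ s t
    rw [e3] at e1
    refine (e1.unique e2).trans ?_
    simp
  rw [h4, h1] at h2
  rw [h3, nodeConstCoeff]
  linear_combination (y - s) * h2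

end

section
variable {κ κ' : ℝ × ℝ → ℝ} {n : ℕ}

/-- The constructions at the nodal cubic are linear over functions of s, so divisibility by powers
of s, hence flatness at s = 0, passes from the right-hand side to the solution and to both
obstructions. -/
theorem nodeQuot_pow_mul (hκ' : ContDiff ℝ ∞ κ') (hκ : ContDiff ℝ ∞ κ)
    (h : ∀ q, κ q = q.1 ^ n * κ' q) (q : ℝ × ℝ) : nodeQuot κ q = q.1 ^ n * nodeQuot κ' q := by
  obtain ⟨s, y⟩ := q
  refine eq_of_mul_eq_off_zero (f := fun y => nodeQuot κ (s, y))
    (g := fun y => s ^ n * nodeQuot κ' (s, y)) ?_ ?_ s (fun y => ?_) y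
  · exact (contDiff_nodeQuot hκ).continuous.comp (by fun_prop)
  · exact continuous_const.mul ((contDiff_nodeQuot hκ').continuous.comp (by fun_prop))
  · have h1 := eq_add_mul_nodeQuot hκ s y
    have h2 := eq_add_mul_nodeQuot hκ' s y
    rw [h, h] at h1
    dsimp only at h1 ⊢
    linear_combination -h1 + s ^ n * h2

theorem nodeLinCoeff_pow_mul (hκ' : ContDiff ℝ ∞ κ') (hκ : ContDiff ℝ ∞ κ)
    (h : ∀ q, κ q = q.1 ^ n * κ' q) (s : ℝ) : nodeLinCoeff κ s = s ^ n * nodeLinCoeff κ' s := by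
  simp only [nodeLinCoeff, nodeQuot_pow_mul hκ' hκ h, intervalIntegral.integral_const_mul]

theorem nodeConstCoeff_pow_mul (hκ' : ContDiff ℝ ∞ κ') (hκ : ContDiff ℝ ∞ κ)
    (h : ∀ q, κ q = q.1 ^ n * κ' q) (s : ℝ) :
    nodeConstCoeff κ s = s ^ n * nodeConstCoeff κ' s := by
  rw [nodeConstCoeff, nodeConstCoeff, h, nodeLinCoeff_pow_mul hκ' hκ h]
  ring

theorem nodeSol_pow_mul (hκ' : ContDiff ℝ ∞ κ') (hκ : ContDiff ℝ ∞ κ)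
    (h : ∀ q, κ q = q.1 ^ n * κ' q) (q : ℝ × ℝ) : nodeSol κ q = q.1 ^ n * nodeSol κ' q := by
  refine nodeQuot_pow_mul (contDiff_nodeSolMul hκ') (contDiff_nodeSolMul hκ) (fun q => ?_) q
  simp only [nodeSolMul, nodeQuot_pow_mul hκ' hκ h, intervalIntegral.integral_const_mul,
    nodeLinCoeff_pow_mul hκ' hκ h]
  ring

end

/-! ### Taylor expansion along the curve of nodal cubics -/

/-- The remainder after subtracting the leading term of the expansion in the distance `δ` to the
nodal cubic. -/
noncomputable def nodeNext (K : (ℝ × ℝ) × ℝ → ℝ) (q : (ℝ × ℝ) × ℝ) : ℝ :=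
  hadamardQuot K q - 2 * dirDeriv (0, 1) (nodeSol fun p => K (p, 0)) q.1

/-- The successive remainders of the expansion in the distance to the nodal cubic. -/
noncomputable def nodeRem (K : (ℝ × ℝ) × ℝ → ℝ) (n : ℕ) : (ℝ × ℝ) × ℝ → ℝ := nodeNext^[n] K

/-- The coefficients of the inhomogeneous term at the nodal cubic. -/
noncomputable def nodeCoeff (K : (ℝ × ℝ) × ℝ → ℝ) (n : ℕ) (p : ℝ × ℝ) : ℝ := nodeRem K n (p, 0)

theorem nodeRem_succ (K : (ℝ × ℝ) × ℝ → ℝ) (n : ℕ) :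
    nodeRem K (n + 1) = nodeNext (nodeRem K n) := Function.iterate_succ_apply' _ _ _

theorem contDiff_nodeNext {K : (ℝ × ℝ) × ℝ → ℝ} (hK : ContDiff ℝ ∞ K) :
    ContDiff ℝ ∞ (nodeNext K) :=
  hK.hadamardQuot.sub (contDiff_const.mul
    (((contDiff_nodeSol (hK.comp (contDiff_id.prodMk contDiff_const))).dirDeriv _).comp
      contDiff_fst))

theorem contDiff_nodeRem {K : (ℝ × ℝ) × ℝ → ℝ} (hK : ContDiff ℝ ∞ K) (n : ℕ) :
    ContDiff ℝ ∞ (nodeRem K n) := by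
  induction n with
  | zero => exact hK
  | succ n ih => rw [nodeRem_succ]; exact contDiff_nodeNext ih

theorem contDiff_nodeCoeff {K : (ℝ × ℝ) × ℝ → ℝ} (hK : ContDiff ℝ ∞ K) (n : ℕ) :
    ContDiff ℝ ∞ (nodeCoeff K n) :=
  (contDiff_nodeRem hK n).comp (contDiff_id.prodMk contDiff_const)

/-- In the variables lam = 3s² and h = 2s³ + δ the cubic is (y - s)²(y + 2s) + δ. A solution b for δ
= 0 leaves the error 2δ b', which is moved to the next power of δ; this explains the correction in
`nodeNext`. -/
theorem node_expansion {K : (ℝ × ℝ) × ℝ → ℝ} (hK : ContDiff ℝ ∞ K) (n : ℕ) (s y δ : ℝ) :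
    K ((s, y), δ) = ∑ j ∈ Finset.range n, δ ^ j *
      (2 * ((y - s) ^ 2 * (y + 2 * s) + δ) * dirDeriv (0, 1) (nodeSol (nodeCoeff K j)) (s, y) +
        3 * (y - s) * (y + s) * nodeSol (nodeCoeff K j) (s, y) +
        nodeConstCoeff (nodeCoeff K j) s + nodeLinCoeff (nodeCoeff K j) s * y) +
      δ ^ n * nodeRem K n ((s, y), δ) := by
  induction n with
  | zero => simp [nodeRem]
  | succ n ih =>
    rw [ih, Finset.sum_range_succ, nodeRem_succ]
    have h1 := nodeSol_ode (contDiff_nodeCoeff hK n) s y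
    have h2 := eq_add_mul_hadamardQuot (contDiff_nodeRem hK n) (s, y) δ
    have h3 : nodeRem K n ((s, y), 0) = nodeCoeff K n (s, y) := rfl
    have h4 : nodeNext (nodeRem K n) ((s, y), δ) = hadamardQuot (nodeRem K n) ((s, y), δ) -
      2 * dirDeriv (0, 1) (nodeSol (nodeCoeff K n)) (s, y) := rfl
    rw [h3] at h2
    rw [h4, h2]
    linear_combination (-δ ^ n) * h1

theorem dirDeriv_mid_of_expansion {B B' : (ℝ × ℝ) × ℝ → ℝ} (hB : ContDiff ℝ ∞ B)
    (hB' : ContDiff ℝ ∞ B') {c : ℕ → ℝ × ℝ → ℝ} (hc : ∀ j, ContDiff ℝ ∞ (c j)) {n : ℕ}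
    (h : ∀ p t, B (p, t) = ∑ j ∈ Finset.range n, c j p * t ^ j + t ^ n * B' (p, t)) (s y t : ℝ) :
    dirDeriv ((0, 1), 0) B ((s, y), t) = ∑ j ∈ Finset.range n, dirDeriv (0, 1) (c j) (s, y) * t ^ j
      + t ^ n * dirDeriv ((0, 1), 0) B' ((s, y), t) := by
  have e1 := hB.hasDerivAt_mid s y t
  have e2 : HasDerivAt (fun y => ∑ j ∈ Finset.range n, c j (s, y) * t ^ j +
      t ^ n * B' ((s, y), t)) (∑ j ∈ Finset.range n, dirDeriv (0, 1) (c j) (s, y) * t ^ j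
      + t ^ n * dirDeriv ((0, 1), 0) B' ((s, y), t)) y :=
    (HasDerivAt.fun_sum fun j _ => ((hc j).hasDerivAt_snd s y).mul_const (t ^ j)).add
      ((hB'.hasDerivAt_mid s y t).const_mul (t ^ n))
  refine e1.unique ?_
  simpa only [h] using e2

theorem sum_range_pow_mul_linear (n : ℕ) (t A C y : ℝ) (d b f g e : ℕ → ℝ) :
    ∑ j ∈ Finset.range n, t ^ j * (A * d j + C * b j + f j + g j * y + e j) =
      A * ∑ j ∈ Finset.range n, d j * t ^ j + C * ∑ j ∈ Finset.range n, b j * t ^ j +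
      ∑ j ∈ Finset.range n, f j * t ^ j + (∑ j ∈ Finset.range n, g j * t ^ j) * y +
      ∑ j ∈ Finset.range n, t ^ j * e j := by
  induction n with
  | zero => simp
  | succ n ih =>
    simp only [Finset.sum_range_succ, ih]
    ring

/-- Sums the formal solution in powers of δ. The set `T` allows an expansion that is valid only for
s ≥ 0, and the clauses on vanishing keep the sums zero wherever all their coefficients are zero. -/
theorem exists_node_borel_sum {K : (ℝ × ℝ) × ℝ → ℝ} {T : Set ℝ}
    {β : ℕ → ℝ × ℝ → ℝ} {φ₀ φ₁ : ℕ → ℝ → ℝ} (hβ : ∀ n, ContDiff ℝ ∞ (β n))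
    (hφ₀ : ∀ n, ContDiff ℝ ∞ (φ₀ n)) (hφ₁ : ∀ n, ContDiff ℝ ∞ (φ₁ n))
    (h : ∀ n, ∃ R : (ℝ × ℝ) × ℝ → ℝ, ContDiff ℝ ∞ R ∧ ∀ s ∈ T, ∀ y δ, K ((s, y), δ) =
      ∑ j ∈ Finset.range n, δ ^ j * (2 * ((y - s) ^ 2 * (y + 2 * s) + δ) *
        dirDeriv (0, 1) (β j) (s, y) + 3 * (y - s) * (y + s) * β j (s, y) + φ₀ j s + φ₁ j s * y) +
      δ ^ n * R ((s, y), δ)) :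
    ∃ (B : (ℝ × ℝ) × ℝ → ℝ) (Φ₀ Φ₁ : ℝ × ℝ → ℝ), ContDiff ℝ ∞ B ∧ ContDiff ℝ ∞ Φ₀ ∧
      ContDiff ℝ ∞ Φ₁ ∧ (∀ s y, (∀ n, β n (s, y) = 0) → ∀ δ, B ((s, y), δ) = 0) ∧
      (∀ s, (∀ n, φ₀ n s = 0) → ∀ δ, Φ₀ (s, δ) = 0) ∧
      (∀ s, (∀ n, φ₁ n s = 0) → ∀ δ, Φ₁ (s, δ) = 0) ∧
      ∀ n, ∃ R : (ℝ × ℝ) × ℝ → ℝ, ContDiff ℝ ∞ R ∧ ∀ s ∈ T, ∀ y δ, K ((s, y), δ) =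
        2 * ((y - s) ^ 2 * (y + 2 * s) + δ) * dirDeriv ((0, 1), 0) B ((s, y), δ) +
        3 * (y - s) * (y + s) * B ((s, y), δ) + Φ₀ (s, δ) + Φ₁ (s, δ) * y +
        δ ^ n * R ((s, y), δ) := by
  obtain ⟨B, hB, hBn, hB0⟩ := exists_borel_sum hβ
  obtain ⟨Φ₀, hΦ₀, hΦ₀n, hΦ₀0⟩ := exists_borel_sum hφ₀
  obtain ⟨Φ₁, hΦ₁, hΦ₁n, hΦ₁0⟩ := exists_borel_sum hφ₁
  refine ⟨B, Φ₀, Φ₁, hB, hΦ₀, hΦ₁, fun s y hs => hB0 (s, y) hs, hΦ₀0, hΦ₁0, fun n => ?_⟩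
  obtain ⟨R, hR, hK⟩ := h n
  obtain ⟨B', hB', eB⟩ := hBn n
  obtain ⟨Ψ₀, hΨ₀, e₀⟩ := hΦ₀n n
  obtain ⟨Ψ₁, hΨ₁, e₁⟩ := hΦ₁n n
  refine ⟨fun q => R q - (2 * ((q.1.2 - q.1.1) ^ 2 * (q.1.2 + 2 * q.1.1) + q.2) *
    dirDeriv ((0, 1), 0) B' q + 3 * (q.1.2 - q.1.1) * (q.1.2 + q.1.1) * B' q +
    Ψ₀ (q.1.1, q.2) + Ψ₁ (q.1.1, q.2) * q.1.2), ?_, fun s hs y δ => ?_⟩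
  · have h1 := hB'.dirDeriv ((0, 1), 0)
    have h2 : ContDiff ℝ ∞ fun q : (ℝ × ℝ) × ℝ => Ψ₀ (q.1.1, q.2) := hΨ₀.comp (by fun_prop)
    have h3 : ContDiff ℝ ∞ fun q : (ℝ × ℝ) × ℝ => Ψ₁ (q.1.1, q.2) := hΨ₁.comp (by fun_prop)
    fun_prop
  · rw [hK s hs, dirDeriv_mid_of_expansion hB hB' hβ eB, eB, e₀, e₁]
    have := sum_range_pow_mul_linear n δ (2 * ((y - s) ^ 2 * (y + 2 * s) + δ))
      (3 * (y - s) * (y + s)) y (fun j => dirDeriv (0, 1) (β j) (s, y)) (fun j => β j (s, y))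
      (fun j => φ₀ j s) (fun j => φ₁ j s) 0
    simp only [Pi.zero_apply, mul_zero, Finset.sum_const_zero, add_zero] at this
    rw [this]
    ring

/-! ### The expansion at the cuspidal cubic -/

/-- The cuspidal cubic y³ + h is the member s = 0 of the nodal family, with δ = h. Smoothness of `k`
is assumed only inside the conclusion, so that the solutions can be chosen as functions of an
arbitrary `k` and used in a recursion. -/
theorem exists_cusp_decomposition (k : ℝ × ℝ → ℝ) : ∃ (b : ℝ × ℝ → ℝ) (φ₀ φ₁ : ℝ → ℝ),
    ContDiff ℝ ∞ k → ContDiff ℝ ∞ b ∧ ContDiff ℝ ∞ φ₀ ∧ ContDiff ℝ ∞ φ₁ ∧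
      ∀ n, ∃ R : ℝ × ℝ → ℝ, ContDiff ℝ ∞ R ∧ ∀ h y, k (h, y) =
        2 * (y ^ 3 + h) * dirDeriv (0, 1) b (h, y) + 3 * y ^ 2 * b (h, y) + φ₀ h + φ₁ h * y +
        h ^ n * R (h, y) := by
  by_cases hk : ContDiff ℝ ∞ k
  swap
  · exact ⟨0, 0, 0, fun h => absurd h hk⟩
  have hK : ContDiff ℝ ∞ fun q : (ℝ × ℝ) × ℝ => k (q.2, q.1.2) := hk.comp (by fun_prop)
  obtain ⟨B, Φ₀, Φ₁, hB, hΦ₀, hΦ₁, -, -, -, h⟩ := exists_node_borel_sum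
    (K := fun q : (ℝ × ℝ) × ℝ => k (q.2, q.1.2)) (T := univ)
    (fun n => contDiff_nodeSol (contDiff_nodeCoeff hK n))
    (fun n => contDiff_nodeConstCoeff (contDiff_nodeCoeff hK n))
    (fun n => contDiff_nodeLinCoeff (contDiff_nodeCoeff hK n))
    fun n => ⟨_, contDiff_nodeRem hK n, fun s _ y δ => node_expansion hK n s y δ⟩
  have hb : ContDiff ℝ ∞ fun q : ℝ × ℝ => B ((0, q.2), q.1) := hB.comp (by fun_prop)
  refine ⟨fun q => B ((0, q.2), q.1), fun h => Φ₀ (0, h), fun h => Φ₁ (0, h), fun _ =>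
    ⟨hb, hΦ₀.comp (by fun_prop), hΦ₁.comp (by fun_prop), fun n => ?_⟩⟩
  obtain ⟨R, hR, hR'⟩ := h n
  refine ⟨fun q => R ((0, q.2), q.1), hR.comp (by fun_prop), fun h y => ?_⟩
  have h1 := hR' 0 (mem_univ _) y h
  have h2 : dirDeriv (0, 1) (fun q : ℝ × ℝ => B ((0, q.2), q.1)) (h, y) =
      dirDeriv ((0, 1), 0) B ((0, y), h) := (hb.hasDerivAt_snd h y).unique (hB.hasDerivAt_mid 0 y h)
  dsimp only at h1 ⊢
  rw [h1, h2]
  ring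

theorem ContDiff.hasDerivAt_last {F : ℝ × ℝ × ℝ → ℝ} (hF : ContDiff ℝ ∞ F) (a b y : ℝ) :
    HasDerivAt (fun t => F (a, b, t)) (_root_.dirDeriv (0, 0, 1) F (a, b, y)) y :=
  hF.hasDerivAt_comp_infty
    ((hasDerivAt_const y a).prodMk ((hasDerivAt_const y b).prodMk (hasDerivAt_id y)))

/-- The operator `b ↦ 2 P ∂b/∂y + (∂P/∂y) b` for the cubic `P = y ^ 3 - lam * y + h`, on functions
of `(lam, h, y)`. -/
noncomputable def levelOp (b : ℝ × ℝ × ℝ → ℝ) (q : ℝ × ℝ × ℝ) : ℝ :=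
  2 * (q.2.2 ^ 3 - q.1 * q.2.2 + q.2.1) * dirDeriv (0, 0, 1) b q + (3 * q.2.2 ^ 2 - q.1) * b q

theorem contDiff_levelOp {b : ℝ × ℝ × ℝ → ℝ} (hb : ContDiff ℝ ∞ b) : ContDiff ℝ ∞ (levelOp b) := by
  have := hb.dirDeriv (0, 0, 1)
  unfold levelOp
  fun_prop

/-- A decomposition modulo functions vanishing to infinite order at `lam = h = 0`. -/
theorem exists_origin_decomposition {k : ℝ × ℝ × ℝ → ℝ} (hk : ContDiff ℝ ∞ k) :
    ∃ (b : ℝ × ℝ × ℝ → ℝ) (φ₀ φ₁ : ℝ × ℝ → ℝ),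
      ContDiff ℝ ∞ b ∧ ContDiff ℝ ∞ φ₀ ∧ ContDiff ℝ ∞ φ₁ ∧
      ∀ n, ∃ U V : ℝ × ℝ × ℝ → ℝ, ContDiff ℝ ∞ U ∧ ContDiff ℝ ∞ V ∧ ∀ lam h y, k (lam, h, y) =
        levelOp b (lam, h, y) + φ₀ (lam, h) + φ₁ (lam, h) * y +
        (h ^ n * U (lam, h, y) + lam ^ n * V (lam, h, y)) := by
  choose sb sφ₀ sφ₁ hsol using exists_cusp_decomposition
  -- At lam = 0 the operator is the cuspidal one; its dependence on lam is the term -lam (2y b' +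
  -- b). This error is moved to the next power of lam, with the opposite sign.
  let nx : ((ℝ × ℝ) × ℝ → ℝ) → (ℝ × ℝ) × ℝ → ℝ := fun K q => hadamardQuot K q +
    2 * q.1.2 * dirDeriv (0, 1) (sb fun p => K (p, 0)) q.1 + sb (fun p => K (p, 0)) q.1
  let S : ℕ → (ℝ × ℝ) × ℝ → ℝ := fun n => nx^[n] fun q => k (q.2, q.1)
  let c : ℕ → ℝ × ℝ → ℝ := fun n p => S n (p, 0)
  have hS1 : ∀ n, S (n + 1) = nx (S n) := fun n => Function.iterate_succ_apply' _ _ _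
  have hc0 : ∀ K : (ℝ × ℝ) × ℝ → ℝ, ContDiff ℝ ∞ K → ContDiff ℝ ∞ fun p => K (p, 0) :=
    fun K hK => hK.comp (by fun_prop)
  have hS : ∀ n, ContDiff ℝ ∞ (S n) := by
    intro n
    induction n with
    | zero => exact hk.comp (by fun_prop)
    | succ n ih =>
      rw [hS1]
      have h1 := ih.hadamardQuot
      have h2 := (hsol _ (hc0 _ ih)).1
      have h3 : ContDiff ℝ ∞ fun q : (ℝ × ℝ) × ℝ =>
        dirDeriv (0, 1) (sb fun p => S n (p, 0)) q.1 := (h2.dirDeriv _).comp contDiff_fst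
      have h4 : ContDiff ℝ ∞ fun q : (ℝ × ℝ) × ℝ => sb (fun p => S n (p, 0)) q.1 :=
        h2.comp contDiff_fst
      simp only [nx]
      fun_prop
  have hc : ∀ n, ContDiff ℝ ∞ (c n) := fun n => hc0 _ (hS n)
  obtain ⟨B, hB, hBn, -⟩ := exists_borel_sum fun n => (hsol _ (hc n)).1
  obtain ⟨Φ₀, hΦ₀, hΦ₀n, -⟩ := exists_borel_sum fun n => (hsol _ (hc n)).2.1
  obtain ⟨Φ₁, hΦ₁, hΦ₁n, -⟩ := exists_borel_sum fun n => (hsol _ (hc n)).2.2.1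
  have hb : ContDiff ℝ ∞ fun q : ℝ × ℝ × ℝ => B (q.2, q.1) := hB.comp (by fun_prop)
  refine ⟨fun q => B (q.2, q.1), fun q => Φ₀ (q.2, q.1), fun q => Φ₁ (q.2, q.1), hb,
    hΦ₀.comp (by fun_prop), hΦ₁.comp (by fun_prop), fun n => ?_⟩
  obtain ⟨B', hB', eB⟩ := hBn n
  obtain ⟨Ψ₀, hΨ₀, e₀⟩ := hΦ₀n n
  obtain ⟨Ψ₁, hΨ₁, e₁⟩ := hΦ₁n n
  choose R hR hR' using fun j => (hsol _ (hc j)).2.2.2 n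
  have hexp : ∀ m lam h y, k (lam, h, y) = ∑ j ∈ Finset.range m, lam ^ j *
      (2 * (y ^ 3 - lam * y + h) * dirDeriv (0, 1) (sb (c j)) (h, y) +
      (3 * y ^ 2 - lam) * sb (c j) (h, y) + sφ₀ (c j) h + sφ₁ (c j) h * y + h ^ n * R j (h, y)) +
      lam ^ m * S m ((h, y), lam) := by
    intro m lam h y
    induction m with
    | zero => simp [S]
    | succ m ih =>
      rw [ih, Finset.sum_range_succ, hS1]
      have h1 := hR' m h y
      have h2 := eq_add_mul_hadamardQuot (hS m) (h, y) lam
      have h3 : S m ((h, y), 0) = c m (h, y) := rfl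
      have h4 : nx (S m) ((h, y), lam) = hadamardQuot (S m) ((h, y), lam) +
        2 * y * dirDeriv (0, 1) (sb (c m)) (h, y) + sb (c m) (h, y) := rfl
      rw [h3] at h2
      rw [h4, h2]
      linear_combination lam ^ m * h1
  refine ⟨fun q => ∑ j ∈ Finset.range n, q.1 ^ j * R j q.2, fun q => S n (q.2, q.1) -
    (2 * (q.2.2 ^ 3 - q.1 * q.2.2 + q.2.1) * dirDeriv ((0, 1), 0) B' (q.2, q.1) +
    (3 * q.2.2 ^ 2 - q.1) * B' (q.2, q.1) + Ψ₀ (q.2.1, q.1) + Ψ₁ (q.2.1, q.1) * q.2.2), ?_, ?_,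
    fun lam h y => ?_⟩
  · exact ContDiff.sum fun j _ => (contDiff_fst.pow j).mul ((hR j).comp contDiff_snd)
  · have h1 : ContDiff ℝ ∞ fun q : ℝ × ℝ × ℝ => S n (q.2, q.1) := (hS n).comp (by fun_prop)
    have h2 : ContDiff ℝ ∞ fun q : ℝ × ℝ × ℝ => B' (q.2, q.1) := hB'.comp (by fun_prop)
    have h3 : ContDiff ℝ ∞ fun q : ℝ × ℝ × ℝ => dirDeriv ((0, 1), 0) B' (q.2, q.1) :=
      (hB'.dirDeriv _).comp (by fun_prop)
    have h4 : ContDiff ℝ ∞ fun q : ℝ × ℝ × ℝ => Ψ₀ (q.2.1, q.1) := hΨ₀.comp (by fun_prop)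
    have h5 : ContDiff ℝ ∞ fun q : ℝ × ℝ × ℝ => Ψ₁ (q.2.1, q.1) := hΨ₁.comp (by fun_prop)
    fun_prop
  · have h2 : dirDeriv (0, 0, 1) (fun q : ℝ × ℝ × ℝ => B (q.2, q.1)) (lam, h, y) =
      dirDeriv ((0, 1), 0) B ((h, y), lam) :=
      (hb.hasDerivAt_last lam h y).unique (hB.hasDerivAt_mid h y lam)
    have hL : levelOp (fun q : ℝ × ℝ × ℝ => B (q.2, q.1)) (lam, h, y) =
        2 * (y ^ 3 - lam * y + h) * dirDeriv ((0, 1), 0) B ((h, y), lam) +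
        (3 * y ^ 2 - lam) * B ((h, y), lam) := by
      rw [levelOp, h2]
    have h3 := sum_range_pow_mul_linear n lam (2 * (y ^ 3 - lam * y + h)) (3 * y ^ 2 - lam) y
      (fun j => dirDeriv (0, 1) (sb (c j)) (h, y)) (fun j => sb (c j) (h, y))
      (fun j => sφ₀ (c j) h) (fun j => sφ₁ (c j) h) (fun j => h ^ n * R j (h, y))
    have h4 : ∑ j ∈ Finset.range n, lam ^ j * (h ^ n * R j (h, y)) =
        h ^ n * ∑ j ∈ Finset.range n, lam ^ j * R j (h, y) := by
      rw [Finset.mul_sum]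
      exact Finset.sum_congr rfl fun j _ => by ring
    rw [hL, dirDeriv_mid_of_expansion hB hB' (fun j => (hsol _ (hc j)).1) eB, eB]
    dsimp only
    rw [e₀, e₁, hexp n, h3, h4]
    ring

/-! ### Flatness along the curve of nodal cubics -/

/-- Smooth functions of `((s, y), δ)` lying in the ideal `(s ^ n, δ ^ n)` for every `n`. -/
def CornerFlat (K : (ℝ × ℝ) × ℝ → ℝ) : Prop :=
  ∀ n : ℕ, ∃ U V : (ℝ × ℝ) × ℝ → ℝ, ContDiff ℝ ∞ U ∧ ContDiff ℝ ∞ V ∧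
    ∀ q, K q = q.1.1 ^ n * U q + q.2 ^ n * V q

/-- Every term of the binomial expansion contains at least `n` factors `a` or at least `n` factors
`b`. It is applied to h = 2s³ + δ. -/
theorem exists_add_pow_eq (n : ℕ) : ∃ A B : ℝ × ℝ → ℝ, ContDiff ℝ ∞ A ∧ ContDiff ℝ ∞ B ∧
    ∀ a b, (a + b) ^ (2 * n) = a ^ n * A (a, b) + b ^ n * B (a, b) := by
  refine ⟨fun q => ∑ m ∈ (Finset.range (2 * n + 1)).filter (fun m => n ≤ m),
    q.1 ^ (m - n) * q.2 ^ (2 * n - m) * (2 * n).choose m,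
    fun q => ∑ m ∈ (Finset.range (2 * n + 1)).filter (fun m => ¬ n ≤ m),
    q.1 ^ m * q.2 ^ (2 * n - m - n) * (2 * n).choose m, ?_, ?_, fun a b => ?_⟩
  · exact ContDiff.sum fun m _ => by fun_prop
  · exact ContDiff.sum fun m _ => by fun_prop
  · rw [add_pow, ← Finset.sum_filter_add_sum_filter_not _ (fun m => n ≤ m)]
    congr 1
    · rw [Finset.mul_sum]
      refine Finset.sum_congr rfl fun m hm => ?_
      have h1 : n ≤ m := (Finset.mem_filter.1 hm).2
      have h2 : a ^ m = a ^ n * a ^ (m - n) := by rw [← pow_add]; congr 1; omega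
      rw [h2]; ring
    · rw [Finset.mul_sum]
      refine Finset.sum_congr rfl fun m hm => ?_
      have h1 := (Finset.mem_filter.1 hm).2
      have h2 : b ^ (2 * n - m) = b ^ n * b ^ (2 * n - m - n) := by
        rw [← pow_add]; congr 1; omega
      rw [h2]; ring

theorem CornerFlat.coeff {K : (ℝ × ℝ) × ℝ → ℝ} (h : CornerFlat K) (n : ℕ) :
    ∃ G : ℝ × ℝ → ℝ, ContDiff ℝ ∞ G ∧ ∀ p, K (p, 0) = p.1 ^ n * G p := by
  obtain ⟨U, V, hU, -, e⟩ := h (n + 1)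
  refine ⟨fun p => p.1 * U (p, 0), contDiff_fst.mul (hU.comp (by fun_prop)), fun p => ?_⟩
  rw [e]
  simp only [ne_eq, Nat.add_eq_zero_iff, one_ne_zero, and_false, not_false_eq_true, zero_pow]
  ring

/-- The difference quotient in δ consumes one factor δ, so the ideal of exponent `n + 1` yields that
of exponent `n`; the correction term is divisible by every power of s because it depends only on the
values at δ = 0. -/
theorem CornerFlat.next {K : (ℝ × ℝ) × ℝ → ℝ} (hK : ContDiff ℝ ∞ K) (h : CornerFlat K) :
    CornerFlat (nodeNext K) := by
  have hc0 : ContDiff ℝ ∞ fun p => K (p, 0) := hK.comp (by fun_prop)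
  intro n
  obtain ⟨U, V, hU, hV, e⟩ := h (n + 1)
  obtain ⟨G, hG, eG⟩ := h.coeff n
  have hs := nodeSol_pow_mul hG hc0 eG
  have hds : ∀ s y, dirDeriv (0, 1) (nodeSol fun p => K (p, 0)) (s, y) =
      s ^ n * dirDeriv (0, 1) (nodeSol G) (s, y) := by
    intro s y
    refine ((contDiff_nodeSol hc0).hasDerivAt_snd s y).unique ?_
    simpa only [hs] using ((contDiff_nodeSol hG).hasDerivAt_snd s y).const_mul (s ^ n)
  refine ⟨fun q => q.1.1 * hadamardQuot U q - 2 * dirDeriv (0, 1) (nodeSol G) q.1, V, ?_, hV,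
    fun q => ?_⟩
  · have h1 := hU.hadamardQuot
    have h2 : ContDiff ℝ ∞ fun q : (ℝ × ℝ) × ℝ => dirDeriv (0, 1) (nodeSol G) q.1 :=
      ((contDiff_nodeSol hG).dirDeriv _).comp contDiff_fst
    fun_prop
  · obtain ⟨⟨s, y⟩, δ⟩ := q
    have hq : hadamardQuot K ((s, y), δ) = s ^ (n + 1) * hadamardQuot U ((s, y), δ) +
        δ ^ n * V ((s, y), δ) := by
      refine eq_of_mul_eq_off_zero (f := fun δ => hadamardQuot K ((s, y), δ))
        (g := fun δ => s ^ (n + 1) * hadamardQuot U ((s, y), δ) + δ ^ n * V ((s, y), δ))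
        (hK.hadamardQuot.continuous.comp (by fun_prop)) ?_ 0 (fun δ => ?_) δ
      · have h1 := hU.hadamardQuot.continuous.comp
          (by fun_prop : Continuous fun δ : ℝ => ((s, y), δ))
        have h2 := hV.continuous.comp (by fun_prop : Continuous fun δ : ℝ => ((s, y), δ))
        exact (continuous_const.mul h1).add ((continuous_id.pow n).mul h2)
      · have h1 := eq_add_mul_hadamardQuot hK (s, y) δ
        have h2 := eq_add_mul_hadamardQuot hU (s, y) δ
        rw [e, e] at h1
        simp only [ne_eq, Nat.add_eq_zero_iff, one_ne_zero, and_false, not_false_eq_true,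
          zero_pow, zero_mul, add_zero] at h1
        rw [sub_zero]
        linear_combination -h1 + s ^ (n + 1) * h2
    simp only [nodeNext]
    rw [hq, hds]
    ring

theorem CornerFlat.rem {K : (ℝ × ℝ) × ℝ → ℝ} (hK : ContDiff ℝ ∞ K) (h : CornerFlat K) (n : ℕ) :
    CornerFlat (nodeRem K n) := by
  induction n with
  | zero => exact h
  | succ n ih => rw [nodeRem_succ]; exact ih.next (contDiff_nodeRem hK n)

/-- A flat function may be cut off at its zero locus. The cut-off is the square root statement
applied to β(t², y), which is flat at t = 0. -/
theorem contDiff_ite_pos {β : ℝ × ℝ → ℝ} (hβ : FlatOn {q | q.1 = 0} β) :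
    ContDiff ℝ ∞ fun q : ℝ × ℝ => if 0 < q.1 then β q else 0 := by
  have h1 : FlatOn {q : ℝ × ℝ × ℝ | q.1 = 0} fun q => β (q.1 ^ 2, q.2.1) := by
    refine (hβ.comp (Ψ := fun q : ℝ × ℝ × ℝ => (q.1 ^ 2, q.2.1)) (by fun_prop)).mono ?_
    intro q (hq : q.1 = 0)
    simp [hq]
  have h2 := (contDiff_indicator_comp_sqrt h1).comp
    (by fun_prop : ContDiff ℝ ∞ fun q : ℝ × ℝ => (q.1, q.2, (0 : ℝ)))
  convert h2 using 1
  funext q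
  by_cases hq : 0 < q.1
  · simp [indicator, hq, Real.sq_sqrt hq.le]
  · simp [indicator, hq]

theorem contDiff_ite_pos_one {β : ℝ → ℝ} (hβ : ContDiff ℝ ∞ β)
    (h : ∀ n : ℕ, ∃ G : ℝ → ℝ, ContDiff ℝ ∞ G ∧ ∀ s, β s = s ^ n * G s) :
    ContDiff ℝ ∞ fun s : ℝ => if 0 < s then β s else 0 := by
  have h1 : FlatOn {q : ℝ × ℝ | q.1 = 0} fun q => β q.1 := by
    refine flatOn_of_forall_eq_pow_mul (hβ.comp contDiff_fst) contDiff_fst fun n => ?_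
    obtain ⟨G, hG, e⟩ := h n
    exact ⟨fun q => G q.1, hG.comp contDiff_fst, fun q => e q.1⟩
  exact (contDiff_ite_pos h1).comp (by fun_prop : ContDiff ℝ ∞ fun s : ℝ => (s, (0 : ℝ)))

/-- A smooth function that vanishes for s ≤ 0 is flat at s = 0 by continuity of its derivatives,
hence smooth in lam = 3s². -/
theorem contDiff_comp_sqrt_third {B : (ℝ × ℝ) × ℝ → ℝ} (hB : ContDiff ℝ ∞ B)
    (h0 : ∀ s ≤ 0, ∀ y δ, B ((s, y), δ) = 0) :
    ContDiff ℝ ∞ fun q : ℝ × ℝ × ℝ => B ((√(q.1 / 3), q.2.2), q.2.1 - 2 * √(q.1 / 3) ^ 3) := by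
  have h1 : FlatOn {q : (ℝ × ℝ) × ℝ | q.1.1 = 0} B := by
    have hO : IsOpen {q : (ℝ × ℝ) × ℝ | q.1.1 < 0} :=
      isOpen_lt (continuous_fst.comp continuous_fst) continuous_const
    refine flatOn_of_eqOn_zero hB hO (fun q hq => h0 q.1.1 (le_of_lt hq) q.1.2 q.2)
      fun q (hq : q.1.1 = 0) => ?_
    obtain ⟨⟨s, y⟩, δ⟩ := q
    simp only at hq
    subst hq
    have hc : Continuous fun s : ℝ => (((s, y), δ) : (ℝ × ℝ) × ℝ) := by fun_prop
    have h2 : (0 : ℝ) ∈ closure (Iio 0) := by rw [closure_Iio]; exact self_mem_Iic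
    exact hc.closure_preimage_subset {q : (ℝ × ℝ) × ℝ | q.1.1 < 0} h2
  have h2 : FlatOn {q : ℝ × ℝ × ℝ | q.1 = 0} fun q => B ((q.1, q.2.2), q.2.1 - 2 * q.1 ^ 3) :=
    h1.comp (Ψ := fun q : ℝ × ℝ × ℝ => ((q.1, q.2.2), q.2.1 - 2 * q.1 ^ 3)) (by fun_prop)
  have h3 := (contDiff_indicator_comp_sqrt h2).comp
    (by fun_prop : ContDiff ℝ ∞ fun q : ℝ × ℝ × ℝ => (q.1 / 3, q.2.1, q.2.2))
  convert h3 using 1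
  funext q
  by_cases hq : 0 < q.1 / 3
  · simp [indicator, hq]
  · rw [h0 _ (Real.sqrt_eq_zero_of_nonpos (not_lt.1 hq)).le]
    simp [indicator, hq]

theorem sqrt_third_eq {s : ℝ} (hs : 0 ≤ s) : √(3 * s ^ 2 / 3) = s := by
  rw [mul_div_cancel_left₀ _ (by norm_num : (3 : ℝ) ≠ 0), Real.sqrt_sq hs]

/-- The decomposition of a function of `(lam, h, y)` into an element of the image of `levelOp`, an
affine function of `y` and a remainder with vanishing Taylor series at the nodal cubics. -/
theorem exists_level_decomposition {k : ℝ × ℝ × ℝ → ℝ} (hk : ContDiff ℝ ∞ k) :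
    ∃ (b : ℝ × ℝ × ℝ → ℝ) (φ₀ φ₁ : ℝ × ℝ → ℝ) (r : ℝ × ℝ × ℝ → ℝ), ContDiff ℝ ∞ b ∧
      ContDiff ℝ ∞ φ₀ ∧ ContDiff ℝ ∞ φ₁ ∧ ContDiff ℝ ∞ r ∧
      (∀ lam h y, k (lam, h, y) =
        levelOp b (lam, h, y) + φ₀ (lam, h) + φ₁ (lam, h) * y + r (lam, h, y)) ∧
      ∀ n, ∃ R : (ℝ × ℝ) × ℝ → ℝ, ContDiff ℝ ∞ R ∧ ∀ s, 0 ≤ s → ∀ y δ,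
        r (3 * s ^ 2, 2 * s ^ 3 + δ, y) = δ ^ n * R ((s, y), δ) := by
  obtain ⟨b, φ₀, φ₁, hb, hφ₀, hφ₁, hrem⟩ := exists_origin_decomposition hk
  let r : ℝ × ℝ × ℝ → ℝ := fun q => k q - levelOp b q - φ₀ (q.1, q.2.1) - φ₁ (q.1, q.2.1) * q.2.2
  have hr : ContDiff ℝ ∞ r := by
    have h1 := contDiff_levelOp hb
    have h2 : ContDiff ℝ ∞ fun q : ℝ × ℝ × ℝ => φ₀ (q.1, q.2.1) := hφ₀.comp (by fun_prop)
    have h3 : ContDiff ℝ ∞ fun q : ℝ × ℝ × ℝ => φ₁ (q.1, q.2.1) := hφ₁.comp (by fun_prop)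
    fun_prop
  let K : (ℝ × ℝ) × ℝ → ℝ := fun q => r (3 * q.1.1 ^ 2, 2 * q.1.1 ^ 3 + q.2, q.1.2)
  have hK : ContDiff ℝ ∞ K := hr.comp (by fun_prop)
  have hKf : CornerFlat K := by
    intro n
    obtain ⟨U, V, hU, hV, e⟩ := hrem (2 * n)
    obtain ⟨A, B, hA, hB, eAB⟩ := exists_add_pow_eq n
    -- From the ideal (h²ⁿ, lam²ⁿ): the power (2s³ + δ)²ⁿ is split into multiples of (2s³)ⁿ and of
    -- δⁿ, and lam²ⁿ = 9ⁿ s⁴ⁿ contributes to the multiples of sⁿ.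
    refine ⟨fun q => (2 ^ n * q.1.1 ^ (2 * n) * A (2 * q.1.1 ^ 3, q.2)) *
      U (3 * q.1.1 ^ 2, 2 * q.1.1 ^ 3 + q.2, q.1.2) + 3 ^ (2 * n) * q.1.1 ^ (3 * n) *
      V (3 * q.1.1 ^ 2, 2 * q.1.1 ^ 3 + q.2, q.1.2),
      fun q => B (2 * q.1.1 ^ 3, q.2) * U (3 * q.1.1 ^ 2, 2 * q.1.1 ^ 3 + q.2, q.1.2),
      ?_, ?_, fun q => ?_⟩
    · have h1 : ContDiff ℝ ∞ fun q : (ℝ × ℝ) × ℝ => A (2 * q.1.1 ^ 3, q.2) :=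
        hA.comp (by fun_prop)
      have h2 : ContDiff ℝ ∞ fun q : (ℝ × ℝ) × ℝ =>
        U (3 * q.1.1 ^ 2, 2 * q.1.1 ^ 3 + q.2, q.1.2) := hU.comp (by fun_prop)
      have h3 : ContDiff ℝ ∞ fun q : (ℝ × ℝ) × ℝ =>
        V (3 * q.1.1 ^ 2, 2 * q.1.1 ^ 3 + q.2, q.1.2) := hV.comp (by fun_prop)
      fun_prop
    · exact (hB.comp (by fun_prop)).mul (hU.comp (by fun_prop))
    · simp only [K, r]
      rw [e, eAB, mul_pow, mul_pow]
      ring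
  have hKn := hKf.rem hK
  have hcoef : ∀ n m, ∃ G : ℝ × ℝ → ℝ, ContDiff ℝ ∞ G ∧ ∀ p, nodeCoeff K n p = p.1 ^ m * G p :=
    fun n m => (hKn n).coeff m
  have hck := contDiff_nodeCoeff hK
  -- The coefficients are replaced by zero for s ≤ 0, which flatness at s = 0 permits; their sums
  -- then vanish for s ≤ 0 and become smooth functions of lam.
  obtain ⟨B, Φ₀, Φ₁, hB, hΦ₀, hΦ₁, hB0, hΦ₀0, hΦ₁0, hfin⟩ := exists_node_borel_sum (K := K)
    (T := Ici 0) (β := fun n q => if 0 < q.1 then nodeSol (nodeCoeff K n) q else 0)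
    (φ₀ := fun n s => if 0 < s then nodeConstCoeff (nodeCoeff K n) s else 0)
    (φ₁ := fun n s => if 0 < s then nodeLinCoeff (nodeCoeff K n) s else 0)
    (fun n => contDiff_ite_pos (flatOn_of_forall_eq_pow_mul (contDiff_nodeSol (hck n))
      contDiff_fst fun m => by
        obtain ⟨G, hG, e⟩ := hcoef n m
        exact ⟨nodeSol G, contDiff_nodeSol hG, nodeSol_pow_mul hG (hck n) e⟩))
    (fun n => contDiff_ite_pos_one (contDiff_nodeConstCoeff (hck n)) fun m => by
      obtain ⟨G, hG, e⟩ := hcoef n m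
      exact ⟨nodeConstCoeff G, contDiff_nodeConstCoeff hG, nodeConstCoeff_pow_mul hG (hck n) e⟩)
    (fun n => contDiff_ite_pos_one (contDiff_nodeLinCoeff (hck n)) fun m => by
      obtain ⟨G, hG, e⟩ := hcoef n m
      exact ⟨nodeLinCoeff G, contDiff_nodeLinCoeff hG, nodeLinCoeff_pow_mul hG (hck n) e⟩)
    (fun n => by
      refine ⟨nodeRem K n, contDiff_nodeRem hK n, fun s hs y δ => ?_⟩
      rw [node_expansion hK n s y δ]
      congr 1
      refine Finset.sum_congr rfl fun j _ => ?_
      obtain ⟨G, hG, e⟩ := hcoef j 1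
      have e0 := nodeSol_pow_mul hG (hck j) e
      have e1 : dirDeriv (0, 1) (fun q : ℝ × ℝ => if 0 < q.1 then nodeSol (nodeCoeff K j) q else 0)
          (s, y) = if 0 < s then dirDeriv (0, 1) (nodeSol (nodeCoeff K j)) (s, y) else 0 := by
        have d1 := (contDiff_ite_pos (flatOn_of_forall_eq_pow_mul (contDiff_nodeSol (hck j))
          contDiff_fst fun m => by
            obtain ⟨G, hG, e⟩ := hcoef j m
            exact ⟨nodeSol G, contDiff_nodeSol hG, nodeSol_pow_mul hG (hck j) e⟩)).hasDerivAt_snd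
              s y
        refine d1.unique ?_
        by_cases h : 0 < s
        · simpa only [h, if_true] using (contDiff_nodeSol (hck j)).hasDerivAt_snd s y
        · simpa only [h, if_false] using hasDerivAt_const y (0 : ℝ)
      rw [e1]
      by_cases h : 0 < s
      · simp only [h, if_true]
      -- At s = 0 the terms removed by the cut-off are zero, because all coefficients are divisible
      -- by s.
      · have hs0 : s = 0 := le_antisymm (not_lt.1 h) hs
        have d0 : dirDeriv (0, 1) (nodeSol (nodeCoeff K j)) (s, y) = 0 := by
          refine ((contDiff_nodeSol (hck j)).hasDerivAt_snd s y).unique ?_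
          have : (fun t => nodeSol (nodeCoeff K j) (s, t)) = fun _ => 0 := by
            funext t
            rw [e0, hs0]
            simp
          rw [this]
          exact hasDerivAt_const y (0 : ℝ)
        simp only [h, if_false]
        rw [d0, e0, nodeConstCoeff_pow_mul hG (hck j) e, nodeLinCoeff_pow_mul hG (hck j) e, hs0]
        simp)
  have hB' := contDiff_comp_sqrt_third hB fun s hs y => hB0 s y fun n => by
    simp [not_lt.2 hs]
  have hΦ₀' := (contDiff_comp_sqrt_third (B := fun q => Φ₀ (q.1.1, q.2))
    (hΦ₀.comp (by fun_prop)) fun s hs y => hΦ₀0 s fun n => by simp [not_lt.2 hs]).comp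
    (by fun_prop : ContDiff ℝ ∞ fun q : ℝ × ℝ => (q.1, q.2, (0 : ℝ)))
  have hΦ₁' := (contDiff_comp_sqrt_third (B := fun q => Φ₁ (q.1.1, q.2))
    (hΦ₁.comp (by fun_prop)) fun s hs y => hΦ₁0 s fun n => by simp [not_lt.2 hs]).comp
    (by fun_prop : ContDiff ℝ ∞ fun q : ℝ × ℝ => (q.1, q.2, (0 : ℝ)))
  set b' : ℝ × ℝ × ℝ → ℝ := fun q => B ((√(q.1 / 3), q.2.2), q.2.1 - 2 * √(q.1 / 3) ^ 3) with hb'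
  let ψ₀ : ℝ × ℝ → ℝ := fun q => Φ₀ (√(q.1 / 3), q.2 - 2 * √(q.1 / 3) ^ 3)
  let ψ₁ : ℝ × ℝ → ℝ := fun q => Φ₁ (√(q.1 / 3), q.2 - 2 * √(q.1 / 3) ^ 3)
  have hψ₀ : ContDiff ℝ ∞ ψ₀ := hΦ₀'
  have hψ₁ : ContDiff ℝ ∞ ψ₁ := hΦ₁'
  have hadd : ∀ q, levelOp (fun q => b q + b' q) q = levelOp b q + levelOp b' q := by
    intro q
    have : dirDeriv (0, 0, 1) (fun q => b q + b' q) q =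
        dirDeriv (0, 0, 1) b q + dirDeriv (0, 0, 1) b' q := by
      rw [dirDeriv, ((hb.hasFDerivAt_infty q).fun_add (hB'.hasFDerivAt_infty q)).fderiv]
      rfl
    simp only [levelOp, this]
    ring
  refine ⟨fun q => b q + b' q, fun q => φ₀ q + ψ₀ q, fun q => φ₁ q + ψ₁ q,
    fun q => r q - levelOp b' q - ψ₀ (q.1, q.2.1) - ψ₁ (q.1, q.2.1) * q.2.2,
    hb.add hB', hφ₀.add hψ₀, hφ₁.add hψ₁, ?_, fun lam h y => ?_, fun n => ?_⟩
  · have h1 := contDiff_levelOp hB'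
    have h2 : ContDiff ℝ ∞ fun q : ℝ × ℝ × ℝ => ψ₀ (q.1, q.2.1) := hψ₀.comp (by fun_prop)
    have h3 : ContDiff ℝ ∞ fun q : ℝ × ℝ × ℝ => ψ₁ (q.1, q.2.1) := hψ₁.comp (by fun_prop)
    fun_prop
  · rw [hadd]
    simp only [r]
    ring
  · obtain ⟨R, hR, e⟩ := hfin n
    refine ⟨R, hR, fun s hs y δ => ?_⟩
    have h1 := e s hs y δ
    have hd : dirDeriv (0, 0, 1) b' (3 * s ^ 2, 2 * s ^ 3 + δ, y) =
        dirDeriv ((0, 1), 0) B ((s, y), δ) := by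
      refine (hB'.hasDerivAt_last _ _ y).unique ?_
      have := hB.hasDerivAt_mid s y δ
      simpa only [hb', sqrt_third_eq hs, add_sub_cancel_left] using this
    have hbv : b' (3 * s ^ 2, 2 * s ^ 3 + δ, y) = B ((s, y), δ) := by
      simp only [hb', sqrt_third_eq hs, add_sub_cancel_left]
    simp only [levelOp, hd, hbv, ψ₀, ψ₁, sqrt_third_eq hs, add_sub_cancel_left]
    simp only [K] at h1
    rw [h1]
    ring

/-- The nodes, viewed in the space of `(lam, h, y)`, times the `y`-axis. -/
def nodeLocus : Set (ℝ × ℝ × ℝ) := {q | ∃ s, 0 ≤ s ∧ q.1 = 3 * s ^ 2 ∧ q.2.1 = 2 * s ^ 3}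

theorem dirDeriv_comm {E : Type} [NormedAddCommGroup E] [NormedSpace ℝ E] {F : E → ℝ}
    (hF : ContDiff ℝ ∞ F) (v w q : E) :
    dirDeriv v (dirDeriv w F) q = dirDeriv w (dirDeriv v F) q := by
  have hd : ContDiff ℝ ∞ (fderiv ℝ F) := hF.fderiv_right (by simp)
  have h1 : ∀ u u' : E, dirDeriv u (dirDeriv u' F) q = fderiv ℝ (fderiv ℝ F) q u u' := by
    intro u u'
    have h2 := (hd.hasFDerivAt_infty q).clm_apply (hasFDerivAt_const u' q)
    rw [dirDeriv]
    have h3 : fderiv ℝ (dirDeriv u' F) q = _ := h2.fderiv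
    rw [h3]
    simp
  rw [h1, h1]
  exact second_derivative_symmetric (fun x => hF.hasFDerivAt_infty x) (hd.hasFDerivAt_infty q) v w

/-- Only the derivatives in h are transversal to `nodeLocus`. Those in y are tangent to it, and the
tangent vector (6s, 6s²) of the curve (3s², 2s³) expresses the derivative in lam by the one in h for
s > 0; the case s = 0 follows by continuity. -/
theorem flatOn_nodeLocus_of_iterate {g : ℝ × ℝ × ℝ → ℝ} (hg : ContDiff ℝ ∞ g)
    (h : ∀ n, ∀ q ∈ nodeLocus, (dirDeriv ((0, 1, 0) : ℝ × ℝ × ℝ))^[n] g q = 0) :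
    FlatOn nodeLocus g := by
  have hiter : ∀ (g : ℝ × ℝ × ℝ → ℝ), ContDiff ℝ ∞ g → ∀ n,
      ContDiff ℝ ∞ ((dirDeriv ((0, 1, 0) : ℝ × ℝ × ℝ))^[n] g) := by
    intro g hg n
    induction n with
    | zero => exact hg
    | succ n ih => rw [Function.iterate_succ_apply']; exact ih.dirDeriv _
  have hcomm : ∀ (v : ℝ × ℝ × ℝ) (g : ℝ × ℝ × ℝ → ℝ), ContDiff ℝ ∞ g → ∀ n,
      (dirDeriv ((0, 1, 0) : ℝ × ℝ × ℝ))^[n] (dirDeriv v g) =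
      dirDeriv v ((dirDeriv ((0, 1, 0) : ℝ × ℝ × ℝ))^[n] g) := by
    intro v g hg n
    induction n with
    | zero => rfl
    | succ n ih =>
      rw [Function.iterate_succ_apply', ih, Function.iterate_succ_apply']
      funext q
      exact dirDeriv_comm (hiter g hg n) _ _ q
  refine flatOn_of_dirDeriv basisThree coordThree (fun v => ?_)
    {g | ContDiff ℝ ∞ g ∧ ∀ n, ∀ q ∈ nodeLocus, (dirDeriv ((0, 1, 0) : ℝ × ℝ × ℝ))^[n] g q = 0}
    (fun F hF => hF.1) (fun F hF i => ⟨hF.1.dirDeriv _, fun n => ?_⟩)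
    (fun F hF q hq => hF.2 0 q hq) ⟨hg, h⟩
  · simp [Fin.sum_univ_three, basisThree, coordThree]
  · rw [hcomm _ _ hF.1]
    have hG := hiter F hF.1 n
    have h0 := hF.2 n
    have h1 := hF.2 (n + 1)
    rw [Function.iterate_succ_apply'] at h1
    set G := (dirDeriv ((0, 1, 0) : ℝ × ℝ × ℝ))^[n] F
    rintro ⟨lam, h, y⟩ ⟨s, hs, e1, e2⟩
    simp only at e1 e2
    subst e1 e2
    have hmem : ∀ s : ℝ, 0 ≤ s → ∀ y, ((3 * s ^ 2, 2 * s ^ 3, y) : ℝ × ℝ × ℝ) ∈ nodeLocus :=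
      fun s hs y => ⟨s, hs, rfl, rfl⟩
    fin_cases i
    · have hpos : ∀ s : ℝ, 0 < s → dirDeriv (1, 0, 0) G (3 * s ^ 2, 2 * s ^ 3, y) = 0 := by
        intro s hs
        have hc : HasDerivAt (fun s : ℝ => ((3 * s ^ 2, 2 * s ^ 3, y) : ℝ × ℝ × ℝ))
            (6 * s, 6 * s ^ 2, 0) s := by
          refine HasDerivAt.prodMk ?_ (HasDerivAt.prodMk ?_ (hasDerivAt_const _ _))
          · exact ((hasDerivAt_pow 2 s).const_mul 3).congr_deriv (by simp; ring)
          · exact ((hasDerivAt_pow 3 s).const_mul 2).congr_deriv (by simp; ring)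
        have h2 := hG.hasDerivAt_comp_infty hc
        have h3 : HasDerivAt (fun s : ℝ => G (3 * s ^ 2, 2 * s ^ 3, y)) 0 s := by
          refine (hasDerivAt_const s (0 : ℝ)).congr_of_eventuallyEq ?_
          filter_upwards [lt_mem_nhds hs] with u hu
          exact h0 _ (hmem u hu.le y)
        have h4 := h2.unique h3
        have h5 := h1 _ (hmem s hs.le y)
        have h6 : ((6 * s, 6 * s ^ 2, 0) : ℝ × ℝ × ℝ) =
            (6 * s) • ((1, 0, 0) : ℝ × ℝ × ℝ) + (6 * s ^ 2) • ((0, 1, 0) : ℝ × ℝ × ℝ) := by simp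
        simp only [dirDeriv] at h4 h5 ⊢
        rw [h6, map_add, map_smul, map_smul, h5, smul_zero, add_zero, smul_eq_mul] at h4
        exact (mul_eq_zero.1 h4).resolve_left (by positivity)
      have hcl : s ∈ closure (Ioi (0 : ℝ)) := by rw [closure_Ioi]; exact hs
      have heq : EqOn (fun s : ℝ => dirDeriv (1, 0, 0) G (3 * s ^ 2, 2 * s ^ 3, y)) (fun _ => 0)
          (closure (Ioi 0)) :=
        EqOn.closure (fun s hs => hpos s hs)
          ((hG.dirDeriv _).continuous.comp (by fun_prop)) continuous_const
      exact heq hcl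
    · exact h1 _ (hmem s hs y)
    · refine (hG.hasDerivAt_last _ _ y).unique ?_
      have : (fun t => G (3 * s ^ 2, 2 * s ^ 3, t)) = fun _ => 0 :=
        funext fun t => h0 _ (hmem s hs t)
      rw [this]
      exact hasDerivAt_const y (0 : ℝ)

/-! ### Circular coordinates around the vanishing cycles -/

/-- The angle `ψ` in the trigonometric solution of the cubic `Y ^ 3 - 3 * Y = 2 - ζ ^ 2`. -/
noncomputable def cubicAngle (ζ : ℝ) : ℝ := 2 / 3 * (Real.pi - Real.arcsin (ζ / 2))

/-- The function `y = Y (z)` for which `H + 2 * q ^ 6 = x ^ 2 + z ^ 2` when `lam = 3 * q ^ 4`. -/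
noncomputable def cycleY (q z : ℝ) : ℝ := 2 * q ^ 2 * Real.cos (cubicAngle (z / q ^ 3))

/-- The derivative of `cycleY`. -/
noncomputable def cycleYDeriv (q z : ℝ) : ℝ :=
  4 / 3 * q⁻¹ * Real.sin (cubicAngle (z / q ^ 3)) * (√(4 - (z / q ^ 3) ^ 2))⁻¹

theorem cos_cubicAngle_cubic {ζ : ℝ} (h : |ζ| ≤ 2) :
    4 * Real.cos (cubicAngle ζ) ^ 3 - 3 * Real.cos (cubicAngle ζ) = 1 - ζ ^ 2 / 2 := by
  rw [← Real.cos_three_mul, cubicAngle]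
  have h' := abs_le.1 h
  have e : 3 * (2 / 3 * (Real.pi - Real.arcsin (ζ / 2))) =
      2 * Real.pi - 2 * Real.arcsin (ζ / 2) := by ring
  rw [e, Real.cos_two_pi_sub, Real.cos_two_mul, Real.cos_sq', Real.sin_arcsin (by linarith)
    (by linarith)]
  ring

theorem cubicAngle_mem {ζ : ℝ} (h : |ζ| < 2) : cubicAngle ζ ∈ Ioo (Real.pi / 3) Real.pi := by
  have h' := abs_lt.1 h
  have h1 : Real.arcsin (ζ / 2) < Real.pi / 2 := by
    rw [Real.arcsin_lt_pi_div_two]; linarith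
  have h2 : -(Real.pi / 2) < Real.arcsin (ζ / 2) := by
    rw [Real.neg_pi_div_two_lt_arcsin]; linarith
  constructor <;> · unfold cubicAngle; linarith

theorem cos_cubicAngle_lt {ζ : ℝ} (h : |ζ| < 2) : Real.cos (cubicAngle ζ) < 1 / 2 := by
  obtain ⟨h1, h2⟩ := cubicAngle_mem h
  rw [← Real.cos_pi_div_three]
  exact Real.cos_lt_cos_of_nonneg_of_le_pi (by positivity) h2.le h1

theorem lt_cos_cubicAngle {ζ : ℝ} (h : |ζ| < 2) : -1 < Real.cos (cubicAngle ζ) := by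
  obtain ⟨h1, h2⟩ := cubicAngle_mem h
  rw [← Real.cos_pi]
  exact Real.cos_lt_cos_of_nonneg_of_le_pi (by linarith [Real.pi_pos]) le_rfl h2

/-- In terms of the half angle the square root splits off the factor 1 - 2 cos ψ, which tends to
zero at the saddle and is, up to q², the difference q² - Y. -/
theorem sqrt_four_sub_sq {ζ : ℝ} (h : |ζ| < 2) :
    √(4 - ζ ^ 2) = 2 * Real.cos (cubicAngle ζ / 2) * (1 - 2 * Real.cos (cubicAngle ζ)) := by
  have h' := abs_lt.1 h
  have e : Real.arcsin (ζ / 2) = Real.pi - 3 * (cubicAngle ζ / 2) := by unfold cubicAngle; ring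
  have h1 : Real.cos (Real.arcsin (ζ / 2)) = -Real.cos (3 * (cubicAngle ζ / 2)) := by
    rw [e, Real.cos_pi_sub]
  rw [Real.cos_arcsin, Real.cos_three_mul] at h1
  have h2 : √(4 - ζ ^ 2) = 2 * √(1 - (ζ / 2) ^ 2) := by
    rw [show 4 - ζ ^ 2 = 2 ^ 2 * (1 - (ζ / 2) ^ 2) by ring, Real.sqrt_mul (by norm_num),
      Real.sqrt_sq (by norm_num)]
  have h3 : Real.cos (cubicAngle ζ) = 2 * Real.cos (cubicAngle ζ / 2) ^ 2 - 1 := by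
    rw [← Real.cos_two_mul]; ring_nf
  rw [h2, h1, h3]
  ring

theorem hasDerivAt_cubicAngle {ζ : ℝ} (h : |ζ| < 2) :
    HasDerivAt cubicAngle (-(2 / 3) * (√(4 - ζ ^ 2))⁻¹) ζ := by
  have h' := abs_lt.1 h
  have h1 := (Real.hasDerivAt_arcsin (x := ζ / 2) (by linarith) (by linarith)).comp ζ
    ((hasDerivAt_id ζ).div_const 2)
  have h2 : √(4 - ζ ^ 2) = 2 * √(1 - (ζ / 2) ^ 2) := by
    rw [show 4 - ζ ^ 2 = 2 ^ 2 * (1 - (ζ / 2) ^ 2) by ring, Real.sqrt_mul (by norm_num),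
      Real.sqrt_sq (by norm_num)]
  refine ((h1.const_sub Real.pi).const_mul (2 / 3)).congr_deriv ?_
  rw [h2, mul_inv]
  simp
  ring

section

variable {q z : ℝ}

theorem abs_div_pow_lt (hq : 0 < q) (hz : |z| < 2 * q ^ 3) : |z / q ^ 3| < 2 := by
  rw [abs_div, abs_of_pos (pow_pos hq 3), div_lt_iff₀ (pow_pos hq 3)]
  exact hz

theorem hasDerivAt_cycleY (hq : 0 < q) (hz : |z| < 2 * q ^ 3) :
    HasDerivAt (cycleY q) (cycleYDeriv q z) z := by
  have h1 := (hasDerivAt_cubicAngle (abs_div_pow_lt hq hz)).comp z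
    ((hasDerivAt_id z).div_const (q ^ 3))
  refine (h1.cos.const_mul (2 * q ^ 2)).congr_deriv ?_
  simp only [cycleYDeriv, Function.comp, id]
  field_simp
  ring

theorem cycleY_lt (hq : 0 < q) (hz : |z| < 2 * q ^ 3) : cycleY q z < q ^ 2 := by
  have := cos_cubicAngle_lt (abs_div_pow_lt hq hz)
  have hq2 : 0 < q ^ 2 := by positivity
  unfold cycleY
  nlinarith

theorem lt_cycleY (hq : 0 < q) (hz : |z| < 2 * q ^ 3) : -(2 * q ^ 2) < cycleY q z := by
  have := lt_cos_cubicAngle (abs_div_pow_lt hq hz)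
  have hq2 : 0 < q ^ 2 := by positivity
  unfold cycleY
  nlinarith

theorem cycleY_cubic (hq : 0 < q) (hz : |z| ≤ 2 * q ^ 3) :
    z ^ 2 = 2 * q ^ 6 - cycleY q z ^ 3 + 3 * q ^ 4 * cycleY q z := by
  have h1 : |z / q ^ 3| ≤ 2 := by
    rw [abs_div, abs_of_pos (pow_pos hq 3), div_le_iff₀ (pow_pos hq 3)]
    exact hz
  have h := cos_cubicAngle_cubic h1
  have e : z ^ 2 = q ^ 6 * (z / q ^ 3) ^ 2 := by field_simp
  unfold cycleY
  rw [e]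
  linear_combination (2 * q ^ 6) * h

theorem cuspH_cycleY (hq : 0 < q) (hz : |z| ≤ 2 * q ^ 3) (x : ℝ) :
    cuspH (3 * q ^ 4) (x, cycleY q z) = x ^ 2 + z ^ 2 - 2 * q ^ 6 := by
  rw [cycleY_cubic hq hz, cuspH]
  ring

theorem two_mul_eq_cycleYDeriv (hq : 0 < q) (hz : |z| < 2 * q ^ 3) :
    2 * z = (3 * q ^ 4 - 3 * cycleY q z ^ 2) * cycleYDeriv q z := by
  have hd := hasDerivAt_cycleY hq hz
  have h1 : HasDerivAt (fun z => 2 * q ^ 6 - cycleY q z ^ 3 + 3 * q ^ 4 * cycleY q z)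
      ((3 * q ^ 4 - 3 * cycleY q z ^ 2) * cycleYDeriv q z) z := by
    refine (((hd.pow 3).const_sub (2 * q ^ 6)).add (hd.const_mul (3 * q ^ 4))).congr_deriv ?_
    norm_num
    ring
  have h2 : HasDerivAt (fun z : ℝ => z ^ 2) (2 * z) z := by simpa using hasDerivAt_pow 2 z
  refine h2.unique (h1.congr_of_eventuallyEq ?_)
  have : ∀ᶠ w in 𝓝 z, |w| < 2 * q ^ 3 := continuous_abs.continuousAt.eventually_lt_const hz
  filter_upwards [this] with w hw
  exact cycleY_cubic hq hw.le

/-- The singularity of Y' at the saddle is exactly that of 1 / (q² - Y): the product is a multiple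
of a sine in [1/2, 1]. All estimates near the saddle rest on this. -/
theorem sub_mul_cycleYDeriv (hq : 0 < q) (hz : |z| < 2 * q ^ 3) :
    (q ^ 2 - cycleY q z) * cycleYDeriv q z =
      4 / 3 * q * Real.sin (cubicAngle (z / q ^ 3) / 2) := by
  have hζ := abs_div_pow_lt hq hz
  obtain ⟨h1, h2⟩ := cubicAngle_mem hζ
  have hc := cos_cubicAngle_lt hζ
  have hu : 0 < Real.cos (cubicAngle (z / q ^ 3) / 2) :=
    Real.cos_pos_of_mem_Ioo ⟨by linarith [Real.pi_pos], by linarith⟩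
  have hs : Real.sin (cubicAngle (z / q ^ 3)) =
      2 * Real.sin (cubicAngle (z / q ^ 3) / 2) * Real.cos (cubicAngle (z / q ^ 3) / 2) := by
    rw [← Real.sin_two_mul]; ring_nf
  have hc' : 1 - 2 * Real.cos (cubicAngle (z / q ^ 3)) ≠ 0 := by linarith
  unfold cycleY cycleYDeriv
  rw [sqrt_four_sub_sq hζ, hs]
  field_simp

theorem sin_half_cubicAngle_mem {ζ : ℝ} (h : |ζ| < 2) :
    Real.sin (cubicAngle ζ / 2) ∈ Icc (1 / 2) 1 := by
  obtain ⟨h1, h2⟩ := cubicAngle_mem h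
  refine ⟨?_, Real.sin_le_one _⟩
  rw [← Real.sin_pi_div_six]
  exact Real.sin_le_sin_of_le_of_le_pi_div_two (by linarith [Real.pi_pos]) (by linarith)
    (by linarith)

theorem cycleYDeriv_pos (hq : 0 < q) (hz : |z| < 2 * q ^ 3) : 0 < cycleYDeriv q z := by
  have h1 := sub_mul_cycleYDeriv hq hz
  have h2 := (sin_half_cubicAngle_mem (abs_div_pow_lt hq hz)).1
  have h3 := cycleY_lt hq hz
  have h4 : 0 < (q ^ 2 - cycleY q z) * cycleYDeriv q z := by
    rw [h1]; have : 0 < Real.sin (cubicAngle (z / q ^ 3) / 2) := by linarith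
    positivity
  exact (pos_iff_pos_of_mul_pos h4).1 (by linarith)

theorem strictMonoOn_cycleY (hq : 0 < q) :
    StrictMonoOn (cycleY q) {z | |z| < 2 * q ^ 3} := by
  have hset : {z : ℝ | |z| < 2 * q ^ 3} = Ioo (-(2 * q ^ 3)) (2 * q ^ 3) := by
    ext z; exact (abs_lt : |z| < 2 * q ^ 3 ↔ _)
  refine strictMonoOn_of_deriv_pos (by rw [hset]; exact convex_Ioo _ _) (fun z hz => ?_)
    fun z hz => ?_
  · exact (hasDerivAt_cycleY hq hz).continuousAt.continuousWithinAt
  · have hz' := interior_subset hz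
    rw [(hasDerivAt_cycleY hq hz').deriv]
    exact cycleYDeriv_pos hq hz'

/-- The inverse of `cycleY`, from the factorization 2q⁶ - y³ + 3q⁴y = (y + q²)²(2q² - y): at the
minimum the double zero gives a smooth square root. -/
theorem cycleY_eq {y : ℝ} (hq : 0 < q) (h1 : -(2 * q ^ 2) < y) (h2 : y < q ^ 2) :
    |(y + q ^ 2) * √(2 * q ^ 2 - y)| < 2 * q ^ 3 ∧
      cycleY q ((y + q ^ 2) * √(2 * q ^ 2 - y)) = y := by
  have hq2 : 0 < q ^ 2 := by positivity
  set z := (y + q ^ 2) * √(2 * q ^ 2 - y) with hz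
  have hsq : z ^ 2 = 2 * q ^ 6 - y ^ 3 + 3 * q ^ 4 * y := by
    rw [hz, mul_pow, Real.sq_sqrt (by linarith)]; ring
  have habs : |z| < 2 * q ^ 3 := by
    refine abs_lt_of_sq_lt_sq ?_ (by positivity)
    rw [hsq]
    have : 0 < (q ^ 2 - y) ^ 2 * (y + 2 * q ^ 2) :=
      mul_pos (pow_pos (by linarith) 2) (by linarith)
    nlinarith
  refine ⟨habs, ?_⟩
  have hr : y / (2 * q ^ 2) ∈ Ioo (-1) (1 / 2) := by
    constructor
    · rw [lt_div_iff₀ (by positivity)]; linarith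
    · rw [div_lt_iff₀ (by positivity)]; linarith
  set φ := Real.arccos (y / (2 * q ^ 2)) with hφ
  have hcos : Real.cos φ = y / (2 * q ^ 2) := Real.cos_arccos hr.1.le (by linarith [hr.2])
  have hy : y = 2 * q ^ 2 * Real.cos φ := by rw [hcos]; field_simp
  have hφ1 : Real.pi / 3 < φ := by
    by_contra hcon
    have := Real.cos_le_cos_of_nonneg_of_le_pi (Real.arccos_nonneg _)
      (by linarith [Real.pi_pos]) (not_lt.1 hcon)
    rw [hcos, Real.cos_pi_div_three] at this
    linarith [hr.2]
  have hφ2 : φ ≤ Real.pi := Real.arccos_le_pi _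
  have hsin : 0 ≤ Real.sin (φ / 2) :=
    Real.sin_nonneg_of_nonneg_of_le_pi (by linarith [Real.pi_pos]) (by linarith)
  have hcos2 : Real.cos φ = 1 - 2 * Real.sin (φ / 2) ^ 2 := by
    have : Real.cos (2 * (φ / 2)) = 1 - 2 * Real.sin (φ / 2) ^ 2 := by
      rw [Real.cos_two_mul, Real.cos_sq']; ring
    rw [← this]; ring_nf
  have hsqrt : √(2 * q ^ 2 - y) = 2 * q * Real.sin (φ / 2) := by
    rw [show 2 * q ^ 2 - y = (2 * q * Real.sin (φ / 2)) ^ 2 by rw [hy, hcos2]; ring,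
      Real.sqrt_sq (by positivity)]
  have hz3 : z / q ^ 3 / 2 = Real.sin (Real.pi - 3 * (φ / 2)) := by
    rw [Real.sin_pi_sub, Real.sin_three_mul, hz, hsqrt, hy, hcos2]
    field_simp
    ring
  unfold cycleY cubicAngle
  rw [hz3, Real.arcsin_sin (by linarith) (by linarith)]
  rw [show 2 / 3 * (Real.pi - (Real.pi - 3 * (φ / 2))) = φ by ring]
  exact hy.symm

end

/-! ### Areas of discs and means over cycles -/

theorem setIntegral_disc_eq {F : ℝ × ℝ → ℝ} (hF : Continuous F) {R : ℝ} (hR : 0 < R) :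
    ∫ p in {p : ℝ × ℝ | p.1 ^ 2 + p.2 ^ 2 ≤ R ^ 2}, F p =
      ∫ r in (0 : ℝ)..R, r * ∫ θ in (-Real.pi)..Real.pi, F (r * Real.cos θ, r * Real.sin θ) := by
  have hm : MeasurableSet {p : ℝ × ℝ | p.1 ^ 2 + p.2 ^ 2 ≤ R ^ 2} :=
    (isClosed_le (by fun_prop) continuous_const).measurableSet
  have hpi : -Real.pi ≤ Real.pi := by linarith [Real.pi_pos]
  set g : ℝ × ℝ → ℝ := fun p => p.1 * F (p.1 * Real.cos p.2, p.1 * Real.sin p.2) with hg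
  have hgc : Continuous g := by fun_prop
  have e1 : ∀ p ∈ polarCoord.target,
      p.1 • ({p : ℝ × ℝ | p.1 ^ 2 + p.2 ^ 2 ≤ R ^ 2}.indicator F) (polarCoord.symm p) =
        (Iic R ×ˢ univ).indicator g p := by
    rintro ⟨r, θ⟩ hp
    rw [polarCoord_target] at hp
    have hr : 0 < r := hp.1
    rw [polarCoord_symm_apply]
    have hiff0 : (r * Real.cos θ, r * Real.sin θ) ∈ {p : ℝ × ℝ | p.1 ^ 2 + p.2 ^ 2 ≤ R ^ 2} ↔
      (r * Real.cos θ) ^ 2 + (r * Real.sin θ) ^ 2 ≤ R ^ 2 := Iff.rfl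
    have hiff : (r * Real.cos θ) ^ 2 + (r * Real.sin θ) ^ 2 ≤ R ^ 2 ↔ r ≤ R := by
      have : (r * Real.cos θ) ^ 2 + (r * Real.sin θ) ^ 2 = r ^ 2 := by
        rw [mul_pow, mul_pow, ← mul_add, Real.cos_sq_add_sin_sq, mul_one]
      rw [this]
      exact sq_le_sq₀ hr.le hR.le
    by_cases h : r ≤ R
    · rw [indicator_of_mem (show (r, θ) ∈ Iic R ×ˢ univ from ⟨h, trivial⟩),
        indicator_of_mem (hiff0.2 (hiff.2 h))]
      rfl
    · rw [indicator_of_notMem (fun h' : (r, θ) ∈ Iic R ×ˢ univ => h h'.1),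
        indicator_of_notMem (fun h' => h (hiff.1 (hiff0.1 h')))]
      simp
  have hset : polarCoord.target ∩ Iic R ×ˢ univ = Ioc 0 R ×ˢ Ioo (-Real.pi) Real.pi := by
    rw [polarCoord_target, prod_inter_prod, inter_univ, Ioi_inter_Iic]
  rw [← integral_indicator hm, ← integral_comp_polarCoord_symm,
    setIntegral_congr_fun polarCoord.open_target.measurableSet e1,
    setIntegral_indicator (measurableSet_Iic.prod MeasurableSet.univ), hset,
    intervalIntegral.integral_of_le hR.le, Measure.volume_eq_prod, setIntegral_prod]
  · refine setIntegral_congr_fun measurableSet_Ioc fun r _ => ?_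
    simp only [hg]
    rw [integral_const_mul, intervalIntegral.integral_of_le hpi, integral_Ioc_eq_integral_Ioo]
  · rw [← Measure.volume_eq_prod]
    exact (hgc.continuousOn.integrableOn_compact (isCompact_Icc.prod isCompact_Icc)).mono_set
      (prod_mono Ioc_subset_Icc_self Ioo_subset_Icc_self)

/-- Differentiation of the integral over the disc with respect to its radius, in polar coordinates.
-/
theorem integral_circle_eq_zero {F : ℝ × ℝ → ℝ} (hF : Continuous F) {R₁ : ℝ}
    (h : ∀ R ∈ Ioo 0 R₁, ∫ p in {p : ℝ × ℝ | p.1 ^ 2 + p.2 ^ 2 ≤ R ^ 2}, F p = 0) {R : ℝ}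
    (hR : R ∈ Ioo 0 R₁) :
    ∫ θ in (0 : ℝ)..2 * Real.pi, F (R * Real.cos θ, R * Real.sin θ) = 0 := by
  set m : ℝ → ℝ := fun r => ∫ θ in (-Real.pi)..Real.pi, F (r * Real.cos θ, r * Real.sin θ)
  have hm : Continuous m :=
    intervalIntegral.continuous_parametric_intervalIntegral_of_continuous' (by fun_prop) _ _
  have hc : Continuous fun r => r * m r := by fun_prop
  have h1 : HasDerivAt (fun R => ∫ r in (0 : ℝ)..R, r * m r) (R * m R) R :=
    intervalIntegral.integral_hasDerivAt_right (hc.intervalIntegrable _ _)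
      (hc.stronglyMeasurableAtFilter _ _) hc.continuousAt
  have h2 : HasDerivAt (fun R => ∫ r in (0 : ℝ)..R, r * m r) 0 R := by
    refine (hasDerivAt_const R (0 : ℝ)).congr_of_eventuallyEq ?_
    filter_upwards [Ioo_mem_nhds hR.1 hR.2] with r hr
    exact (setIntegral_disc_eq hF hr.1).symm.trans (h r hr)
  have h3 : m R = 0 := (mul_eq_zero.1 (h1.unique h2)).resolve_left hR.1.ne'
  have hper : Function.Periodic (fun θ => F (R * Real.cos θ, R * Real.sin θ)) (2 * Real.pi) :=
    fun θ => by simp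
  have := hper.intervalIntegral_add_eq 0 (-Real.pi)
  rw [zero_add, show -Real.pi + 2 * Real.pi = Real.pi by ring] at this
  rw [this]
  exact h3

/-- The integral of `f` over a vanishing cycle with respect to twice the time of the Hamiltonian
flow of `H`. -/
noncomputable def circleMean (f : ℝ × ℝ × ℝ → ℝ) (q R : ℝ) : ℝ :=
  ∫ θ in (0 : ℝ)..2 * Real.pi,
    f (3 * q ^ 4, R * Real.cos θ, cycleY q (R * Real.sin θ)) * cycleYDeriv q (R * Real.sin θ)

theorem continuous_cubicAngle : Continuous cubicAngle := by
  unfold cubicAngle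
  exact continuous_const.mul (continuous_const.sub (Real.continuous_arcsin.comp (by fun_prop)))

theorem continuous_cycleY (q : ℝ) : Continuous (cycleY q) := by
  have := continuous_cubicAngle
  unfold cycleY
  fun_prop

theorem abs_mul_sin_lt {R c : ℝ} (hR : R ∈ Ioo 0 c) (θ : ℝ) : |R * Real.sin θ| < c := by
  rw [abs_mul, abs_of_pos hR.1]
  exact (mul_le_of_le_one_right hR.1.le (Real.abs_sin_le_one θ)).trans_lt hR.2

/-- With z as second coordinate, H + 2q⁶ is x² + z². Every level between the minimum -2q⁶ and the
saddle value 2q⁶ corresponds to a radius R in (0, 2q³). -/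
theorem vanishingDisc_eq_image {q : ℝ} (hq : 0 < q) {R : ℝ} (hR : R ∈ Ioo 0 (2 * q ^ 3)) :
    vanishingDisc (R ^ 2 - 2 * q ^ 6) (3 * q ^ 4) =
      Prod.map id (cycleY q) '' {p : ℝ × ℝ | p.1 ^ 2 + p.2 ^ 2 ≤ R ^ 2} := by
  have hsq : √(3 * q ^ 4 / 3) = q ^ 2 := by
    rw [show 3 * q ^ 4 / 3 = (q ^ 2) ^ 2 by ring, Real.sqrt_sq (by positivity)]
  ext ⟨x, y⟩
  simp only [vanishingDisc, hsq, mem_ofPred_eq, mem_image, Prod.map, id]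
  constructor
  · rintro ⟨h1, h2⟩
    have hR2 : R ^ 2 < (2 * q ^ 3) ^ 2 := by
      have := hR.1; have := hR.2
      gcongr
    have h3 : -(2 * q ^ 2) < y := by
      by_contra hcon
      have : (y - q ^ 2) ^ 2 * (y + 2 * q ^ 2) ≤ 0 :=
        mul_nonpos_of_nonneg_of_nonpos (sq_nonneg _) (by linarith)
      simp only [cuspH] at h1
      nlinarith [sq_nonneg x]
    obtain ⟨h4, h5⟩ := cycleY_eq hq h3 h2
    refine ⟨(x, (y + q ^ 2) * √(2 * q ^ 2 - y)), ?_, by rw [h5]⟩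
    have := cuspH_cycleY hq h4.le x
    rw [h5] at this
    simp only
    linarith
  · rintro ⟨⟨x', z⟩, h1, h2⟩
    simp only [Prod.mk.injEq] at h1 h2
    have hz : |z| < 2 * q ^ 3 := by
      refine (abs_le_of_sq_le_sq (a := z) (b := R) (by nlinarith [sq_nonneg x']) hR.1.le
        ).trans_lt hR.2
    rw [← h2.1, ← h2.2]
    refine ⟨?_, cycleY_lt hq hz⟩
    rw [cuspH_cycleY hq hz.le]
    linarith

theorem circleMean_eq_zero {f : ℝ × ℝ × ℝ → ℝ} (hf : Continuous f) {q : ℝ} (hq : 0 < q)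
    (h : ∀ R ∈ Ioo 0 (2 * q ^ 3),
      ∫ p in vanishingDisc (R ^ 2 - 2 * q ^ 6) (3 * q ^ 4), f (3 * q ^ 4, p) = 0)
    {R : ℝ} (hR : R ∈ Ioo 0 (2 * q ^ 3)) : circleMean f q R = 0 := by
  obtain ⟨R₁, hRR₁, hR₁⟩ := exists_between hR.2
  have hR₁0 : 0 < R₁ := hR.1.trans hRR₁
  set c : ℝ := 4 - (R₁ / q ^ 3) ^ 2 with hcdef
  have hc : 0 < c := by
    have h1 := abs_div_pow_lt hq (z := R₁) (by rwa [abs_of_pos hR₁0])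
    have := sq_lt_sq' (abs_lt.1 h1).1 (abs_lt.1 h1).2
    linarith
  -- The density `cycleYDeriv` is singular at |z| = 2q³. Truncation of the square root from below
  -- gives a density continuous on the whole line that agrees with it for |z| ≤ R₁.
  set d : ℝ → ℝ := fun z => 4 / 3 * q⁻¹ * Real.sin (cubicAngle (z / q ^ 3)) *
    (√(max (4 - (z / q ^ 3) ^ 2) c))⁻¹ with hd
  have hdc : Continuous d := by
    have := continuous_cubicAngle
    have h1 : Continuous fun z : ℝ => (√(max (4 - (z / q ^ 3) ^ 2) c))⁻¹ := by
      refine Continuous.inv₀ (by fun_prop) fun z => ?_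
      exact (Real.sqrt_pos.2 (hc.trans_le (le_max_right _ _))).ne'
    fun_prop
  have hdeq : ∀ z, |z| ≤ R₁ → d z = cycleYDeriv q z := by
    intro z hz
    simp only [hd, cycleYDeriv]
    rw [max_eq_left]
    have : (z / q ^ 3) ^ 2 ≤ (R₁ / q ^ 3) ^ 2 := by
      rw [div_pow, div_pow]
      have := sq_le_sq' (abs_le.1 hz).1 (abs_le.1 hz).2
      gcongr
    linarith
  have hY := continuous_cycleY q
  set F : ℝ × ℝ → ℝ := fun p => f (3 * q ^ 4, p.1, cycleY q p.2) * d p.2 with hF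
  have hFc : Continuous F := by fun_prop
  have key := integral_circle_eq_zero hFc (R₁ := R₁) (fun R' hR' => ?_) ⟨hR.1, hRR₁⟩
  · rw [← key]
    refine intervalIntegral.integral_congr fun θ _ => ?_
    simp only [hF]
    rw [hdeq _ (abs_mul_sin_lt ⟨hR.1, hRR₁⟩ θ).le]
  · have hR'' : R' ∈ Ioo 0 (2 * q ^ 3) := ⟨hR'.1, hR'.2.trans hR₁⟩
    have hz : ∀ p ∈ {p : ℝ × ℝ | p.1 ^ 2 + p.2 ^ 2 ≤ R' ^ 2}, |p.2| ≤ R' := fun p hp =>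
      abs_le_of_sq_le_sq (by
        have hp' : p.1 ^ 2 + p.2 ^ 2 ≤ R' ^ 2 := hp
        nlinarith [sq_nonneg p.1]) hR'.1.le
    have h1 := h R' hR''
    rw [vanishingDisc_eq_image hq hR'', integral_image_eq_integral_abs_det_fderiv_smul volume
      (f' := fun p => (ContinuousLinearMap.id ℝ ℝ).prodMap
        (ContinuousLinearMap.toSpanSingleton ℝ (cycleYDeriv q p.2)))
      (isClosed_le (by fun_prop) continuous_const).measurableSet] at h1
    · rw [← h1]
      refine setIntegral_congr_fun
        (isClosed_le (by fun_prop) continuous_const).measurableSet fun p hp => ?_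
      have hp2 := hz p hp
      have hdet : (((ContinuousLinearMap.id ℝ ℝ).prodMap
        (ContinuousLinearMap.toSpanSingleton ℝ (cycleYDeriv q p.2)) : ℝ × ℝ →L[ℝ] ℝ × ℝ)).det =
          cycleYDeriv q p.2 := by
        have e : (((ContinuousLinearMap.id ℝ ℝ).prodMap (ContinuousLinearMap.toSpanSingleton ℝ
            (cycleYDeriv q p.2)) : ℝ × ℝ →L[ℝ] ℝ × ℝ) : ℝ × ℝ →ₗ[ℝ] ℝ × ℝ) =
            LinearMap.prodMap LinearMap.id (cycleYDeriv q p.2 • LinearMap.id) := by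
          ext <;> simp
        rw [ContinuousLinearMap.det, e, LinearMap.det_prodMap, LinearMap.det_id, one_mul,
          LinearMap.det_smul]
        simp
      simp only [hF, hdet, Prod.map, id, smul_eq_mul]
      rw [abs_of_pos (cycleYDeriv_pos hq (hp2.trans_lt hR''.2)), hdeq _ (hp2.trans hR'.2.le),
        mul_comm]
    · intro p hp
      exact (HasFDerivAt.prodMap p (hasFDerivAt_id p.1)
        (hasDerivAt_cycleY hq ((hz p hp).trans_lt hR''.2)).hasFDerivAt).hasFDerivWithinAt
    · rintro ⟨x, z⟩ hp ⟨x', z'⟩ hp' he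
      simp only [Prod.map, id, Prod.mk.injEq] at he
      rw [Prod.mk.injEq]
      exact ⟨he.1, (strictMonoOn_cycleY hq).injOn ((hz _ hp).trans_lt hR''.2)
        ((hz _ hp').trans_lt hR''.2) he.2⟩

/-- The Hamiltonian derivative `2 * x * ∂a/∂y - ∂H/∂y * ∂a/∂x`. -/
noncomputable def cuspBracket (a : ℝ × ℝ × ℝ → ℝ) (p : ℝ × ℝ × ℝ) : ℝ :=
  2 * p.2.1 * dirDeriv (0, 0, 1) a p - (p.1 - 3 * p.2.2 ^ 2) * dirDeriv (0, 1, 0) a p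

theorem contDiff_cuspBracket {a : ℝ × ℝ × ℝ → ℝ} (ha : ContDiff ℝ ∞ a) :
    ContDiff ℝ ∞ (cuspBracket a) := by
  have h1 := ha.dirDeriv (0, 0, 1)
  have h2 := ha.dirDeriv (0, 1, 0)
  unfold cuspBracket
  fun_prop

theorem hasDerivAt_circle_curve {q : ℝ} (hq : 0 < q) {R : ℝ} (hR : R ∈ Ioo 0 (2 * q ^ 3))
    (θ : ℝ) :
    HasDerivAt (fun θ => ((3 * q ^ 4, R * Real.cos θ, cycleY q (R * Real.sin θ)) : ℝ × ℝ × ℝ))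
      (0, -(R * Real.sin θ), cycleYDeriv q (R * Real.sin θ) * (R * Real.cos θ)) θ := by
  have h1 : HasDerivAt (fun θ => R * Real.cos θ) (-(R * Real.sin θ)) θ :=
    ((Real.hasDerivAt_cos θ).const_mul R).congr_deriv (by ring)
  have h2 : HasDerivAt (fun θ => cycleY q (R * Real.sin θ))
      (cycleYDeriv q (R * Real.sin θ) * (R * Real.cos θ)) θ :=
    HasDerivAt.comp (h₂ := cycleY q) θ (hasDerivAt_cycleY hq (abs_mul_sin_lt hR θ)) ((Real.hasDerivAt_sin θ).const_mul R)
  exact (hasDerivAt_const θ _).prodMk (h1.prodMk h2)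

/-- The curve is an orbit of the Hamiltonian field, run with time element ½ Y' dθ; the relation 2z =
(lam - 3Y²) Y' makes the x-component agree. Consequently Hamiltonian derivatives have zero mean over
the cycles. -/
theorem hasDerivAt_comp_circle_curve {a : ℝ × ℝ × ℝ → ℝ} (ha : ContDiff ℝ ∞ a) {q : ℝ}
    (hq : 0 < q) {R : ℝ} (hR : R ∈ Ioo 0 (2 * q ^ 3)) (θ : ℝ) :
    HasDerivAt (fun θ => a (3 * q ^ 4, R * Real.cos θ, cycleY q (R * Real.sin θ)))
      (1 / 2 * (cuspBracket a (3 * q ^ 4, R * Real.cos θ, cycleY q (R * Real.sin θ)) *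
        cycleYDeriv q (R * Real.sin θ))) θ := by
  refine (ha.hasDerivAt_comp_infty (hasDerivAt_circle_curve hq hR θ)).congr_deriv ?_
  set p : ℝ × ℝ × ℝ := (3 * q ^ 4, R * Real.cos θ, cycleY q (R * Real.sin θ)) with hp
  have h1 := two_mul_eq_cycleYDeriv hq (abs_mul_sin_lt hR θ)
  set Z := cycleYDeriv q (R * Real.sin θ)
  have e : ((0, -(R * Real.sin θ), Z * (R * Real.cos θ)) : ℝ × ℝ × ℝ) =
      (-(R * Real.sin θ)) • ((0, 1, 0) : ℝ × ℝ × ℝ) +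
        (Z * (R * Real.cos θ)) • ((0, 0, 1) : ℝ × ℝ × ℝ) := by simp
  simp only [cuspBracket, dirDeriv]
  rw [e, map_add, map_smul, map_smul, smul_eq_mul, smul_eq_mul]
  have e2 : p.1 - 3 * p.2.2 ^ 2 = 3 * q ^ 4 - 3 * cycleY q (R * Real.sin θ) ^ 2 := rfl
  have e3 : p.2.1 = R * Real.cos θ := rfl
  rw [e2, e3]
  linear_combination (-(1 / 2) * (fderiv ℝ a p) (0, 1, 0)) * h1

theorem continuous_cycleYDeriv_mul_sin {q : ℝ} (hq : 0 < q) {R : ℝ}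
    (hR : R ∈ Ioo 0 (2 * q ^ 3)) : Continuous fun θ => cycleYDeriv q (R * Real.sin θ) := by
  have := continuous_cubicAngle
  unfold cycleYDeriv
  have h1 : Continuous fun θ : ℝ => (√(4 - (R * Real.sin θ / q ^ 3) ^ 2))⁻¹ := by
    refine Continuous.inv₀ (by fun_prop) fun θ => (Real.sqrt_pos.2 ?_).ne'
    have h1 := abs_div_pow_lt hq (abs_mul_sin_lt hR θ)
    have := sq_lt_sq' (abs_lt.1 h1).1 (abs_lt.1 h1).2
    linarith
  fun_prop

theorem intervalIntegrable_circle {f : ℝ × ℝ × ℝ → ℝ} (hf : Continuous f) {q : ℝ} (hq : 0 < q)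
    {R : ℝ} (hR : R ∈ Ioo 0 (2 * q ^ 3)) (a b : ℝ) :
    IntervalIntegrable (fun θ => f (3 * q ^ 4, R * Real.cos θ, cycleY q (R * Real.sin θ)) *
      cycleYDeriv q (R * Real.sin θ)) volume a b := by
  have h1 := continuous_cycleYDeriv_mul_sin hq hR
  have h2 := continuous_cycleY q
  exact Continuous.intervalIntegrable (by fun_prop) _ _

theorem circleMean_cuspBracket {a : ℝ × ℝ × ℝ → ℝ} (ha : ContDiff ℝ ∞ a) {q : ℝ}
    (hq : 0 < q) {R : ℝ} (hR : R ∈ Ioo 0 (2 * q ^ 3)) : circleMean (cuspBracket a) q R = 0 := by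
  have h := intervalIntegral.integral_eq_sub_of_hasDerivAt
    (fun θ _ => hasDerivAt_comp_circle_curve ha hq hR θ)
    ((intervalIntegrable_circle (contDiff_cuspBracket ha).continuous hq hR 0
      (2 * Real.pi)).const_mul _)
  rw [intervalIntegral.integral_const_mul] at h
  simp only [Real.cos_two_pi, Real.sin_two_pi, Real.cos_zero, Real.sin_zero, sub_self] at h
  unfold circleMean
  linarith

theorem circleMean_add {f g : ℝ × ℝ × ℝ → ℝ} (hf : Continuous f) (hg : Continuous g) {q : ℝ}
    (hq : 0 < q) {R : ℝ} (hR : R ∈ Ioo 0 (2 * q ^ 3)) :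
    circleMean (fun p => f p + g p) q R = circleMean f q R + circleMean g q R := by
  unfold circleMean
  rw [← intervalIntegral.integral_add (intervalIntegrable_circle hf hq hR _ _)
    (intervalIntegrable_circle hg hq hR _ _)]
  simp only [add_mul]

/-! ### Flatness of the obstruction at the node -/

theorem exists_eq_mul_of_eq_zero {E : ℝ → ℝ} (hE : ContDiff ℝ ∞ E) (h0 : E 0 = 0) :
    ∃ E' : ℝ → ℝ, ContDiff ℝ ∞ E' ∧ ∀ δ, E δ = δ * E' δ := by
  let F : ℝ × ℝ → ℝ := fun q => E q.2
  have hF : ContDiff ℝ ∞ F := hE.comp contDiff_snd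
  refine ⟨fun δ => hadamardQuot F (0, δ), hF.hadamardQuot.comp (by fun_prop), fun δ => ?_⟩
  have := eq_add_mul_hadamardQuot hF 0 δ
  simpa [F, h0] using this

/-- Two scales of growth separate the two coefficients. After division by the common power of ε,
boundedness of the other terms and divergence of `M₁` force the leading coefficient of `E` to
vanish. Then E = δE₂ contributes only ε M₁ → 0, and the lower bound on `M₂` forces that of `G` to
vanish too. The level below the saddle is δ = -ε. -/
theorem flat_of_unbounded_mean {E G M₁ M₂ Mr : ℝ → ℝ} (hE : ContDiff ℝ ∞ E)
    (hG : ContDiff ℝ ∞ G) (hM₁ : Tendsto M₁ (𝓝[>] 0) atTop)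
    (hM₁' : Tendsto (fun ε => ε * M₁ ε) (𝓝[>] 0) (𝓝 0)) {c C : ℝ} (hc : 0 < c)
    (hM₂ : ∀ᶠ ε in 𝓝[>] 0, c ≤ M₂ ε ∧ M₂ ε ≤ C)
    (hr : ∀ n : ℕ, ∃ B, ∀ᶠ ε in 𝓝[>] 0, |Mr ε| ≤ ε ^ n * (B * M₁ ε))
    (h : ∀ᶠ ε in 𝓝[>] 0, E (-ε) * M₁ ε - G (-ε) * M₂ ε + Mr ε = 0) (n : ℕ) :
    ∃ E' G' : ℝ → ℝ, ContDiff ℝ ∞ E' ∧ ContDiff ℝ ∞ G' ∧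
      ∀ δ, E δ = δ ^ n * E' δ ∧ G δ = δ ^ n * G' δ := by
  induction n with
  | zero => exact ⟨E, G, hE, hG, fun δ => by simp⟩
  | succ n ih =>
    obtain ⟨E₁, G₁, hE₁, hG₁, e⟩ := ih
    obtain ⟨B, hB⟩ := hr (n + 1)
    have hpos : ∀ᶠ ε : ℝ in 𝓝[>] 0, 0 < ε := self_mem_nhdsWithin
    set r : ℝ → ℝ := fun ε => Mr ε / (-ε) ^ n with hrdef
    have hr0 : Tendsto r (𝓝[>] 0) (𝓝 0) := by
      have h1 : Tendsto (fun ε => B * (ε * M₁ ε)) (𝓝[>] 0) (𝓝 0) := by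
        simpa using hM₁'.const_mul B
      refine squeeze_zero_norm' ?_ h1
      filter_upwards [hB, hpos] with ε h2 h3
      rw [Real.norm_eq_abs, abs_div, abs_pow, abs_neg, abs_of_pos h3, div_le_iff₀ (pow_pos h3 n)]
      refine h2.trans (le_of_eq ?_)
      ring
    have heq : ∀ᶠ ε in 𝓝[>] 0, E₁ (-ε) * M₁ ε - G₁ (-ε) * M₂ ε + r ε = 0 := by
      filter_upwards [h, hpos] with ε h2 h3
      rw [(e (-ε)).1, (e (-ε)).2] at h2
      have h4 : (-ε) ^ n ≠ 0 := pow_ne_zero _ (by linarith)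
      simp only [hrdef]
      field_simp
      linarith
    have hcomp : ∀ {F : ℝ → ℝ}, ContDiff ℝ ∞ F →
        Tendsto (fun ε => F (-ε)) (𝓝[>] 0) (𝓝 (F 0)) := by
      intro F hF
      have h1 : Continuous fun ε => F (-ε) := hF.continuous.comp continuous_neg
      have h2 := h1.tendsto 0
      rw [neg_zero] at h2
      exact h2.mono_left nhdsWithin_le_nhds
    have hGM : IsBoundedUnder (· ≤ ·) (𝓝[>] 0) (norm ∘ fun ε => r ε - G₁ (-ε) * M₂ ε) := by
      have hb1 := (hcomp hG₁).norm.isBoundedUnder_le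
      have hb2 := hr0.norm.isBoundedUnder_le
      obtain ⟨b1, hb1⟩ := hb1
      obtain ⟨b2, hb2⟩ := hb2
      rw [eventually_map] at hb1 hb2
      refine ⟨b2 + b1 * C, ?_⟩
      rw [eventually_map]
      filter_upwards [hb1, hb2, hM₂] with ε h1 h2 h3
      simp only [Function.comp]
      refine (norm_sub_le _ _).trans (add_le_add h2 ?_)
      rw [norm_mul]
      refine mul_le_mul h1 ?_ (norm_nonneg _) ((norm_nonneg _).trans h1)
      rw [Real.norm_eq_abs, abs_of_nonneg (hc.le.trans h3.1)]
      exact h3.2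
    have hE0 : E₁ 0 = 0 := by
      have h1 : Tendsto (fun ε => (r ε - G₁ (-ε) * M₂ ε) * (M₁ ε)⁻¹) (𝓝[>] 0) (𝓝 0) :=
        hM₁.inv_tendsto_atTop.zero_mul_isBoundedUnder_le hGM |>.congr fun ε => mul_comm _ _
      have h2 : Tendsto (fun ε => E₁ (-ε)) (𝓝[>] 0) (𝓝 (-0)) := by
        refine h1.neg.congr' ?_
        filter_upwards [heq, hM₁.eventually_gt_atTop 0] with ε h3 h4
        field_simp
        linarith
      rw [neg_zero] at h2
      exact tendsto_nhds_unique (hcomp hE₁) h2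
    obtain ⟨E₂, hE₂, e2⟩ := exists_eq_mul_of_eq_zero hE₁ hE0
    have hG0 : G₁ 0 = 0 := by
      have h1 : Tendsto (fun ε => r ε - E₂ (-ε) * (ε * M₁ ε)) (𝓝[>] 0) (𝓝 0) := by
        simpa using hr0.sub ((hcomp hE₂).mul hM₁')
      have h2 : Tendsto (fun ε => G₁ (-ε)) (𝓝[>] 0) (𝓝 0) := by
        refine squeeze_zero_norm' (a := fun ε => c⁻¹ * ‖r ε - E₂ (-ε) * (ε * M₁ ε)‖) ?_
          (by simpa using h1.norm.const_mul c⁻¹)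
        filter_upwards [heq, hM₂] with ε h3 h4
        have h5 : r ε - E₂ (-ε) * (ε * M₁ ε) = G₁ (-ε) * M₂ ε := by
          rw [e2] at h3
          linarith
        have h6 : 0 < M₂ ε := hc.trans_le h4.1
        rw [h5, norm_mul, Real.norm_eq_abs (M₂ ε), abs_of_pos h6, ← mul_assoc, mul_comm c⁻¹,
          mul_assoc, inv_mul_eq_div]
        refine le_mul_of_one_le_right (norm_nonneg _) ?_
        rw [one_le_div hc]
        exact h4.1
      exact tendsto_nhds_unique (hcomp hG₁) h2
    obtain ⟨G₂, hG₂, e3⟩ := exists_eq_mul_of_eq_zero hG₁ hG0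
    refine ⟨E₂, G₂, hE₂, hG₂, fun δ => ⟨?_, ?_⟩⟩
    · rw [(e δ).1, e2, pow_succ, mul_assoc]
    · rw [(e δ).2, e3, pow_succ, mul_assoc]

/-- The radius of the circle of points with `H = 2 * q ^ 6 - ε`. -/
noncomputable def nearNodeRadius (q ε : ℝ) : ℝ := √(4 * q ^ 6 - ε)

section

variable {q ε : ℝ}

theorem nearNodeRadius_sq (hε : ε ∈ Ioo 0 (4 * q ^ 6)) :
    nearNodeRadius q ε ^ 2 = 4 * q ^ 6 - ε :=
  Real.sq_sqrt (by linarith [hε.2])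

theorem nearNodeRadius_mem (hq : 0 < q) (hε : ε ∈ Ioo 0 (4 * q ^ 6)) :
    nearNodeRadius q ε ∈ Ioo 0 (2 * q ^ 3) := by
  refine ⟨Real.sqrt_pos.2 (by linarith [hε.2]), ?_⟩
  rw [nearNodeRadius, Real.sqrt_lt' (by positivity)]
  have := hε.1
  nlinarith

/-- At the saddle value the cubic has the double root y = q² and the simple root y = -2q². -/
theorem cycleY_factor (hq : 0 < q) (hε : ε ∈ Ioo 0 (4 * q ^ 6)) (θ : ℝ) :
    (q ^ 2 - cycleY q (nearNodeRadius q ε * Real.sin θ)) ^ 2 *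
      (cycleY q (nearNodeRadius q ε * Real.sin θ) + 2 * q ^ 2) =
        ε + nearNodeRadius q ε ^ 2 * Real.cos θ ^ 2 := by
  have h := cycleY_cubic hq (abs_mul_sin_lt (nearNodeRadius_mem hq hε) θ).le
  have h1 := nearNodeRadius_sq hε
  rw [Real.cos_sq']
  linear_combination h - h1

/-- By `cycleY_factor`, q² - Y is at least √ε / (2q), since Y + 2q² ≤ 4q². -/
theorem cycleYDeriv_le (hq : 0 < q) (hε : ε ∈ Ioo 0 (4 * q ^ 6)) (θ : ℝ) :
    cycleYDeriv q (nearNodeRadius q ε * Real.sin θ) ≤ 8 / 3 * q ^ 2 / √ε := by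
  have hz := abs_mul_sin_lt (nearNodeRadius_mem hq hε) θ
  have h1 := cycleY_factor hq hε θ
  have h2 := sub_mul_cycleYDeriv hq hz
  have h3 := sin_half_cubicAngle_mem (abs_div_pow_lt hq hz)
  have h4 := cycleY_lt hq hz
  have h6 := cycleYDeriv_pos hq hz
  set Y := cycleY q (nearNodeRadius q ε * Real.sin θ)
  set D := cycleYDeriv q (nearNodeRadius q ε * Real.sin θ)
  have hsε : 0 < √ε := Real.sqrt_pos.2 hε.1
  have h5 : √ε / (2 * q) ≤ q ^ 2 - Y := by
    rw [div_le_iff₀ (by positivity)]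
    refine Real.sqrt_le_iff.2 ⟨mul_nonneg (by linarith) (by positivity), ?_⟩
    have h7 : 0 ≤ nearNodeRadius q ε ^ 2 * Real.cos θ ^ 2 := by positivity
    have h8 : (q ^ 2 - Y) ^ 2 * (Y + 2 * q ^ 2) ≤ (q ^ 2 - Y) ^ 2 * (4 * q ^ 2) := by
      refine mul_le_mul_of_nonneg_left ?_ (sq_nonneg _)
      nlinarith [sq_nonneg q]
    nlinarith
  rw [le_div_iff₀ hsε]
  have h7 : √ε / (2 * q) * D ≤ 4 / 3 * q := by
    calc √ε / (2 * q) * D ≤ (q ^ 2 - Y) * D := mul_le_mul_of_nonneg_right h5 h6.le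
      _ = _ := h2
      _ ≤ 4 / 3 * q * 1 := mul_le_mul_of_nonneg_left h3.2 (by positivity)
      _ = _ := mul_one _
  rw [div_mul_eq_mul_div, div_le_iff₀ (by positivity)] at h7
  linarith

theorem cycleY_zero (q : ℝ) : cycleY q 0 = -q ^ 2 := by
  have : cubicAngle (0 / q ^ 3) = Real.pi - Real.pi / 3 := by
    simp [cubicAngle]; ring
  rw [cycleY, this, Real.cos_pi_sub, Real.cos_pi_div_three]
  ring

/-- Near the top of the circle, cos θ = sin u ≤ u and ε ≤ u², so `cycleY_factor` bounds q² - Y by a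
multiple of u. The factor Y + 2q² is at least q² since Y ≥ -q² on the upper half. -/
theorem le_cycleYDeriv (hq : 0 < q) (hε : ε ∈ Ioo 0 (4 * q ^ 6)) {u : ℝ} (hu : √ε ≤ u)
    (hu1 : u ≤ 1) :
    2 / 3 * q ^ 2 / (1 + 2 * q ^ 3) * u⁻¹ ≤
      cycleYDeriv q (nearNodeRadius q ε * Real.sin (Real.pi / 2 - u)) := by
  have hR := nearNodeRadius_mem hq hε
  have hz := abs_mul_sin_lt hR (Real.pi / 2 - u)
  have h1 := cycleY_factor hq hε (Real.pi / 2 - u)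
  have h2 := sub_mul_cycleYDeriv hq hz
  have h3 := sin_half_cubicAngle_mem (abs_div_pow_lt hq hz)
  have h4 := cycleY_lt hq hz
  have h6 := cycleYDeriv_pos hq hz
  have hsε : 0 < √ε := Real.sqrt_pos.2 hε.1
  have hu0 : 0 < u := hsε.trans_le hu
  have hY : -q ^ 2 ≤ cycleY q (nearNodeRadius q ε * Real.sin (Real.pi / 2 - u)) := by
    rw [← cycleY_zero]
    refine (strictMonoOn_cycleY hq).monotoneOn ?_ hz ?_
    · change |(0 : ℝ)| < _
      rw [abs_zero]; positivity
    · refine mul_nonneg hR.1.le ?_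
      rw [Real.sin_pi_div_two_sub]
      exact (Real.cos_pos_of_mem_Ioo ⟨by linarith [Real.pi_pos],
        by linarith [Real.pi_gt_three]⟩).le
  rw [Real.cos_pi_div_two_sub] at h1
  set Y := cycleY q (nearNodeRadius q ε * Real.sin (Real.pi / 2 - u))
  set D := cycleYDeriv q (nearNodeRadius q ε * Real.sin (Real.pi / 2 - u))
  have hεu : ε ≤ u ^ 2 := by
    rw [← Real.sq_sqrt hε.1.le]
    gcongr
  have hsin : Real.sin u ^ 2 ≤ u ^ 2 := by
    have := Real.abs_sin_le_abs (x := u)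
    exact sq_le_sq.2 this
  have hR2 : nearNodeRadius q ε ^ 2 ≤ 4 * q ^ 6 := by rw [nearNodeRadius_sq hε]; linarith [hε.1]
  have h5 : (q ^ 2 - Y) * q ≤ (1 + 2 * q ^ 3) * u := by
    refine abs_le_of_sq_le_sq' ?_ (by positivity) |>.2
    have h7 : ((q ^ 2 - Y) * q) ^ 2 ≤ (q ^ 2 - Y) ^ 2 * (Y + 2 * q ^ 2) := by
      rw [mul_pow]
      exact mul_le_mul_of_nonneg_left (by linarith) (sq_nonneg _)
    rw [h1] at h7
    have h8 : nearNodeRadius q ε ^ 2 * Real.sin u ^ 2 ≤ 4 * q ^ 6 * u ^ 2 :=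
      mul_le_mul hR2 hsin (sq_nonneg _) (by positivity)
    have h9 : 0 ≤ q ^ 3 * u ^ 2 := by positivity
    nlinarith
  have h7 : 2 / 3 * q ≤ (q ^ 2 - Y) * D := by
    rw [h2]; nlinarith [h3.1]
  rw [div_mul_eq_mul_div, div_le_iff₀ (by positivity), mul_inv_le_iff₀ hu0]
  nlinarith [mul_le_mul_of_nonneg_right h5 h6.le]

/-- Logarithmic divergence of the period at a hyperbolic saddle: the lower bound c / u is integrated
over √ε ≤ u ≤ 1. -/
theorem tendsto_circleMean_one (hq : 0 < q) :
    Tendsto (fun ε => circleMean (fun _ => 1) q (nearNodeRadius q ε)) (𝓝[>] 0) atTop := by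
  set c := 2 / 3 * q ^ 2 / (1 + 2 * q ^ 3) with hc
  have hc0 : 0 < c := by positivity
  have h1 : Tendsto (fun ε => c * (-(1 / 2) * Real.log ε)) (𝓝[>] 0) atTop :=
    ((Real.tendsto_log_nhdsGT_zero.const_mul_atBot_of_neg (by norm_num))).const_mul_atTop hc0
  refine tendsto_atTop_mono' _ ?_ h1
  filter_upwards [Ioo_mem_nhdsGT (show (0 : ℝ) < min 1 (4 * q ^ 6) by positivity)]
    with ε hε'
  have hε : ε ∈ Ioo 0 (4 * q ^ 6) := ⟨hε'.1, hε'.2.trans_le (min_le_right _ _)⟩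
  have hε1 : ε < 1 := hε'.2.trans_le (min_le_left _ _)
  have hsε : 0 < √ε := Real.sqrt_pos.2 hε.1
  have hsε1 : √ε ≤ 1 := Real.sqrt_le_one.2 hε1.le
  have hR := nearNodeRadius_mem hq hε
  have hcont := continuous_cycleYDeriv_mul_sin hq hR
  have hpi := Real.pi_gt_three
  have e1 : c * (-(1 / 2) * Real.log ε) = ∫ u in √ε..1, c * u⁻¹ := by
    rw [intervalIntegral.integral_const_mul, integral_inv_of_pos hsε one_pos,
      Real.log_div one_ne_zero hsε.ne', Real.log_one, Real.log_sqrt hε.1.le]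
    ring
  rw [e1]
  calc ∫ u in √ε..1, c * u⁻¹ ≤
        ∫ u in √ε..1, cycleYDeriv q (nearNodeRadius q ε * Real.sin (Real.pi / 2 - u)) := by
        refine intervalIntegral.integral_mono_on hsε1 ?_ ?_ fun u hu =>
          le_cycleYDeriv hq hε hu.1 hu.2
        · refine (ContinuousOn.intervalIntegrable fun u hu => ?_)
          rw [uIcc_of_le hsε1] at hu
          exact (continuousAt_const.mul
            (continuousAt_inv₀ (hsε.trans_le hu.1).ne')).continuousWithinAt
        · exact (hcont.comp (by fun_prop : Continuous fun u : ℝ =>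
            Real.pi / 2 - u)).intervalIntegrable _ _
    _ = ∫ θ in (Real.pi / 2 - 1)..(Real.pi / 2 - √ε),
          cycleYDeriv q (nearNodeRadius q ε * Real.sin θ) :=
        intervalIntegral.integral_comp_sub_left
          (fun θ => cycleYDeriv q (nearNodeRadius q ε * Real.sin θ)) _
    _ ≤ ∫ θ in (0 : ℝ)..2 * Real.pi, cycleYDeriv q (nearNodeRadius q ε * Real.sin θ) := by
        refine intervalIntegral.integral_mono_interval (by linarith) (by linarith) (by linarith)
          ?_ (hcont.intervalIntegrable _ _)
        exact Eventually.of_forall fun θ => (cycleYDeriv_pos hq (abs_mul_sin_lt hR θ)).le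
    _ = _ := by simp [circleMean]

theorem circleMean_one_nonneg (hq : 0 < q) {R : ℝ} (hR : R ∈ Ioo 0 (2 * q ^ 3)) :
    0 ≤ circleMean (fun _ => 1) q R := by
  unfold circleMean
  refine intervalIntegral.integral_nonneg (by positivity) fun θ _ => ?_
  simpa using (cycleYDeriv_pos hq (abs_mul_sin_lt hR θ)).le

/-- The crude bound of order 1 / √ε for the period is sufficient here. -/
theorem tendsto_mul_circleMean_one (hq : 0 < q) :
    Tendsto (fun ε => ε * circleMean (fun _ => 1) q (nearNodeRadius q ε)) (𝓝[>] 0) (𝓝 0) := by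
  have h1 : Tendsto (fun ε => 2 * Real.pi * (8 / 3 * q ^ 2) * √ε) (𝓝[>] 0) (𝓝 0) := by
    have : Continuous fun ε => 2 * Real.pi * (8 / 3 * q ^ 2) * √ε := by fun_prop
    have h2 := this.tendsto 0
    rw [Real.sqrt_zero, mul_zero] at h2
    exact h2.mono_left nhdsWithin_le_nhds
  refine squeeze_zero_norm' ?_ h1
  filter_upwards [Ioo_mem_nhdsGT (show (0 : ℝ) < 4 * q ^ 6 by positivity)] with ε hε
  have hR := nearNodeRadius_mem hq hε
  have hsε : 0 < √ε := Real.sqrt_pos.2 hε.1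
  have h2 : circleMean (fun _ => 1) q (nearNodeRadius q ε) ≤
      2 * Real.pi * (8 / 3 * q ^ 2 / √ε) := by
    have := intervalIntegral.integral_mono_on (a := 0) (b := 2 * Real.pi) (by positivity)
      ((continuous_cycleYDeriv_mul_sin hq hR).intervalIntegrable (μ := volume) _ _)
      (continuous_const.intervalIntegrable _ _) fun θ _ => cycleYDeriv_le hq hε θ
    rw [intervalIntegral.integral_const, sub_zero, smul_eq_mul] at this
    simpa only [circleMean, one_mul] using this
  rw [Real.norm_eq_abs, abs_of_nonneg (mul_nonneg hε.1.le (circleMean_one_nonneg hq hR))]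
  calc _ ≤ ε * (2 * Real.pi * (8 / 3 * q ^ 2 / √ε)) := mul_le_mul_of_nonneg_left h2 hε.1.le
    _ = (√ε * √ε) * (2 * Real.pi * (8 / 3 * q ^ 2 / √ε)) := by rw [Real.mul_self_sqrt hε.1.le]
    _ = _ := by field_simp

theorem circleMean_sub_mem (hq : 0 < q) {R : ℝ} (hR : R ∈ Ioo 0 (2 * q ^ 3)) :
    2 * Real.pi * (2 / 3 * q) ≤ circleMean (fun p => q ^ 2 - p.2.2) q R ∧
      circleMean (fun p => q ^ 2 - p.2.2) q R ≤ 2 * Real.pi * (4 / 3 * q) := by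
  have hint := intervalIntegrable_circle (f := fun p => q ^ 2 - p.2.2) (by fun_prop) hq hR 0
    (2 * Real.pi)
  have hval := fun θ => sub_mul_cycleYDeriv hq (abs_mul_sin_lt hR θ)
  have hmem := fun θ => sin_half_cubicAngle_mem (abs_div_pow_lt hq (abs_mul_sin_lt hR θ))
  constructor
  · have := intervalIntegral.integral_mono_on (a := 0) (b := 2 * Real.pi)
      (f := fun _ => 2 / 3 * q) (by positivity) (intervalIntegrable_const) hint fun θ _ => by
        simp only [hval]; nlinarith [(hmem θ).1]
    rw [intervalIntegral.integral_const, sub_zero, smul_eq_mul] at this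
    exact this
  · have := intervalIntegral.integral_mono_on (a := 0) (b := 2 * Real.pi)
      (g := fun _ => 4 / 3 * q) (by positivity) hint (intervalIntegrable_const) fun θ _ => by
        simp only [hval]; nlinarith [(hmem θ).2]
    rw [intervalIntegral.integral_const, sub_zero, smul_eq_mul] at this
    exact this

end

theorem circleMean_const_mul (c : ℝ) (f : ℝ × ℝ × ℝ → ℝ) (q R : ℝ) :
    circleMean (fun p => c * f p) q R = c * circleMean f q R := by
  unfold circleMean
  rw [← intervalIntegral.integral_const_mul]
  simp only [mul_assoc]

theorem circleMean_congr {f g : ℝ × ℝ × ℝ → ℝ} {q : ℝ} (hq : 0 < q) {R : ℝ}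
    (hR : R ∈ Ioo 0 (2 * q ^ 3)) (h : ∀ x y, y < q ^ 2 → -(2 * q ^ 2) < y →
      cuspH (3 * q ^ 4) (x, y) = R ^ 2 - 2 * q ^ 6 → f (3 * q ^ 4, x, y) = g (3 * q ^ 4, x, y)) :
    circleMean f q R = circleMean g q R := by
  unfold circleMean
  refine intervalIntegral.integral_congr fun θ _ => ?_
  have hz := abs_mul_sin_lt hR θ
  rw [h _ _ (cycleY_lt hq hz) (lt_cycleY hq hz)]
  rw [cuspH_cycleY hq hz.le, mul_pow, mul_pow, ← mul_add, Real.cos_sq_add_sin_sq, mul_one]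

/-! ### Reduction to a flat function on the space of levels -/

/-- The point of the space of levels below a point of the `(lam, x, y)`-space. -/
def levelPoint (p : ℝ × ℝ × ℝ) : ℝ × ℝ × ℝ := (p.1, cuspH p.1 p.2, p.2.2)

theorem contDiff_levelPoint : ContDiff ℝ ∞ levelPoint := by
  unfold levelPoint cuspH
  fun_prop

/-- On a cycle the level is constant, and φ₀ + φ₁ y = E - G (q² - y) with G = φ₁ and E = φ₀ + q² φ₁
depends on y only through q² - y, whose mean stays bounded. The mean of the flat remainder is at
most a multiple of εⁿ times the mean of 1, so E and G are divisible by all powers of δ. -/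
theorem exists_eq_pow_mul_of_circleMean {φ₀ φ₁ : ℝ × ℝ → ℝ} {r : ℝ × ℝ × ℝ → ℝ}
    (hφ₀ : ContDiff ℝ ∞ φ₀) (hφ₁ : ContDiff ℝ ∞ φ₁) (hr : ContDiff ℝ ∞ r)
    (hrem : ∀ n, ∃ R : (ℝ × ℝ) × ℝ → ℝ, ContDiff ℝ ∞ R ∧ ∀ s, 0 ≤ s → ∀ y δ,
      r (3 * s ^ 2, 2 * s ^ 3 + δ, y) = δ ^ n * R ((s, y), δ)) {q : ℝ} (hq : 0 < q)
    (hM : ∀ R ∈ Ioo 0 (2 * q ^ 3), circleMean (fun p => φ₀ (p.1, cuspH p.1 p.2) +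
      φ₁ (p.1, cuspH p.1 p.2) * p.2.2 + r (levelPoint p)) q R = 0) (n : ℕ) (y : ℝ) :
    ∃ T : ℝ → ℝ, ContDiff ℝ ∞ T ∧ ∀ δ, φ₀ (3 * q ^ 4, 2 * q ^ 6 + δ) +
      φ₁ (3 * q ^ 4, 2 * q ^ 6 + δ) * y + r (3 * q ^ 4, 2 * q ^ 6 + δ, y) = δ ^ n * T δ := by
  have e4 : 3 * (q ^ 2) ^ 2 = 3 * q ^ 4 := by ring
  have e6 : 2 * (q ^ 2) ^ 3 = 2 * q ^ 6 := by ring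
  let G : ℝ → ℝ := fun δ => φ₁ (3 * q ^ 4, 2 * q ^ 6 + δ)
  let E : ℝ → ℝ := fun δ => φ₀ (3 * q ^ 4, 2 * q ^ 6 + δ) + q ^ 2 * G δ
  have hG : ContDiff ℝ ∞ G := hφ₁.comp (by fun_prop)
  have hE : ContDiff ℝ ∞ E := (hφ₀.comp (by fun_prop)).add (contDiff_const.mul hG)
  have hmem : Ioo 0 (4 * q ^ 6) ∈ 𝓝[>] (0 : ℝ) := Ioo_mem_nhdsGT (by positivity)
  have hrc := hr.continuous
  obtain ⟨E', G', hE', hG', e⟩ := flat_of_unbounded_mean hE hG (tendsto_circleMean_one hq)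
    (tendsto_mul_circleMean_one hq) (by positivity : 0 < 2 * Real.pi * (2 / 3 * q))
    (M₂ := fun ε => circleMean (fun p => q ^ 2 - p.2.2) q (nearNodeRadius q ε))
    (Mr := fun ε => circleMean (fun p => r (3 * q ^ 4, 2 * q ^ 6 + -ε, p.2.2)) q
      (nearNodeRadius q ε)) (C := 2 * Real.pi * (4 / 3 * q)) (by
      filter_upwards [hmem] with ε hε using circleMean_sub_mem hq (nearNodeRadius_mem hq hε))
    (fun n => by
      obtain ⟨R, hR, eR⟩ := hrem n
      obtain ⟨B, hB⟩ := ((isCompact_Icc (a := -(2 * q ^ 2)) (b := q ^ 2)).prod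
        (isCompact_Icc (a := -(4 * q ^ 6)) (b := 0))).exists_bound_of_continuousOn
        (f := fun w : ℝ × ℝ => R ((q ^ 2, w.1), w.2)) (hR.continuous.comp
          (by fun_prop)).continuousOn
      refine ⟨B, ?_⟩
      filter_upwards [hmem] with ε hε
      have hRε := nearNodeRadius_mem hq hε
      rw [← circleMean_const_mul, ← circleMean_const_mul, ← Real.norm_eq_abs]
      refine intervalIntegral.norm_integral_le_of_norm_le (by positivity)
        (Eventually.of_forall fun θ _ => ?_)
        (intervalIntegrable_circle (f := fun _ => ε ^ n * (B * 1)) continuous_const hq hRε _ _)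
      have hz := abs_mul_sin_lt hRε θ
      have hD := (cycleYDeriv_pos hq hz).le
      rw [norm_mul, Real.norm_of_nonneg hD]
      refine mul_le_mul_of_nonneg_right ?_ hD
      simp only
      rw [← e4, ← e6, eR _ (by positivity), norm_mul, norm_pow, norm_neg,
        Real.norm_of_nonneg hε.1.le, mul_one]
      refine mul_le_mul_of_nonneg_left ?_ (pow_nonneg hε.1.le _)
      exact hB (cycleY q (nearNodeRadius q ε * Real.sin θ), -ε)
        ⟨⟨(lt_cycleY hq hz).le, (cycleY_lt hq hz).le⟩, by linarith [hε.2], by linarith [hε.1]⟩)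
    (by
      filter_upwards [hmem] with ε hε
      have hRε := nearNodeRadius_mem hq hε
      rw [← hM _ hRε, sub_eq_add_neg, ← neg_mul, ← circleMean_const_mul, ← circleMean_const_mul,
        ← circleMean_add (by fun_prop) (by fun_prop) hq hRε,
        ← circleMean_add (by fun_prop) (by fun_prop) hq hRε]
      refine circleMean_congr hq hRε fun x y _ _ hH => ?_
      have hH' : cuspH (3 * q ^ 4) (x, y) = 2 * q ^ 6 + -ε := by
        rw [hH, nearNodeRadius_sq hε]; ring
      simp only [levelPoint, hH', E, G]
      ring) n
  obtain ⟨R, hR, eR⟩ := hrem n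
  refine ⟨fun δ => E' δ + G' δ * (y - q ^ 2) + R ((q ^ 2, y), δ), ?_, fun δ => ?_⟩
  · have : ContDiff ℝ ∞ fun δ => R ((q ^ 2, y), δ) := hR.comp (by fun_prop)
    fun_prop
  · have h1 := (e δ).1
    have h2 := (e δ).2
    have h3 := eR (q ^ 2) (by positivity) y δ
    rw [e4, e6] at h3
    simp only [E, G] at h1 h2
    linear_combination h1 + (y - q ^ 2) * h2 + h3

/-- Divisibility by all powers of δ on each line in the h-direction is inherited by the derivatives
in h. The nodes with s > 0 suffice, the origin being a limit of them. -/
theorem flatOn_nodeLocus_of_line {g : ℝ × ℝ × ℝ → ℝ} (hg : ContDiff ℝ ∞ g)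
    (h : ∀ s, 0 < s → ∀ y, ∀ n : ℕ, ∃ T : ℝ → ℝ, ContDiff ℝ ∞ T ∧
      ∀ δ, g (3 * s ^ 2, 2 * s ^ 3 + δ, y) = δ ^ n * T δ) : FlatOn nodeLocus g := by
  refine flatOn_nodeLocus_of_iterate hg fun n => ?_
  have key : ∀ n, ContDiff ℝ ∞ ((dirDeriv ((0, 1, 0) : ℝ × ℝ × ℝ))^[n] g) ∧
      ∀ s, 0 < s → ∀ y, ∀ m : ℕ, ∃ T : ℝ → ℝ, ContDiff ℝ ∞ T ∧ ∀ δ,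
        (dirDeriv ((0, 1, 0) : ℝ × ℝ × ℝ))^[n] g (3 * s ^ 2, 2 * s ^ 3 + δ, y) =
          δ ^ m * T δ := by
    intro n
    induction n with
    | zero => exact ⟨hg, h⟩
    | succ n ih =>
      rw [Function.iterate_succ_apply']
      refine ⟨ih.1.dirDeriv _, fun s hs y m => ?_⟩
      obtain ⟨T, hT, e⟩ := ih.2 s hs y (m + 1)
      have hT' : ContDiff ℝ ∞ (deriv T) := ((contDiff_infty_iff_deriv (𝕜 := ℝ)).1 hT).2
      refine ⟨fun δ => (m + 1) * T δ + δ * deriv T δ, by fun_prop, fun δ => ?_⟩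
      have hc : HasDerivAt (fun δ : ℝ => ((3 * s ^ 2, 2 * s ^ 3 + δ, y) : ℝ × ℝ × ℝ))
          (0, 1, 0) δ := (hasDerivAt_const _ _).prodMk
            (((hasDerivAt_id δ).const_add _).prodMk (hasDerivAt_const _ _))
      have h1 := ih.1.hasDerivAt_comp_infty hc
      simp only [e] at h1
      have h2 := ((hasDerivAt_id δ).pow (m + 1)).mul
        ((hT.differentiable (by simp)) δ).hasDerivAt
      refine (h1.unique h2).trans ?_
      simp
      ring
  rintro ⟨lam, h', y⟩ ⟨s, hs, e1, e2⟩
  simp only at e1 e2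
  subst e1 e2
  have hpos : ∀ s : ℝ, 0 < s →
      (dirDeriv ((0, 1, 0) : ℝ × ℝ × ℝ))^[n] g (3 * s ^ 2, 2 * s ^ 3, y) = 0 := by
    intro s hs
    obtain ⟨T, -, e⟩ := (key n).2 s hs y 1
    simpa using e 0
  have hcl : s ∈ closure (Ioi (0 : ℝ)) := by rw [closure_Ioi]; exact hs
  exact EqOn.closure (fun s hs => hpos s hs)
    ((key n).1.continuous.comp (by fun_prop : Continuous fun s : ℝ =>
      ((3 * s ^ 2, 2 * s ^ 3, y) : ℝ × ℝ × ℝ))) continuous_const hcl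

theorem cuspBracket_eq_of_hasDerivAt {a : ℝ × ℝ × ℝ → ℝ} (ha : ContDiff ℝ ∞ a) {lam x y d : ℝ}
    (h : HasDerivAt (fun t => a (lam, x + t * (3 * y ^ 2 - lam), y + t * (2 * x))) d 0) :
    cuspBracket a (lam, x, y) = d := by
  have hc : HasDerivAt (fun t : ℝ => ((lam, x + t * (3 * y ^ 2 - lam), y + t * (2 * x)) :
      ℝ × ℝ × ℝ)) (0, 3 * y ^ 2 - lam, 2 * x) 0 :=
    (hasDerivAt_const _ _).prodMk ((((hasDerivAt_id (0 : ℝ)).mul_const _).const_add x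
      |>.congr_deriv (one_mul _)).prodMk (((hasDerivAt_id (0 : ℝ)).mul_const _).const_add y
      |>.congr_deriv (one_mul _)))
  have h1 := (ha.hasDerivAt_comp_infty hc).unique h
  simp only [zero_mul, add_zero] at h1
  have e : ((0, 3 * y ^ 2 - lam, 2 * x) : ℝ × ℝ × ℝ) =
      (3 * y ^ 2 - lam) • ((0, 1, 0) : ℝ × ℝ × ℝ) + (2 * x) • ((0, 0, 1) : ℝ × ℝ × ℝ) := by simp
  simp only [dirDeriv] at h1
  rw [← h1, e, map_add, map_smul, map_smul, smul_eq_mul, smul_eq_mul]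
  simp only [cuspBracket, dirDeriv]
  ring

/-- The line is tangent to the Hamiltonian field, so H is stationary on it to first order and only
the y-variable of `b` contributes. -/
theorem hasDerivAt_comp_levelPoint_line {b : ℝ × ℝ × ℝ → ℝ} (hb : ContDiff ℝ ∞ b)
    (lam x y : ℝ) :
    HasDerivAt (fun t => b (levelPoint (lam, x + t * (3 * y ^ 2 - lam), y + t * (2 * x))))
      (2 * x * dirDeriv (0, 0, 1) b (levelPoint (lam, x, y))) 0 := by
  have hx : HasDerivAt (fun t : ℝ => x + t * (3 * y ^ 2 - lam)) (3 * y ^ 2 - lam) 0 :=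
    ((hasDerivAt_id (0 : ℝ)).mul_const _).const_add x |>.congr_deriv (one_mul _)
  have hy : HasDerivAt (fun t : ℝ => y + t * (2 * x)) (2 * x) 0 :=
    ((hasDerivAt_id (0 : ℝ)).mul_const _).const_add y |>.congr_deriv (one_mul _)
  have hH : HasDerivAt (fun t : ℝ => cuspH lam (x + t * (3 * y ^ 2 - lam), y + t * (2 * x)))
      0 0 := by
    refine (((hx.pow 2).sub (hy.pow 3)).add (hy.const_mul lam)).congr_deriv ?_
    norm_num
    ring
  have h1 := hb.hasDerivAt_comp_infty ((hasDerivAt_const (0 : ℝ) lam).prodMk (hH.prodMk hy))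
  simp only [zero_mul, add_zero] at h1
  refine h1.congr_deriv ?_
  have e : ((0, 0, 2 * x) : ℝ × ℝ × ℝ) = (2 * x) • ((0, 0, 1) : ℝ × ℝ × ℝ) := by simp
  simp only [dirDeriv]
  rw [e, map_smul, smul_eq_mul]
  rfl

theorem cuspBracket_comp_levelPoint {b : ℝ × ℝ × ℝ → ℝ} (hb : ContDiff ℝ ∞ b) (lam x y : ℝ) :
    cuspBracket (fun p => b (levelPoint p)) (lam, x, y) =
      2 * x * dirDeriv (0, 0, 1) b (levelPoint (lam, x, y)) :=
  cuspBracket_eq_of_hasDerivAt (hb.comp contDiff_levelPoint)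
    (hasDerivAt_comp_levelPoint_line hb lam x y)

/-- The derivative of x b is 2x² b' + (3y² - lam) b, and on the level x² equals the cubic y³ - lam y
+ h; this is the origin of `levelOp`. -/
theorem cuspBracket_mul_comp_levelPoint {b : ℝ × ℝ × ℝ → ℝ} (hb : ContDiff ℝ ∞ b)
    (lam x y : ℝ) :
    cuspBracket (fun p => p.2.1 * b (levelPoint p)) (lam, x, y) =
      levelOp b (levelPoint (lam, x, y)) := by
  refine cuspBracket_eq_of_hasDerivAt (contDiff_snd.fst.mul (hb.comp contDiff_levelPoint)) ?_
  have hx : HasDerivAt (fun t : ℝ => x + t * (3 * y ^ 2 - lam)) (3 * y ^ 2 - lam) 0 :=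
    ((hasDerivAt_id (0 : ℝ)).mul_const _).const_add x |>.congr_deriv (one_mul _)
  refine (hx.mul (hasDerivAt_comp_levelPoint_line hb lam x y)).congr_deriv ?_
  simp only [levelOp, levelPoint, cuspH, zero_mul, add_zero]
  ring

theorem cuspBracket_add {a b : ℝ × ℝ × ℝ → ℝ} (ha : ContDiff ℝ ∞ a) (hb : ContDiff ℝ ∞ b)
    (p : ℝ × ℝ × ℝ) : cuspBracket (fun p => a p + b p) p = cuspBracket a p + cuspBracket b p := by
  simp only [cuspBracket, dirDeriv]
  rw [fderiv_fun_add (ha.differentiable (by simp) p) (hb.differentiable (by simp) p)]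
  simp only [add_apply]
  ring

/-- The derivative of b(lam, H, y) is 2x b', so b is half the primitive in y of k along the level,
with x² replaced by h + y³ - lam y. No condition on means is needed. -/
theorem exists_cuspBracket_odd {k : ℝ × ℝ × ℝ → ℝ} (hk : ContDiff ℝ ∞ k) :
    ∃ a : ℝ × ℝ × ℝ → ℝ, ContDiff ℝ ∞ a ∧ ∀ lam x y,
      cuspBracket a (lam, x, y) = x * k (lam, x ^ 2, y) := by
  let F : (ℝ × ℝ × ℝ) × ℝ → ℝ := fun w =>
    k (w.1.1, w.1.2.1 + (w.2 * w.1.2.2) ^ 3 - w.1.1 * (w.2 * w.1.2.2), w.2 * w.1.2.2)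
  have hF : ContDiff ℝ ∞ F := hk.comp (by fun_prop)
  let b : ℝ × ℝ × ℝ → ℝ := fun w => 1 / 2 * (w.2.2 * ∫ t in (0 : ℝ)..1, F (w, t))
  have hb : ContDiff ℝ ∞ b := by
    have := contDiff_integral_param 0 1 hF
    fun_prop
  have hbval : ∀ lam h y, b (lam, h, y) = 1 / 2 * ∫ t in (0 : ℝ)..y,
      k (lam, h + t ^ 3 - lam * t, t) := by
    intro lam h y
    have := intervalIntegral.mul_integral_comp_mul_right (a := 0) (b := 1)
      (f := fun t => k (lam, h + t ^ 3 - lam * t, t)) y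
    rw [zero_mul, one_mul] at this
    rw [← this]
  have hbd : ∀ lam h y, dirDeriv (0, 0, 1) b (lam, h, y) =
      1 / 2 * k (lam, h + y ^ 3 - lam * y, y) := by
    intro lam h y
    have hc : Continuous fun t => k (lam, h + t ^ 3 - lam * t, t) :=
      hk.continuous.comp (by fun_prop)
    have h1 := hb.hasDerivAt_last lam h y
    simp only [hbval] at h1
    exact h1.unique ((intervalIntegral.integral_hasDerivAt_right (hc.intervalIntegrable _ _)
      (hc.stronglyMeasurableAtFilter _ _) hc.continuousAt).const_mul _)
  refine ⟨fun p => b (levelPoint p), hb.comp contDiff_levelPoint, fun lam x y => ?_⟩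
  rw [cuspBracket_comp_levelPoint hb]
  simp only [levelPoint, hbd]
  rw [show cuspH lam (x, y) + y ^ 3 - lam * y = x ^ 2 by simp only [cuspH]; ring]
  ring

/-- Up to Hamiltonian derivatives, a function with vanishing means over the vanishing cycles is a
function on the space of levels that is flat at the saddle points. -/
theorem exists_flat_reduction {f : ℝ × ℝ × ℝ → ℝ} (hf : ContDiff ℝ ∞ f) {q₀ : ℝ} (hq₀ : 0 < q₀)
    (hM : ∀ q ∈ Ioo 0 q₀, ∀ R ∈ Ioo 0 (2 * q ^ 3), circleMean f q R = 0) :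
    ∃ a r : ℝ × ℝ × ℝ → ℝ, ContDiff ℝ ∞ a ∧ FlatOn nodeLocus r ∧
      (∀ q, 0 < q → ∀ R ∈ Ioo 0 (2 * q ^ 3), circleMean (fun p => r (levelPoint p)) q R = 0) ∧
      ∃ l > 0, ∀ lam, |lam| < l → ∀ x y,
        f (lam, x, y) = cuspBracket a (lam, x, y) + r (levelPoint (lam, x, y)) := by
  obtain ⟨k₀, k₁, hk₀, hk₁, e⟩ := exists_even_odd_decomposition hf
  obtain ⟨a₁, ha₁, e₁⟩ := exists_cuspBracket_odd hk₁
  -- The even part, rewritten on the space of levels by x² = h + y³ - lam y.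
  let k : ℝ × ℝ × ℝ → ℝ := fun w => k₀ (w.1, w.2.1 + w.2.2 ^ 3 - w.1 * w.2.2, w.2.2)
  have hk : ContDiff ℝ ∞ k := hk₀.comp (by fun_prop)
  obtain ⟨b, φ₀, φ₁, r, hb, hφ₀, hφ₁, hr, e₂, hrem⟩ := exists_level_decomposition hk
  let a₂ : ℝ × ℝ × ℝ → ℝ := fun p => p.2.1 * b (levelPoint p)
  have ha₂ : ContDiff ℝ ∞ a₂ := contDiff_snd.fst.mul (hb.comp contDiff_levelPoint)
  let g : ℝ × ℝ × ℝ → ℝ := fun w => φ₀ (w.1, w.2.1) + φ₁ (w.1, w.2.1) * w.2.2 + r w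
  have hg : ContDiff ℝ ∞ g := by
    have h1 : ContDiff ℝ ∞ fun w : ℝ × ℝ × ℝ => φ₀ (w.1, w.2.1) := hφ₀.comp (by fun_prop)
    have h2 : ContDiff ℝ ∞ fun w : ℝ × ℝ × ℝ => φ₁ (w.1, w.2.1) := hφ₁.comp (by fun_prop)
    fun_prop
  have hfe : ∀ p, f p = cuspBracket (fun p => a₁ p + a₂ p) p + g (levelPoint p) := by
    rintro ⟨lam, x, y⟩
    rw [cuspBracket_add ha₁ ha₂, e₁, cuspBracket_mul_comp_levelPoint hb, e]
    have h1 := e₂ lam (cuspH lam (x, y)) y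
    have h2 : k (lam, cuspH lam (x, y), y) = k₀ (lam, x ^ 2, y) := by
      simp only [k, cuspH]; ring_nf
    rw [h2] at h1
    simp only [levelPoint, g]
    rw [h1]
    ring
  have hgM : ∀ q ∈ Ioo 0 q₀, ∀ R ∈ Ioo 0 (2 * q ^ 3),
      circleMean (fun p => g (levelPoint p)) q R = 0 := by
    intro q hq R hR
    have h1 := hM q hq R hR
    rw [funext hfe, circleMean_add (g := fun p => g (levelPoint p)) (contDiff_cuspBracket (ha₁.add ha₂)).continuous
      (hg.comp contDiff_levelPoint).continuous hq.1 hR,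
      circleMean_cuspBracket (ha₁.add ha₂) hq.1 hR, zero_add] at h1
    exact h1
  -- The means are known to vanish only for q < q₀, while the flat function has to satisfy its
  -- conditions for all q > 0. The cut-off in lam is zero at lam = 3q⁴ for q ≥ q₀ and one for |lam|
  -- ≤ q₀⁴; being constant on each cycle, it keeps the means zero.
  let β : ContDiffBump (0 : ℝ) := ⟨q₀ ^ 4, 2 * q₀ ^ 4, by positivity, by
    have : 0 < q₀ ^ 4 := by positivity
    linarith⟩
  let r' : ℝ × ℝ × ℝ → ℝ := fun w => β w.1 * g w
  have hr' : ContDiff ℝ ∞ r' := (β.contDiff.comp contDiff_fst).mul hg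
  have hβ : ∀ q : ℝ, 0 < q → q₀ ≤ q → β (3 * q ^ 4) = 0 := by
    intro q hq h
    refine β.zero_of_le_dist ?_
    rw [Real.dist_eq, sub_zero, abs_of_pos (by positivity)]
    have : q₀ ^ 4 ≤ q ^ 4 := by gcongr
    change 2 * q₀ ^ 4 ≤ _
    linarith [pow_pos hq 4]
  refine ⟨fun p => a₁ p + a₂ p, r', ha₁.add ha₂, flatOn_nodeLocus_of_line hr' ?_, ?_,
    q₀ ^ 4, by positivity, fun lam hl x y => ?_⟩
  · intro s hs y n
    obtain ⟨q, hq, rfl⟩ : ∃ q, 0 < q ∧ q ^ 2 = s := ⟨√s, Real.sqrt_pos.2 hs, Real.sq_sqrt hs.le⟩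
    have e4 : 3 * (q ^ 2) ^ 2 = 3 * q ^ 4 := by ring
    have e6 : 2 * (q ^ 2) ^ 3 = 2 * q ^ 6 := by ring
    rw [e4, e6]
    rcases lt_or_ge q q₀ with h | h
    · obtain ⟨T, hT, eT⟩ := exists_eq_pow_mul_of_circleMean hφ₀ hφ₁ hr hrem hq
        (hgM q ⟨hq, h⟩) n y
      refine ⟨fun δ => β (3 * q ^ 4) * T δ, contDiff_const.mul hT, fun δ => ?_⟩
      simp only [r', g]
      rw [eT]
      ring
    · exact ⟨fun _ => 0, contDiff_const, fun δ => by simp [r', hβ q hq h]⟩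
  · intro q hq R hR
    have h1 : circleMean (fun p => r' (levelPoint p)) q R =
        circleMean (fun p => β (3 * q ^ 4) * g (levelPoint p)) q R :=
      circleMean_congr hq hR fun x y _ _ _ => rfl
    rw [h1, circleMean_const_mul]
    rcases lt_or_ge q q₀ with h | h
    · rw [hgM q ⟨hq, h⟩ R hR, mul_zero]
    · rw [hβ q hq h, zero_mul]
  · rw [hfe]
    simp only [r']
    have : β (levelPoint (lam, x, y)).1 = 1 :=
      β.one_of_mem_closedBall (by rw [mem_closedBall_zero_iff]; exact hl.le)
    rw [this, one_mul]

/-! ### Calculus of functions with controlled singularities -/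

section
variable {E κ : Type} [NormedAddCommGroup E] [NormedSpace ℝ E] [Fintype κ]

/-- The elements of the algebra `𝒜` whose differential has coefficients in `𝒜`. -/
def coeffSubalgebra (O : Set E) (l : κ → E →L[ℝ] ℝ) (𝒜 : Subalgebra ℝ (E → ℝ)) :
    Subalgebra ℝ (E → ℝ) where
  carrier := {M | M ∈ 𝒜 ∧ HasCoeffDeriv O l 𝒜 M}
  mul_mem' hM hN := ⟨mul_mem hM.1 hN.1, hM.2.mul hN.2 hM.1 hN.1⟩
  add_mem' hM hN := ⟨add_mem hM.1 hN.1, hM.2.add hN.2⟩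
  algebraMap_mem' r := ⟨𝒜.algebraMap_mem r, HasCoeffDeriv.const O l 𝒜 r⟩

variable {O : Set E} {l : κ → E →L[ℝ] ℝ} {𝒜 : Subalgebra ℝ (E → ℝ)}

theorem mem_coeffSubalgebra_const (c : ℝ) : (fun _ => c) ∈ coeffSubalgebra O l 𝒜 :=
  (coeffSubalgebra O l 𝒜).algebraMap_mem c

theorem mem_coeffSubalgebra_coord [DecidableEq κ] (k : κ) (h : (fun p => l k p) ∈ 𝒜) :
    (fun p => l k p) ∈ coeffSubalgebra O l 𝒜 := by
  refine ⟨h, Pi.single k 1, fun j => ?_, fun p _ => ?_⟩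
  · by_cases hj : j = k
    · subst hj; simp
    · rw [Pi.single_eq_of_ne hj]; exact 𝒜.zero_mem
  · refine (l k).hasFDerivAt.congr_fderiv ?_
    rw [Finset.sum_eq_single k]
    · simp
    · intro j _ hj
      rw [Pi.single_eq_of_ne hj]; simp
    · simp

theorem mem_coeffSubalgebra_comp {φ : ℝ → ℝ} {M N : E → ℝ} (hM : M ∈ coeffSubalgebra O l 𝒜)
    (h : (fun p => φ (M p)) ∈ 𝒜) (hN : N ∈ 𝒜) (hφ : ∀ p ∈ O, HasDerivAt φ (N p) (M p)) :
    (fun p => φ (M p)) ∈ coeffSubalgebra O l 𝒜 := by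
  obtain ⟨c, hc, hd⟩ := hM.2
  refine ⟨h, fun k => N * c k, fun k => mul_mem hN (hc k), fun p hp => ?_⟩
  refine ((hφ p hp).comp_hasFDerivAt p (hd p hp)).congr_fderiv ?_
  rw [Finset.smul_sum]
  simp only [Pi.mul_apply, smul_smul]

omit [NormedSpace ℝ E] in
theorem exists_bound_of_continuous {f W : E → ℝ} (hf : Continuous f) (p₀ : E) :
    ∃ C, ∃ N : ℕ, ∀ᶠ p in 𝓝 p₀, p ∈ O → |f p| * W p ^ N ≤ C := by
  refine ⟨|f p₀| + 1, 0, ?_⟩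
  have : ∀ᶠ p in 𝓝 p₀, |f p| < |f p₀| + 1 :=
    (hf.abs.continuousAt).eventually_lt_const (by linarith)
  filter_upwards [this] with p hp _
  simpa using hp.le

omit [NormedSpace ℝ E] in
/-- A function with a power bounded by an inverse power of `W` is itself so bounded. -/
theorem exists_bound_of_sq {f b W : E → ℝ} (hb : Continuous b) (hW : Continuous W) (N : ℕ)
    (hW0 : ∀ p ∈ O, 0 ≤ W p) (m : ℕ) (hm : m ≠ 0)
    (h : ∀ p ∈ O, |f p| ^ m * W p ^ N ≤ b p) (p₀ : E) :
    ∃ C, ∃ N : ℕ, ∀ᶠ p in 𝓝 p₀, p ∈ O → |f p| * W p ^ N ≤ C := by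
  have hc : Continuous fun p => W p ^ N + b p := by fun_prop
  refine ⟨W p₀ ^ N + b p₀ + 1, N, ?_⟩
  filter_upwards [hc.continuousAt.eventually_lt_const (lt_add_one (W p₀ ^ N + b p₀))] with p hp hO
  refine le_trans ?_ hp.le
  have h0 : 0 ≤ W p ^ N := pow_nonneg (hW0 p hO) N
  have h1 : |f p| ≤ 1 + |f p| ^ m := by
    rcases le_or_gt (|f p|) 1 with h2 | h2
    · linarith [pow_nonneg (abs_nonneg (f p)) m]
    · linarith [le_self_pow₀ h2.le hm]
  calc |f p| * W p ^ N ≤ (1 + |f p| ^ m) * W p ^ N := mul_le_mul_of_nonneg_right h1 h0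
    _ = W p ^ N + |f p| ^ m * W p ^ N := by ring
    _ ≤ _ := by linarith [h p hO]

end

/-- The coordinates of `(ℝ × ℝ × ℝ) × ℝ`. -/
noncomputable def coordFour : Fin 4 → ((ℝ × ℝ × ℝ) × ℝ →L[ℝ] ℝ) :=
  ![(coordThree 0).comp (ContinuousLinearMap.fst ℝ (ℝ × ℝ × ℝ) ℝ),
    (coordThree 1).comp (ContinuousLinearMap.fst ℝ (ℝ × ℝ × ℝ) ℝ),
    (coordThree 2).comp (ContinuousLinearMap.fst ℝ (ℝ × ℝ × ℝ) ℝ),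
    ContinuousLinearMap.snd ℝ (ℝ × ℝ × ℝ) ℝ]

/-! ### The saddle levels and the distance from them -/

/-- The value of `H` at the saddle point, for `lam ≥ 0`. -/
noncomputable def saddleLevel (lam : ℝ) : ℝ := 2 * √(lam / 3) ^ 3

theorem continuous_saddleLevel : Continuous saddleLevel := by
  unfold saddleLevel
  fun_prop

/-- The saddle value is a multiple of lam^(3/2); the exponent exceeds one, so it is locally
Lipschitz even at lam = 0, as required of the weight. -/
theorem abs_saddleLevel_sub_le (a b : ℝ) :
    |saddleLevel a - saddleLevel b| ≤ (√(a / 3) + √(b / 3)) * |a - b| := by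
  set u := √(a / 3) with hu
  set v := √(b / 3) with hv
  have hu0 : 0 ≤ u := Real.sqrt_nonneg _
  have hv0 : 0 ≤ v := Real.sqrt_nonneg _
  have hsq : ∀ c : ℝ, √(c / 3) ^ 2 = max (c / 3) 0 := fun c => by
    rcases le_total 0 (c / 3) with h | h
    · rw [Real.sq_sqrt h, max_eq_left h]
    · rw [Real.sqrt_eq_zero_of_nonpos h, max_eq_right h]; ring
  have h1 : |u ^ 2 - v ^ 2| ≤ 1 / 3 * |a - b| := by
    rw [hu, hv, hsq, hsq]
    refine (abs_max_sub_max_le_abs _ _ _).trans (le_of_eq ?_)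
    rw [← sub_div, abs_div]
    norm_num
    ring
  have h2 : |u - v| * (u + v) = |u ^ 2 - v ^ 2| := by
    rw [sq_sub_sq, abs_mul, abs_of_nonneg (add_nonneg hu0 hv0), mul_comm]
  have h3 : saddleLevel a - saddleLevel b = 2 * ((u - v) * (u ^ 2 + u * v + v ^ 2)) := by
    unfold saddleLevel; rw [← hu, ← hv]; ring
  rw [h3, abs_mul, abs_mul, abs_of_nonneg (by positivity : 0 ≤ u ^ 2 + u * v + v ^ 2)]
  have h4 : u ^ 2 + u * v + v ^ 2 ≤ (u + v) * (u + v) := by nlinarith [mul_nonneg hu0 hv0]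
  have h5 : |u - v| * (u ^ 2 + u * v + v ^ 2) ≤ |u - v| * ((u + v) * (u + v)) :=
    mul_le_mul_of_nonneg_left h4 (abs_nonneg _)
  rw [← mul_assoc, h2] at h5
  have h6 : |u ^ 2 - v ^ 2| * (u + v) ≤ 1 / 3 * |a - b| * (u + v) :=
    mul_le_mul_of_nonneg_right h1 (add_nonneg hu0 hv0)
  have h7 : 0 ≤ |a - b| * (u + v) := mul_nonneg (abs_nonneg _) (add_nonneg hu0 hv0)
  rw [abs_of_pos (by norm_num : (0 : ℝ) < 2)]
  nlinarith

/-- A distance from the values `(lam, h)` at the saddle points. -/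
noncomputable def nodeDist (lam h : ℝ) : ℝ := |h - saddleLevel lam| + max (-lam) 0

theorem nodeDist_nonneg (lam h : ℝ) : 0 ≤ nodeDist lam h :=
  add_nonneg (abs_nonneg _) (le_max_right _ _)

theorem continuous_nodeDist : Continuous fun w : ℝ × ℝ => nodeDist w.1 w.2 := by
  have := continuous_saddleLevel
  unfold nodeDist
  fun_prop

theorem nodeDist_locallyLipschitz (p₀ : (ℝ × ℝ × ℝ) × ℝ) :
    ∃ C, ∃ r > 0, ∀ p ∈ Metric.ball p₀ r, ∀ q ∈ Metric.ball p₀ r,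
      |nodeDist p.1.1 (cuspH p.1.1 p.1.2) - nodeDist q.1.1 (cuspH q.1.1 q.1.2)| ≤ C * ‖p - q‖ := by
  have hH : ContDiff ℝ 1 fun p : (ℝ × ℝ × ℝ) × ℝ => cuspH p.1.1 p.1.2 := by
    unfold cuspH; fun_prop
  obtain ⟨K, t, ht, hK⟩ := (hH.contDiffAt (x := p₀)).exists_lipschitzOnWith
  have hc : Continuous fun p : (ℝ × ℝ × ℝ) × ℝ => √(p.1.1 / 3) := by fun_prop
  obtain ⟨r, hr, hball⟩ := Metric.mem_nhds_iff.1 (inter_mem ht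
    (hc.continuousAt.eventually_lt_const (lt_add_one (√(p₀.1.1 / 3)))))
  set B := √(p₀.1.1 / 3) + 1
  refine ⟨K + 2 * B + 1, r, hr, fun p hp q hq => ?_⟩
  have h1 : |p.1.1 - q.1.1| ≤ ‖p - q‖ := by
    calc |p.1.1 - q.1.1| = ‖(p - q).1.1‖ := rfl
      _ ≤ ‖(p - q).1‖ := norm_fst_le _
      _ ≤ ‖p - q‖ := norm_fst_le _
  have h2 : |cuspH p.1.1 p.1.2 - cuspH q.1.1 q.1.2| ≤ K * ‖p - q‖ := by
    have := hK.dist_le_mul p (hball hp).1 q (hball hq).1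
    rwa [Real.dist_eq, dist_eq_norm] at this
  have h3 : |saddleLevel p.1.1 - saddleLevel q.1.1| ≤ 2 * B * ‖p - q‖ := by
    refine (abs_saddleLevel_sub_le _ _).trans ?_
    have hp2 : √(p.1.1 / 3) < B := (hball hp).2
    have hq2 : √(q.1.1 / 3) < B := (hball hq).2
    have := Real.sqrt_nonneg (p₀.1.1 / 3)
    refine mul_le_mul (by linarith) h1 (abs_nonneg _) ?_
    have := Real.sqrt_nonneg (p.1.1 / 3)
    linarith
  have h4 : |max (-p.1.1) 0 - max (-q.1.1) 0| ≤ ‖p - q‖ := by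
    refine (abs_max_sub_max_le_abs _ _ _).trans ?_
    rw [show -p.1.1 - -q.1.1 = -(p.1.1 - q.1.1) by ring, abs_neg]
    exact h1
  have h5 := abs_abs_sub_abs_le_abs_sub (cuspH p.1.1 p.1.2 - saddleLevel p.1.1)
    (cuspH q.1.1 q.1.2 - saddleLevel q.1.1)
  have h6 : |cuspH p.1.1 p.1.2 - saddleLevel p.1.1 - (cuspH q.1.1 q.1.2 - saddleLevel q.1.1)| ≤
      |cuspH p.1.1 p.1.2 - cuspH q.1.1 q.1.2| + |saddleLevel p.1.1 - saddleLevel q.1.1| := by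
    rw [show cuspH p.1.1 p.1.2 - saddleLevel p.1.1 - (cuspH q.1.1 q.1.2 - saddleLevel q.1.1) =
      (cuspH p.1.1 p.1.2 - cuspH q.1.1 q.1.2) - (saddleLevel p.1.1 - saddleLevel q.1.1) by ring]
    exact abs_sub _ _
  unfold nodeDist
  rw [add_sub_add_comm]
  refine (abs_add_le _ _).trans ?_
  linarith

theorem exists_mem_nodeLocus_dist_le (lam h y : ℝ) :
    ∃ w ∈ nodeLocus, w = (3 * √(lam / 3) ^ 2, 2 * √(lam / 3) ^ 3, y) ∧
      ‖((lam, h, y) : ℝ × ℝ × ℝ) - w‖ ≤ nodeDist lam h := by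
  refine ⟨_, ⟨√(lam / 3), Real.sqrt_nonneg _, rfl, rfl⟩, rfl, ?_⟩
  have h1 : |lam - 3 * √(lam / 3) ^ 2| = max (-lam) 0 := by
    rcases le_total 0 lam with h | h
    · rw [Real.sq_sqrt (by positivity), max_eq_right (by linarith)]
      rw [show lam - 3 * (lam / 3) = 0 by ring, abs_zero]
    · rw [Real.sqrt_eq_zero_of_nonpos (by linarith), max_eq_left (by linarith)]
      rw [show lam - 3 * (0 : ℝ) ^ 2 = lam by ring, abs_of_nonpos h]
  simp only [Prod.mk_sub_mk, Prod.norm_def, Real.norm_eq_abs, sub_self, abs_zero]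
  rw [h1]
  have h2 : |h - 2 * √(lam / 3) ^ 3| = |h - saddleLevel lam| := rfl
  rw [h2]
  have h3 := abs_nonneg (h - saddleLevel lam)
  have h4 := le_max_right (-lam) 0
  unfold nodeDist
  exact max_le (by linarith) (max_le (by linarith) (by linarith))

/-- The absorption principle with weight `nodeDist`, which bounds the distance to the point of
`nodeLocus` with the same y. It remains for each region to exhibit generators closed under
differentiation and to bound their growth. -/
theorem contDiff_indicator_mul_comp_level {O : Set ((ℝ × ℝ × ℝ) × ℝ)} (hO : IsOpen O)
    (h0 : ∀ p ∈ closure O, p ∉ O → nodeDist p.1.1 (cuspH p.1.1 p.1.2) = 0)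
    {s : Set ((ℝ × ℝ × ℝ) × ℝ → ℝ)}
    (hs : s ⊆ coeffSubalgebra O coordFour (Algebra.adjoin ℝ s))
    (hcoord : ∀ k, (fun p => coordFour k p) ∈ coeffSubalgebra O coordFour (Algebra.adjoin ℝ s))
    (hγ : ∀ γ ∈ s, ∀ p₀, ∃ C, ∃ N : ℕ, ∀ᶠ p in 𝓝 p₀, p ∈ O →
      |γ p| * nodeDist p.1.1 (cuspH p.1.1 p.1.2) ^ N ≤ C)
    {Y : (ℝ × ℝ × ℝ) × ℝ → ℝ} (hY : Y ∈ coeffSubalgebra O coordFour (Algebra.adjoin ℝ s))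
    {B : (ℝ × ℝ × ℝ) × ℝ → ℝ} (hB : Continuous B) (hYB : ∀ p ∈ O, |Y p| ≤ B p)
    {M : (ℝ × ℝ × ℝ) × ℝ → ℝ} (hM : M ∈ Algebra.adjoin ℝ s) {r : ℝ × ℝ × ℝ → ℝ}
    (hr : FlatOn nodeLocus r) :
    ContDiff ℝ ∞ (O.indicator fun p => M p * r (p.1.1, cuspH p.1.1 p.1.2, Y p)) := by
  have hH : (fun p : (ℝ × ℝ × ℝ) × ℝ => cuspH p.1.1 p.1.2) ∈
      coeffSubalgebra O coordFour (Algebra.adjoin ℝ s) := by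
    have e : (fun p : (ℝ × ℝ × ℝ) × ℝ => cuspH p.1.1 p.1.2) =
        (fun p => coordFour 1 p) ^ 2 - (fun p => coordFour 2 p) ^ 3 +
          (fun p => coordFour 0 p) * (fun p => coordFour 2 p) := by
      funext p
      simp [cuspH, coordFour, coordThree]
    rw [e]
    exact add_mem (sub_mem (pow_mem (hcoord 1) 2) (pow_mem (hcoord 2) 3))
      (mul_mem (hcoord 0) (hcoord 2))
  have hWc : Continuous fun p : (ℝ × ℝ × ℝ) × ℝ => nodeDist p.1.1 (cuspH p.1.1 p.1.2) :=
    continuous_nodeDist.comp (by unfold cuspH; fun_prop : Continuous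
      fun p : (ℝ × ℝ × ℝ) × ℝ => (p.1.1, cuspH p.1.1 p.1.2))
  refine contDiff_indicator_mul_comp hO (Z := nodeLocus) (l := coordFour) (s := s)
    (fun γ h => (hs h).2) (e := basisThree)
    (g := ![fun p => coordFour 0 p, fun p => cuspH p.1.1 p.1.2, Y]) ?_
    (G := fun p => (p.1.1, cuspH p.1.1 p.1.2, Y p)) ?_
    (W := fun p => nodeDist p.1.1 (cuspH p.1.1 p.1.2)) (fun p _ => nodeDist_nonneg _ _)
    (exists_le_mul_norm_sub hO nodeDist_locallyLipschitz h0) (fun p₀ _ γ h => hγ γ h p₀) ?_ hM hr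
  · intro j
    fin_cases j
    · exact (hcoord 0).2
    · exact hH.2
    · exact hY.2
  · intro p _
    simp [Fin.sum_univ_three, basisThree, coordFour, coordThree]
  · intro p₀ _
    have hc1 : Continuous fun p : (ℝ × ℝ × ℝ) × ℝ => |p.1.1| + |cuspH p.1.1 p.1.2| + B p := by
      unfold cuspH; fun_prop
    have hc2 : Continuous fun p : (ℝ × ℝ × ℝ) × ℝ =>
        |3 * √(p.1.1 / 3) ^ 2| + |2 * √(p.1.1 / 3) ^ 3| + B p := by fun_prop
    set R := max (|p₀.1.1| + |cuspH p₀.1.1 p₀.1.2| + B p₀)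
      (|3 * √(p₀.1.1 / 3) ^ 2| + |2 * √(p₀.1.1 / 3) ^ 3| + B p₀) with hR
    refine ⟨R + 1, 1, ?_⟩
    filter_upwards [hc1.continuousAt.eventually_lt_const (lt_add_one _ |>.trans_le
        (add_le_add_left (le_max_left _ _ : _ ≤ R) 1)),
      hc2.continuousAt.eventually_lt_const (lt_add_one _ |>.trans_le
        (add_le_add_left (le_max_right _ _ : _ ≤ R) 1))] with p h1 h2 hp
    obtain ⟨w, hw, e, hd⟩ := exists_mem_nodeLocus_dist_le p.1.1 (cuspH p.1.1 p.1.2) (Y p)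
    have hYp := hYB p hp
    have hnorm : ∀ a b c : ℝ, ‖((a, b, c) : ℝ × ℝ × ℝ)‖ ≤ |a| + |b| + |c| := by
      intro a b c
      simp only [Prod.norm_def, Real.norm_eq_abs]
      have := abs_nonneg a; have := abs_nonneg b; have := abs_nonneg c
      exact max_le (by linarith) (max_le (by linarith) (by linarith))
    refine ⟨w, hw, ?_, ?_, by rwa [pow_one]⟩
    · exact (hnorm _ _ _).trans (by linarith)
    · rw [e]
      exact (hnorm _ _ _).trans (by linarith)

/-! ### The solution inside the vanishing discs -/

/-- The part of the space that is filled by the vanishing discs. -/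
def innerRegion : Set (ℝ × ℝ × ℝ) :=
  {p | 0 < p.1 ∧ p.2.2 < √(p.1 / 3) ∧ cuspH p.1 p.2 < saddleLevel p.1}

theorem isOpen_innerRegion : IsOpen innerRegion := by
  have h1 : Continuous fun p : ℝ × ℝ × ℝ => saddleLevel p.1 :=
    continuous_saddleLevel.comp continuous_fst
  have h2 : Continuous fun p : ℝ × ℝ × ℝ => cuspH p.1 p.2 := by unfold cuspH; fun_prop
  have h3 : Continuous fun p : ℝ × ℝ × ℝ => √(p.1 / 3) := by fun_prop
  exact (isOpen_lt continuous_const continuous_fst).inter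
    ((isOpen_lt (continuous_snd.comp continuous_snd) h3).inter (isOpen_lt h2 h1))

/-- The function `q` with `lam = 3 * q ^ 4`. -/
noncomputable def quarticRoot (lam : ℝ) : ℝ := √√(lam / 3)

theorem quarticRoot_pow {lam : ℝ} (h : 0 ≤ lam) :
    quarticRoot lam ^ 2 = √(lam / 3) ∧ lam = 3 * quarticRoot lam ^ 4 := by
  have h1 : quarticRoot lam ^ 2 = √(lam / 3) := Real.sq_sqrt (Real.sqrt_nonneg _)
  refine ⟨h1, ?_⟩
  have h2 := Real.sq_sqrt (show 0 ≤ lam / 3 by positivity)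
  rw [← h1] at h2
  linear_combination -3 * h2

/-- The coordinate that completes `x` to circular coordinates. -/
noncomputable def circleCoord (lam y : ℝ) : ℝ :=
  (y + quarticRoot lam ^ 2) * √(2 * quarticRoot lam ^ 2 - y)

theorem mem_innerRegion {lam x y : ℝ} (h : (lam, x, y) ∈ innerRegion) :
    0 < quarticRoot lam ∧ lam = 3 * quarticRoot lam ^ 4 ∧ -(2 * quarticRoot lam ^ 2) < y ∧
      y < quarticRoot lam ^ 2 ∧
      x ^ 2 + circleCoord lam y ^ 2 = cuspH lam (x, y) + 2 * quarticRoot lam ^ 6 ∧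
      nodeDist lam (cuspH lam (x, y)) =
        4 * quarticRoot lam ^ 6 - (x ^ 2 + circleCoord lam y ^ 2) ∧
      x ^ 2 + circleCoord lam y ^ 2 < 4 * quarticRoot lam ^ 6 := by
  obtain ⟨h1, h2, h3⟩ := h
  simp only at h1 h2 h3
  obtain ⟨e1, e2⟩ := quarticRoot_pow h1.le
  have hq : 0 < quarticRoot lam := Real.sqrt_pos.2 (Real.sqrt_pos.2 (by positivity))
  rw [← e1] at h2
  have e3 : saddleLevel lam = 2 * quarticRoot lam ^ 6 := by
    rw [saddleLevel, ← e1]; ring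
  have e4 : nodeDist lam (cuspH lam (x, y)) = 2 * quarticRoot lam ^ 6 - cuspH lam (x, y) := by
    rw [nodeDist, max_eq_right (by linarith), abs_of_neg (by linarith), e3]; ring
  rw [e3] at h3
  have hcubic : circleCoord lam y ^ 2 =
      2 * quarticRoot lam ^ 6 - y ^ 3 + 3 * quarticRoot lam ^ 4 * y := by
    rw [circleCoord, mul_pow, Real.sq_sqrt (by nlinarith)]; ring
  have hH : x ^ 2 + circleCoord lam y ^ 2 = cuspH lam (x, y) + 2 * quarticRoot lam ^ 6 := by
    rw [hcubic, cuspH]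
    linear_combination -y * e2
  refine ⟨hq, e2, ?_, h2, hH, by linarith, by linarith⟩
  by_contra hcon
  have h5 : (y - quarticRoot lam ^ 2) ^ 2 * (y + 2 * quarticRoot lam ^ 2) ≤ 0 :=
    mul_nonpos_of_nonneg_of_nonpos (sq_nonneg _) (by linarith)
  nlinarith [sq_nonneg x]

/-- The weak inequalities persist in the closure. If lam = 0, they force y = 0 and H ≤ 0; if y =
√(lam / 3), then H is at least the saddle value; otherwise only H can reach its bound. -/
theorem nodeDist_of_mem_closure_innerRegion {p : ℝ × ℝ × ℝ} (hp : p ∈ closure innerRegion)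
    (hp' : p ∉ innerRegion) : nodeDist p.1 (cuspH p.1 p.2) = 0 := by
  obtain ⟨lam, x, y⟩ := p
  have hq : Continuous quarticRoot := by unfold quarticRoot; fun_prop
  have hc : ∀ {f : ℝ × ℝ × ℝ → ℝ}, Continuous f → (∀ p ∈ innerRegion, 0 ≤ f p) →
      0 ≤ f (lam, x, y) := fun hf h =>
    closure_minimal h (isClosed_le continuous_const hf) hp
  have h1 : 0 ≤ lam := hc (f := fun p => p.1) (by fun_prop) fun p hp => hp.1.le
  have h2 : 0 ≤ √(lam / 3) - y := hc (f := fun p => √(p.1 / 3) - p.2.2) (by fun_prop)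
    fun p hp => by linarith [hp.2.1]
  have hs := continuous_saddleLevel
  have h3 : 0 ≤ saddleLevel lam - cuspH lam (x, y) :=
    hc (f := fun p => saddleLevel p.1 - cuspH p.1 p.2) (by unfold cuspH; fun_prop)
    fun p hp => by linarith [hp.2.2]
  have h4 : 0 ≤ y + 2 * quarticRoot lam ^ 2 :=
    hc (f := fun p => p.2.2 + 2 * quarticRoot p.1 ^ 2) (by fun_prop) fun p hp => by
      obtain ⟨-, -, h, -⟩ := mem_innerRegion (lam := p.1) (x := p.2.1) (y := p.2.2) hp
      linarith
  have hn : nodeDist lam (cuspH lam (x, y)) = saddleLevel lam - cuspH lam (x, y) := by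
    rw [nodeDist, max_eq_right (by linarith), abs_of_nonpos (by linarith)]; ring
  simp only
  rw [hn]
  refine le_antisymm ?_ h3
  have hsq := Real.sq_sqrt (show 0 ≤ lam / 3 by positivity)
  rcases h1.eq_or_lt with h5 | h5
  · subst h5
    simp only [quarticRoot, saddleLevel, zero_div, Real.sqrt_zero] at h2 h4 h3 ⊢
    have : y = 0 := by linarith
    subst this
    simp only [cuspH] at h3 ⊢
    nlinarith [sq_nonneg x]
  · rcases h2.eq_or_lt with h6 | h6
    · have : y = √(lam / 3) := by linarith
      have hl : lam = 3 * √(lam / 3) ^ 2 := by linarith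
      rw [this]
      set t := √(lam / 3) with ht
      have h7 : saddleLevel lam = 2 * t ^ 3 := rfl
      rw [h7, cuspH]
      simp only
      rw [hl]
      nlinarith [sq_nonneg x]
    · by_contra h7
      exact hp' ⟨h5, by simpa using h6, by simp only; linarith⟩

/-- The rotated circular coordinate, divided by its maximal value up to a factor two. -/
noncomputable def rotatedCoord (p : (ℝ × ℝ × ℝ) × ℝ) : ℝ :=
  (p.1.2.1 * Real.sin p.2 + circleCoord p.1.1 p.1.2.2 * Real.cos p.2) / quarticRoot p.1.1 ^ 3

/-- In the inner region the weight is 4q⁶ - (x² + z²), and a rotated coordinate is at most the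
radius. Hence 1 / √(4 - ζ²) grows at most like an inverse power of the weight, uniformly in the
angle of rotation. -/
theorem rotatedCoord_sq {p : (ℝ × ℝ × ℝ) × ℝ} (hp : p.1 ∈ innerRegion) :
    nodeDist p.1.1 (cuspH p.1.1 p.1.2) ≤
      quarticRoot p.1.1 ^ 6 * (4 - rotatedCoord p ^ 2) := by
  obtain ⟨⟨lam, x, y⟩, t⟩ := p
  obtain ⟨hq, -, -, -, -, h, -⟩ := mem_innerRegion hp
  simp only at h ⊢
  rw [h]
  set z := circleCoord lam y
  have e : quarticRoot lam ^ 6 * rotatedCoord ((lam, x, y), t) ^ 2 =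
      (x * Real.sin t + z * Real.cos t) ^ 2 := by
    change quarticRoot lam ^ 6 * ((x * Real.sin t + z * Real.cos t) / quarticRoot lam ^ 3) ^ 2 = _
    field_simp
  have e2 : (x * Real.sin t + z * Real.cos t) ^ 2 + (x * Real.cos t - z * Real.sin t) ^ 2 =
      x ^ 2 + z ^ 2 := by
    linear_combination (x ^ 2 + z ^ 2) * Real.sin_sq_add_cos_sq t
  nlinarith [sq_nonneg (x * Real.cos t - z * Real.sin t)]

theorem nodeDist_pos_of_mem_innerRegion {p : ℝ × ℝ × ℝ} (hp : p ∈ innerRegion) :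
    0 < nodeDist p.1 (cuspH p.1 p.2) := by
  have := hp.2.2
  exact add_pos_of_pos_of_nonneg (abs_pos.2 (by linarith)) (le_max_right _ _)

theorem abs_rotatedCoord_lt {p : (ℝ × ℝ × ℝ) × ℝ} (hp : p.1 ∈ innerRegion) :
    |rotatedCoord p| < 2 := by
  have h1 := rotatedCoord_sq hp
  have h2 := nodeDist_pos_of_mem_innerRegion hp
  obtain ⟨hq, -⟩ := mem_innerRegion (lam := p.1.1) (x := p.1.2.1) (y := p.1.2.2) hp
  have h3 : 0 < 4 - rotatedCoord p ^ 2 := (pos_iff_pos_of_mul_pos (h2.trans_le h1)).1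
    (by positivity)
  refine abs_lt_of_sq_lt_sq (by linarith) (by norm_num)

/-- The integrand of the inner solution: t times the value of r(lam, H, Y) Y' at the point of the
cycle rotated by the angle t. The rotation is written through sin t and cos t, so no angular
coordinate occurs and the centre of the disc is not singular. -/
theorem contDiff_indicator_inner {r : ℝ × ℝ × ℝ → ℝ} (hr : FlatOn nodeLocus r) :
    ContDiff ℝ ∞ ({p : (ℝ × ℝ × ℝ) × ℝ | p.1 ∈ innerRegion}.indicator fun p => p.2 *
      (r (p.1.1, cuspH p.1.1 p.1.2, 2 * quarticRoot p.1.1 ^ 2 *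
        Real.cos (cubicAngle (rotatedCoord p))) *
      (4 / 3 * (quarticRoot p.1.1)⁻¹ * Real.sin (cubicAngle (rotatedCoord p)) *
        (√(4 - rotatedCoord p ^ 2))⁻¹))) := by
  set O : Set ((ℝ × ℝ × ℝ) × ℝ) := {p | p.1 ∈ innerRegion} with hOdef
  have hO : IsOpen O := isOpen_innerRegion.preimage continuous_fst
  let L : (ℝ × ℝ × ℝ) × ℝ → ℝ := fun p => coordFour 0 p
  let X : (ℝ × ℝ × ℝ) × ℝ → ℝ := fun p => coordFour 1 p
  let Y : (ℝ × ℝ × ℝ) × ℝ → ℝ := fun p => coordFour 2 p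
  let T : (ℝ × ℝ × ℝ) × ℝ → ℝ := fun p => coordFour 3 p
  let q : (ℝ × ℝ × ℝ) × ℝ → ℝ := fun p => √√(L p / 3)
  let qi : (ℝ × ℝ × ℝ) × ℝ → ℝ := fun p => (q p)⁻¹
  let u : (ℝ × ℝ × ℝ) × ℝ → ℝ := (fun _ => 2) * q ^ 2 - Y
  let w : (ℝ × ℝ × ℝ) × ℝ → ℝ := fun p => √(u p)
  let wi : (ℝ × ℝ × ℝ) × ℝ → ℝ := fun p => (w p)⁻¹
  let C : (ℝ × ℝ × ℝ) × ℝ → ℝ := fun p => Real.cos (T p)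
  let S : (ℝ × ℝ × ℝ) × ℝ → ℝ := fun p => Real.sin (T p)
  let ζ : (ℝ × ℝ × ℝ) × ℝ → ℝ := (X * S + (Y + q ^ 2) * w * C) * qi ^ 3
  let c : (ℝ × ℝ × ℝ) × ℝ → ℝ := fun p => Real.cos (cubicAngle (ζ p))
  let d : (ℝ × ℝ × ℝ) × ℝ → ℝ := fun p => Real.sin (cubicAngle (ζ p))
  let k : (ℝ × ℝ × ℝ) × ℝ → ℝ := fun p => (√(4 - ζ p ^ 2))⁻¹
  have hζ : ζ = rotatedCoord := by
    funext p
    simp only [ζ, rotatedCoord, circleCoord, Pi.mul_apply, Pi.add_apply, Pi.pow_apply, X, S, Y,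
      q, w, C, qi, u, T, L, quarticRoot, Pi.sub_apply]
    rw [div_eq_mul_inv, inv_pow]
    rfl
  have hζ2 : ∀ p ∈ O, |ζ p| < 2 := fun p hp => by rw [hζ]; exact abs_rotatedCoord_lt hp
  have hq0 : ∀ p ∈ O, 0 < q p := fun p hp =>
    (mem_innerRegion (lam := p.1.1) (x := p.1.2.1) (y := p.1.2.2) hp).1
  have hL0 : ∀ p ∈ O, 0 < L p := fun p hp => hp.1
  have hu0 : ∀ p ∈ O, q p ^ 2 < u p := fun p hp => by
    have := (mem_innerRegion (lam := p.1.1) (x := p.1.2.1) (y := p.1.2.2) hp).2.2.2.1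
    change q p ^ 2 < 2 * q p ^ 2 - p.1.2.2
    have h' : p.1.2.2 < q p ^ 2 := this
    linarith
  have hw0 : ∀ p ∈ O, 0 < w p := fun p hp =>
    Real.sqrt_pos.2 ((pow_pos (hq0 p hp) 2).trans (hu0 p hp))
  -- The inverses `qi`, `wi`, `k` are included because they occur in the derivatives of the roots
  -- and of `cubicAngle`; with them the list is closed under differentiation. Only these three can
  -- be unbounded near the boundary.
  let s : Set ((ℝ × ℝ × ℝ) × ℝ → ℝ) := {L, X, Y, T, q, qi, w, wi, C, S, c, d, k}
  set 𝒜 := Algebra.adjoin ℝ s with h𝒜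
  set ℬ := coeffSubalgebra O coordFour 𝒜 with hℬ
  have hsub : ∀ γ ∈ s, γ ∈ 𝒜 := fun γ h => Algebra.subset_adjoin h
  have aq : q ∈ 𝒜 := hsub _ (by simp [s])
  have aqi : qi ∈ 𝒜 := hsub _ (by simp [s])
  have aw : w ∈ 𝒜 := hsub _ (by simp [s])
  have awi : wi ∈ 𝒜 := hsub _ (by simp [s])
  have aC : C ∈ 𝒜 := hsub _ (by simp [s])
  have aS : S ∈ 𝒜 := hsub _ (by simp [s])
  have ac : c ∈ 𝒜 := hsub _ (by simp [s])
  have ad : d ∈ 𝒜 := hsub _ (by simp [s])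
  have ak : k ∈ 𝒜 := hsub _ (by simp [s])
  have bL : L ∈ ℬ := mem_coeffSubalgebra_coord 0 (hsub _ (by simp [s, L]))
  have bX : X ∈ ℬ := mem_coeffSubalgebra_coord 1 (hsub _ (by simp [s, X]))
  have bY : Y ∈ ℬ := mem_coeffSubalgebra_coord 2 (hsub _ (by simp [s, Y]))
  have bT : T ∈ ℬ := mem_coeffSubalgebra_coord 3 (hsub _ (by simp [s, T]))
  have bq : q ∈ ℬ := by
    refine mem_coeffSubalgebra_comp (φ := fun v => √√(v / 3)) (N := (1 / 12 : ℝ) • qi ^ 3) bL aq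
      (Subalgebra.smul_mem _ (pow_mem aqi 3) _) fun p hp => ?_
    have h1 := hL0 p hp
    have h2 : 0 < √(L p / 3) := Real.sqrt_pos.2 (by positivity)
    refine ((((hasDerivAt_id (L p)).div_const 3).sqrt (by simpa using h1.ne')).sqrt
      h2.ne').congr_deriv ?_
    have h3 : √(L p / 3) = q p ^ 2 := (Real.sq_sqrt h2.le).symm
    have h4 := (hq0 p hp).ne'
    simp only [id, Pi.smul_apply, Pi.pow_apply, smul_eq_mul, qi]
    rw [h3, Real.sqrt_sq (hq0 p hp).le]
    field_simp
    norm_num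
  have bqi : qi ∈ ℬ := by
    refine mem_coeffSubalgebra_comp (φ := fun v => v⁻¹) (N := (-1 : ℝ) • qi ^ 2) bq aqi
      (Subalgebra.smul_mem _ (pow_mem aqi 2) _) fun p hp => ?_
    refine (hasDerivAt_inv (hq0 p hp).ne').congr_deriv ?_
    simp [qi]
  have bu : u ∈ ℬ := sub_mem (mul_mem (mem_coeffSubalgebra_const 2) (pow_mem bq 2)) bY
  have bw : w ∈ ℬ := by
    refine mem_coeffSubalgebra_comp (φ := fun v => √v) (N := (1 / 2 : ℝ) • wi) bu aw
      (Subalgebra.smul_mem _ awi _) fun p hp => ?_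
    refine ((hasDerivAt_id (u p)).sqrt (Real.sqrt_pos.1 (hw0 p hp)).ne').congr_deriv ?_
    simp only [id, Pi.smul_apply, smul_eq_mul, wi, w]
    rw [one_div, one_div, mul_inv]
  have bwi : wi ∈ ℬ := by
    refine mem_coeffSubalgebra_comp (φ := fun v => v⁻¹) (N := (-1 : ℝ) • wi ^ 2) bw awi
      (Subalgebra.smul_mem _ (pow_mem awi 2) _) fun p hp => ?_
    refine (hasDerivAt_inv (hw0 p hp).ne').congr_deriv ?_
    simp [wi]
  have bC : C ∈ ℬ := mem_coeffSubalgebra_comp (φ := Real.cos) (N := (-1 : ℝ) • S) bT aC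
    (Subalgebra.smul_mem _ aS _) fun p _ => (Real.hasDerivAt_cos (T p)).congr_deriv (by simp [S])
  have bS : S ∈ ℬ := mem_coeffSubalgebra_comp (φ := Real.sin) (N := C) bT aS aC
    fun p _ => Real.hasDerivAt_sin (T p)
  have bζ : ζ ∈ ℬ := mul_mem (add_mem (mul_mem bX bS)
    (mul_mem (mul_mem (add_mem bY (pow_mem bq 2)) bw) bC)) (pow_mem bqi 3)
  have bc : c ∈ ℬ := by
    refine mem_coeffSubalgebra_comp (φ := fun v => Real.cos (cubicAngle v))
      (N := (2 / 3 : ℝ) • (d * k)) bζ ac (Subalgebra.smul_mem _ (mul_mem ad ak) _) fun p hp => ?_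
    refine (hasDerivAt_cubicAngle (hζ2 p hp)).cos.congr_deriv ?_
    simp only [Pi.smul_apply, Pi.mul_apply, smul_eq_mul, d, k]
    ring
  have bd : d ∈ ℬ := by
    refine mem_coeffSubalgebra_comp (φ := fun v => Real.sin (cubicAngle v))
      (N := (-(2 / 3) : ℝ) • (c * k)) bζ ad (Subalgebra.smul_mem _ (mul_mem ac ak) _)
      fun p hp => ?_
    refine (hasDerivAt_cubicAngle (hζ2 p hp)).sin.congr_deriv ?_
    simp only [Pi.smul_apply, Pi.mul_apply, smul_eq_mul, c, k]
    ring
  have hk0 : ∀ p ∈ O, 0 < 4 - ζ p ^ 2 := fun p hp => by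
    have := sq_lt_sq' (abs_lt.1 (hζ2 p hp)).1 (abs_lt.1 (hζ2 p hp)).2
    linarith
  have bk : k ∈ ℬ := by
    refine mem_coeffSubalgebra_comp (φ := fun v => (√(4 - v ^ 2))⁻¹)
      (N := ζ * k ^ 3) bζ ak (mul_mem bζ.1 (pow_mem ak 3)) fun p hp => ?_
    have h1 := hk0 p hp
    have h2 : 0 < √(4 - ζ p ^ 2) := Real.sqrt_pos.2 h1
    refine ((((hasDerivAt_pow 2 (ζ p)).const_sub 4).sqrt h1.ne').inv h2.ne').congr_deriv ?_
    simp only [Pi.mul_apply, Pi.pow_apply, k]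
    field_simp
    norm_num
  have hWc : Continuous fun p : (ℝ × ℝ × ℝ) × ℝ => nodeDist p.1.1 (cuspH p.1.1 p.1.2) :=
    continuous_nodeDist.comp (by unfold cuspH; fun_prop : Continuous
      fun p : (ℝ × ℝ × ℝ) × ℝ => (p.1.1, cuspH p.1.1 p.1.2))
  have cL : Continuous L := (coordFour 0).continuous
  have cX : Continuous X := (coordFour 1).continuous
  have cY : Continuous Y := (coordFour 2).continuous
  have cT : Continuous T := (coordFour 3).continuous
  have cq : Continuous q := by fun_prop
  have cw : Continuous w := by fun_prop
  have cC : Continuous C := by fun_prop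
  have cS : Continuous S := by fun_prop
  have hW4 : ∀ p ∈ O, nodeDist p.1.1 (cuspH p.1.1 p.1.2) ≤ 4 * q p ^ 6 := fun p hp => by
    have := (mem_innerRegion (lam := p.1.1) (x := p.1.2.1) (y := p.1.2.2) hp).2.2.2.2.2.1
    have h' : nodeDist p.1.1 (cuspH p.1.1 p.1.2) =
      4 * q p ^ 6 - (p.1.2.1 ^ 2 + circleCoord p.1.1 p.1.2.2 ^ 2) := this
    rw [h']
    nlinarith [sq_nonneg p.1.2.1, sq_nonneg (circleCoord p.1.1 p.1.2.2)]
  -- The weight is at most the depth 4q⁶ of the disc below the saddle, so it also controls the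
  -- inverse of q as lam tends to zero.
  have hqi : ∀ p ∈ O, |qi p| ^ 6 * nodeDist p.1.1 (cuspH p.1.1 p.1.2) ^ 1 ≤ 4 := by
    intro p hp
    have h1 := hW4 p hp
    have h2 := hq0 p hp
    rw [abs_of_pos (inv_pos.2 h2), pow_one, inv_pow, inv_mul_le_iff₀ (by positivity)]
    linarith
  have main := contDiff_indicator_mul_comp_level hO ?_ (s := s) ?_ ?_ ?_
    (Y := (fun _ => 2) * q ^ 2 * c) (B := fun p => 2 * q p ^ 2) ?_ (by fun_prop) ?_
    (M := T * ((4 / 3 : ℝ) • (qi * d * k))) ?_ hr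
  · refine (congrArg (fun f => ContDiff ℝ ∞ (O.indicator f)) (funext fun p => ?_)).mpr main
    simp only [Pi.mul_apply, Pi.pow_apply, Pi.smul_apply, smul_eq_mul, c, d, k, hζ, qi, q, L, T]
    have e0 : coordFour 0 p = p.1.1 := rfl
    have e3 : coordFour 3 p = p.2 := rfl
    rw [e0, e3]
    simp only [quarticRoot]
    ring
  · intro p hp hp'
    exact nodeDist_of_mem_closure_innerRegion
      ((continuous_fst.closure_preimage_subset innerRegion) hp) hp'
  · rintro γ (rfl | rfl | rfl | rfl | rfl | rfl | rfl | rfl | rfl | rfl | rfl | rfl | rfl) <;>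
      assumption
  · intro j
    fin_cases j
    · exact bL
    · exact bX
    · exact bY
    · exact bT
  · rintro γ (rfl | rfl | rfl | rfl | rfl | rfl | rfl | rfl | rfl | rfl | rfl | rfl | rfl)
    · exact exists_bound_of_continuous cL
    · exact exists_bound_of_continuous cX
    · exact exists_bound_of_continuous cY
    · exact exists_bound_of_continuous cT
    · exact exists_bound_of_continuous cq
    · exact exists_bound_of_sq (b := fun _ => 4) continuous_const hWc 1
        (fun p _ => nodeDist_nonneg _ _) 6 (by norm_num) hqi
    · exact exists_bound_of_continuous cw
    · refine exists_bound_of_sq (b := fun _ => 4) continuous_const hWc 1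
        (fun p _ => nodeDist_nonneg _ _) 6 (by norm_num) fun p hp => le_trans ?_ (hqi p hp)
      refine mul_le_mul_of_nonneg_right ?_ (pow_nonneg (nodeDist_nonneg _ _) _)
      have h1 : q p ≤ w p := Real.le_sqrt_of_sq_le (hu0 p hp).le
      have h2 := hq0 p hp
      rw [abs_of_pos (inv_pos.2 h2), abs_of_pos (inv_pos.2 (hw0 p hp))]
      gcongr
    · exact exists_bound_of_continuous cC
    · exact exists_bound_of_continuous cS
    · exact exists_bound_of_sq (b := fun _ => 1) continuous_const hWc 0
        (fun p _ => nodeDist_nonneg _ _) 1 one_ne_zero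
        fun p _ => by simpa using Real.abs_cos_le_one _
    · exact exists_bound_of_sq (b := fun _ => 1) continuous_const hWc 0
        (fun p _ => nodeDist_nonneg _ _) 1 one_ne_zero
        fun p _ => by simpa using Real.abs_sin_le_one _
    · refine exists_bound_of_sq (b := fun p => q p ^ 6) (by fun_prop) hWc 1
        (fun p _ => nodeDist_nonneg _ _) 2 two_ne_zero fun p hp => ?_
      have h1 : nodeDist p.1.1 (cuspH p.1.1 p.1.2) ≤ q p ^ 6 * (4 - rotatedCoord p ^ 2) :=
        rotatedCoord_sq hp
      rw [← hζ] at h1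
      rw [sq_abs, pow_one]
      simp only [k]
      rw [inv_pow, Real.sq_sqrt (hk0 p hp).le, inv_mul_le_iff₀ (hk0 p hp)]
      linarith
  · exact mul_mem (mul_mem (mem_coeffSubalgebra_const 2) (pow_mem bq 2)) bc
  · intro p _
    have h1 : |c p| ≤ 1 := Real.abs_cos_le_one _
    change |2 * q p ^ 2 * c p| ≤ _
    rw [abs_mul, abs_of_nonneg (by positivity)]
    exact mul_le_of_le_one_right (by positivity) h1
  · exact mul_mem bT.1 (Subalgebra.smul_mem _ (mul_mem (mul_mem aqi ad) ak) _)

/-- The integral equals that of (u - θ) g(u) over a period starting at θ. The term with θ drops out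
by the zero mean, and the ends of the period contribute (θ + 2π) g(θ) - θ g(θ). -/
theorem hasDerivAt_integral_mul_comp_add {g : ℝ → ℝ} (hg : Continuous g)
    (hper : Function.Periodic g (2 * Real.pi)) (h0 : ∫ t in (0 : ℝ)..2 * Real.pi, g t = 0)
    (θ : ℝ) :
    HasDerivAt (fun θ => ∫ t in (0 : ℝ)..2 * Real.pi, t * g (θ + t)) (2 * Real.pi * g θ) θ := by
  have hc : Continuous fun u => u * g u := by fun_prop
  have hK : ∀ v, HasDerivAt (fun v => ∫ u in (0 : ℝ)..v, u * g u) (v * g v) v := fun v =>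
    intervalIntegral.integral_hasDerivAt_right (hc.intervalIntegrable _ _)
      (hc.stronglyMeasurableAtFilter _ _) hc.continuousAt
  have e : (fun θ => ∫ t in (0 : ℝ)..2 * Real.pi, t * g (θ + t)) = fun θ =>
      (∫ u in (0 : ℝ)..(θ + 2 * Real.pi), u * g u) - ∫ u in (0 : ℝ)..θ, u * g u := by
    funext θ
    have e1 : ∫ t in (0 : ℝ)..2 * Real.pi, t * g (θ + t) =
        ∫ u in θ..(θ + 2 * Real.pi), (u - θ) * g u := by
      have := intervalIntegral.integral_comp_add_left (a := 0) (b := 2 * Real.pi)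
        (fun u => (u - θ) * g u) θ
      simpa using this
    have e2 : ∫ u in θ..(θ + 2 * Real.pi), g u = 0 := by
      have := hper.intervalIntegral_add_eq θ 0
      rwa [zero_add, h0] at this
    rw [e1, intervalIntegral.integral_interval_sub_left (hc.intervalIntegrable _ _)
      (hc.intervalIntegrable _ _)]
    simp only [sub_mul]
    rw [intervalIntegral.integral_sub (hc.intervalIntegrable _ _)
      ((by fun_prop : Continuous fun u => θ * g u).intervalIntegrable _ _), intervalIntegral.integral_const_mul, e2]
    ring
  rw [e]
  refine (((hK (θ + 2 * Real.pi)).comp_add_const θ (2 * Real.pi)).sub (hK θ)).congr_deriv ?_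
  rw [hper θ]
  ring

theorem quarticRoot_three_mul {q : ℝ} (hq : 0 < q) : quarticRoot (3 * q ^ 4) = q := by
  rw [quarticRoot, show 3 * q ^ 4 / 3 = (q ^ 2) ^ 2 by ring, Real.sqrt_sq (by positivity),
    Real.sqrt_sq hq.le]

theorem circleCoord_cycleY {q : ℝ} (hq : 0 < q) {z : ℝ} (hz : |z| < 2 * q ^ 3) :
    circleCoord (3 * q ^ 4) (cycleY q z) = z := by
  obtain ⟨h1, h2⟩ := cycleY_eq hq (lt_cycleY hq hz) (cycleY_lt hq hz)
  rw [circleCoord, quarticRoot_three_mul hq]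
  exact (strictMonoOn_cycleY hq).injOn h1 hz h2

theorem circle_mem_innerRegion {q : ℝ} (hq : 0 < q) {R : ℝ} (hR : R ∈ Ioo 0 (2 * q ^ 3))
    (θ : ℝ) : (3 * q ^ 4, R * Real.cos θ, cycleY q (R * Real.sin θ)) ∈ innerRegion := by
  have hz := abs_mul_sin_lt hR θ
  have e : √(3 * q ^ 4 / 3) = q ^ 2 := by
    rw [show 3 * q ^ 4 / 3 = (q ^ 2) ^ 2 by ring, Real.sqrt_sq (by positivity)]
  refine ⟨by positivity, ?_, ?_⟩
  · simp only
    rw [e]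
    exact cycleY_lt hq hz
  · simp only
    rw [saddleLevel, e, cuspH_cycleY hq hz.le]
    have h1 : R ^ 2 < (2 * q ^ 3) ^ 2 := by
      have := hR.1; have := hR.2
      gcongr
    have h2 : (R * Real.cos θ) ^ 2 + (R * Real.sin θ) ^ 2 = R ^ 2 := by
      rw [mul_pow, mul_pow, ← mul_add, Real.cos_sq_add_sin_sq, mul_one]
    rw [h2]
    linarith

/-- Polar coordinates in the (x, z)-plane. The condition x ≠ 0 excludes the centre; the points it
loses are recovered later by density. -/
theorem exists_circle_eq {p : ℝ × ℝ × ℝ} (hp : p ∈ innerRegion) (hx : p.2.1 ≠ 0) :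
    ∃ q R θ : ℝ, 0 < q ∧ R ∈ Ioo 0 (2 * q ^ 3) ∧
      p = (3 * q ^ 4, R * Real.cos θ, cycleY q (R * Real.sin θ)) := by
  obtain ⟨lam, x, y⟩ := p
  obtain ⟨hq, hl, hy1, hy2, -, -, hlt⟩ := mem_innerRegion hp
  set q := quarticRoot lam with hqdef
  set z := circleCoord lam y with hz
  let w : ℂ := ⟨x, z⟩
  have hw : w ≠ 0 := fun h => hx (congrArg Complex.re h)
  have hw2 : ‖w‖ ^ 2 = x ^ 2 + z ^ 2 := by
    rw [Complex.sq_norm, Complex.normSq_mk]; ring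
  refine ⟨q, ‖w‖, w.arg, hq, ⟨norm_pos_iff.2 hw, ?_⟩, ?_⟩
  · refine lt_of_pow_lt_pow_left₀ 2 (by positivity) ?_
    rw [hw2]
    linarith
  · rw [Complex.norm_mul_cos_arg, Complex.norm_mul_sin_arg]
    simp only [w]
    rw [← hl, hz, circleCoord, ← hqdef, (cycleY_eq hq hy1 hy2).2]

/-- The primitive along each cycle is given by an average over the rotated points, which requires no
base point on the cycle. Zero mean is what makes it single-valued. -/
theorem exists_inner_solution {r : ℝ × ℝ × ℝ → ℝ} (hr : FlatOn nodeLocus r)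
    (hM : ∀ q, 0 < q → ∀ R ∈ Ioo 0 (2 * q ^ 3),
      circleMean (fun p => r (levelPoint p)) q R = 0) :
    ∃ a : ℝ × ℝ × ℝ → ℝ, ContDiff ℝ ∞ a ∧ (∀ p ∉ innerRegion, a p = 0) ∧
      ∀ p ∈ innerRegion, p.2.1 ≠ 0 → cuspBracket a p = r (levelPoint p) := by
  have hF := contDiff_indicator_inner hr
  set F := {p : (ℝ × ℝ × ℝ) × ℝ | p.1 ∈ innerRegion}.indicator fun p => p.2 *
      (r (p.1.1, cuspH p.1.1 p.1.2, 2 * quarticRoot p.1.1 ^ 2 *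
        Real.cos (cubicAngle (rotatedCoord p))) *
      (4 / 3 * (quarticRoot p.1.1)⁻¹ * Real.sin (cubicAngle (rotatedCoord p)) *
        (√(4 - rotatedCoord p ^ 2))⁻¹)) with hFdef
  -- The θ-derivative of the integral is 2π g(θ), and d/dθ is half of Y' times the Hamiltonian
  -- derivative; hence the factor 1 / (4π).
  let a : ℝ × ℝ × ℝ → ℝ := fun p => 1 / (4 * Real.pi) * ∫ t in (0 : ℝ)..2 * Real.pi, F (p, t)
  have ha : ContDiff ℝ ∞ a := contDiff_const.mul (contDiff_integral_param 0 (2 * Real.pi) hF)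
  refine ⟨a, ha, fun p hp => ?_, fun p hp hx => ?_⟩
  · have : ∀ t, F (p, t) = 0 := fun t =>
      indicator_of_notMem (s := {p : (ℝ × ℝ × ℝ) × ℝ | p.1 ∈ innerRegion}) hp _
    simp [a, this]
  · obtain ⟨q, R, θ, hq, hR, rfl⟩ := exists_circle_eq hp hx
    have hH : ∀ θ, cuspH (3 * q ^ 4) (R * Real.cos θ, cycleY q (R * Real.sin θ)) =
        R ^ 2 - 2 * q ^ 6 := fun θ => by
      rw [cuspH_cycleY hq (abs_mul_sin_lt hR θ).le, mul_pow, mul_pow, ← mul_add,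
        Real.cos_sq_add_sin_sq, mul_one]
    let g : ℝ → ℝ := fun u => r (3 * q ^ 4, R ^ 2 - 2 * q ^ 6, cycleY q (R * Real.sin u)) *
      cycleYDeriv q (R * Real.sin u)
    have hgc : Continuous g := by
      have h1 := continuous_cycleYDeriv_mul_sin hq hR
      have h2 := continuous_cycleY q
      have h3 := hr.contDiff.continuous
      fun_prop
    have hper : Function.Periodic g (2 * Real.pi) := fun u => by simp [g]
    have hg0 : ∫ t in (0 : ℝ)..2 * Real.pi, g t = 0 := by
      refine Eq.trans ?_ (hM q hq R hR)
      refine intervalIntegral.integral_congr fun u _ => ?_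
      simp only [levelPoint, hH, g]
    have hval : ∀ θ, a (3 * q ^ 4, R * Real.cos θ, cycleY q (R * Real.sin θ)) =
        1 / (4 * Real.pi) * ∫ t in (0 : ℝ)..2 * Real.pi, t * g (θ + t) := by
      intro θ
      simp only [a]
      congr 1
      refine intervalIntegral.integral_congr fun t _ => ?_
      have hmem : (((3 * q ^ 4, R * Real.cos θ, cycleY q (R * Real.sin θ)), t) :
          (ℝ × ℝ × ℝ) × ℝ) ∈ {p : (ℝ × ℝ × ℝ) × ℝ | p.1 ∈ innerRegion} :=
        circle_mem_innerRegion hq hR θ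
      have hrot : rotatedCoord ((3 * q ^ 4, R * Real.cos θ, cycleY q (R * Real.sin θ)), t) =
          R * Real.sin (θ + t) / q ^ 3 := by
        simp only [rotatedCoord]
        rw [circleCoord_cycleY hq (abs_mul_sin_lt hR θ), quarticRoot_three_mul hq, Real.sin_add]
        ring
      simp only [hFdef]
      rw [indicator_of_mem hmem, hrot]
      simp only [hH, quarticRoot_three_mul hq]
      rfl
    have h1 := hasDerivAt_comp_circle_curve ha hq hR θ
    simp only [hval] at h1
    have h2 := h1.unique ((hasDerivAt_integral_mul_comp_add hgc hper hg0 θ).const_mul _)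
    have hpos := cycleYDeriv_pos hq (abs_mul_sin_lt hR θ)
    have hpi := Real.pi_pos
    simp only [levelPoint, hH]
    refine mul_right_cancel₀ hpos.ne' ?_
    have h3 : 1 / (4 * Real.pi) * (2 * Real.pi * g θ) = 1 / 2 * g θ := by
      field_simp
      norm_num
    rw [h3] at h2
    simp only [g] at h2
    linarith

/-! ### The largest root of the level cubic -/

/-- The pairs `(lam, ρ)` for which `ρ` is the relevant root of `t ^ 3 - lam * t + h`, where
`h = lam * ρ - ρ ^ 3`: the largest root, or the only one. -/
def rootRegion : Set (ℝ × ℝ) :=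
  {w | (0 < w.2 ∧ w.1 < 3 * w.2 ^ 2) ∨ (w.2 < 0 ∧ 4 * w.1 < 3 * w.2 ^ 2) ∨ w.1 < 0}

theorem isOpen_rootRegion : IsOpen rootRegion :=
  ((isOpen_lt continuous_const continuous_snd).inter
    (isOpen_lt continuous_fst (by fun_prop : Continuous fun w : ℝ × ℝ => 3 * w.2 ^ 2))).union
    (((isOpen_lt continuous_snd continuous_const).inter
      (isOpen_lt (by fun_prop : Continuous fun w : ℝ × ℝ => 4 * w.1)
        (by fun_prop : Continuous fun w : ℝ × ℝ => 3 * w.2 ^ 2))).union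
      (isOpen_lt continuous_fst continuous_const))

theorem rootRegion_pos {lam ρ : ℝ} (h : (lam, ρ) ∈ rootRegion) : 0 < 3 * ρ ^ 2 - lam := by
  rcases h with ⟨h1, h2⟩ | ⟨h1, h2⟩ | h1 <;> simp only at *
  · linarith
  · have := mul_pos_of_neg_of_neg h1 h1
    nlinarith
  · nlinarith [sq_nonneg ρ]

/-- Distinct roots of one cubic satisfy lam = ρ² + ρσ + σ². This gives lam ≥ 0 and lam ≥ ¾σ², and
lam ≥ 3 min(ρ, σ)² if both are positive, against the inequalities defining the region. -/
theorem rootRegion_unique {lam ρ σ : ℝ} (hρ : (lam, ρ) ∈ rootRegion)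
    (hσ : (lam, σ) ∈ rootRegion) (h : lam * ρ - ρ ^ 3 = lam * σ - σ ^ 3) : ρ = σ := by
  by_contra hne
  have hl : lam = ρ ^ 2 + ρ * σ + σ ^ 2 := by
    have : (ρ - σ) * (lam - (ρ ^ 2 + ρ * σ + σ ^ 2)) = 0 := by linear_combination h
    have := (mul_eq_zero.1 this).resolve_left (sub_ne_zero.2 hne)
    linarith
  have hl0 : 0 ≤ lam := by rw [hl]; nlinarith [sq_nonneg (ρ + σ), sq_nonneg ρ, sq_nonneg σ]
  rcases hρ with ⟨h1, h2⟩ | ⟨h1, h2⟩ | h1 <;> rcases hσ with ⟨h3, h4⟩ | ⟨h3, h4⟩ | h3 <;>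
    simp only at * <;> try linarith
  · rcases le_total ρ σ with h5 | h5 <;> nlinarith
  · nlinarith [sq_nonneg (2 * ρ + σ)]
  · nlinarith [sq_nonneg (2 * σ + ρ)]
  · nlinarith [mul_pos_of_neg_of_neg h1 h3, sq_nonneg ρ, sq_nonneg σ]

/-- Intermediate values of lam t - t³. It takes the saddle value at the double root s and at the
simple root -2s, so the root is sought to the right of s for lower levels and to the left of -2s for
higher ones; `k` is large enough for the function to pass h. -/
theorem exists_root {lam h : ℝ} (hA : lam < 0 ∨ h ≠ saddleLevel lam) :
    ∃ ρ, (lam, ρ) ∈ rootRegion ∧ lam * ρ - ρ ^ 3 = h := by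
  have hc : Continuous fun ρ : ℝ => lam * ρ - ρ ^ 3 := by fun_prop
  set k := |h| + 1 with hk
  have hk1 : 1 ≤ k := by have := abs_nonneg h; linarith
  have hk2 : k ≤ k ^ 3 := le_self_pow₀ hk1 (by norm_num)
  have h1 := abs_le.1 (le_refl |h|)
  rcases lt_or_ge lam 0 with hl | hl
  · obtain ⟨ρ, -, e⟩ := intermediate_value_Icc' (show -k ≤ k by linarith) hc.continuousOn
      (show h ∈ Icc (lam * k - k ^ 3) (lam * -k - (-k) ^ 3) by
        constructor <;> nlinarith)
    exact ⟨ρ, Or.inr (Or.inr hl), e⟩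
  · have hne := hA.resolve_left (not_lt.2 hl)
    set s := √(lam / 3) with hs
    have hs0 : 0 ≤ s := Real.sqrt_nonneg _
    have hls : lam = 3 * s ^ 2 := by
      rw [hs, Real.sq_sqrt (by positivity)]; ring
    have hsl : saddleLevel lam = 2 * s ^ 3 := rfl
    rw [hsl] at hne
    have hM : |h| ≤ (2 * s + k) * ((2 * s + k) ^ 2 - 3 * s ^ 2) := by
      have : k * k ^ 2 ≤ (2 * s + k) * ((2 * s + k) ^ 2 - 3 * s ^ 2) := by
        refine mul_le_mul (by linarith) (by nlinarith) (by positivity) (by positivity)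
      nlinarith
    rcases lt_or_gt_of_ne hne with hlt | hgt
    · obtain ⟨ρ, hρ, e⟩ := intermediate_value_Icc' (show s ≤ 2 * s + k by linarith)
        hc.continuousOn (show h ∈ Icc (lam * (2 * s + k) - (2 * s + k) ^ 3)
          (lam * s - s ^ 3) by
          rw [hls]
          constructor <;> nlinarith)
      simp only at e
      have hρs : s < ρ := lt_of_le_of_ne hρ.1 fun h' => by
        rw [← h', hls] at e; nlinarith
      refine ⟨ρ, Or.inl ⟨by simp only; linarith, ?_⟩, e⟩
      simp only
      rw [hls]
      have : s ^ 2 < ρ ^ 2 := by gcongr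
      linarith
    · obtain ⟨ρ, hρ, e⟩ := intermediate_value_Icc' (show -(2 * s + k) ≤ -(2 * s) by linarith)
        hc.continuousOn (show h ∈ Icc (lam * (-(2 * s)) - (-(2 * s)) ^ 3)
          (lam * (-(2 * s + k)) - (-(2 * s + k)) ^ 3) by
          rw [hls]
          constructor <;> nlinarith)
      simp only at e
      have hρs : ρ < -(2 * s) := lt_of_le_of_ne hρ.2 fun h' => by
        rw [h', hls] at e; nlinarith
      refine ⟨ρ, Or.inr (Or.inl ⟨by simp only; linarith, ?_⟩), e⟩
      simp only
      rw [hls]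
      nlinarith

open Classical in
/-- The relevant root `ρ` of the cubic `t ^ 3 - lam * t + h`. -/
noncomputable def levelRoot (w : ℝ × ℝ) : ℝ :=
  if h : ∃ ρ, (w.1, ρ) ∈ rootRegion ∧ w.1 * ρ - ρ ^ 3 = w.2 then h.choose else 0

theorem levelRoot_spec {w : ℝ × ℝ} (hA : w.1 < 0 ∨ w.2 ≠ saddleLevel w.1) :
    (w.1, levelRoot w) ∈ rootRegion ∧ w.1 * levelRoot w - levelRoot w ^ 3 = w.2 := by
  have h := exists_root hA
  rw [levelRoot, dif_pos h]
  exact h.choose_spec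

theorem levelRoot_eq {lam ρ : ℝ} (h : (lam, ρ) ∈ rootRegion) :
    levelRoot (lam, lam * ρ - ρ ^ 3) = ρ := by
  have h' : ∃ σ, (lam, σ) ∈ rootRegion ∧ lam * σ - σ ^ 3 = lam * ρ - ρ ^ 3 := ⟨ρ, h, rfl⟩
  rw [levelRoot, dif_pos h']
  exact rootRegion_unique h'.choose_spec.1 h h'.choose_spec.2

/-- The map (lam, ρ) ↦ (lam, lam ρ - ρ³) has invertible differential where 3ρ² - lam > 0. Its local
inverse stays in the open set `rootRegion`, so by uniqueness of the root it is `levelRoot`. -/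
theorem hasFDerivAt_levelRoot {w : ℝ × ℝ} (hA : w.1 < 0 ∨ w.2 ≠ saddleLevel w.1) :
    HasFDerivAt levelRoot ((levelRoot w * (3 * levelRoot w ^ 2 - w.1)⁻¹) •
      ContinuousLinearMap.fst ℝ ℝ ℝ - (3 * levelRoot w ^ 2 - w.1)⁻¹ •
      ContinuousLinearMap.snd ℝ ℝ ℝ) w := by
  obtain ⟨hB, hw⟩ := levelRoot_spec hA
  obtain ⟨lam, h⟩ := w
  simp only at hB hw ⊢
  set ρ := levelRoot (lam, h) with hρ
  have hD := rootRegion_pos hB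
  set d := 3 * ρ ^ 2 - lam with hd
  let f : ℝ × ℝ → ℝ × ℝ := fun v => (v.1, v.1 * v.2 - v.2 ^ 3)
  let A : ℝ × ℝ →L[ℝ] ℝ × ℝ := (ContinuousLinearMap.fst ℝ ℝ ℝ).prod
    (ρ • ContinuousLinearMap.fst ℝ ℝ ℝ - d • ContinuousLinearMap.snd ℝ ℝ ℝ)
  let A' : ℝ × ℝ →L[ℝ] ℝ × ℝ := (ContinuousLinearMap.fst ℝ ℝ ℝ).prod
    ((ρ * d⁻¹) • ContinuousLinearMap.fst ℝ ℝ ℝ - d⁻¹ • ContinuousLinearMap.snd ℝ ℝ ℝ)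
  let e : (ℝ × ℝ) ≃L[ℝ] ℝ × ℝ := ContinuousLinearEquiv.equivOfInverse A A'
    (fun v => by
      ext
      · simp [A, A']
      · simp [A, A']; field_simp; ring)
    (fun v => by
      ext
      · simp [A, A']
      · simp [A, A']; field_simp; ring)
  have hf : HasStrictFDerivAt f (e : ℝ × ℝ →L[ℝ] ℝ × ℝ) (lam, ρ) := by
    have h1 : HasStrictFDerivAt (fun v : ℝ × ℝ => v.1) (ContinuousLinearMap.fst ℝ ℝ ℝ) (lam, ρ) :=
      hasStrictFDerivAt_fst
    have h2 : HasStrictFDerivAt (fun v : ℝ × ℝ => v.2) (ContinuousLinearMap.snd ℝ ℝ ℝ) (lam, ρ) :=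
      hasStrictFDerivAt_snd
    refine (h1.prodMk ((h1.mul h2).sub (h2.pow 3))).congr_fderiv ?_
    ext
    · simp [e, A]
    · simp [e, A]
    · simp [e, A]
    · simp [e, A, hd]
  have hinv := hf.to_localInverse
  have hfw : f (lam, ρ) = (lam, h) := by simp only [f]; rw [hw]
  have hr := hf.eventually_right_inverse
  rw [hfw] at hinv hr
  set g := hf.localInverse f e (lam, ρ)
  have hgw : g (lam, h) = (lam, ρ) := by
    have := hf.localInverse_apply_image
    rwa [hfw] at this
  have hgB : ∀ᶠ v in 𝓝 (lam, h), g v ∈ rootRegion := by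
    have := hinv.hasFDerivAt.continuousAt
    refine this.eventually (isOpen_rootRegion.mem_nhds ?_)
    rw [hgw]; exact hB
  have hd2 := hinv.hasFDerivAt.snd
  refine (hd2.congr_of_eventuallyEq ?_).congr_fderiv ?_
  · filter_upwards [hr, hgB] with v h1 h2
    have e0 := Prod.ext_iff.1 h1
    have e1 : (g v).1 = v.1 := e0.1
    have e2 : (g v).1 * (g v).2 - (g v).2 ^ 3 = v.2 := e0.2
    have h3 := levelRoot_eq (lam := (g v).1) (ρ := (g v).2) h2
    rw [e2, e1] at h3
    exact h3
  · ext <;> rfl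

theorem abs_root_le (lam ρ : ℝ) : |ρ| ≤ 1 + |lam| + |lam * ρ - ρ ^ 3| := by
  rcases le_or_gt |ρ| 1 with h | h
  · have := abs_nonneg lam
    have := abs_nonneg (lam * ρ - ρ ^ 3)
    linarith
  · have h1 : |ρ| ^ 3 ≤ |lam| * |ρ| + |lam * ρ - ρ ^ 3| := by
      have := abs_sub_abs_le_abs_sub (ρ ^ 3) (lam * ρ)
      rw [abs_pow, abs_mul, abs_sub_comm (ρ ^ 3)] at this
      linarith
    have h2 := abs_nonneg (lam * ρ - ρ ^ 3)
    have h3 : |ρ| * |ρ| ^ 2 ≤ |ρ| * (|lam| + |lam * ρ - ρ ^ 3|) := by nlinarith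
    have h4 : |ρ| ^ 2 ≤ |lam| + |lam * ρ - ρ ^ 3| := le_of_mul_le_mul_left h3 (by linarith)
    nlinarith

/-- The quotient of the cubic by `t - ρ` controls the distance from the saddle points. -/
theorem nodeDist_le_mul_quadratic {lam ρ t : ℝ} (hB : (lam, ρ) ∈ rootRegion) (ht : ρ ≤ t) :
    0 < t ^ 2 + t * ρ + ρ ^ 2 - lam ∧ nodeDist lam (lam * ρ - ρ ^ 3) ≤
      (4 + 4 * |ρ|) * (t ^ 2 + t * ρ + ρ ^ 2 - lam) := by
  rcases lt_or_ge lam 0 with hl | hl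
  · have hQ : 3 / 4 * (ρ ^ 2 - lam) ≤ t ^ 2 + t * ρ + ρ ^ 2 - lam := by
      nlinarith [sq_nonneg (2 * t + ρ)]
    have h0 : 0 < ρ ^ 2 - lam := by nlinarith [sq_nonneg ρ]
    refine ⟨by linarith, ?_⟩
    have hs : saddleLevel lam = 0 := by
      rw [saddleLevel, Real.sqrt_eq_zero_of_nonpos (by linarith)]; ring
    have hh : |lam * ρ - ρ ^ 3| = |ρ| * (ρ ^ 2 - lam) := by
      rw [show lam * ρ - ρ ^ 3 = -(ρ * (ρ ^ 2 - lam)) by ring, abs_neg, abs_mul, abs_of_pos h0]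
    rw [nodeDist, hs, sub_zero, hh, max_eq_left (by linarith)]
    have h1 := abs_nonneg ρ
    have h2 : (4 + 4 * |ρ|) * (3 / 4 * (ρ ^ 2 - lam)) ≤
        (4 + 4 * |ρ|) * (t ^ 2 + t * ρ + ρ ^ 2 - lam) :=
      mul_le_mul_of_nonneg_left hQ (by positivity)
    nlinarith [mul_nonneg h1 h0.le, sq_nonneg ρ]
  · set s := √(lam / 3) with hs
    have hs0 : 0 ≤ s := Real.sqrt_nonneg _
    have hls : lam = 3 * s ^ 2 := by
      rw [hs, Real.sq_sqrt (by positivity)]; ring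
    have hsl : saddleLevel lam = 2 * s ^ 3 := rfl
    have hW : nodeDist lam (lam * ρ - ρ ^ 3) = |(ρ - s) ^ 2 * (ρ + 2 * s)| := by
      rw [nodeDist, max_eq_right (by linarith), hsl, add_zero, ← abs_neg]
      congr 1
      rw [hls]; ring
    rw [hW]
    rcases hB with ⟨h1, h2⟩ | ⟨h1, h2⟩ | h1 <;> simp only at *
    · have hρs : s < ρ := lt_of_pow_lt_pow_left₀ 2 h1.le (by linarith)
      have hQ : 3 * (ρ - s) * (ρ + s) ≤ t ^ 2 + t * ρ + ρ ^ 2 - lam := by nlinarith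
      have h3 : 0 < (ρ - s) * (ρ + s) := mul_pos (by linarith) (by linarith)
      refine ⟨by linarith, ?_⟩
      rw [abs_of_nonneg (mul_nonneg (sq_nonneg _) (by linarith)), abs_of_pos h1]
      have h4 : (ρ - s) ^ 2 * (ρ + 2 * s) ≤ (2 * ρ) * ((ρ - s) * (ρ + s)) := by
        have h5 : (ρ - s) * (ρ + 2 * s) ≤ (2 * ρ) * (ρ + s) := by nlinarith
        have := mul_le_mul_of_nonneg_left h5 (show 0 ≤ ρ - s by linarith)
        nlinarith
      have h6 : (4 + 4 * ρ) * (3 * (ρ - s) * (ρ + s)) ≤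
          (4 + 4 * ρ) * (t ^ 2 + t * ρ + ρ ^ 2 - lam) :=
        mul_le_mul_of_nonneg_left hQ (by positivity)
      nlinarith [mul_pos h1 h3]
    · have hρs : 2 * s < -ρ := by
        refine lt_of_pow_lt_pow_left₀ 2 (by linarith) ?_
        nlinarith
      have hQ : 3 / 4 * ((-ρ - 2 * s) * (-ρ + 2 * s)) ≤ t ^ 2 + t * ρ + ρ ^ 2 - lam := by
        nlinarith [sq_nonneg (2 * t + ρ)]
      have h3 : 0 < (-ρ - 2 * s) * (-ρ + 2 * s) := mul_pos (by linarith) (by linarith)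
      refine ⟨by linarith, ?_⟩
      rw [abs_of_nonpos (mul_nonpos_of_nonneg_of_nonpos (sq_nonneg _) (by linarith)),
        abs_of_neg h1]
      have h4 : -((ρ - s) ^ 2 * (ρ + 2 * s)) ≤ (2 * -ρ) * ((-ρ - 2 * s) * (-ρ + 2 * s)) := by
        have h5 : (s - ρ) ^ 2 ≤ (2 * -ρ) * (-ρ + 2 * s) := by nlinarith
        have := mul_le_mul_of_nonneg_left h5 (show 0 ≤ -ρ - 2 * s by linarith)
        nlinarith
      have h6 : (4 + 4 * -ρ) * (3 / 4 * ((-ρ - 2 * s) * (-ρ + 2 * s))) ≤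
          (4 + 4 * -ρ) * (t ^ 2 + t * ρ + ρ ^ 2 - lam) :=
        mul_le_mul_of_nonneg_left hQ (by linarith)
      nlinarith [mul_pos (neg_pos.2 h1) h3]
    · linarith

/-! ### The solution outside the vanishing discs -/

/-- The part of the space outside the vanishing discs and the levels of the saddle points. -/
def outerRegion : Set (ℝ × ℝ × ℝ) :=
  {p | p.1 < 0 ∨ saddleLevel p.1 < cuspH p.1 p.2 ∨
    (√(p.1 / 3) < p.2.2 ∧ cuspH p.1 p.2 < saddleLevel p.1)}

theorem isOpen_outerRegion : IsOpen outerRegion := by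
  have h1 : Continuous fun p : ℝ × ℝ × ℝ => saddleLevel p.1 :=
    continuous_saddleLevel.comp continuous_fst
  have h2 : Continuous fun p : ℝ × ℝ × ℝ => cuspH p.1 p.2 := by unfold cuspH; fun_prop
  have h3 : Continuous fun p : ℝ × ℝ × ℝ => √(p.1 / 3) := by fun_prop
  exact (isOpen_lt continuous_fst continuous_const).union ((isOpen_lt h1 h2).union
    ((isOpen_lt h3 (continuous_snd.comp continuous_snd)).inter (isOpen_lt h2 h1)))

theorem outerRegion_level {p : ℝ × ℝ × ℝ} (hp : p ∈ outerRegion) :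
    p.1 < 0 ∨ cuspH p.1 p.2 ≠ saddleLevel p.1 := by
  rcases hp with h | h | h
  · exact Or.inl h
  · exact Or.inr h.ne'
  · exact Or.inr h.2.ne

/-- The root for the level of a point. -/
noncomputable def pointRoot (p : ℝ × ℝ × ℝ) : ℝ := levelRoot (p.1, cuspH p.1 p.2)

/-- On the level, (y - ρ)(y² + yρ + ρ² - lam) = x² ≥ 0. If y < ρ, the second factor is not positive,
which is possible only below the saddle level and to the left of the saddle, that is, in a vanishing
disc. -/
theorem pointRoot_spec {p : ℝ × ℝ × ℝ} (hp : p ∈ outerRegion) :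
    (p.1, pointRoot p) ∈ rootRegion ∧
      p.1 * pointRoot p - pointRoot p ^ 3 = cuspH p.1 p.2 ∧ pointRoot p ≤ p.2.2 := by
  obtain ⟨h1, h2⟩ := levelRoot_spec (w := (p.1, cuspH p.1 p.2)) (outerRegion_level hp)
  obtain ⟨lam, x, y⟩ := p
  refine ⟨h1, h2, ?_⟩
  change (lam, levelRoot (lam, cuspH lam (x, y))) ∈ rootRegion at h1
  change levelRoot (lam, cuspH lam (x, y)) ≤ y
  simp only at h2
  set ρ := levelRoot (lam, cuspH lam (x, y))
  by_contra hlt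
  rw [not_le] at hlt
  have hfac : (y - ρ) * (y ^ 2 + y * ρ + ρ ^ 2 - lam) = x ^ 2 := by
    simp only [cuspH] at h2
    linear_combination h2
  have hQ : y ^ 2 + y * ρ + ρ ^ 2 - lam ≤ 0 := by
    by_contra hcon
    nlinarith [sq_nonneg x, mul_neg_of_neg_of_pos (sub_neg.2 hlt) (not_le.1 hcon)]
  rcases lt_or_ge lam 0 with hl | hl
  · nlinarith [sq_nonneg (2 * y + ρ), sq_nonneg ρ]
  · rcases h1 with ⟨h3, h4⟩ | ⟨h3, h4⟩ | h3 <;> simp only at *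
    · set s := √(lam / 3) with hs
      have hs0 : 0 ≤ s := Real.sqrt_nonneg _
      have hls : lam = 3 * s ^ 2 := by
        rw [hs, Real.sq_sqrt (by positivity)]; ring
      have hsl : saddleLevel lam = 2 * s ^ 3 := rfl
      have hρs : s < ρ := lt_of_pow_lt_pow_left₀ 2 h3.le (by linarith)
      have hlev : cuspH lam (x, y) < saddleLevel lam := by
        rw [← h2, hsl, hls]
        have : 0 < (ρ - s) ^ 2 * (ρ + 2 * s) :=
          mul_pos (pow_pos (by linarith) 2) (by linarith)
        nlinarith
      rcases hp with h5 | h5 | h5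
      · exact absurd h5 (not_lt.2 hl)
      · exact absurd h5 (not_lt.2 hlev.le)
      · have h6 : s < y := h5.1
        nlinarith
    · nlinarith [sq_nonneg (2 * y + ρ)]
    · linarith

/-- A point outside the region and below the saddle level would lie in the open `innerRegion`, which
does not meet the outer one. -/
theorem nodeDist_of_mem_closure_outerRegion {p : ℝ × ℝ × ℝ} (hp : p ∈ closure outerRegion)
    (hp' : p ∉ outerRegion) : nodeDist p.1 (cuspH p.1 p.2) = 0 := by
  obtain ⟨lam, x, y⟩ := p
  have hc1 : Continuous fun p : ℝ × ℝ × ℝ => saddleLevel p.1 :=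
    continuous_saddleLevel.comp continuous_fst
  have hc2 : Continuous fun p : ℝ × ℝ × ℝ => cuspH p.1 p.2 := by unfold cuspH; fun_prop
  have hc3 : Continuous fun p : ℝ × ℝ × ℝ => √(p.1 / 3) := by fun_prop
  simp only [outerRegion, mem_ofPred_eq, not_or, not_and, not_lt] at hp'
  obtain ⟨h1, h2, h3⟩ := hp'
  have hn : nodeDist lam (cuspH lam (x, y)) = saddleLevel lam - cuspH lam (x, y) := by
    rw [nodeDist, max_eq_right (by linarith), abs_of_nonpos (by linarith)]; ring
  simp only
  rw [hn]
  rcases h2.eq_or_lt with h4 | h4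
  · rw [h4, sub_self]
  · exfalso
    have hs0 : 0 ≤ √(lam / 3) := Real.sqrt_nonneg _
    have hls : lam = 3 * √(lam / 3) ^ 2 := by
      rw [Real.sq_sqrt (by positivity)]; ring
    have hsl : saddleLevel lam = 2 * √(lam / 3) ^ 3 := rfl
    have h5 : y < √(lam / 3) := by
      by_contra hcon
      have := h3 (lt_of_le_of_ne (not_lt.1 hcon) fun h => by
        rw [hsl, cuspH, ← h] at h4
        simp only at h4
        nlinarith [sq_nonneg x])
      linarith
    have hl : 0 < lam := by
      refine lt_of_le_of_ne h1 fun h => ?_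
      rw [hsl] at h4
      rw [← h, zero_div, Real.sqrt_zero] at h4 h5
      simp only [cuspH] at h4
      nlinarith [sq_nonneg x, sq_nonneg y]
    have hopen : IsOpen {p : ℝ × ℝ × ℝ | 0 < p.1 ∧ p.2.2 < √(p.1 / 3) ∧
        cuspH p.1 p.2 < saddleLevel p.1} := isOpen_innerRegion
    obtain ⟨⟨lam', x', y'⟩, h6, h7⟩ := mem_closure_iff.1 hp _ hopen ⟨hl, h5, h4⟩
    rcases h7 with h7 | h7 | h7 <;> simp only [mem_ofPred_eq] at h6 h7
    · linarith
    · linarith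
    · linarith

/-- The points of the level that join the axis `x = 0` to a point. -/
noncomputable def pathPoint (p : (ℝ × ℝ × ℝ) × ℝ) : ℝ :=
  pointRoot p.1 + p.2 ^ 2 * (p.1.2.2 - pointRoot p.1)

/-- The quotient of the level cubic by `t - ρ`, where `ρ` is the root. -/
noncomputable def rootQuotient (p : ℝ × ℝ × ℝ) (t : ℝ) : ℝ :=
  t ^ 2 + t * pointRoot p + pointRoot p ^ 2 - p.1

theorem rootQuotient_bound {p : ℝ × ℝ × ℝ} (hp : p ∈ outerRegion) {t : ℝ}
    (ht : pointRoot p ≤ t) : 0 < rootQuotient p t ∧ nodeDist p.1 (cuspH p.1 p.2) ≤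
      (8 + 4 * |p.1| + 4 * |cuspH p.1 p.2|) * rootQuotient p t := by
  obtain ⟨h1, h2, -⟩ := pointRoot_spec hp
  obtain ⟨h3, h4⟩ := nodeDist_le_mul_quadratic h1 ht
  have h5 := abs_root_le p.1 (pointRoot p)
  rw [h2] at h4 h5
  refine ⟨h3, h4.trans ?_⟩
  refine mul_le_mul_of_nonneg_right ?_ h3.le
  linarith

theorem pointRoot_le_pathPoint {p : (ℝ × ℝ × ℝ) × ℝ} (hp : p.1 ∈ outerRegion) :
    pointRoot p.1 ≤ pathPoint p := by
  have := (pointRoot_spec hp).2.2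
  have h2 : 0 ≤ p.2 ^ 2 * (p.1.2.2 - pointRoot p.1) :=
    mul_nonneg (sq_nonneg _) (by linarith)
  unfold pathPoint
  linarith

/-- The integrand of the outer solution. The only singular generators are the inverse of 3ρ² - lam
and two inverse roots of the quadratic quotient of the cubic, and `nodeDist_le_mul_quadratic` bounds
all three. -/
theorem contDiff_indicator_outer {r : ℝ × ℝ × ℝ → ℝ} (hr : FlatOn nodeLocus r) :
    ContDiff ℝ ∞ ({p : (ℝ × ℝ × ℝ) × ℝ | p.1 ∈ outerRegion}.indicator fun p =>
      p.1.2.1 * (√(rootQuotient p.1 p.1.2.2))⁻¹ * (√(rootQuotient p.1 (pathPoint p)))⁻¹ *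
        r (p.1.1, cuspH p.1.1 p.1.2, pathPoint p)) := by
  set O : Set ((ℝ × ℝ × ℝ) × ℝ) := {p | p.1 ∈ outerRegion} with hOdef
  have hO : IsOpen O := isOpen_outerRegion.preimage continuous_fst
  let L : (ℝ × ℝ × ℝ) × ℝ → ℝ := fun p => coordFour 0 p
  let X : (ℝ × ℝ × ℝ) × ℝ → ℝ := fun p => coordFour 1 p
  let Y : (ℝ × ℝ × ℝ) × ℝ → ℝ := fun p => coordFour 2 p
  let T : (ℝ × ℝ × ℝ) × ℝ → ℝ := fun p => coordFour 3 p
  let ρ : (ℝ × ℝ × ℝ) × ℝ → ℝ := fun p => pointRoot p.1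
  let e : (ℝ × ℝ × ℝ) × ℝ → ℝ := (fun _ => 3) * ρ ^ 2 - L
  let D : (ℝ × ℝ × ℝ) × ℝ → ℝ := fun p => (e p)⁻¹
  let Z : (ℝ × ℝ × ℝ) × ℝ → ℝ := ρ + T ^ 2 * (Y - ρ)
  let A : (ℝ × ℝ × ℝ) × ℝ → ℝ := Y ^ 2 + Y * ρ + ρ ^ 2 - L
  let B : (ℝ × ℝ × ℝ) × ℝ → ℝ := Z ^ 2 + Z * ρ + ρ ^ 2 - L
  let k : (ℝ × ℝ × ℝ) × ℝ → ℝ := fun p => (√(A p))⁻¹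
  let l : (ℝ × ℝ × ℝ) × ℝ → ℝ := fun p => (√(B p))⁻¹
  have he0 : ∀ p ∈ O, 0 < e p := fun p hp => rootRegion_pos (pointRoot_spec hp).1
  have hA0 : ∀ p ∈ O, 0 < A p := fun p hp => (rootQuotient_bound hp (pointRoot_spec hp).2.2).1
  have hB0 : ∀ p ∈ O, 0 < B p := fun p hp =>
    (rootQuotient_bound hp (pointRoot_le_pathPoint hp)).1
  let s : Set ((ℝ × ℝ × ℝ) × ℝ → ℝ) := {L, X, Y, T, ρ, D, k, l}
  set 𝒜 := Algebra.adjoin ℝ s with h𝒜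
  set ℬ := coeffSubalgebra O coordFour 𝒜 with hℬ
  have hsub : ∀ γ ∈ s, γ ∈ 𝒜 := fun γ h => Algebra.subset_adjoin h
  have aρ : ρ ∈ 𝒜 := hsub _ (by simp [s])
  have aD : D ∈ 𝒜 := hsub _ (by simp [s])
  have ak : k ∈ 𝒜 := hsub _ (by simp [s])
  have al : l ∈ 𝒜 := hsub _ (by simp [s])
  have bL : L ∈ ℬ := mem_coeffSubalgebra_coord 0 (hsub _ (by simp [s, L]))
  have bX : X ∈ ℬ := mem_coeffSubalgebra_coord 1 (hsub _ (by simp [s, X]))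
  have bY : Y ∈ ℬ := mem_coeffSubalgebra_coord 2 (hsub _ (by simp [s, Y]))
  have bT : T ∈ ℬ := mem_coeffSubalgebra_coord 3 (hsub _ (by simp [s, T]))
  have bρ : ρ ∈ ℬ := by
    -- From dρ = (ρ dlam - dh) / (3ρ² - lam), with h = x² - y³ + lam y.
    refine ⟨aρ, ![ρ * D - D * Y, (-2 : ℝ) • (X * D), D * ((3 : ℝ) • Y ^ 2 - L), 0], ?_,
      fun p hp => ?_⟩
    · intro j
      fin_cases j
      · exact sub_mem (mul_mem aρ aD) (mul_mem aD bY.1)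
      · exact Subalgebra.smul_mem _ (mul_mem bX.1 aD) _
      · exact mul_mem aD (sub_mem (Subalgebra.smul_mem _ (pow_mem bY.1 2) _) bL.1)
      · exact zero_mem _
    · have h1 := hasFDerivAt_levelRoot (w := (p.1.1, cuspH p.1.1 p.1.2)) (outerRegion_level hp)
      have hL : HasFDerivAt (fun p : (ℝ × ℝ × ℝ) × ℝ => p.1.1) (coordFour 0) p :=
        (coordFour 0).hasFDerivAt
      have hX : HasFDerivAt (fun p : (ℝ × ℝ × ℝ) × ℝ => p.1.2.1) (coordFour 1) p :=
        (coordFour 1).hasFDerivAt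
      have hY : HasFDerivAt (fun p : (ℝ × ℝ × ℝ) × ℝ => p.1.2.2) (coordFour 2) p :=
        (coordFour 2).hasFDerivAt
      have hH : HasFDerivAt (fun p : (ℝ × ℝ × ℝ) × ℝ => cuspH p.1.1 p.1.2) _ p :=
        ((hX.pow 2).sub (hY.pow 3)).add (hL.mul hY)
      refine (h1.comp p (hL.prodMk hH)).congr_fderiv ?_
      have e1 : levelRoot (p.1.1, cuspH p.1.1 p.1.2) = ρ p := rfl
      have e2 : (3 * ρ p ^ 2 - p.1.1)⁻¹ = D p := rfl
      have e3 : X p = p.1.2.1 := rfl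
      have e4 : Y p = p.1.2.2 := rfl
      have e5 : L p = p.1.1 := rfl
      simp only [e1, e2]
      refine ContinuousLinearMap.ext fun v => ?_
      simp only [Fin.sum_univ_four, Matrix.cons_val_zero, Matrix.cons_val_one, Matrix.cons_val,
        Pi.zero_apply, Pi.sub_apply, Pi.mul_apply, Pi.smul_apply, Pi.pow_apply, smul_eq_mul,
        ContinuousLinearMap.comp_apply, sub_apply, add_apply, smul_apply,
        ContinuousLinearMap.prod_apply, ContinuousLinearMap.coe_fst',
        ContinuousLinearMap.coe_snd', e3, e4, e5, zero_mul, add_zero]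
      norm_num
      ring
  have bD : D ∈ ℬ := by
    refine mem_coeffSubalgebra_comp (φ := fun v => v⁻¹) (N := (-1 : ℝ) • D ^ 2)
      (sub_mem (mul_mem (mem_coeffSubalgebra_const 3) (pow_mem bρ 2)) bL) aD
      (Subalgebra.smul_mem _ (pow_mem aD 2) _) fun p hp => ?_
    refine (hasDerivAt_inv (he0 p hp).ne').congr_deriv ?_
    simp [D]
  have hsqrt : ∀ v : ℝ, 0 < v →
      HasDerivAt (fun v => (√v)⁻¹) (-(1 / 2) * (√v)⁻¹ ^ 3) v := by
    intro v hv
    have h2 : 0 < √v := Real.sqrt_pos.2 hv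
    refine (((hasDerivAt_id v).sqrt hv.ne').inv h2.ne').congr_deriv ?_
    simp only [id]
    field_simp
  have bA : A ∈ ℬ := sub_mem (add_mem (add_mem (pow_mem bY 2) (mul_mem bY bρ)) (pow_mem bρ 2)) bL
  have bZ : Z ∈ ℬ := add_mem bρ (mul_mem (pow_mem bT 2) (sub_mem bY bρ))
  have bB : B ∈ ℬ := sub_mem (add_mem (add_mem (pow_mem bZ 2) (mul_mem bZ bρ)) (pow_mem bρ 2)) bL
  have bk : k ∈ ℬ := mem_coeffSubalgebra_comp (φ := fun v => (√v)⁻¹)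
    (N := (-(1 / 2) : ℝ) • k ^ 3) bA ak (Subalgebra.smul_mem _ (pow_mem ak 3) _)
    fun p hp => hsqrt _ (hA0 p hp)
  have bl : l ∈ ℬ := mem_coeffSubalgebra_comp (φ := fun v => (√v)⁻¹)
    (N := (-(1 / 2) : ℝ) • l ^ 3) bB al (Subalgebra.smul_mem _ (pow_mem al 3) _)
    fun p hp => hsqrt _ (hB0 p hp)
  have cH : Continuous fun p : (ℝ × ℝ × ℝ) × ℝ => cuspH p.1.1 p.1.2 := by
    unfold cuspH; fun_prop
  have hWc : Continuous fun p : (ℝ × ℝ × ℝ) × ℝ => nodeDist p.1.1 (cuspH p.1.1 p.1.2) :=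
    continuous_nodeDist.comp (by fun_prop : Continuous
      fun p : (ℝ × ℝ × ℝ) × ℝ => (p.1.1, cuspH p.1.1 p.1.2))
  let b : (ℝ × ℝ × ℝ) × ℝ → ℝ := fun p => 8 + 4 * |p.1.1| + 4 * |cuspH p.1.1 p.1.2|
  have cb : Continuous b := by fun_prop
  have hρb : ∀ p ∈ O, |ρ p| ≤ b p := by
    intro p hp
    have h1 := abs_root_le p.1.1 (ρ p)
    have h2 : p.1.1 * ρ p - ρ p ^ 3 = cuspH p.1.1 p.1.2 := (pointRoot_spec hp).2.1
    rw [h2] at h1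
    have := abs_nonneg p.1.1
    have := abs_nonneg (cuspH p.1.1 p.1.2)
    simp only [b]
    linarith
  have hinv : ∀ Q : (ℝ × ℝ × ℝ) × ℝ → ℝ, (∀ p ∈ O, 0 < Q p) →
      (∀ p ∈ O, nodeDist p.1.1 (cuspH p.1.1 p.1.2) ≤ b p * Q p) → ∀ p ∈ O,
      |(√(Q p))⁻¹| ^ 2 * nodeDist p.1.1 (cuspH p.1.1 p.1.2) ^ 1 ≤ b p := by
    intro Q h1 h2 p hp
    rw [sq_abs, pow_one, inv_pow, Real.sq_sqrt (h1 p hp).le, inv_mul_le_iff₀ (h1 p hp)]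
    linarith [h2 p hp]
  have main := contDiff_indicator_mul_comp_level hO ?_ (s := s) ?_ ?_ ?_
    (Y := Z) (B := fun p => b p + p.2 ^ 2 * (|p.1.2.2| + b p)) bZ (by fun_prop) ?_
    (M := X * k * l) (mul_mem (mul_mem bX.1 ak) al) hr
  · exact main
  · intro p hp hp'
    exact nodeDist_of_mem_closure_outerRegion
      ((continuous_fst.closure_preimage_subset outerRegion) hp) hp'
  · rintro γ (rfl | rfl | rfl | rfl | rfl | rfl | rfl | rfl) <;> assumption
  · intro j
    fin_cases j
    · exact bL
    · exact bX
    · exact bY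
    · exact bT
  · rintro γ (rfl | rfl | rfl | rfl | rfl | rfl | rfl | rfl)
    · exact exists_bound_of_continuous (coordFour 0).continuous
    · exact exists_bound_of_continuous (coordFour 1).continuous
    · exact exists_bound_of_continuous (coordFour 2).continuous
    · exact exists_bound_of_continuous (coordFour 3).continuous
    · exact exists_bound_of_sq cb hWc 0 (fun p _ => nodeDist_nonneg _ _) 1 one_ne_zero
        fun p hp => by simpa using hρb p hp
    · refine exists_bound_of_sq cb hWc 1 (fun p _ => nodeDist_nonneg _ _) 1 one_ne_zero
        fun p hp => ?_
      have h1 := he0 p hp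
      have h2 := (rootQuotient_bound hp le_rfl).2
      have h3 : rootQuotient p.1 (pointRoot p.1) = e p := by
        change _ = 3 * pointRoot p.1 ^ 2 - p.1.1
        rw [rootQuotient]; ring
      rw [h3] at h2
      rw [pow_one, pow_one, abs_of_pos (inv_pos.2 h1), inv_mul_le_iff₀ h1]
      linarith
    · exact exists_bound_of_sq cb hWc 1 (fun p _ => nodeDist_nonneg _ _) 2 two_ne_zero
        (hinv A hA0 fun p hp => (rootQuotient_bound hp (pointRoot_spec hp).2.2).2)
    · exact exists_bound_of_sq cb hWc 1 (fun p _ => nodeDist_nonneg _ _) 2 two_ne_zero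
        (hinv B hB0 fun p hp => (rootQuotient_bound hp (pointRoot_le_pathPoint hp)).2)
  · intro p hp
    have h1 := hρb p hp
    change |ρ p + p.2 ^ 2 * (p.1.2.2 - ρ p)| ≤ _
    refine (abs_add_le _ _).trans (add_le_add h1 ?_)
    rw [abs_mul, abs_of_nonneg (sq_nonneg p.2)]
    refine mul_le_mul_of_nonneg_left ?_ (sq_nonneg _)
    exact (abs_sub _ _).trans (by linarith)

/-- With y = ρ + u² and x = u √Q(u) the level curve is parametrized smoothly through its point on
the axis x = 0, and the Hamiltonian time is du / √Q. The solution is the integral of r over this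
time from u = 0; the substitution v = t u turns it into an integral over [0, 1] that depends
smoothly on the point. The curve is not closed, so no condition on means arises. -/
theorem exists_outer_solution {r : ℝ × ℝ × ℝ → ℝ} (hr : FlatOn nodeLocus r) :
    ∃ a : ℝ × ℝ × ℝ → ℝ, ContDiff ℝ ∞ a ∧ (∀ p ∉ outerRegion, a p = 0) ∧
      ∀ p ∈ outerRegion, cuspBracket a p = r (levelPoint p) := by
  have hF := contDiff_indicator_outer hr
  set F := {p : (ℝ × ℝ × ℝ) × ℝ | p.1 ∈ outerRegion}.indicator fun p =>
      p.1.2.1 * (√(rootQuotient p.1 p.1.2.2))⁻¹ * (√(rootQuotient p.1 (pathPoint p)))⁻¹ *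
        r (p.1.1, cuspH p.1.1 p.1.2, pathPoint p) with hFdef
  let a : ℝ × ℝ × ℝ → ℝ := fun p => ∫ t in (0 : ℝ)..1, F (p, t)
  have ha : ContDiff ℝ ∞ a := contDiff_integral_param 0 1 hF
  refine ⟨a, ha, fun p hp => ?_, ?_⟩
  · have : ∀ t, F (p, t) = 0 := fun t =>
      indicator_of_notMem (s := {p : (ℝ × ℝ × ℝ) × ℝ | p.1 ∈ outerRegion}) hp _
    simp [a, this]
  · rintro ⟨lam, x, y⟩ hp
    obtain ⟨hB, hh, hy⟩ := pointRoot_spec hp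
    obtain ⟨hQy, -⟩ := rootQuotient_bound hp hy
    set ρ := pointRoot (lam, x, y) with hρ
    simp only at hB hh hy
    have hQ0 : ∀ u : ℝ, 0 < (ρ + u ^ 2) ^ 2 + (ρ + u ^ 2) * ρ + ρ ^ 2 - lam := fun u =>
      (rootQuotient_bound hp (by linarith [sq_nonneg u])).1
    let Q : ℝ → ℝ := fun u => (ρ + u ^ 2) ^ 2 + (ρ + u ^ 2) * ρ + ρ ^ 2 - lam
    let c : ℝ → ℝ × ℝ × ℝ := fun u => (lam, u * √(Q u), ρ + u ^ 2)
    set h := lam * ρ - ρ ^ 3 with hhdef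
    have hcH : ∀ u, cuspH lam (u * √(Q u), ρ + u ^ 2) = h := by
      intro u
      simp only [cuspH]
      rw [mul_pow, Real.sq_sqrt (hQ0 u).le]
      simp only [hhdef]
      ring
    have hcρ : ∀ u, pointRoot (c u) = ρ := fun u => by
      rw [pointRoot]
      simp only [c]
      rw [hcH, hhdef, levelRoot_eq hB]
    have hcc : Continuous c := by fun_prop
    have hQd : ∀ u, HasDerivAt Q ((6 * ρ + 4 * u ^ 2) * u) u := fun u => by
      have h1 : HasDerivAt (fun u : ℝ => ρ + u ^ 2) (2 * u) u := by
        simpa using (hasDerivAt_pow 2 u).const_add ρ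
      refine ((((h1.pow 2).add (h1.mul_const ρ)).add_const (ρ ^ 2)).sub_const lam).congr_deriv ?_
      norm_num
      ring
    -- The parameter of the given point. The inner quotient already equals it: Q there is the
    -- quadratic quotient at y, as `hQeq` shows, and the definition is simplified accordingly.
    set u₀ := x / √(Q (x / √(rootQuotient (lam, x, y) y))) with hu₀
    have hyρ : (x / √(rootQuotient (lam, x, y) y)) ^ 2 = y - ρ := by
      have h1 : (y - ρ) * rootQuotient (lam, x, y) y = x ^ 2 := by
        simp only [rootQuotient, cuspH] at hh ⊢
        rw [← hρ]
        linear_combination hh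
      rw [div_pow, Real.sq_sqrt hQy.le, ← h1]
      field_simp
    have hQeq : Q (x / √(rootQuotient (lam, x, y) y)) = rootQuotient (lam, x, y) y := by
      simp only [Q]
      rw [hyρ, rootQuotient, ← hρ]
      ring
    rw [hQeq] at hu₀
    rw [← hu₀] at hQeq hyρ
    have hcu : c u₀ = (lam, x, y) := by
      simp only [c]
      rw [hQeq, hyρ, hu₀, div_mul_cancel₀ _ (Real.sqrt_pos.2 hQy).ne']
      simp
    let g : ℝ → ℝ := fun u => (√(Q u))⁻¹ * r (lam, h, ρ + u ^ 2)
    have hgc : Continuous g := by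
      have h1 := hr.contDiff.continuous
      have h2 : Continuous fun u => (√(Q u))⁻¹ :=
        Continuous.inv₀ (by fun_prop) fun u => (Real.sqrt_pos.2 (hQ0 u)).ne'
      fun_prop
    have hval : ∀ᶠ u in 𝓝 u₀, a (c u) = ∫ v in (0 : ℝ)..u, g v := by
      have hmem : ∀ᶠ u in 𝓝 u₀, c u ∈ outerRegion :=
        hcc.continuousAt.eventually (isOpen_outerRegion.mem_nhds (by rw [hcu]; exact hp))
      filter_upwards [hmem] with u hu
      have e1 : ∫ v in (0 : ℝ)..u, g v = ∫ t in (0 : ℝ)..1, u * g (t * u) := by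
        have := intervalIntegral.mul_integral_comp_mul_right (a := 0) (b := 1) (f := g) u
        rw [zero_mul, one_mul] at this
        rw [← this, intervalIntegral.integral_const_mul]
      rw [e1]
      simp only [a]
      refine intervalIntegral.integral_congr fun t _ => ?_
      have hu' : (c u, t) ∈ {p : (ℝ × ℝ × ℝ) × ℝ | p.1 ∈ outerRegion} := hu
      have e2 : pathPoint (c u, t) = ρ + (t * u) ^ 2 := by
        simp only [pathPoint, hcρ, c]
        ring
      have e3 : rootQuotient (c u) (ρ + (t * u) ^ 2) = Q (t * u) := by
        rw [rootQuotient, hcρ]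
      have e4 : rootQuotient (c u) (c u).2.2 = Q u := by
        rw [rootQuotient, hcρ]
      have e5 : cuspH (c u).1 (c u).2 = h := hcH u
      simp only [hFdef]
      rw [indicator_of_mem hu']
      simp only
      rw [e4, e2, e3, e5]
      have e6 : √(Q u) ≠ 0 := (Real.sqrt_pos.2 (hQ0 u)).ne'
      simp only [g, c]
      field_simp
    have hd1 : HasDerivAt (fun u => a (c u)) (g u₀) u₀ :=
      (intervalIntegral.integral_hasDerivAt_right (hgc.intervalIntegrable _ _)
        (hgc.stronglyMeasurableAtFilter _ _) hgc.continuousAt).congr_of_eventuallyEq hval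
    set w := √(Q u₀) with hw
    have hw0 : 0 < w := Real.sqrt_pos.2 (hQ0 u₀)
    have hw2 : w ^ 2 = Q u₀ := Real.sq_sqrt (hQ0 u₀).le
    have hx : x = u₀ * w := by
      have := congrArg (fun p : ℝ × ℝ × ℝ => p.2.1) hcu
      exact this.symm
    have hc' : HasDerivAt c (0, w⁻¹ * (3 * y ^ 2 - lam), w⁻¹ * (2 * x)) u₀ := by
      refine (hasDerivAt_const _ _).prodMk (HasDerivAt.prodMk ?_ ?_)
      · refine ((hasDerivAt_id u₀).mul ((hQd u₀).sqrt (hQ0 u₀).ne')).congr_deriv ?_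
        rw [← hw]
        have hy' : y = ρ + u₀ ^ 2 := by linarith
        simp only [id]
        rw [hy']
        simp only [Q] at hw2
        field_simp
        linear_combination 2 * hw2
      · refine ((hasDerivAt_pow 2 u₀).const_add ρ).congr_deriv ?_
        rw [hx]
        field_simp
        norm_num
    have hd2 := ha.hasDerivAt_comp_infty hc'
    rw [hcu] at hd2
    have hd3 := hd2.unique hd1
    have e7 : ((0, w⁻¹ * (3 * y ^ 2 - lam), w⁻¹ * (2 * x)) : ℝ × ℝ × ℝ) =
        w⁻¹ • ((3 * y ^ 2 - lam) • ((0, 1, 0) : ℝ × ℝ × ℝ) +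
          (2 * x) • ((0, 0, 1) : ℝ × ℝ × ℝ)) := by simp
    have e8 : cuspBracket a (lam, x, y) = w * (w⁻¹ * r (lam, h, y)) := by
      have e9 : g u₀ = w⁻¹ * r (lam, h, y) := by
        simp only [g]
        rw [hyρ, add_sub_cancel]
      rw [← e9, ← hd3]
      simp only [dirDeriv, cuspBracket]
      rw [e7, map_smul, map_add, map_smul, map_smul]
      simp only [smul_eq_mul]
      field_simp
      ring
    rw [e8, mul_inv_cancel_left₀ hw0.ne', levelPoint, hh]

/-! ### Gluing of the two solutions -/

theorem cuspBracket_eq_zero_of_eventually {a : ℝ × ℝ × ℝ → ℝ} {p : ℝ × ℝ × ℝ}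
    (h : ∀ᶠ q in 𝓝 p, a q = 0) : cuspBracket a p = 0 := by
  have h1 : fderiv ℝ a p = 0 := by
    have : a =ᶠ[𝓝 p] fun _ => (0 : ℝ) := h
    rw [this.fderiv_eq]
    simp
  simp [cuspBracket, dirDeriv, h1]

theorem disjoint_inner_outer {p : ℝ × ℝ × ℝ} (h : p ∈ innerRegion) : p ∉ outerRegion := by
  rintro (h1 | h1 | h1)
  · exact absurd h.1 (not_lt.2 h1.le)
  · exact absurd h.2.2 (not_lt.2 h1.le)
  · exact absurd h.2.1 (not_lt.2 h1.1.le)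

theorem inner_or_outer {p : ℝ × ℝ × ℝ} (h : cuspH p.1 p.2 ≠ saddleLevel p.1) :
    p ∈ innerRegion ∨ p ∈ outerRegion := by
  obtain ⟨lam, x, y⟩ := p
  simp only at h
  rcases lt_or_ge lam 0 with hl | hl
  · exact Or.inr (Or.inl hl)
  rcases lt_or_gt_of_ne h with h1 | h1
  · have hsl : saddleLevel lam = 2 * √(lam / 3) ^ 3 := rfl
    have hs0 : 0 ≤ √(lam / 3) := Real.sqrt_nonneg _
    have hls : lam = 3 * √(lam / 3) ^ 2 := by
      rw [Real.sq_sqrt (by positivity)]; ring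
    rcases lt_trichotomy y (√(lam / 3)) with h2 | h2 | h2
    · refine Or.inl ⟨lt_of_le_of_ne hl fun h3 : 0 = lam => ?_, h2, h1⟩
      rw [hsl] at h1
      rw [← h3, zero_div, Real.sqrt_zero] at h1 h2
      simp only [cuspH] at h1
      nlinarith [sq_nonneg x, sq_nonneg y]
    · exfalso
      rw [hsl, cuspH, ← h2] at h1
      rw [← h2] at hls
      simp only at h1
      nlinarith [sq_nonneg x]
    · exact Or.inr (Or.inr (Or.inr ⟨h2, h1⟩))
  · exact Or.inr (Or.inr (Or.inl h1))

/-- Each solution vanishes on the open region of the other, so the sum solves the equation off the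
saddle levels and the axis x = 0. On every line in the x-direction these exclude finitely many
points, and both sides are continuous. -/
theorem exists_cuspBracket_eq_comp_levelPoint {r : ℝ × ℝ × ℝ → ℝ} (hr : FlatOn nodeLocus r)
    (hM : ∀ q, 0 < q → ∀ R ∈ Ioo 0 (2 * q ^ 3),
      circleMean (fun p => r (levelPoint p)) q R = 0) :
    ∃ a : ℝ × ℝ × ℝ → ℝ, ContDiff ℝ ∞ a ∧ ∀ p, cuspBracket a p = r (levelPoint p) := by
  obtain ⟨a, ha, ha0, hai⟩ := exists_inner_solution hr hM
  obtain ⟨b, hb, hb0, hbo⟩ := exists_outer_solution hr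
  refine ⟨fun p => a p + b p, ha.add hb, ?_⟩
  have hgood : ∀ p : ℝ × ℝ × ℝ, p.2.1 ≠ 0 → cuspH p.1 p.2 ≠ saddleLevel p.1 →
      cuspBracket (fun p => a p + b p) p = r (levelPoint p) := by
    intro p hx hH
    rw [cuspBracket_add ha hb]
    rcases inner_or_outer hH with h | h
    · rw [hai p h hx, cuspBracket_eq_zero_of_eventually, add_zero]
      filter_upwards [isOpen_innerRegion.mem_nhds h] with q hq
      exact hb0 q (disjoint_inner_outer hq)
    · rw [hbo p h, cuspBracket_eq_zero_of_eventually, zero_add]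
      filter_upwards [isOpen_outerRegion.mem_nhds h] with q hq
      exact ha0 q fun h' => disjoint_inner_outer h' hq
  rintro ⟨lam, x, y⟩
  have hfin : ({0} ∪ {x : ℝ | x ^ 2 = saddleLevel lam + y ^ 3 - lam * y}).Finite := by
    refine (finite_singleton 0).union ?_
    set c := saddleLevel lam + y ^ 3 - lam * y
    refine (Set.toFinite {√c, -√c}).subset fun x hx => ?_
    have hx' : x ^ 2 = c := hx
    rw [← hx', Real.sqrt_sq_eq_abs]
    rcases abs_cases x with ⟨h, -⟩ | ⟨h, -⟩
    · left; exact h.symm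
    · right; rw [h, neg_neg]; rfl
  have hdense : Dense ({0} ∪ {x : ℝ | x ^ 2 = saddleLevel lam + y ^ 3 - lam * y})ᶜ :=
    hfin.countable.dense_compl ℝ
  have h1 : Continuous fun x : ℝ => cuspBracket (fun p => a p + b p) (lam, x, y) :=
    (contDiff_cuspBracket (ha.add hb)).continuous.comp (by fun_prop)
  have h2 : Continuous fun x : ℝ => r (levelPoint (lam, x, y)) :=
    (hr.contDiff.comp contDiff_levelPoint).continuous.comp (by fun_prop)
  refine congrFun (Continuous.ext_on hdense h1 h2 fun x hx => ?_) x
  rw [mem_compl_iff, mem_union, not_or] at hx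
  refine hgood _ hx.1 fun h => hx.2 ?_
  have h' : cuspH lam (x, y) = saddleLevel lam := h
  change x ^ 2 = _
  rw [← h', cuspH]
  ring

/-- A function with vanishing means over the vanishing cycles is a Hamiltonian derivative. -/
theorem exists_cuspBracket_eq {f : ℝ × ℝ × ℝ → ℝ} (hf : ContDiff ℝ ∞ f) {q₀ : ℝ} (hq₀ : 0 < q₀)
    (hM : ∀ q ∈ Ioo 0 q₀, ∀ R ∈ Ioo 0 (2 * q ^ 3), circleMean f q R = 0) :
    ∃ a : ℝ × ℝ × ℝ → ℝ, ContDiff ℝ ∞ a ∧ ∃ l > 0, ∀ lam, |lam| < l → ∀ x y,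
      cuspBracket a (lam, x, y) = f (lam, x, y) := by
  obtain ⟨a, r, ha, hr, hrM, l, hl, e⟩ := exists_flat_reduction hf hq₀ hM
  obtain ⟨b, hb, eb⟩ := exists_cuspBracket_eq_comp_levelPoint hr hrM
  refine ⟨fun p => a p + b p, ha.add hb, l, hl, fun lam h x y => ?_⟩
  rw [cuspBracket_add ha hb, eb, e lam h x y]

/-! ### Smooth inverse and implicit functions -/

/-- Inverse function theorem for `C^∞` maps, with open neighbourhoods on which the inverse is
smooth. -/
theorem exists_smooth_inverse {E : Type*} [NormedAddCommGroup E] [NormedSpace ℝ E]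
    [CompleteSpace E] {f : E → E} (hf : ContDiff ℝ ∞ f) {a : E} (e : E ≃L[ℝ] E)
    (hfe : HasFDerivAt f (e : E →L[ℝ] E) a) {N : Set E} (hN : IsOpen N) (haN : a ∈ N)
    {M : Set E} (hM : IsOpen M) (haM : f a ∈ M) :
    ∃ (V W : Set E) (g : E → E), IsOpen V ∧ IsOpen W ∧ a ∈ V ∧ V ⊆ N ∧ W ⊆ M ∧
      MapsTo f V W ∧ MapsTo g W V ∧ (∀ p ∈ V, g (f p) = p) ∧ (∀ q ∈ W, f (g q) = q) ∧
      ContDiffOn ℝ ∞ g W := by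
  set Q := hf.contDiffAt.toOpenPartialHomeomorph f hfe (by simp) with hQ
  have hQf : (Q : E → E) = f := hf.contDiffAt.toOpenPartialHomeomorph_coe hfe (by simp)
  have haQ : a ∈ Q.source := hf.contDiffAt.mem_toOpenPartialHomeomorph_source hfe (by simp)
  -- The open set where the differential is invertible; with `V` inside it the inverse is smooth on
  -- all of `W`, not merely at one point.
  set R : Set E := fderiv ℝ f ⁻¹' range ((↑) : (E ≃L[ℝ] E) → E →L[ℝ] E) with hR
  have hRo : IsOpen R := (ContinuousLinearEquiv.isOpen (𝕜 := ℝ) (E := E) (F := E)).preimage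
    (hf.continuous_fderiv (by simp))
  have haR : a ∈ R := ⟨e, hfe.fderiv.symm⟩
  set V := Q.source ∩ (N ∩ R ∩ f ⁻¹' M) with hV
  have hVo : IsOpen V := Q.open_source.inter ((hN.inter hRo).inter (hM.preimage hf.continuous))
  have hmemW : ∀ q, q ∈ Q.target ∩ Q.symm ⁻¹' V ↔ q ∈ Q.target ∧ Q.symm q ∈ V := fun q => Iff.rfl
  refine ⟨V, Q.target ∩ Q.symm ⁻¹' V, Q.symm, hVo, Q.isOpen_inter_preimage_symm hVo,
    ⟨haQ, ⟨haN, haR⟩, haM⟩, fun p hp => hp.2.1.1, ?_, ?_, fun q hq => hq.2, ?_, ?_, ?_⟩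
  · rintro q ⟨hq, hq2⟩
    have := hq2.2.2
    rw [mem_preimage, ← hQf, Q.right_inv hq] at this
    exact this
  · intro p hp
    have h1 : Q p ∈ Q.target := Q.map_source hp.1
    rw [← hQf, hmemW, Q.left_inv hp.1]
    exact ⟨h1, hp⟩
  · intro p hp
    rw [← hQf]
    exact Q.left_inv hp.1
  · intro q hq
    rw [← hQf]
    exact Q.right_inv hq.1
  · rintro q ⟨hq, hq2⟩
    obtain ⟨e', he'⟩ := hq2.2.1.2
    refine (Q.contDiffAt_symm (f₀' := e') hq ?_ ?_).contDiffWithinAt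
    · rw [hQf, he']
      exact (hf.differentiable (by simp) _).hasFDerivAt
    · rw [hQf]
      exact hf.contDiffAt

/-- Implicit function theorem for `C^∞` maps. -/
theorem exists_smooth_implicit {P B : Type*} [NormedAddCommGroup P] [NormedSpace ℝ P]
    [CompleteSpace P] [NormedAddCommGroup B] [NormedSpace ℝ B] [CompleteSpace B]
    {F : P × B → B} (hF : ContDiff ℝ ∞ F) {p₀ : P} {b₀ : B} (h0 : F (p₀, b₀) = 0)
    (e : B ≃L[ℝ] B) (he : HasFDerivAt (fun b => F (p₀, b)) (e : B →L[ℝ] B) b₀) :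
    ∃ (O : Set P) (S : P → B), IsOpen O ∧ p₀ ∈ O ∧ ContDiffOn ℝ ∞ S O ∧ S p₀ = b₀ ∧
      (∀ p ∈ O, F (p, S p) = 0) ∧
      ∀ᶠ v in 𝓝 (p₀, b₀), F v = 0 → v.2 = S v.1 := by
  set f : P × B → P × B := fun v => (v.1, F v) with hfdef
  have hf : ContDiff ℝ ∞ f := contDiff_fst.prodMk hF
  set D := fderiv ℝ F (p₀, b₀) with hD
  have hFD : HasFDerivAt F D (p₀, b₀) := (hF.differentiable (by simp) _).hasFDerivAt
  have hDe : ∀ b, D (0, b) = e b := by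
    intro b
    have h1 : HasFDerivAt (fun b => F (p₀, b)) (D.comp (ContinuousLinearMap.inr ℝ P B)) b₀ :=
      hFD.comp b₀ (hasFDerivAt_prodMk_right p₀ b₀)
    have := congrArg (fun L => L b) (h1.unique he)
    simpa using this
  have hDadd : ∀ p b, D (p, b) = D (p, 0) + e b := by
    intro p b
    rw [← hDe, ← map_add]
    simp
  set L : P × B →L[ℝ] P × B := (ContinuousLinearMap.fst ℝ P B).prod D with hL
  set K : P × B →L[ℝ] P × B := (ContinuousLinearMap.fst ℝ P B).prod
    ((e.symm : B →L[ℝ] B).comp (ContinuousLinearMap.snd ℝ P B -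
      D.comp ((ContinuousLinearMap.inl ℝ P B).comp (ContinuousLinearMap.fst ℝ P B)))) with hK
  let E : (P × B) ≃L[ℝ] (P × B) := ContinuousLinearEquiv.equivOfInverse L K
    (by
      rintro ⟨p, b⟩
      simp [hL, hK, hDadd p b])
    (by
      rintro ⟨p, b⟩
      simp [hL, hK, hDadd p (e.symm b - e.symm (D (p, 0)))])
  have hE : HasFDerivAt f (E : P × B →L[ℝ] P × B) (p₀, b₀) := hasFDerivAt_fst.prodMk hFD
  obtain ⟨V, W, g, hVo, hWo, hV, -, -, hfV, hgW, hgf, hfg, hg⟩ :=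
    exists_smooth_inverse hf E hE isOpen_univ (mem_univ _) isOpen_univ (mem_univ _)
  have hι : ContDiff ℝ ∞ fun p : P => ((p, 0) : P × B) := contDiff_id.prodMk contDiff_const
  have hf0 : f (p₀, b₀) = (p₀, 0) := by simp [hfdef, h0]
  have hg1 : ∀ p b, (p, b) ∈ W → (g (p, b)).1 = p ∧ F (g (p, b)) = b := by
    intro p b h
    have := hfg _ h
    simpa [hfdef, Prod.ext_iff] using this
  refine ⟨(fun p : P => ((p, 0) : P × B)) ⁻¹' W, fun p => (g (p, 0)).2,
    hWo.preimage hι.continuous, ?_, ?_, ?_, ?_, ?_⟩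
  · change (p₀, 0) ∈ W
    rw [← hf0]
    exact hfV hV
  · exact contDiff_snd.comp_contDiffOn (hg.comp hι.contDiffOn fun p hp => hp)
  · have := hgf _ hV
    rw [hf0] at this
    simp [this]
  · intro p hp
    obtain ⟨h1, h2⟩ := hg1 p 0 hp
    have : (p, (g (p, 0)).2) = g (p, 0) := Prod.ext h1.symm rfl
    rw [this, h2]
  · filter_upwards [hVo.mem_nhds hV] with v hv hFv
    have h1 := hgf v hv
    have h2 : f v = (v.1, 0) := by simp [hfdef, hFv]
    rw [h2] at h1
    simp [h1]

/-- A function smooth near a point agrees near that point with a globally smooth one. -/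
theorem exists_contDiff_eventuallyEq {E V : Type*} [NormedAddCommGroup E] [NormedSpace ℝ E]
    [FiniteDimensional ℝ E] [NormedAddCommGroup V] [NormedSpace ℝ V] {f : E → V} {O : Set E}
    (hO : IsOpen O) (hf : ContDiffOn ℝ ∞ f O) {a : E} (ha : a ∈ O) :
    ∃ g : E → V, ContDiff ℝ ∞ g ∧ ∀ᶠ p in 𝓝 a, g p = f p := by
  obtain ⟨r, hr, hrO⟩ := Metric.isOpen_iff.1 hO a ha
  let χ : ContDiffBump a := ⟨r / 4, r / 2, by positivity, by linarith⟩
  refine ⟨fun p => χ p • f p, contDiff_iff_contDiffAt.2 fun p => ?_, ?_⟩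
  · by_cases hp : p ∈ O
    · exact χ.contDiff.contDiffAt.smul (hf.contDiffAt (hO.mem_nhds hp))
    · have hp2 : p ∈ (Metric.closedBall a (r / 2))ᶜ := fun h =>
        hp (hrO (Metric.closedBall_subset_ball (by linarith) h))
      have h0 : (fun p => χ p • f p) =ᶠ[𝓝 p] fun _ => 0 := by
        filter_upwards [Metric.isClosed_closedBall.isOpen_compl.mem_nhds hp2] with z hz
        have : χ z = 0 := χ.zero_of_le_dist (not_le.1 (show ¬ dist z a ≤ r / 2 from hz)).le
        simp [this]
      exact contDiffAt_const.congr_of_eventuallyEq h0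
  · filter_upwards [Metric.closedBall_mem_nhds a χ.rIn_pos] with z hz
    simp [χ.one_of_mem_closedBall hz]

/-! ### The local flow of the Hamiltonian field -/

/-- Continuous curves parametrized by `[-1, 1]`. -/
abbrev CurveSpace := C(Icc (-1 : ℝ) 1, ℝ)

/-- A curve, extended to the whole line by constants. -/
noncomputable def CurveSpace.extend (γ : CurveSpace) : ℝ → ℝ :=
  IccExtend (by norm_num : (-1 : ℝ) ≤ 1) γ

theorem CurveSpace.continuous_extend (γ : CurveSpace) : Continuous γ.extend :=
  γ.continuous.Icc_extend'

theorem CurveSpace.extend_of_mem (γ : CurveSpace) {u : ℝ} (hu : u ∈ Icc (-1 : ℝ) 1) :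
    γ.extend u = γ ⟨u, hu⟩ := IccExtend_of_mem _ _ hu

theorem CurveSpace.norm_extend_le (γ : CurveSpace) (u : ℝ) : ‖γ.extend u‖ ≤ ‖γ‖ :=
  γ.norm_coe_le_norm _

/-- The primitive vanishing at `0`, as a continuous linear operator on curves. -/
noncomputable def CurveSpace.primitive : CurveSpace →L[ℝ] CurveSpace :=
  LinearMap.mkContinuous
    { toFun := fun γ => ⟨fun u => ∫ s in (0 : ℝ)..u, γ.extend s,
        (intervalIntegral.continuous_primitive
          (fun a b => γ.continuous_extend.intervalIntegrable a b) 0).comp continuous_subtype_val⟩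
      map_add' := fun γ δ => by
        ext u
        exact intervalIntegral.integral_add (γ.continuous_extend.intervalIntegrable _ _)
          (δ.continuous_extend.intervalIntegrable _ _)
      map_smul' := fun c γ => by
        ext u
        exact intervalIntegral.integral_const_mul c _ } 1
    (fun γ => by
      rw [one_mul]
      refine (ContinuousMap.norm_le _ (norm_nonneg _)).2 fun u => ?_
      refine (intervalIntegral.norm_integral_le_of_norm_le_const
        (fun s _ => γ.norm_extend_le s)).trans ?_
      have : |(u : ℝ) - 0| ≤ 1 := by
        rw [sub_zero, abs_le]
        exact u.2
      nlinarith [norm_nonneg γ])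

theorem CurveSpace.primitive_apply (γ : CurveSpace) (u : Icc (-1 : ℝ) 1) :
    CurveSpace.primitive γ u = ∫ s in (0 : ℝ)..u, γ.extend s := rfl

/-- The vanishing of this map says that a pair of curves is, up to the time scale `v.1.2`, the
trajectory of the Hamiltonian vector field of `cuspH` that starts at `v.1.1`. -/
noncomputable def trajectoryDefect (v : ((ℝ × ℝ × ℝ) × ℝ) × (CurveSpace × CurveSpace)) :
    CurveSpace × CurveSpace :=
  (v.2.1 - v.1.1.2.1 • (1 : CurveSpace) - v.1.2 • CurveSpace.primitive
      ((3 : ℝ) • v.2.2 ^ 2 - v.1.1.1 • (1 : CurveSpace)),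
    v.2.2 - v.1.1.2.2 • (1 : CurveSpace) - v.1.2 • CurveSpace.primitive ((2 : ℝ) • v.2.1))

theorem contDiff_trajectoryDefect : ContDiff ℝ ∞ trajectoryDefect := by
  unfold trajectoryDefect
  fun_prop

theorem trajectoryDefect_eq_zero_iff {lam x y t : ℝ} {ξ η : CurveSpace} :
    trajectoryDefect (((lam, x, y), t), (ξ, η)) = 0 ↔ ∀ u : Icc (-1 : ℝ) 1,
      ξ u = x + t * (∫ s in (0 : ℝ)..u, (3 * η.extend s ^ 2 - lam)) ∧
      η u = y + t * ∫ s in (0 : ℝ)..u, 2 * ξ.extend s := by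
  simp only [trajectoryDefect, Prod.mk_eq_zero, ContinuousMap.ext_iff, ← forall_and]
  refine forall_congr' fun u => ?_
  refine and_congr ?_ ?_
  · have h : ((3 : ℝ) • η ^ 2 - lam • (1 : CurveSpace)).extend
        = fun s => 3 * η.extend s ^ 2 - lam := by
      ext s
      simp [CurveSpace.extend, IccExtend]
    simp only [ContinuousMap.sub_apply, ContinuousMap.smul_apply, ContinuousMap.one_apply,
      smul_eq_mul, mul_one, CurveSpace.primitive_apply, h, ContinuousMap.zero_apply]
    constructor <;> intro h <;> linarith
  · have h : ((2 : ℝ) • ξ).extend = fun s => 2 * ξ.extend s := by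
      ext s
      simp [CurveSpace.extend, IccExtend]
    simp only [ContinuousMap.sub_apply, ContinuousMap.smul_apply, ContinuousMap.one_apply,
      smul_eq_mul, mul_one, CurveSpace.primitive_apply, h, ContinuousMap.zero_apply]
    constructor <;> intro h <;> linarith

/-- The curve run at `c` times its speed. -/
noncomputable def CurveSpace.rescale (γ : CurveSpace) (c : ℝ) : CurveSpace :=
  ⟨fun u => γ.extend (c * u), γ.continuous_extend.comp (by fun_prop)⟩

theorem CurveSpace.norm_rescale_le (γ : CurveSpace) (c : ℝ) : ‖γ.rescale c‖ ≤ ‖γ‖ :=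
  (ContinuousMap.norm_le _ (norm_nonneg _)).2 fun _ => γ.norm_extend_le _

theorem CurveSpace.rescale_extend (γ : CurveSpace) (c : ℝ) {u : ℝ} (hu : u ∈ Icc (-1 : ℝ) 1) :
    (γ.rescale c).extend u = γ.extend (c * u) :=
  CurveSpace.extend_of_mem _ hu

theorem uIcc_zero_subset {u : ℝ} (hu : u ∈ Icc (-1 : ℝ) 1) : uIcc 0 u ⊆ Icc (-1 : ℝ) 1 :=
  uIcc_subset_Icc (by norm_num) hu

/-- A trajectory with time scale t, run at speed c, is one with time scale t c. This relates the end
points of the trajectories of different durations, which define the flow, to points of a single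
trajectory. -/
theorem trajectoryDefect_rescale {lam x y t c : ℝ} (hc : c ∈ Icc (-1 : ℝ) 1) {ξ η : CurveSpace}
    (h : trajectoryDefect (((lam, x, y), t), (ξ, η)) = 0) :
    trajectoryDefect (((lam, x, y), t * c), (ξ.rescale c, η.rescale c)) = 0 := by
  rw [trajectoryDefect_eq_zero_iff] at h ⊢
  intro u
  have hcu : c * u ∈ Icc (-1 : ℝ) 1 := by
    rw [mem_Icc, ← abs_le, abs_mul]
    exact mul_le_one₀ (abs_le.2 hc) (abs_nonneg _) (abs_le.2 u.2)
  obtain ⟨h1, h2⟩ := h ⟨c * u, hcu⟩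
  have e1 : (∫ s in (0 : ℝ)..u, (3 * (η.rescale c).extend s ^ 2 - lam))
      = ∫ s in (0 : ℝ)..u, (3 * η.extend (c * s) ^ 2 - lam) :=
    intervalIntegral.integral_congr fun s hs => by
      rw [CurveSpace.rescale_extend _ _ (uIcc_zero_subset u.2 hs)]
  have e2 : (∫ s in (0 : ℝ)..u, 2 * (ξ.rescale c).extend s)
      = ∫ s in (0 : ℝ)..u, 2 * ξ.extend (c * s) :=
    intervalIntegral.integral_congr fun s hs => by
      rw [CurveSpace.rescale_extend _ _ (uIcc_zero_subset u.2 hs)]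
  have e3 := intervalIntegral.mul_integral_comp_mul_left (a := 0) (b := (u : ℝ)) c
    (f := fun s => 3 * η.extend s ^ 2 - lam)
  have e4 := intervalIntegral.mul_integral_comp_mul_left (a := 0) (b := (u : ℝ)) c
    (f := fun s => 2 * ξ.extend s)
  rw [mul_zero] at e3 e4
  constructor
  · rw [e1, mul_assoc, e3, ← h1]
    exact ξ.extend_of_mem hcu
  · rw [e2, mul_assoc, e4, ← h2]
    exact η.extend_of_mem hcu

theorem hasDerivAt_of_trajectoryDefect {lam x y t : ℝ} (ht : t ≠ 0) {ξ η : CurveSpace}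
    (h : trajectoryDefect (((lam, x, y), t), (ξ, η)) = 0) {s : ℝ} (hs : |s| < |t|) :
    HasDerivAt (fun s => ξ.extend (s / t)) (3 * η.extend (s / t) ^ 2 - lam) s ∧
    HasDerivAt (fun s => η.extend (s / t)) (2 * ξ.extend (s / t)) s := by
  rw [trajectoryDefect_eq_zero_iff] at h
  have hmem : s / t ∈ Ioo (-1 : ℝ) 1 := by
    rw [mem_Ioo, ← abs_lt, abs_div]
    exact (div_lt_one (abs_pos.2 ht)).2 hs
  have hcξ := ξ.continuous_extend
  have hcη := η.continuous_extend
  have hd : HasDerivAt (fun s : ℝ => s / t) (1 / t) s := (hasDerivAt_id s).div_const t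
  have hev : ∀ᶠ u in 𝓝 (s / t), u ∈ Icc (-1 : ℝ) 1 := Icc_mem_nhds hmem.1 hmem.2
  constructor
  · have h1 : HasDerivAt ξ.extend (t * (3 * η.extend (s / t) ^ 2 - lam)) (s / t) := by
      have hi : HasDerivAt (fun u => x + t * ∫ s in (0 : ℝ)..u, (3 * η.extend s ^ 2 - lam))
          (t * (3 * η.extend (s / t) ^ 2 - lam)) (s / t) :=
        ((Continuous.integral_hasStrictDerivAt (by fun_prop) 0 (s / t)).hasDerivAt.const_mul
          t).const_add x
      refine hi.congr_of_eventuallyEq ?_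
      filter_upwards [hev] with u hu
      rw [ξ.extend_of_mem hu, (h ⟨u, hu⟩).1]
    exact (h1.comp s hd).congr_deriv (by field_simp)
  · have h1 : HasDerivAt η.extend (t * (2 * ξ.extend (s / t))) (s / t) := by
      have hi : HasDerivAt (fun u => y + t * ∫ s in (0 : ℝ)..u, 2 * ξ.extend s)
          (t * (2 * ξ.extend (s / t))) (s / t) :=
        ((Continuous.integral_hasStrictDerivAt (by fun_prop) 0 (s / t)).hasDerivAt.const_mul
          t).const_add y
      refine hi.congr_of_eventuallyEq ?_
      filter_upwards [hev] with u hu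
      rw [η.extend_of_mem hu, (h ⟨u, hu⟩).2]
    exact (h1.comp s hd).congr_deriv (by field_simp)

/-- The Hamiltonian vector field of `cuspH`, the parameter being fixed. -/
def cuspField (p : ℝ × ℝ × ℝ) : ℝ × ℝ × ℝ := (0, 3 * p.2.2 ^ 2 - p.1, 2 * p.2.1)

theorem contDiff_cuspField : ContDiff ℝ ∞ cuspField := by
  unfold cuspField
  fun_prop

/-- The Hamiltonian vector field of `cuspH` has a smooth local flow at the origin. -/
theorem exists_smooth_flow :
    ∃ fl : (ℝ × ℝ × ℝ) × ℝ → ℝ × ℝ × ℝ, ContDiff ℝ ∞ fl ∧ ∃ ε > 0,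
      ∀ p : ℝ × ℝ × ℝ, ‖p‖ < ε → ∀ t : ℝ, |t| < ε → fl (p, 0) = p ∧ (fl (p, t)).1 = p.1 ∧
        HasDerivAt (fun s => fl (p, s)) (cuspField (fl (p, t))) t := by
  have hbase : ∀ b, trajectoryDefect (((0 : ℝ × ℝ × ℝ), (0 : ℝ)), b) = b := by
    intro b
    simp [trajectoryDefect]
  -- At the initial point 0 and time 0 the defect is the identity in the curves, so the integral
  -- equation is solved by a smooth function of initial point and time.
  obtain ⟨O, S, hO, hO0, hS, hS0, hFS, hN⟩ := exists_smooth_implicit contDiff_trajectoryDefect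
    (p₀ := ((0 : ℝ × ℝ × ℝ), (0 : ℝ))) (b₀ := 0) (hbase 0)
    (ContinuousLinearEquiv.refl ℝ (CurveSpace × CurveSpace))
    ((hasFDerivAt_id (𝕜 := ℝ) (0 : CurveSpace × CurveSpace)).congr_of_eventuallyEq
      (Eventually.of_forall hbase))
  have h1 : (1 : ℝ) ∈ Icc (-1 : ℝ) 1 := by norm_num
  have hev : ∀ u : Icc (-1 : ℝ) 1, ContDiff ℝ ∞ fun γ : CurveSpace => γ u := fun u =>
    (ContinuousMap.evalCLM ℝ u : CurveSpace →L[ℝ] ℝ).contDiff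
  set end₁ : Icc (-1 : ℝ) 1 := ⟨1, h1⟩ with hend
  set f : (ℝ × ℝ × ℝ) × ℝ → ℝ × ℝ × ℝ :=
    fun v => (v.1.1, (S v).1 end₁, (S v).2 end₁) with hf
  have hfO : ContDiffOn ℝ ∞ f O := by
    refine ContDiffOn.prodMk (by fun_prop) (ContDiffOn.prodMk ?_ ?_)
    · exact (hev end₁).comp_contDiffOn (contDiff_fst.comp_contDiffOn hS)
    · exact (hev end₁).comp_contDiffOn (contDiff_snd.comp_contDiffOn hS)
  obtain ⟨fl, hfl, hflf⟩ := exists_contDiff_eventuallyEq hO hfO hO0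
  obtain ⟨δ, hδ, hδN⟩ := Metric.eventually_nhds_iff_ball.1 hN
  have hScont : ContinuousAt S 0 := (hS.contDiffAt (hO.mem_nhds hO0)).continuousAt
  have hSδ : ∀ᶠ v in 𝓝 (0 : (ℝ × ℝ × ℝ) × ℝ), ‖S v‖ < δ := by
    have : ∀ᶠ v in 𝓝 (0 : (ℝ × ℝ × ℝ) × ℝ), S v ∈ Metric.ball (S 0) δ :=
      hScont (Metric.ball_mem_nhds _ hδ)
    filter_upwards [this] with v hv
    have e0 : S 0 = 0 := hS0
    simpa [e0] using hv
  have hOev : ∀ᶠ v in 𝓝 (0 : (ℝ × ℝ × ℝ) × ℝ), v ∈ O := hO.mem_nhds hO0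
  have hball : ∀ᶠ v in 𝓝 (0 : (ℝ × ℝ × ℝ) × ℝ), v ∈ Metric.ball 0 δ := Metric.ball_mem_nhds _ hδ
  obtain ⟨ε, hε, hall⟩ := Metric.eventually_nhds_iff_ball.1 ((hSδ.and hflf).and
    (hOev.and hball))
  have hall' : ∀ p : ℝ × ℝ × ℝ, ‖p‖ < ε → ∀ t : ℝ, |t| < ε →
      ‖S (p, t)‖ < δ ∧ fl (p, t) = f (p, t) ∧ (p, t) ∈ O ∧ ‖(p, t)‖ < δ := by
    intro p hp t ht
    have : (p, t) ∈ Metric.ball (0 : (ℝ × ℝ × ℝ) × ℝ) ε := by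
      rw [mem_ball_zero_iff, Prod.norm_def]
      exact max_lt hp ht
    obtain ⟨⟨a, b⟩, c, d⟩ := hall _ this
    exact ⟨a, b, c, by simpa using d⟩
  refine ⟨fl, hfl, ε / 2, by positivity, ?_⟩
  rintro ⟨lam, x, y⟩ hp t ht
  have hp' : ‖((lam, x, y) : ℝ × ℝ × ℝ)‖ < ε := by linarith
  -- A fixed duration still admissible in `hall'`; trajectories of all shorter durations are
  -- compared with this one.
  set T := ε / 2 with hT
  have hTε : |T| < ε := by rw [abs_of_pos (by positivity)]; linarith
  have hT0 : 0 < T := by positivity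
  obtain ⟨hST, -, hTO, -⟩ := hall' _ hp' T hTε
  set ξ := (S ((lam, x, y), T)).1 with hξ
  set η := (S ((lam, x, y), T)).2 with hη
  have hdef : trajectoryDefect (((lam, x, y), T), (ξ, η)) = 0 := hFS _ hTO
  -- The rescaled long trajectory solves the equation for the duration s and is small, so by local
  -- uniqueness it is the chosen solution; its end point is the value of the long trajectory at s /
  -- T.
  have key : ∀ s : ℝ, |s| < T →
      fl ((lam, x, y), s) = (lam, ξ.extend (s / T), η.extend (s / T)) := by
    intro s hs
    obtain ⟨hSs, hfls, hsO, hsδ⟩ := hall' _ hp' s (by linarith)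
    have hc : s / T ∈ Icc (-1 : ℝ) 1 := by
      rw [mem_Icc, ← abs_le, abs_div, abs_of_pos hT0]
      exact (div_le_one hT0).2 hs.le
    have hr := trajectoryDefect_rescale hc hdef
    rw [mul_div_cancel₀ _ hT0.ne'] at hr
    have hmem : (((lam, x, y), s), (ξ.rescale (s / T), η.rescale (s / T))) ∈
        Metric.ball (((0 : ℝ × ℝ × ℝ), (0 : ℝ)), (0 : CurveSpace × CurveSpace)) δ := by
      rw [show (((0 : ℝ × ℝ × ℝ), (0 : ℝ)), (0 : CurveSpace × CurveSpace)) = 0 from rfl,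
        mem_ball_zero_iff, Prod.norm_def]
      refine max_lt hsδ (lt_of_le_of_lt ?_ hST)
      rw [Prod.norm_def, Prod.norm_def]
      exact max_le_max (ξ.norm_rescale_le _) (η.norm_rescale_le _)
    have hu : (ξ.rescale (s / T), η.rescale (s / T)) = S ((lam, x, y), s) := hδN _ hmem hr
    rw [hfls, hf]
    simp only [← hu]
    refine Prod.ext rfl (Prod.ext ?_ ?_)
    · change ξ.extend (s / T * 1) = _
      rw [mul_one]
    · change η.extend (s / T * 1) = _
      rw [mul_one]
  refine ⟨?_, ?_, ?_⟩
  · rw [key 0 (by simpa using hT0), zero_div]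
    have h0 : (0 : ℝ) ∈ Icc (-1 : ℝ) 1 := by norm_num
    obtain ⟨a, b⟩ := trajectoryDefect_eq_zero_iff.1 hdef ⟨0, h0⟩
    rw [CurveSpace.extend_of_mem _ h0, CurveSpace.extend_of_mem _ h0, a, b]
    simp
  · rw [key t ht]
  · obtain ⟨a, b⟩ := hasDerivAt_of_trajectoryDefect hT0.ne' hdef (s := t)
      (by rwa [abs_of_pos hT0])
    have hd := (hasDerivAt_const t lam).prodMk (a.prodMk b)
    rw [key t ht]
    refine HasDerivAt.congr_of_eventuallyEq (hd.congr_deriv rfl) ?_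
    have : ∀ᶠ s in 𝓝 t, |s| < T := (isOpen_lt continuous_abs continuous_const).mem_nhds ht
    filter_upwards [this] with s hs
    exact key s hs

theorem cuspBracket_eq_fderiv (a : ℝ × ℝ × ℝ → ℝ) (p : ℝ × ℝ × ℝ) :
    cuspBracket a p = fderiv ℝ a p (cuspField p) := by
  have : cuspField p = (3 * p.2.2 ^ 2 - p.1) • ((0, 1, 0) : ℝ × ℝ × ℝ)
      + (2 * p.2.1) • ((0, 0, 1) : ℝ × ℝ × ℝ) := by
    simp [cuspField]
  rw [this, map_add, map_smul, map_smul, cuspBracket, dirDeriv, dirDeriv, smul_eq_mul, smul_eq_mul]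
  ring

theorem HasDerivAt.cuspH {c : ℝ → ℝ × ℝ × ℝ} {v : ℝ × ℝ × ℝ} {t : ℝ} (h : HasDerivAt c v t)
    (l : ℝ) : HasDerivAt (fun s => _root_.cuspH l (c s).2)
      (2 * (c t).2.1 * v.2.1 + (l - 3 * (c t).2.2 ^ 2) * v.2.2) t := by
  have hp : HasDerivAt (fun s => (c s).2) v.2 t :=
    (ContinuousLinearMap.snd ℝ ℝ (ℝ × ℝ)).hasFDerivAt.comp_hasDerivAt t h
  have hx : HasDerivAt (fun s => (c s).2.1) v.2.1 t :=
    (ContinuousLinearMap.fst ℝ ℝ ℝ).hasFDerivAt.comp_hasDerivAt t hp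
  have hy : HasDerivAt (fun s => (c s).2.2) v.2.2 t :=
    (ContinuousLinearMap.snd ℝ ℝ ℝ).hasFDerivAt.comp_hasDerivAt t hp
  refine (((hx.pow 2).sub (hy.pow 3)).add (hy.const_mul l)).congr_deriv ?_
  norm_num
  ring

/-- `fl` is a flow of `cuspField` for points and times of size less than `ε`. -/
structure IsCuspFlow (fl : (ℝ × ℝ × ℝ) × ℝ → ℝ × ℝ × ℝ) (ε : ℝ) : Prop where
  smooth : ContDiff ℝ ∞ fl
  pos : 0 < ε
  zero : ∀ p : ℝ × ℝ × ℝ, ‖p‖ < ε → fl (p, 0) = p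
  fst : ∀ p : ℝ × ℝ × ℝ, ‖p‖ < ε → ∀ t : ℝ, |t| < ε → (fl (p, t)).1 = p.1
  deriv : ∀ p : ℝ × ℝ × ℝ, ‖p‖ < ε → ∀ t : ℝ, |t| < ε →
    HasDerivAt (fun s => fl (p, s)) (cuspField (fl (p, t))) t

theorem exists_isCuspFlow : ∃ fl ε, IsCuspFlow fl ε := by
  obtain ⟨fl, h, ε, hε, H⟩ := exists_smooth_flow
  exact ⟨fl, ε, h, hε, fun p hp => (H p hp 0 (by simpa using hε)).1,
    fun p hp t ht => (H p hp t ht).2.1, fun p hp t ht => (H p hp t ht).2.2⟩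

namespace IsCuspFlow

variable {fl : (ℝ × ℝ × ℝ) × ℝ → ℝ × ℝ × ℝ} {ε : ℝ}

theorem map_zero (h : IsCuspFlow fl ε) : fl 0 = 0 := h.zero 0 (by simpa using h.pos)

theorem cuspH_eq (h : IsCuspFlow fl ε) {p : ℝ × ℝ × ℝ} (hp : ‖p‖ < ε) {t : ℝ} (ht : |t| < ε) :
    cuspH p.1 (fl (p, t)).2 = cuspH p.1 p.2 := by
  have hd : ∀ s : ℝ, |s| < ε → HasDerivAt (fun s => cuspH p.1 (fl (p, s)).2) 0 s := by
    intro s hs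
    refine ((h.deriv p hp s hs).cuspH p.1).congr_deriv ?_
    simp only [cuspField, h.fst p hp s hs]
    ring
  have hmem : ∀ s : ℝ, s ∈ Ioo (-ε) ε ↔ |s| < ε := fun s => by rw [mem_Ioo, abs_lt]
  have := (isOpen_Ioo (a := -ε) (b := ε)).is_const_of_deriv_eq_zero (𝕜 := ℝ)
    isPreconnected_Ioo
    (f := fun s => cuspH p.1 (fl (p, s)).2)
    (fun s hs => (hd s ((hmem s).1 hs)).differentiableAt.differentiableWithinAt)
    (fun s hs => (hd s ((hmem s).1 hs)).deriv) ((hmem t).2 ht)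
    ((hmem 0).2 (by simpa using h.pos))
  simpa [h.zero p hp] using this

/-- Both sides solve the same equation in t with the same initial value, and stay in a neighbourhood
on which the field is Lipschitz. -/
theorem exists_group_law (h : IsCuspFlow fl ε) :
    ∃ r > 0, ∀ p : ℝ × ℝ × ℝ, ‖p‖ < r → ∀ s : ℝ, |s| < r → ∀ t : ℝ, |t| < r →
      fl (fl (p, s), t) = fl (p, s + t) := by
  obtain ⟨K, Z, hZ, hK⟩ := (contDiff_cuspField.contDiffAt (x := 0)).of_le
    (by exact_mod_cast le_top : (1 : WithTop ℕ∞) ≤ ∞) |>.exists_lipschitzOnWith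
  have hc := h.smooth.continuous
  have t1 : Tendsto (fun v : ((ℝ × ℝ × ℝ) × ℝ) × ℝ => fl (fl v.1, v.2)) (𝓝 0) (𝓝 0) := by
    have : Continuous fun v : ((ℝ × ℝ × ℝ) × ℝ) × ℝ => fl (fl v.1, v.2) := by fun_prop
    have h2 := this.tendsto 0
    rwa [show fl (fl (0 : ((ℝ × ℝ × ℝ) × ℝ) × ℝ).1, (0 : ((ℝ × ℝ × ℝ) × ℝ) × ℝ).2) = 0 from
      (congrArg (fun z => fl (z, 0)) h.map_zero).trans h.map_zero] at h2
  have t2 : Tendsto (fun v : ((ℝ × ℝ × ℝ) × ℝ) × ℝ => fl (v.1.1, v.1.2 + v.2)) (𝓝 0) (𝓝 0) := by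
    have : Continuous fun v : ((ℝ × ℝ × ℝ) × ℝ) × ℝ => fl (v.1.1, v.1.2 + v.2) := by fun_prop
    have h2 := this.tendsto 0
    rwa [show fl ((0 : ((ℝ × ℝ × ℝ) × ℝ) × ℝ).1.1, (0 : ((ℝ × ℝ × ℝ) × ℝ) × ℝ).1.2
      + (0 : ((ℝ × ℝ × ℝ) × ℝ) × ℝ).2) = 0 by
      simp only [Prod.fst_zero, Prod.snd_zero, add_zero]
      exact h.map_zero] at h2
  have t3 : Tendsto (fun v : ((ℝ × ℝ × ℝ) × ℝ) × ℝ => fl v.1) (𝓝 0) (𝓝 0) := by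
    have : Continuous fun v : ((ℝ × ℝ × ℝ) × ℝ) × ℝ => fl v.1 := by fun_prop
    have h2 := this.tendsto 0
    rwa [show fl (0 : ((ℝ × ℝ × ℝ) × ℝ) × ℝ).1 = 0 from h.map_zero] at h2
  obtain ⟨r, hr, hall⟩ := Metric.eventually_nhds_iff_ball.1 (((t1.eventually_mem hZ).and
    (t2.eventually_mem hZ)).and (t3.eventually_mem (Metric.ball_mem_nhds 0 h.pos)))
  refine ⟨min r (ε / 2), lt_min hr (by linarith [h.pos]), fun p hp s hs t ht => ?_⟩
  have hall' : ∀ u : ℝ, |u| < min r (ε / 2) → fl (fl (p, s), u) ∈ Z ∧ fl (p, s + u) ∈ Z ∧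
      ‖fl (p, s)‖ < ε := by
    intro u hu
    have hv : ((p, s), u) ∈ Metric.ball (0 : ((ℝ × ℝ × ℝ) × ℝ) × ℝ) r := by
      rw [mem_ball_zero_iff, Prod.norm_def, Prod.norm_def]
      exact max_lt (max_lt (hp.trans_le (min_le_left _ _)) (hs.trans_le (min_le_left _ _)))
        (hu.trans_le (min_le_left _ _))
    obtain ⟨⟨a, b⟩, c⟩ := hall _ hv
    exact ⟨a, b, by simpa using c⟩
  have hm0 : |(0 : ℝ)| < min r (ε / 2) := by
    rw [abs_zero]
    exact lt_min hr (by linarith [h.pos])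
  have hr2 := min_le_right r (ε / 2)
  have hpε : ‖p‖ < ε := by linarith [h.pos]
  have hIoo : ∀ u, u ∈ Ioo (-(min r (ε / 2))) (min r (ε / 2)) ↔ |u| < min r (ε / 2) := fun u => by
    rw [mem_Ioo, abs_lt]
  refine ODE_solution_unique_of_mem_Ioo (v := fun _ => cuspField) (s := fun _ => Z) (K := K)
    (f := fun t => fl (fl (p, s), t)) (g := fun t => fl (p, s + t)) (t₀ := 0)
    (fun _ _ => hK) ((hIoo 0).2 hm0) (fun u hu => ?_) (fun u hu => ?_) ?_ ((hIoo t).2 ht)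
  · obtain ⟨a, b, c⟩ := hall' u ((hIoo u).1 hu)
    exact ⟨h.deriv _ c u (by linarith [(hIoo u).1 hu, h.pos]), a⟩
  · obtain ⟨a, b, c⟩ := hall' u ((hIoo u).1 hu)
    refine ⟨?_, b⟩
    have hsu : |s + u| < ε := (abs_add_le s u).trans_lt (by linarith [(hIoo u).1 hu])
    have h1 := h.deriv p hpε (s + u) hsu
    exact h1.comp_const_add s u
  · simp only [add_zero]
    exact h.zero _ (hall' 0 hm0).2.2

end IsCuspFlow

/-! ### The diffeomorphism as a time map of the flow -/

/-- The Jacobian determinant, in the plane variables, of a map of `ℝ × Plane`. -/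
noncomputable def planeJacobian (Φ : ℝ × ℝ × ℝ → ℝ × ℝ × ℝ) (p : ℝ × ℝ × ℝ) : ℝ :=
  (fderiv ℝ Φ p (0, 1, 0)).2.1 * (fderiv ℝ Φ p (0, 0, 1)).2.2
    - (fderiv ℝ Φ p (0, 0, 1)).2.1 * (fderiv ℝ Φ p (0, 1, 0)).2.2

theorem continuous_planeJacobian {Φ : ℝ × ℝ × ℝ → ℝ × ℝ × ℝ} (hΦ : ContDiff ℝ ∞ Φ) :
    Continuous (planeJacobian Φ) := by
  have h : ∀ v : ℝ × ℝ × ℝ, Continuous fun p => fderiv ℝ Φ p v := fun v =>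
    (hΦ.continuous_fderiv (by simp)).clm_apply continuous_const
  have h1 := h (0, 1, 0)
  have h2 := h (0, 0, 1)
  unfold planeJacobian
  fun_prop

/-- A map preserving `cuspH` and multiplying its Hamiltonian field by `k` has Jacobian `k` at the
points where this field does not vanish. -/
theorem planeJacobian_eq {Φ : ℝ × ℝ × ℝ → ℝ × ℝ × ℝ} (hΦ : ContDiff ℝ ∞ Φ) {p : ℝ × ℝ × ℝ} {k : ℝ}
    (h1 : ∀ᶠ q in 𝓝 p, (Φ q).1 = q.1) (hH : ∀ᶠ q in 𝓝 p, cuspH q.1 (Φ q).2 = cuspH q.1 q.2)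
    (hk : fderiv ℝ Φ p (cuspField p) = k • cuspField (Φ p)) (hx : p.2.1 ≠ 0) :
    planeJacobian Φ p = k := by
  -- The identity H ∘ Φ = H, differentiated in the direction v of the plane.
  have hd : ∀ v : ℝ × ℝ, 2 * (Φ p).2.1 * (fderiv ℝ Φ p (0, v)).2.1
      + (p.1 - 3 * (Φ p).2.2 ^ 2) * (fderiv ℝ Φ p (0, v)).2.2
      = 2 * p.2.1 * v.1 + (p.1 - 3 * p.2.2 ^ 2) * v.2 := by
    intro v
    have hc : HasDerivAt (fun t : ℝ => (p.1, p.2.1 + t * v.1, p.2.2 + t * v.2))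
        ((0, v) : ℝ × ℝ × ℝ) 0 := by
      refine (hasDerivAt_const _ _).prodMk (HasDerivAt.prodMk ?_ ?_)
      · simpa using ((hasDerivAt_id (0 : ℝ)).mul_const v.1).const_add p.2.1
      · simpa using ((hasDerivAt_id (0 : ℝ)).mul_const v.2).const_add p.2.2
    have hc0 : (fun t : ℝ => (p.1, p.2.1 + t * v.1, p.2.2 + t * v.2)) 0 = p := by simp
    have hΦc : HasDerivAt (fun t : ℝ => Φ (p.1, p.2.1 + t * v.1, p.2.2 + t * v.2))
        (fderiv ℝ Φ p (0, v)) 0 := by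
      have h2 : HasFDerivAt Φ (fderiv ℝ Φ p)
          ((fun t : ℝ => (p.1, p.2.1 + t * v.1, p.2.2 + t * v.2)) 0) := by
        rw [hc0]
        exact (hΦ.differentiable (by simp) p).hasFDerivAt
      exact h2.comp_hasDerivAt 0 hc
    have hL := hΦc.cuspH p.1
    have hR := hc.cuspH p.1
    have hct : Tendsto (fun t : ℝ => (p.1, p.2.1 + t * v.1, p.2.2 + t * v.2)) (𝓝 0) (𝓝 p) := by
      have := hc.continuousAt
      rwa [ContinuousAt, show (p.1, p.2.1 + 0 * v.1, p.2.2 + 0 * v.2) = p from hc0] at this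
    have := hL.unique (hR.congr_of_eventuallyEq ((hct.eventually hH).mono fun t ht => ht))
    simpa using this
  have e1 := hd (1, 0)
  have e2 := hd (0, 1)
  have hX : cuspField p = (3 * p.2.2 ^ 2 - p.1) • ((0, 1, 0) : ℝ × ℝ × ℝ)
      + (2 * p.2.1) • ((0, 0, 1) : ℝ × ℝ × ℝ) := by
    simp [cuspField]
  rw [hX, map_add, map_smul, map_smul] at hk
  have e3 := congrArg (fun z => z.2.1) hk
  have e4 := congrArg (fun z => z.2.2) hk
  simp [cuspField] at e1 e2 e3 e4
  rw [h1.self_of_nhds] at e3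
  -- Cramer's rule: the two components of DΦ X = k X(Φ), combined with the components of DΦ ∂x, give
  -- 2x times the Jacobian on one side and k dH(DΦ ∂x) = 2x k on the other.
  have : (2 * p.2.1) * (planeJacobian Φ p - k) = 0 := by
    unfold planeJacobian
    linear_combination (fderiv ℝ Φ p (0, 1, 0)).2.1 * e4 - (fderiv ℝ Φ p (0, 1, 0)).2.2 * e3 + k * e1
  rcases mul_eq_zero.1 this with h | h
  · exact absurd h (by simpa using hx)
  · linarith

/-- The integral of a function along a flow line over the time interval `[0, v.2]`. -/
noncomputable def flowIntegral (fl : (ℝ × ℝ × ℝ) × ℝ → ℝ × ℝ × ℝ) (g : ℝ × ℝ × ℝ → ℝ)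
    (v : (ℝ × ℝ × ℝ) × ℝ) : ℝ := v.2 * ∫ u in (0 : ℝ)..1, g (fl (v.1, v.2 * u))

theorem contDiff_flowIntegral {fl : (ℝ × ℝ × ℝ) × ℝ → ℝ × ℝ × ℝ} {g : ℝ × ℝ × ℝ → ℝ}
    (hfl : ContDiff ℝ ∞ fl) (hg : ContDiff ℝ ∞ g) : ContDiff ℝ ∞ (flowIntegral fl g) := by
  have h : ContDiff ℝ ∞ fun w : ((ℝ × ℝ × ℝ) × ℝ) × ℝ => g (fl (w.1.1, w.1.2 * w.2)) :=
    hg.comp (hfl.comp (by fun_prop))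
  exact contDiff_snd.mul (contDiff_integral_param 0 1 h)

theorem flowIntegral_eq (fl : (ℝ × ℝ × ℝ) × ℝ → ℝ × ℝ × ℝ) (g : ℝ × ℝ × ℝ → ℝ)
    (p : ℝ × ℝ × ℝ) (t : ℝ) : flowIntegral fl g (p, t) = ∫ u in (0 : ℝ)..t, g (fl (p, u)) := by
  have := intervalIntegral.mul_integral_comp_mul_left (a := 0) (b := 1) t
    (f := fun u => g (fl (p, u)))
  simpa [flowIntegral] using this

theorem hasDerivAt_flowIntegral {fl : (ℝ × ℝ × ℝ) × ℝ → ℝ × ℝ × ℝ} {g : ℝ × ℝ × ℝ → ℝ}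
    (hfl : Continuous fl) (hg : Continuous g) (p : ℝ × ℝ × ℝ) (t : ℝ) :
    HasDerivAt (fun t => flowIntegral fl g (p, t)) (g (fl (p, t))) t := by
  simp only [flowIntegral_eq]
  exact (Continuous.integral_hasStrictDerivAt (by fun_prop) 0 t).hasDerivAt

/-- The time-`T p` map of a flow. -/
def flowMap (fl : (ℝ × ℝ × ℝ) × ℝ → ℝ × ℝ × ℝ) (T : ℝ × ℝ × ℝ → ℝ) (p : ℝ × ℝ × ℝ) : ℝ × ℝ × ℝ :=
  fl (p, T p)

/-- If the time function `T` solves `flowIntegral = a` and `a` is a primitive of `g₁ - g₂` along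
the flow, then the time-`T` map stretches the Hamiltonian field by `g₁ / g₂`. -/
theorem IsCuspFlow.exists_stretch {fl : (ℝ × ℝ × ℝ) × ℝ → ℝ × ℝ × ℝ} {ε r : ℝ}
    (h : IsCuspFlow fl ε) {g₁ g₂ a T : ℝ × ℝ × ℝ → ℝ} (hg₂ : ContDiff ℝ ∞ g₂)
    (ha : ContDiff ℝ ∞ a) (hT : ContDiff ℝ ∞ T)
    (hgrp : ∀ p : ℝ × ℝ × ℝ, ‖p‖ < r → ∀ s : ℝ, |s| < r → ∀ t : ℝ, |t| < r →
      fl (fl (p, s), t) = fl (p, s + t)) {p : ℝ × ℝ × ℝ} (hpr : ‖p‖ < r) (hpε : ‖p‖ < ε)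
    (hTp : |T p| < min r ε)
    (haT : ∀ᶠ q in 𝓝 p, flowIntegral fl g₂ (q, T q) = a q)
    (hbr : cuspBracket a p = g₁ p - g₂ p) :
    ∃ k : ℝ, fderiv ℝ (flowMap fl T) p (cuspField p) = k • cuspField (flowMap fl T p) ∧
      g₂ (flowMap fl T p) * k = g₁ p := by
  have hflc := h.smooth.continuous
  have hc : HasDerivAt (fun s => fl (p, s)) (cuspField p) 0 := by
    have := h.deriv p hpε 0 (by simpa using h.pos)
    rwa [h.zero p hpε] at this
  have hc0 : fl (p, 0) = p := h.zero p hpε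
  have comp : ∀ {V : Type} [NormedAddCommGroup V] [NormedSpace ℝ V] (f : ℝ × ℝ × ℝ → V),
      ContDiff ℝ ∞ f → HasDerivAt (fun s => f (fl (p, s))) (fderiv ℝ f p (cuspField p)) 0 := by
    intro V _ _ f hf
    have h2 : HasFDerivAt f (fderiv ℝ f p) (fl (p, 0)) := by
      rw [hc0]
      exact (hf.differentiable (by simp) p).hasFDerivAt
    exact h2.comp_hasDerivAt (0 : ℝ) hc
  have hTc := comp T hT
  have hac := comp a ha
  have hΦ : ContDiff ℝ ∞ (flowMap fl T) := h.smooth.comp (contDiff_id.prodMk hT)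
  have hΦc := comp _ hΦ
  -- The image of the flow line of p is the same flow line with time s + T at the point of time s; k
  -- is the derivative of this time at s = 0.
  set k := 1 + fderiv ℝ T p (cuspField p) with hk
  have hσ : HasDerivAt (fun s => s + T (fl (p, s))) k 0 := (hasDerivAt_id (0 : ℝ)).add hTc
  have hσ0 : 0 + T (fl (p, 0)) = T p := by rw [hc0, zero_add]
  have htend : Tendsto (fun s => fl (p, s)) (𝓝 0) (𝓝 p) := by
    have := hc.continuousAt
    rwa [ContinuousAt, hc0] at this
  have hTr : |T p| < r := hTp.trans_le (min_le_left _ _)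
  have hr0 : 0 < r := (norm_nonneg p).trans_lt hpr
  have ev1 : ∀ᶠ s in 𝓝 (0 : ℝ), |T (fl (p, s))| < r :=
    htend.eventually (((hT.continuous.abs).continuousAt).eventually_lt continuousAt_const hTr)
  have ev2 : ∀ᶠ s in 𝓝 (0 : ℝ), |s| < r :=
    continuous_abs.continuousAt.eventually_lt continuousAt_const (by simpa using hr0)
  have evΦ : ∀ᶠ s in 𝓝 (0 : ℝ), flowMap fl T (fl (p, s)) = fl (p, s + T (fl (p, s))) := by
    filter_upwards [ev1, ev2] with s h1 h2
    exact hgrp p hpr s h2 _ h1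
  -- By the group law, a at time s is the integral of g₂ from s to s + T along one fixed orbit. Its
  -- derivative at s = 0 gives X a = g₂(Φ) k - g₂, hence g₂(Φ) k = g₁.
  have evA : ∀ᶠ s in 𝓝 (0 : ℝ), a (fl (p, s))
      = flowIntegral fl g₂ (p, s + T (fl (p, s))) - flowIntegral fl g₂ (p, s) := by
    filter_upwards [ev1, ev2, htend.eventually haT] with s h1 h2 h3
    rw [← h3, flowIntegral_eq, flowIntegral_eq, flowIntegral_eq,
      intervalIntegral.integral_interval_sub_left]
    · have e := intervalIntegral.integral_comp_add_left (a := 0) (b := T (fl (p, s)))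
        (fun u => g₂ (fl (p, u))) s
      rw [add_zero] at e
      rw [← e]
      refine intervalIntegral.integral_congr fun u hu => ?_
      have hu' : |u| < r := by
        refine lt_of_le_of_lt ?_ h1
        have := abs_sub_left_of_mem_uIcc hu
        simpa using this
      simp only [hgrp p hpr s h2 u hu']
    · exact (hg₂.continuous.comp (by fun_prop)).intervalIntegrable _ _
    · exact (hg₂.continuous.comp (by fun_prop)).intervalIntegrable _ _
  have hTε : |T p| < ε := hTp.trans_le (min_le_right _ _)
  refine ⟨k, ?_, ?_⟩
  · have hd : HasDerivAt (fun t => fl (p, t)) (cuspField (flowMap fl T p))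
        (0 + T (fl (p, 0))) := by
      rw [hσ0]
      exact h.deriv p hpε _ hTε
    have := HasDerivAt.scomp (0 : ℝ) hd hσ
    exact hΦc.unique (this.congr_of_eventuallyEq evΦ)
  · have hd : HasDerivAt (fun t => flowIntegral fl g₂ (p, t)) (g₂ (flowMap fl T p))
        (0 + T (fl (p, 0))) := by
      rw [hσ0]
      exact hasDerivAt_flowIntegral hflc hg₂.continuous p (T p)
    have h1 := HasDerivAt.comp (0 : ℝ) hd hσ
    have h2 := hasDerivAt_flowIntegral hflc hg₂.continuous p 0
    have := hac.unique ((h1.sub h2).congr_of_eventuallyEq evA)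
    rw [← cuspBracket_eq_fderiv, hbr, hc0] at this
    linarith

/-- If `g₁ - g₂` is the derivative of a smooth function along the Hamiltonian field of `cuspH`,
then some smooth map near the origin preserves `cuspH` and pulls `g₂ dx ∧ dy` back to
`g₁ dx ∧ dy`. -/
theorem exists_moser_map {g₁ g₂ a : ℝ × ℝ × ℝ → ℝ} (hg₁ : ContDiff ℝ ∞ g₁)
    (hg₂ : ContDiff ℝ ∞ g₂) (ha : ContDiff ℝ ∞ a) (ha0 : a 0 = 0) (h0 : g₂ 0 ≠ 0)
    (hbr : ∀ᶠ p in 𝓝 0, cuspBracket a p = g₁ p - g₂ p) :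
    ∃ Φ : ℝ × ℝ × ℝ → ℝ × ℝ × ℝ, ContDiff ℝ ∞ Φ ∧ Φ 0 = 0 ∧ ∀ᶠ p in 𝓝 0, (Φ p).1 = p.1 ∧
      cuspH p.1 (Φ p).2 = cuspH p.1 p.2 ∧ g₂ (Φ p) * planeJacobian Φ p = g₁ p := by
  obtain ⟨fl, ε, h⟩ := exists_isCuspFlow
  obtain ⟨r, hr, hgrp⟩ := h.exists_group_law
  have hflc := h.smooth.continuous
  have hε := h.pos
  -- The time is an implicit function: at the origin the derivative in t is g₂(0) ≠ 0, and a(0) = 0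
  -- gives T(0) = 0.
  set F : (ℝ × ℝ × ℝ) × ℝ → ℝ := fun v => flowIntegral fl g₂ v - a v.1 with hF
  have hFs : ContDiff ℝ ∞ F := (contDiff_flowIntegral h.smooth hg₂).sub (ha.comp contDiff_fst)
  have hF0 : F ((0 : ℝ × ℝ × ℝ), (0 : ℝ)) = 0 := by simp [hF, flowIntegral, ha0]
  have hFd : HasDerivAt (fun t => F ((0 : ℝ × ℝ × ℝ), t)) (g₂ 0) 0 := by
    have := (hasDerivAt_flowIntegral hflc hg₂.continuous 0 0).sub_const (a 0)
    rwa [h.zero 0 (by simpa using hε)] at this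
  obtain ⟨O, S, hO, hO0, hS, hS0, hFS, -⟩ :=
    exists_smooth_implicit hFs hF0 _ (hFd.hasFDerivAt_equiv h0)
  obtain ⟨T, hT, hTS⟩ := exists_contDiff_eventuallyEq hO hS hO0
  have hT0 : T 0 = 0 := by rw [hTS.self_of_nhds, hS0]
  have haT : ∀ᶠ q in 𝓝 0, flowIntegral fl g₂ (q, T q) = a q := by
    filter_upwards [hTS, hO.mem_nhds hO0] with q h1 h2
    rw [h1]
    linarith [hFS q h2]
  have hΦ : ContDiff ℝ ∞ (flowMap fl T) := h.smooth.comp (contDiff_id.prodMk hT)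
  have hm : 0 < min r ε := lt_min hr hε
  have evT : ∀ᶠ p in 𝓝 0, |T p| < min r ε :=
    hT.continuous.abs.continuousAt.eventually_lt continuousAt_const (by simpa [hT0] using hm)
  have evp : ∀ᶠ p in 𝓝 (0 : ℝ × ℝ × ℝ), ‖p‖ < min r ε :=
    continuous_norm.continuousAt.eventually_lt continuousAt_const (by simpa using hm)
  have ev1 : ∀ᶠ p in 𝓝 0, (flowMap fl T p).1 = p.1 ∧
      cuspH p.1 (flowMap fl T p).2 = cuspH p.1 p.2 := by
    filter_upwards [evT, evp] with p h1 h2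
    exact ⟨h.fst p (h2.trans_le (min_le_right _ _)) _ (h1.trans_le (min_le_right _ _)),
      h.cuspH_eq (h2.trans_le (min_le_right _ _)) (h1.trans_le (min_le_right _ _))⟩
  have ev2 : ∀ᶠ p in 𝓝 0, p.2.1 ≠ 0 →
      g₂ (flowMap fl T p) * planeJacobian (flowMap fl T) p = g₁ p := by
    filter_upwards [evT, evp, ev1.eventually_nhds, haT.eventually_nhds, hbr] with p h1 h2 h3 h4 h5 hx
    obtain ⟨k, hk, hgk⟩ := h.exists_stretch hg₂ ha hT hgrp (h2.trans_le (min_le_left _ _))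
      (h2.trans_le (min_le_right _ _)) h1 h4 h5
    rw [planeJacobian_eq hΦ (h3.mono fun _ z => z.1) (h3.mono fun _ z => z.2) hk hx, hgk]
  refine ⟨flowMap fl T, hΦ, ?_, ?_⟩
  · rw [flowMap, hT0]
    exact h.zero 0 (by simpa using hε)
  filter_upwards [ev1, ev2.eventually_nhds] with p h1 h2
  refine ⟨h1.1, h1.2, ?_⟩
  set G : ℝ × ℝ × ℝ → ℝ :=
    fun p => g₂ (flowMap fl T p) * planeJacobian (flowMap fl T) p - g₁ p with hG
  have hGc : Continuous G :=
    ((hg₂.continuous.comp hΦ.continuous).mul (continuous_planeJacobian hΦ)).sub hg₁.continuous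
  have hline : Continuous fun x : ℝ => G (p.1, x, p.2.2) := hGc.comp (by fun_prop)
  have htl : Tendsto (fun x : ℝ => (p.1, x, p.2.2)) (𝓝 p.2.1) (𝓝 p) :=
    (by fun_prop : Continuous fun x : ℝ => (p.1, x, p.2.2)).tendsto p.2.1
  suffices hGp : G p = 0 by linarith [hGp, show G p = _ from rfl]
  -- The Jacobian was computed from the x-component of dH, which vanishes at x = 0; there the
  -- identity follows by continuity along the x-direction.
  by_cases hx : p.2.1 = 0
  · have hz : ∀ᶠ x in 𝓝[≠] p.2.1, G (p.1, x, p.2.2) = 0 := by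
      filter_upwards [(htl.eventually h2).filter_mono nhdsWithin_le_nhds, self_mem_nhdsWithin]
        with x hx1 hx2
      have : x ≠ 0 := by
        rw [← hx]
        exact hx2
      exact sub_eq_zero.2 (hx1 this)
    have h3 : Tendsto (fun x : ℝ => G (p.1, x, p.2.2)) (𝓝[≠] p.2.1) (𝓝 (G p)) :=
      (hline.tendsto p.2.1).mono_left nhdsWithin_le_nhds
    exact tendsto_nhds_unique (h3.congr' hz) tendsto_const_nhds
  · exact sub_eq_zero.2 (h2.self_of_nhds hx)

/-- A map that preserves the parameter and has nonzero Jacobian at a point is a local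
diffeomorphism there. -/
theorem exists_smooth_inverse_of_planeJacobian {f : ℝ × ℝ × ℝ → ℝ × ℝ × ℝ} (hf : ContDiff ℝ ∞ f)
    (hfst : ∀ p, (f p).1 = p.1) {a : ℝ × ℝ × ℝ} (hJ : planeJacobian f a ≠ 0)
    {N M : Set (ℝ × ℝ × ℝ)} (hN : IsOpen N) (haN : a ∈ N) (hM : IsOpen M) (haM : f a ∈ M) :
    ∃ (V W : Set (ℝ × ℝ × ℝ)) (g : ℝ × ℝ × ℝ → ℝ × ℝ × ℝ), IsOpen V ∧ IsOpen W ∧ a ∈ V ∧ V ⊆ N ∧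
      W ⊆ M ∧ MapsTo f V W ∧ MapsTo g W V ∧ (∀ p ∈ V, g (f p) = p) ∧ (∀ q ∈ W, f (g q) = q) ∧
      ContDiffOn ℝ ∞ g W := by
  have hfd : HasFDerivAt f (fderiv ℝ f a) a := (hf.differentiable (by simp) a).hasFDerivAt
  have h1 : ∀ v, (fderiv ℝ f a v).1 = v.1 := by
    intro v
    have e1 : HasFDerivAt (fun p => (f p).1)
        ((ContinuousLinearMap.fst ℝ ℝ (ℝ × ℝ)).comp (fderiv ℝ f a)) a :=
      (ContinuousLinearMap.fst ℝ ℝ (ℝ × ℝ)).hasFDerivAt.comp a hfd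
    have e2 : HasFDerivAt (fun p : ℝ × ℝ × ℝ => (f p).1) (ContinuousLinearMap.fst ℝ ℝ (ℝ × ℝ)) a := by
      simp only [hfst]
      exact hasFDerivAt_fst
    exact congrArg (fun L => L v) (e1.unique e2)
  have hinj : Function.Injective (fderiv ℝ f a : ℝ × ℝ × ℝ →ₗ[ℝ] ℝ × ℝ × ℝ) := by
    refine (injective_iff_map_eq_zero _).2 ?_
    rintro ⟨l, x, y⟩ hv
    have hv : fderiv ℝ f a (l, x, y) = 0 := hv
    have hl : l = 0 := by
      have := h1 (l, x, y)
      rw [hv] at this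
      exact this.symm
    subst hl
    have hdec : ((0, x, y) : ℝ × ℝ × ℝ) = x • (0, 1, 0) + y • (0, 0, 1) := by simp
    rw [hdec, map_add, map_smul, map_smul] at hv
    have e1 := congrArg (fun z => z.2.1) hv
    have e2 := congrArg (fun z => z.2.2) hv
    simp at e1 e2
    have hx : x * planeJacobian f a = 0 := by
      unfold planeJacobian
      linear_combination (fderiv ℝ f a (0, 0, 1)).2.2 * e1 - (fderiv ℝ f a (0, 0, 1)).2.1 * e2
    have hy : y * planeJacobian f a = 0 := by
      unfold planeJacobian
      linear_combination (fderiv ℝ f a (0, 1, 0)).2.1 * e2 - (fderiv ℝ f a (0, 1, 0)).2.2 * e1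
    simp [(mul_eq_zero.1 hx).resolve_right hJ, (mul_eq_zero.1 hy).resolve_right hJ]
  let e := (LinearEquiv.ofInjectiveEndo _ hinj).toContinuousLinearEquiv
  have he : (e : ℝ × ℝ × ℝ →L[ℝ] ℝ × ℝ × ℝ) = fderiv ℝ f a := by
    refine ContinuousLinearMap.ext fun v => ?_
    rfl
  exact exists_smooth_inverse hf e (he ▸ hfd) hN haN hM haM

/-! ### Two-forms on the plane -/

/-- The coefficient of a `2`-form with respect to `dx ∧ dy`. -/
noncomputable def areaCoeff (η : Plane [⋀^Fin 2]→L[ℝ] ℝ) : ℝ := η ![((1, 0) : Plane), ((0, 1) : Plane)]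

theorem apply_eq_det_mul_areaCoeff (η : Plane [⋀^Fin 2]→L[ℝ] ℝ) (v w : Plane) :
    η ![v, w] = (v.1 * w.2 - w.1 * v.2) * areaCoeff η := by
  have hadd : ∀ v v' w : Plane, η ![v + v', w] = η ![v, w] + η ![v', w] := fun v v' w => by
    simpa using η.cons_add ![w] v v'
  have hsmul : ∀ (c : ℝ) (v w : Plane), η ![c • v, w] = c * η ![v, w] := fun c v w => by
    simpa using η.cons_smul ![w] c v
  have hself : ∀ v : Plane, η ![v, v] = 0 := fun v =>
    η.map_eq_zero_of_eq ![v, v] (i := 0) (j := 1) rfl (by decide)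
  have hswap : ∀ v w : Plane, η ![w, v] = -η ![v, w] := fun v w => by
    have h : (![v, w] : Fin 2 → Plane) ∘ Equiv.swap 0 1 = ![w, v] := by
      ext i <;> fin_cases i <;> rfl
    have := η.map_swap ![v, w] (i := 0) (j := 1) (by decide)
    rwa [h] at this
  have hadd' : ∀ v w w' : Plane, η ![v, w + w'] = η ![v, w] + η ![v, w'] := fun v w w' => by
    rw [hswap, hadd, hswap v w, hswap v w']
    ring
  have hsmul' : ∀ (c : ℝ) (v w : Plane), η ![v, c • w] = c * η ![v, w] := fun c v w => by
    rw [hswap, hsmul, hswap v w]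
    ring
  have hdec : ∀ v : Plane, v = v.1 • ((1, 0) : Plane) + v.2 • ((0, 1) : Plane) := fun v => by simp
  rw [hdec v, hdec w]
  simp only [hadd, hadd', hsmul, hsmul', hself, hswap ((1, 0) : Plane) ((0, 1) : Plane)]
  simp [areaCoeff]
  ring

theorem form_ext_areaCoeff {η ζ : Plane [⋀^Fin 2]→L[ℝ] ℝ} (h : areaCoeff η = areaCoeff ζ) :
    η = ζ := by
  ext m
  have hm : m = ![m 0, m 1] := by
    ext i <;> fin_cases i <;> rfl
  rw [hm, apply_eq_det_mul_areaCoeff, apply_eq_det_mul_areaCoeff, h]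

theorem areaCoeff_ne_zero {η : Plane [⋀^Fin 2]→L[ℝ] ℝ}
    (h : ∀ v : Plane, (∀ w : Plane, η ![v, w] = 0) → v = 0) : areaCoeff η ≠ 0 := by
  intro h0
  have := h (1, 0) fun w => by rw [apply_eq_det_mul_areaCoeff, h0, mul_zero]
  simpa using congrArg Prod.fst this

theorem areaCoeff_pullbackForm (φ : Plane → Plane) (η : Plane → Plane [⋀^Fin 2]→L[ℝ] ℝ)
    (p : Plane) : areaCoeff (pullbackForm φ η p) =
      ((fderiv ℝ φ p (1, 0)).1 * (fderiv ℝ φ p (0, 1)).2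
        - (fderiv ℝ φ p (0, 1)).1 * (fderiv ℝ φ p (1, 0)).2) * areaCoeff (η (φ p)) := by
  rw [← apply_eq_det_mul_areaCoeff, areaCoeff, pullbackForm,
    ContinuousAlternatingMap.compContinuousLinearMap_apply]
  congr 1
  ext i <;> fin_cases i <;> rfl

theorem areaCoeff_pullbackForm_slice {f : ℝ × ℝ × ℝ → ℝ × ℝ × ℝ} (hf : ContDiff ℝ ∞ f)
    (η : Plane → Plane [⋀^Fin 2]→L[ℝ] ℝ) (lam : ℝ) (p : Plane) :
    areaCoeff (pullbackForm (fun p => (f (lam, p)).2) η p) =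
      planeJacobian f (lam, p) * areaCoeff (η (f (lam, p)).2) := by
  have h1 : HasFDerivAt f (fderiv ℝ f (lam, p)) (lam, p) :=
    (hf.differentiable (by simp) _).hasFDerivAt
  have h2 : HasFDerivAt (fun p => (f (lam, p)).2) ((ContinuousLinearMap.snd ℝ ℝ (ℝ × ℝ)).comp
      ((fderiv ℝ f (lam, p)).comp (ContinuousLinearMap.inr ℝ ℝ (ℝ × ℝ)))) p :=
    (ContinuousLinearMap.snd ℝ ℝ (ℝ × ℝ)).hasFDerivAt.comp p
      (h1.comp p (hasFDerivAt_prodMk_right lam p))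
  rw [areaCoeff_pullbackForm, h2.fderiv]
  rfl

theorem IsSmoothSymplecticFamilyOn.contDiffOn_areaCoeff {η : FormFamily} {U : Set (ℝ × Plane)}
    (h : IsSmoothSymplecticFamilyOn η U) :
    ContDiffOn ℝ ∞ (fun q : ℝ × Plane => areaCoeff (η q.1 q.2)) U :=
  (ContinuousAlternatingMap.apply ℝ Plane ℝ
    ![((1, 0) : Plane), ((0, 1) : Plane)]).contDiff.comp_contDiffOn h.smooth

/-- A point of a small vanishing disc is close to the origin. -/
theorem abs_le_of_mem_vanishingDisc {q R : ℝ} (hq : 0 < q) (hR : R ∈ Ioo 0 (2 * q ^ 3))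
    {p : Plane} (hp : p ∈ vanishingDisc (R ^ 2 - 2 * q ^ 6) (3 * q ^ 4)) :
    |p.1| ≤ 6 * q ^ 3 ∧ |p.2| ≤ 2 * q ^ 2 := by
  obtain ⟨h1, h2⟩ := hp
  have hs : √(3 * q ^ 4 / 3) = q ^ 2 := by
    rw [show 3 * q ^ 4 / 3 = (q ^ 2) ^ 2 by ring]
    exact Real.sqrt_sq (by positivity)
  rw [hs] at h2
  unfold cuspH at h1
  have hR2 : R ^ 2 < 4 * q ^ 6 := by nlinarith [hR.1, hR.2]
  -- The disc lies below the saddle level 2q⁶, and 2q⁶ - 3q⁴y + y³ has the double root q² and the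
  -- simple root -2q².
  have h3 : p.1 ^ 2 < (q ^ 2 - p.2) ^ 2 * (p.2 + 2 * q ^ 2) := by nlinarith
  have h4 : 0 < p.2 + 2 * q ^ 2 := by
    by_contra hn
    nlinarith [mul_nonneg (sq_nonneg (q ^ 2 - p.2)) (neg_nonneg.2 (not_lt.1 hn)), sq_nonneg p.1]
  have hq2 : 0 < q ^ 2 := by positivity
  refine ⟨?_, abs_le.2 ⟨by linarith, by linarith⟩⟩
  have h5 : (q ^ 2 - p.2) ^ 2 ≤ (3 * q ^ 2) ^ 2 :=
    pow_le_pow_left₀ (by linarith) (by linarith) 2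
  have h6 : (q ^ 2 - p.2) ^ 2 * (p.2 + 2 * q ^ 2) ≤ (3 * q ^ 2) ^ 2 * (3 * q ^ 2) :=
    mul_le_mul h5 (by linarith) h4.le (by positivity)
  refine abs_le_of_sq_le_sq ?_ (by positivity)
  nlinarith [pow_pos hq 6]

theorem mem_swallowTail_of_mem_Ioo {q R : ℝ} (hq : 0 < q) (hR : R ∈ Ioo 0 (2 * q ^ 3)) :
    (R ^ 2 - 2 * q ^ 6, 3 * q ^ 4) ∈ swallowTail := by
  have hR2 : R ^ 2 < 4 * q ^ 6 := by nlinarith [hR.1, hR.2]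
  have hR3 : 0 < R ^ 2 := pow_pos hR.1 2
  refine ⟨by positivity, ?_⟩
  simp only
  nlinarith

/-- Equality of the area functions gives vanishing circle means of the difference of the
coefficients. -/
theorem exists_circleMean_eq_zero {ω₁ ω₂ : FormFamily} {g₁ g₂ : ℝ × ℝ × ℝ → ℝ}
    (hg₁ : Continuous g₁) (hg₂ : Continuous g₂)
    (h₁ : ∀ᶠ q in 𝓝 (0 : ℝ × ℝ × ℝ), g₁ q = areaCoeff (ω₁ q.1 q.2))
    (h₂ : ∀ᶠ q in 𝓝 (0 : ℝ × ℝ × ℝ), g₂ q = areaCoeff (ω₂ q.1 q.2))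
    (hI : ∀ᶠ b : ℝ × ℝ in 𝓝 ((0, 0) : ℝ × ℝ), b ∈ swallowTail →
      areaFunction ω₁ b.1 b.2 = areaFunction ω₂ b.1 b.2) :
    ∃ q₀ > 0, ∀ q ∈ Ioo 0 q₀, ∀ R ∈ Ioo 0 (2 * q ^ 3),
      circleMean (fun p => g₁ p - g₂ p) q R = 0 := by
  obtain ⟨ε, hε, hεI⟩ := Metric.eventually_nhds_iff_ball.1 hI
  obtain ⟨δ, hδ, hδg⟩ := Metric.eventually_nhds_iff_ball.1 (h₁.and h₂)
  -- For q < 1 the coordinates of the disc, its level and lam are all at most 6q in absolute value,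
  -- so 6q < min ε δ keeps them in the balls where the hypotheses hold.
  refine ⟨min 1 (min ε δ / 6), by positivity, fun q hq R hR => ?_⟩
  refine circleMean_eq_zero (hg₁.sub hg₂) hq.1 (fun R hR => ?_) hR
  have hq0 := hq.1
  have hq1 : q < 1 := hq.2.trans_le (min_le_left _ _)
  have hq6 : 6 * q < min ε δ := by
    have := hq.2.trans_le (min_le_right _ _)
    linarith
  have hqε : 6 * q < ε := hq6.trans_le (min_le_left _ _)
  have hqδ : 6 * q < δ := hq6.trans_le (min_le_right _ _)
  have hpow : ∀ n : ℕ, n ≠ 0 → q ^ n ≤ q := fun n hn => pow_le_of_le_one hq0.le hq1.le hn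
  have hR2 : R ^ 2 < 4 * q ^ 6 := by nlinarith [hR.1, hR.2]
  have hR3 : 0 < R ^ 2 := pow_pos hR.1 2
  have hlam : |3 * q ^ 4| ≤ 3 * q := by
    rw [abs_of_pos (by positivity)]
    linarith [hpow 4 (by norm_num)]
  have hball : (R ^ 2 - 2 * q ^ 6, 3 * q ^ 4) ∈ Metric.ball ((0, 0) : ℝ × ℝ) ε := by
    rw [show ((0, 0) : ℝ × ℝ) = 0 from rfl, mem_ball_zero_iff, Prod.norm_def]
    refine max_lt ?_ (by rw [Real.norm_eq_abs]; linarith)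
    rw [Real.norm_eq_abs, abs_lt]
    constructor <;> nlinarith [hpow 6 (by norm_num)]
  have hdisc : ∀ p ∈ vanishingDisc (R ^ 2 - 2 * q ^ 6) (3 * q ^ 4),
      (3 * q ^ 4, p) ∈ Metric.ball (0 : ℝ × ℝ × ℝ) δ ∧ p ∈ Metric.closedBall (0 : Plane) 6 := by
    intro p hp
    obtain ⟨a, b⟩ := abs_le_of_mem_vanishingDisc hq0 hR hp
    have a' : |p.1| ≤ 6 * q := a.trans (by linarith [hpow 3 (by norm_num)])
    have b' : |p.2| ≤ 2 * q := b.trans (by linarith [hpow 2 (by norm_num)])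
    constructor
    · rw [mem_ball_zero_iff, Prod.norm_def, Prod.norm_def]
      exact max_lt (by rw [Real.norm_eq_abs]; linarith)
        (max_lt (by rw [Real.norm_eq_abs]; linarith) (by rw [Real.norm_eq_abs]; linarith))
    · rw [mem_closedBall_zero_iff, Prod.norm_def]
      exact max_le (by rw [Real.norm_eq_abs]; linarith) (by rw [Real.norm_eq_abs]; linarith)
  have hmeas : MeasurableSet (vanishingDisc (R ^ 2 - 2 * q ^ 6) (3 * q ^ 4)) := by
    have hc : Continuous (cuspH (3 * q ^ 4)) := by
      unfold cuspH
      fun_prop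
    exact (isClosed_le hc continuous_const).measurableSet.inter
      (isOpen_lt continuous_snd continuous_const).measurableSet
  have hint : ∀ g : ℝ × ℝ × ℝ → ℝ, Continuous g → IntegrableOn (fun p : Plane => g (3 * q ^ 4, p))
      (vanishingDisc (R ^ 2 - 2 * q ^ 6) (3 * q ^ 4)) := fun g hg =>
    (((hg.comp (by fun_prop : Continuous fun p : Plane => (3 * q ^ 4, p))).continuousOn
      (s := Metric.closedBall (0 : Plane) 6)).integrableOn_compact
        (isCompact_closedBall _ _)).mono_set fun p hp => (hdisc p hp).2
  have harea := hεI _ hball (mem_swallowTail_of_mem_Ioo hq0 hR)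
  have hA := mul_left_cancel₀ (by positivity : 1 / (2 * Real.pi) ≠ 0) harea
  have e1 : ∫ p in vanishingDisc (R ^ 2 - 2 * q ^ 6) (3 * q ^ 4), g₁ (3 * q ^ 4, p)
      = ∫ p in vanishingDisc (R ^ 2 - 2 * q ^ 6) (3 * q ^ 4), areaCoeff (ω₁ (3 * q ^ 4) p) :=
    setIntegral_congr_fun hmeas fun p hp => (hδg _ (hdisc p hp).1).1
  have e2 : ∫ p in vanishingDisc (R ^ 2 - 2 * q ^ 6) (3 * q ^ 4), g₂ (3 * q ^ 4, p)
      = ∫ p in vanishingDisc (R ^ 2 - 2 * q ^ 6) (3 * q ^ 4), areaCoeff (ω₂ (3 * q ^ 4) p) :=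
    setIntegral_congr_fun hmeas fun p hp => (hδg _ (hdisc p hp).1).2
  simp only [Pi.sub_apply]
  rw [integral_sub (hint g₁ hg₁) (hint g₂ hg₂), e1, e2, sub_eq_zero]
  exact hA

theorem cuspBracket_at_zero (a : ℝ × ℝ × ℝ → ℝ) : cuspBracket a 0 = 0 := by simp [cuspBracket]

theorem cuspBracket_sub_const (a : ℝ × ℝ × ℝ → ℝ) (c : ℝ) (p : ℝ × ℝ × ℝ) :
    cuspBracket (fun q => a q - c) p = cuspBracket a p := by
  simp only [cuspBracket, dirDeriv, fderiv_sub_const]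

/-- Two nowhere vanishing continuous functions on a connected set that agree at a point have
a positive quotient. -/
theorem div_pos_of_isPreconnected {X : Type*} [TopologicalSpace X] {U : Set X}
    (hU : IsPreconnected U) {g₁ g₂ : X → ℝ} (h₁ : ContinuousOn g₁ U) (h₂ : ContinuousOn g₂ U)
    (hn₁ : ∀ q ∈ U, g₁ q ≠ 0) (hn₂ : ∀ q ∈ U, g₂ q ≠ 0) {a : X} (ha : a ∈ U) (he : g₁ a = g₂ a)
    {q : X} (hq : q ∈ U) : 0 < g₁ q / g₂ q := by
  by_contra hneg
  have hc : ContinuousOn (fun q => g₁ q / g₂ q) U := h₁.div h₂ hn₂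
  have ha1 : g₁ a / g₂ a = 1 := by rw [he, div_self (hn₂ a ha)]
  obtain ⟨z, hz, hz0⟩ := hU.intermediate_value hq ha hc
    (show (0 : ℝ) ∈ Icc (g₁ q / g₂ q) (g₁ a / g₂ a) from
      ⟨not_lt.1 hneg, by rw [ha1]; exact zero_le_one⟩)
  exact div_ne_zero (hn₁ z hz) (hn₂ z hz) hz0

/-- The map of `exists_moser_map`, corrected to preserve the parameter everywhere. -/
theorem exists_moser_map_fst {g₁ g₂ a : ℝ × ℝ × ℝ → ℝ} (hg₁ : ContDiff ℝ ∞ g₁)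
    (hg₂ : ContDiff ℝ ∞ g₂) (ha : ContDiff ℝ ∞ a) (h0 : g₂ 0 ≠ 0)
    (hbr : ∀ᶠ p in 𝓝 0, cuspBracket a p = g₁ p - g₂ p) :
    ∃ f : ℝ × ℝ × ℝ → ℝ × ℝ × ℝ, ContDiff ℝ ∞ f ∧ f 0 = 0 ∧ (∀ p, (f p).1 = p.1) ∧
      ∀ᶠ p in 𝓝 0, cuspH p.1 (f p).2 = cuspH p.1 p.2 ∧ g₂ (f p) * planeJacobian f p = g₁ p := by
  obtain ⟨Φ, hΦ, hΦ0, hev⟩ := exists_moser_map hg₁ hg₂ (ha.sub (contDiff_const (c := a 0)))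
    (sub_self _) h0 (hbr.mono fun p hp => (cuspBracket_sub_const a (a 0) p).trans hp)
  refine ⟨fun p => (p.1, (Φ p).2), contDiff_fst.prodMk (contDiff_snd.comp hΦ), ?_, fun _ => rfl, ?_⟩
  · simp [hΦ0]
  · filter_upwards [hev.eventually_nhds] with p hp
    have heq : (fun p => (p.1, (Φ p).2)) =ᶠ[𝓝 p] Φ := hp.mono fun q hq => Prod.ext hq.1.symm rfl
    obtain ⟨-, h2, h3⟩ := hp.self_of_nhds
    refine ⟨h2, ?_⟩
    rw [planeJacobian, heq.fderiv_eq, show (p.1, (Φ p).2) = Φ p from heq.self_of_nhds]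
    exact h3

/-- The first conclusion needs only equality of the coefficients at the origin and connectedness of
`U`; the second is local and follows from the division theorem, the time map of the flow and the
inverse function theorem. -/
theorem mainTheorem2 (ω₁ ω₂ : FormFamily) (U : Set (ℝ × Plane))
    (hU : IsOpen U) (hUc : IsConnected U) (h0 : ((0, (0, 0)) : ℝ × Plane) ∈ U)
    (hω₁ : IsSmoothSymplecticFamilyOn ω₁ U) (hω₂ : IsSmoothSymplecticFamilyOn ω₂ U)
    (hI : ∀ᶠ b : ℝ × ℝ in 𝓝 ((0, 0) : ℝ × ℝ), b ∈ swallowTail →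
      areaFunction ω₁ b.1 b.2 = areaFunction ω₂ b.1 b.2) :
    (∀ q ∈ U, ∃ c : ℝ, 0 < c ∧ ω₁ q.1 q.2 = c • ω₂ q.1 q.2) ∧
    ∃ (V W : Set (ℝ × Plane)) (Φ : ℝ → Plane → Plane),
      ((0, (0, 0)) : ℝ × Plane) ∈ V ∧ V ⊆ U ∧ ((0, (0, 0)) : ℝ × Plane) ∈ W ∧ W ⊆ U ∧
      IsSmoothDiffeoFamily Φ V W ∧
      (∀ q ∈ V, cuspH q.1 (Φ q.1 q.2) = cuspH q.1 q.2) ∧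
      (∀ q ∈ V, pullbackForm (Φ q.1) (ω₂ q.1) q.2 = ω₁ q.1 q.2) := by
  have hs₁ := hω₁.contDiffOn_areaCoeff
  have hs₂ := hω₂.contDiffOn_areaCoeff
  have hn₁ : ∀ q ∈ U, areaCoeff (ω₁ q.1 q.2) ≠ 0 := fun q hq =>
    areaCoeff_ne_zero (hω₁.nondegenerate q hq)
  have hn₂ : ∀ q ∈ U, areaCoeff (ω₂ q.1 q.2) ≠ 0 := fun q hq =>
    areaCoeff_ne_zero (hω₂.nondegenerate q hq)
  -- Small vanishing discs see the coefficients only near the origin, so these may be replaced by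
  -- globally smooth functions.
  obtain ⟨g₁, hg₁, he₁⟩ := exists_contDiff_eventuallyEq hU hs₁ h0
  obtain ⟨g₂, hg₂, he₂⟩ := exists_contDiff_eventuallyEq hU hs₂ h0
  obtain ⟨q₀, hq₀, hM⟩ := exists_circleMean_eq_zero hg₁.continuous hg₂.continuous he₁ he₂ hI
  obtain ⟨a, ha, l, hl, hbr⟩ := exists_cuspBracket_eq (hg₁.sub hg₂) hq₀ hM
  have hbr' : ∀ᶠ p in 𝓝 (0 : ℝ × ℝ × ℝ), cuspBracket a p = g₁ p - g₂ p := by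
    have : ∀ᶠ p in 𝓝 (0 : ℝ × ℝ × ℝ), |p.1| < l :=
      (by fun_prop : Continuous fun p : ℝ × ℝ × ℝ => |p.1|).continuousAt.eventually_lt
        continuousAt_const (by simpa using hl)
    filter_upwards [this] with p hp
    exact hbr p.1 hp p.2.1 p.2.2
  -- The origin is a critical point of H for lam = 0, so every Hamiltonian derivative vanishes
  -- there.
  have hg0 : g₁ 0 = g₂ 0 := by
    have := hbr'.self_of_nhds
    rw [cuspBracket_at_zero] at this
    linarith
  have hg₁0 : g₁ 0 = areaCoeff (ω₁ 0 (0, 0)) := he₁.self_of_nhds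
  have hg₂0 : g₂ 0 = areaCoeff (ω₂ 0 (0, 0)) := he₂.self_of_nhds
  refine ⟨fun q hq => ⟨areaCoeff (ω₁ q.1 q.2) / areaCoeff (ω₂ q.1 q.2),
    div_pos_of_isPreconnected hUc.isPreconnected hs₁.continuousOn hs₂.continuousOn hn₁ hn₂ h0
      (by rw [← hg₁0, ← hg₂0, hg0]) hq, form_ext_areaCoeff ?_⟩, ?_⟩
  · exact (div_mul_cancel₀ _ (hn₂ q hq)).symm
  have hg₂n : g₂ 0 ≠ 0 := by
    rw [hg₂0]
    exact hn₂ _ h0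
  obtain ⟨f, hf, hf0, hffst, hfev⟩ := exists_moser_map_fst hg₁ hg₂ ha hg₂n hbr'
  have hJ : planeJacobian f 0 ≠ 0 := by
    have := hfev.self_of_nhds.2
    rw [hf0, hg0] at this
    intro hJ
    rw [hJ, mul_zero] at this
    exact hg₂n this.symm
  have hft : Tendsto f (𝓝 0) (𝓝 0) := by
    have := hf.continuous.tendsto 0
    rwa [hf0] at this
  -- The neighbourhood is small enough that the original coefficients agree with `g₁` at q and with
  -- `g₂` at the image f q.
  obtain ⟨N, hN, hNo, hN0⟩ := eventually_nhds_iff.1 ((hfev.and he₁).and (hft.eventually he₂))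
  obtain ⟨V, W, g, hVo, hWo, hV0, hVN, hWU, hfV, hgW, hgf, hfg, hg⟩ :=
    exists_smooth_inverse_of_planeJacobian hf hffst hJ (hNo.inter hU) ⟨hN0, h0⟩ hU
      (show f 0 ∈ U by rw [hf0]; exact h0)
  have hff : ∀ q : ℝ × Plane, (q.1, (f q).2) = f q := fun q => Prod.ext (hffst q).symm rfl
  have hgg : ∀ q ∈ W, (q.1, (g q).2) = g q := fun q hq => by
    refine Prod.ext ?_ rfl
    have := hffst (g q)
    rw [hfg q hq] at this
    exact this
  refine ⟨V, W, fun lam p => (f (lam, p)).2, hV0, fun q hq => (hVN hq).2, ?_, hWU,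
    ⟨hVo, hWo, (contDiff_snd.comp hf).contDiffOn, fun q hq => ?_, fun lam p => (g (lam, p)).2,
      contDiff_snd.comp_contDiffOn hg, fun q hq => ?_, fun q hq => ?_, fun q hq => ?_⟩,
    fun q hq => (hN q (hVN hq).1).1.1.1, fun q hq => form_ext_areaCoeff ?_⟩
  · have := hfV hV0
    rwa [hf0] at this
  · change (q.1, (f q).2) ∈ W
    rw [hff]
    exact hfV hq
  · change (q.1, (g q).2) ∈ V
    rw [hgg q hq]
    exact hgW hq
  · change (g (q.1, (f q).2)).2 = q.2
    rw [hff, hgf q hq]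
  · change (f (q.1, (g q).2)).2 = q.2
    rw [hgg q hq, hfg q hq]
  · obtain ⟨⟨⟨-, h2⟩, h3⟩, h4⟩ := hN q (hVN hq).1
    rw [areaCoeff_pullbackForm_slice hf, ← h3, ← h2, h4, hffst, mul_comm]
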